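/- **Setting.** Let $\Gamma$ be a countable metric space of finite dimension: there are $d\in\mathbb N$ and $\kappa$ such that every closed ball of radius $r\ge 0$ has at most $\kappa(1+r)^d$ points. To each $x\in\Gamma$ attach a nonzero finite-dimensional complex Hilbert space $\mathcal H_x$; for finite $\Lambda\subset\Gamma$ let $\mathcal H_\Lambda=\bigotimes_{x\in\Lambda}\mathcal H_x$ and $\mathcal A_\Lambda=\mathcal B(\mathcal H_\Lambda)$, with $\mathcal A_Z\subset\mathcal A_\Lambda$ for $Z\subset\Lambda$ by tensoring with the identity. An admissible decay function is an $F:[0,\infty)\to(0,\infty)$ with $\sup_x\sum_yF(d(x,y))<\infty$, $\sup_{x,z}\sum_y\frac{F(d(x,y))F(d(y,z))}{F(d(x,z))}<\infty$ and $\sup_{r\ge0}(1+r^k)F(r)<\infty$ for all $k\in\mathbb N$. A potential $\Phi$ assigns to finite sets $Z\subset\Lambda\subset\Gamma$ an element $\Phi^\Lambda(Z)\in\mathcal A_Z$ (possibly independent of $\Lambda$), and $$\|\Phi\|_F=\sup_{\Lambda}\sup_{x,y\in\Gamma}\frac1{F(d(x,y))}\sum_{Z\subset\Lambda,\;Z\ni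 x,y}\|\Phi^\Lambda(Z)\|.$$ A local Hamiltonian is a family $H_\Lambda=\sum_{Z\subset\Lambda}\Phi^\Lambda(Z)$ with $\Phi^\Lambda(Z)=\Phi^\Lambda(Z)^*$ and $\|\Phi\|_F<\infty$ for some admissible $F$. **Assumptions.** Let $n\in\mathbb N$ and let $H_s$, $s\in[0,1]$, be a local Hamiltonian with potential $\Phi_s$ such that each $s\mapsto\Phi^\Lambda_s(Z)$ is in $C^{n+1}([0,1])$ and, for some admissible $F$, $\sup_{s\in[0,1]}\|\partial_s^k\Phi_s\|_F<\infty$ for $k=0,\dots,n+1$. Assume that the (possibly degenerate) ground state energy of $H_{\Lambda,s}$ is separated from the rest of the spectrum by a gap at least $\gamma>0$, uniformly in $s\in[0,1]$ and in $\Lambda$, and that $\partial_s^kH_{\Lambda,s}|_{s=0}=0$ for $k=1,\dots,n+1$ and all $\Lambda$. Let $P_s=P_{\Lambda,s}$ be the orthogonal projection onto the ground state space of $H_{\Lambda,s}$. **Proposition.** There are an admissible decay function $F$, a constant $C$, local Hamiltonians $A_1(s),\dots,A_n(s)$, independent of $\epsilon$, and local Hamiltonians $R^{(n)}_\epsilon(s)$,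 for $s\in[0,1]$ and $\epsilon\in(0,1]$, such that the following holds. For all $s$ and $\epsilon$, the potential of each $A_p(s)$ has $F$-norm at most $C$, and the potential of $R^{(n)}_\epsilon(s)$ has $F$-norm at most $C\epsilon^{n+1}$. For all $\epsilon\in(0,1]$ and all finite $\Lambda$, the dressed projection $$\Pi^{(n)}_\epsilon(s)=V_\epsilon(s)P_sV_\epsilon(s)^*,\qquad V_\epsilon(s)=e^{iS_\epsilon(s)},\qquad S_\epsilon(s)=\sum_{p=1}^n\epsilon^pA_p(s),$$ is differentiable on $[0,1]$ and satisfies $$i\epsilon\,\tfrac{d}{ds}\Pi^{(n)}_\epsilon(s)=[H_s+R^{(n)}_\epsilon(s),\Pi^{(n)}_\epsilon(s)]\quad(s\in[0,1]),\qquad \Pi^{(n)}_\epsilon(0)=P_0 .$$ -/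

import Mathlib

open scoped ENNReal NNReal

noncomputable section

namespace SpinLattice

/-- Balls of the metric space `Γ` are finite and grow at most polynomially: the lattice has a
finite spatial dimension. -/
def HasFiniteDimension (Γ : Type*) [MetricSpace Γ] : Prop :=
  ∃ (d : ℕ) (κ : ℝ), ∀ (x : Γ) (r : ℝ), 0 ≤ r →
    (Metric.closedBall x r).Finite ∧ ((Metric.closedBall x r).ncard : ℝ) ≤ κ * (1 + r) ^ d

/-- `F : [0, ∞) → (0, ∞)` is an admissible decay function on `Γ`: it is uniformly summable
(`‖F‖₁ < ∞`), satisfies the convolution condition (`C_F < ∞`), and decays faster than any inverse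
power. Only the values of `F` on `[0, ∞)` matter. -/
structure IsDecayFunction (Γ : Type*) [MetricSpace Γ] (F : ℝ → ℝ) : Prop where
  pos : ∀ r, 0 ≤ r → 0 < F r
  summable : ∃ C : ℝ, ∀ x : Γ,
    Summable (fun y : Γ => F (dist x y)) ∧ ∑' y : Γ, F (dist x y) ≤ C
  convolution : ∃ C : ℝ, ∀ x z : Γ,
    Summable (fun y : Γ => F (dist x y) * F (dist y z) / F (dist x z)) ∧
      ∑' y : Γ, F (dist x y) * F (dist y z) / F (dist x z) ≤ C
  fast : ∀ k : ℕ, ∃ C : ℝ, ∀ r, 0 ≤ r → (1 + r ^ k) * F r ≤ C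

variable {Γ : Type*} [DecidableEq Γ]

/-- Labels of the product orthonormal basis of `⨂_{x ∈ Λ} ℂ^{D x}`. -/
abbrev Config (D : Γ → ℕ) (Λ : Finset Γ) : Type _ := (x : Λ) → Fin (D x.1)

/-- The Hilbert space `⨂_{x ∈ Λ} ℂ^{D x}`, realised as `ℓ²` of the product basis labels. -/
abbrev Hilb (D : Γ → ℕ) (Λ : Finset Γ) : Type _ := EuclideanSpace ℂ (Config D Λ)

/-- The algebra of observables on `Λ`: all operators on the Hilbert space of `Λ`, with the
operator norm and the adjoint as `star`. -/
abbrev Obs (D : Γ → ℕ) (Λ : Finset Γ) : Type _ := Hilb D Λ →L[ℂ] Hilb D Λ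

/-- Restriction of a label on `Λ` to a subset `Z`. -/
def Config.restrict {D : Γ → ℕ} {Z Λ : Finset Γ} (h : Z ⊆ Λ) (σ : Config D Λ) : Config D Z :=
  fun x => σ ⟨x.1, h x.2⟩

/-- The embedding `a ↦ a ⊗ 1_{Λ \ Z}` of the observables on `Z` into those on `Λ ⊇ Z`:
the matrix element between `σ` and `τ` is that of `a` between the restrictions to `Z` if `σ` and
`τ` agree outside `Z`, and zero otherwise. -/
def embed {D : Γ → ℕ} {Z Λ : Finset Γ} (h : Z ⊆ Λ) (a : Obs D Z) : Obs D Λ :=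
  Matrix.toEuclideanCLM (n := Config D Λ) (𝕜 := ℂ) (Matrix.of fun σ τ =>
    if ∀ x : Λ, x.1 ∉ Z → σ x = τ x then
      (Matrix.toEuclideanCLM (n := Config D Z) (𝕜 := ℂ)).symm a (σ.restrict h) (τ.restrict h)
    else 0)

/-- An interaction potential: in every finite volume `Λ` it gives an observable on each
`Z ⊆ Λ` (the values at other `Z` are never used). A potential that does not depend on the volume
is the special case of a function constant in `Λ`. -/
abbrev Potential (D : Γ → ℕ) : Type _ := (_Λ Z : Finset Γ) → Obs D Z

/-- All the terms of the potential are self-adjoint. -/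
def Potential.IsHermitian {D : Γ → ℕ} (Φ : Potential D) : Prop :=
  ∀ Λ Z : Finset Γ, Z ⊆ Λ → IsSelfAdjoint (Φ Λ Z)

/-- The Hamiltonian in volume `Λ`: the sum over `Z ⊆ Λ` of the terms of the potential. -/
def Potential.ham {D : Γ → ℕ} (Φ : Potential D) (Λ : Finset Γ) : Obs D Λ :=
  ∑ Z ∈ Λ.powerset.attach, embed (Finset.mem_powerset.1 Z.2) (Φ Λ Z.1)

/-- The norm `‖Φ‖_F`, the supremum over the volumes `Λ` and the pairs of sites `x, y` of
`F(d(x,y))⁻¹ ∑_{Z ⊆ Λ, Z ∋ x, y} ‖Φ(Z)‖`. -/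
def Potential.fNorm {D : Γ → ℕ} [MetricSpace Γ] (F : ℝ → ℝ) (Φ : Potential D) : ℝ≥0∞ :=
  ⨆ (Λ : Finset Γ) (x : Γ) (y : Γ),
    (∑ Z ∈ Λ.powerset with x ∈ Z ∧ y ∈ Z, ‖Φ Λ Z‖ₑ) / ENNReal.ofReal (F (dist x y))

/-- The `k`-th derivative on `[0,1]` of a time-dependent potential, term by term. -/
def Potential.timeDeriv {D : Γ → ℕ} (k : ℕ) (Φ : ℝ → Potential D) (s : ℝ) : Potential D :=
  fun Λ Z => iteratedDerivWithin k (fun r => Φ r Λ Z) (Set.Icc 0 1) s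

/-- The time-dependent potential `Φ` defines a local Hamiltonian of class `C^m` on `[0,1]`:
its terms are self-adjoint and `C^m`, and for a common admissible `F` the potential and its
derivatives up to order `m` have `F`-norms bounded uniformly in time (and volume). -/
structure IsLocalC {D : Γ → ℕ} [MetricSpace Γ] (m : ℕ) (Φ : ℝ → Potential D) : Prop where
  hermitian : ∀ s ∈ Set.Icc (0 : ℝ) 1, (Φ s).IsHermitian
  contDiffOn : ∀ Λ Z : Finset Γ, Z ⊆ Λ → ContDiffOn ℝ m (fun s => Φ s Λ Z) (Set.Icc 0 1)
  bounded : ∃ F : ℝ → ℝ, IsDecayFunction Γ F ∧ ∀ k ≤ m, ∃ C : ℝ≥0, ∀ s ∈ Set.Icc (0 : ℝ) 1,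
    (Potential.timeDeriv k Φ s).fNorm F ≤ C

/-- The ground state energy: the bottom of the spectrum. -/
def groundEnergy {D : Γ → ℕ} {Λ : Finset Γ} (H : Obs D Λ) : ℝ := sInf (spectrum ℝ H)

/-- The orthogonal projection onto the ground state space. -/
def groundProj {D : Γ → ℕ} {Λ : Finset Γ} (H : Obs D Λ) : Obs D Λ :=
  (Module.End.eigenspace (H : Hilb D Λ →ₗ[ℂ] Hilb D Λ) (groundEnergy H : ℂ)).starProjection

/-- The ground state energy is separated from the rest of the spectrum by a gap of size at least
some `γ > 0`, uniformly in `s ∈ [0,1]` and in the volume. -/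
def UniformlyGapped {D : Γ → ℕ} (Φ : ℝ → Potential D) : Prop :=
  ∃ γ : ℝ, 0 < γ ∧ ∀ (Λ : Finset Γ), ∀ s ∈ Set.Icc (0 : ℝ) 1,
    ∀ μ ∈ spectrum ℝ ((Φ s).ham Λ), μ ≠ groundEnergy ((Φ s).ham Λ) →
      groundEnergy ((Φ s).ham Λ) + γ ≤ μ

/-- `S_ε(s) = ∑_{p=1}^n ε^p A_p(s)` in volume `Λ`. -/
def dressS {D : Γ → ℕ} (A : ℕ → ℝ → Potential D) (n : ℕ) (ε s : ℝ) (Λ : Finset Γ) : Obs D Λ :=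
  ∑ p ∈ Finset.Icc 1 n, ((ε : ℂ) ^ p) • (A p s).ham Λ

/-- The dressing transformation `V_ε(s) = exp(i S_ε(s))`. -/
def dressV {D : Γ → ℕ} (A : ℕ → ℝ → Potential D) (n : ℕ) (ε s : ℝ) (Λ : Finset Γ) : Obs D Λ :=
  NormedSpace.exp (Complex.I • dressS A n ε s Λ)

/-- The dressed projection `Π_ε(s) = V_ε(s) P_s V_ε(s)*`, where `P_s` is the ground state
projection of the Hamiltonian of `Φ`. -/
def dressedProj {D : Γ → ℕ} (Φ : ℝ → Potential D) (A : ℕ → ℝ → Potential D) (n : ℕ)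
    (ε s : ℝ) (Λ : Finset Γ) : Obs D Λ :=
  dressV A n ε s Λ * groundProj ((Φ s).ham Λ) * star (dressV A n ε s Λ)

end SpinLattice

end

/-! In a fixed volume the result is a recursive expansion in powers of `ε`. For a gapped family the
ground projection is transported by a generator, `P' = i[K, P]`, where `K = I(H')` and `I(a) = ∫
w(t) ∫_0^t e^{iuH} a e^{-iuH} du dt` is the map `quasiAdiabatic` (`deriv_projection_eq`). The real
weight `w` has all moments finite, and its Fourier transform is 1 near zero and 0 at distances of
the order of the gap. Hence `i[H, I(a)]` is the `w`-weighted time average of `a` minus `a`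
(`liouvillian_quasiAdiabatic`), and time averages commute with `P`, because `w` suppresses all
transitions across the gap.

Undoing the conjugation by `e^{iS}` shows that the dressed projection solves the wanted equation
with remainder `e^{iS}(Y - Q)e^{-iS}`, where `Y = ∫_0^1 e^{-iuS}(-εS' + i[S,H])e^{iuS} du - εK` and
`Q` is anything that commutes with `P` (`dressed_equation`). The coefficient of `ε^k` in `Y` is
`i[A_k, H] + L_k`, and `L_k` involves only the `A_p` with `p < k` (`lowerCoeff_congr`). The choice
`A_k = -I(L_k)` (`exists_dressing`) turns this coefficient into the time average of `L_k`. All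
orders up to `n` can therefore be collected in `Q`, and what is left carries a factor `ε^(n+1)`
(`dressed_expansion`).

The remaining work is locality, uniformly in the volume. Every operator is written as a sum over
sites of quasi-local observables: conditional expectations onto balls around the site approximate
them with errors smaller than any inverse power of the radius. This class is stable under
commutators with local Hamiltonians, under the Heisenberg dynamics with bounds polynomial in time (a
consequence of the Lieb–Robinson bound `commutator_heis_le`), under integration against a weight
with finite moments, and under time differentiation as far as the smoothness of the Hamiltonian
allows. At the end `Growth.exists_potential` cuts the site observables into shells supported on
balls, and `Growth.exists_decayFunction` builds one admissible `F` out of the countably many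
polynomial bounds.

For the initial condition, the derivatives of the Hamiltonian vanish at time zero, so `K` is central
there together with its first `n` derivatives. This property passes through the recursion to every
`A_p`, and conjugation by `e^{iS(0)}` is then trivial (`IsDressing.heis_dressGen_zero`). -/

set_option linter.unusedSectionVars false

noncomputable section

namespace SpinLattice

variable {Γ : Type*} [DecidableEq Γ]

/-! ### Local observable algebras as Kronecker factors. -/

section Embedding

variable {D : Γ → ℕ}

/-- Splitting a label on `Λ` into its restrictions to `Z` and to `Λ \ Z`. -/
def splitConfig (D : Γ → ℕ) {Z Λ : Finset Γ} (h : Z ⊆ Λ) :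
    Config D Λ ≃ Config D Z × Config D (Λ \ Z) where
  toFun σ := (σ.restrict h, σ.restrict Finset.sdiff_subset)
  invFun p := fun x => if hx : x.1 ∈ Z then p.1 ⟨x.1, hx⟩ else
    p.2 ⟨x.1, Finset.mem_sdiff.2 ⟨x.2, hx⟩⟩
  left_inv σ := by
    funext x
    by_cases hx : x.1 ∈ Z <;> simp [hx, Config.restrict]
  right_inv p := by
    refine Prod.ext ?_ ?_
    · funext x
      simp [Config.restrict]
    · funext x
      have := (Finset.mem_sdiff.1 x.2).2
      simp [Config.restrict, this]

open scoped Kronecker in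
/-- The embedding of observables on the level of matrices, as a Kronecker product. -/
def embedMatrix (D : Γ → ℕ) {Z Λ : Finset Γ} (h : Z ⊆ Λ)
    (A : Matrix (Config D Z) (Config D Z) ℂ) : Matrix (Config D Λ) (Config D Λ) ℂ :=
  (A ⊗ₖ (1 : Matrix (Config D (Λ \ Z)) (Config D (Λ \ Z)) ℂ)).submatrix
    (splitConfig D h) (splitConfig D h)

lemma restrict_sdiff_eq_iff {Z Λ : Finset Γ} (σ τ : Config D Λ) :
    (σ.restrict (Finset.sdiff_subset : Λ \ Z ⊆ Λ) = τ.restrict Finset.sdiff_subset) ↔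
      ∀ x : Λ, x.1 ∉ Z → σ x = τ x := by
  constructor
  · intro h x hx
    exact congrFun h ⟨x.1, Finset.mem_sdiff.2 ⟨x.2, hx⟩⟩
  · intro h
    funext x
    exact h ⟨x.1, _⟩ (Finset.mem_sdiff.1 x.2).2

lemma embedMatrix_apply {Z Λ : Finset Γ} (h : Z ⊆ Λ)
    (A : Matrix (Config D Z) (Config D Z) ℂ) (σ τ : Config D Λ) :
    embedMatrix D h A σ τ =
      if ∀ x : Λ, x.1 ∉ Z → σ x = τ x then A (σ.restrict h) (τ.restrict h) else 0 := by
  simp only [embedMatrix, Matrix.submatrix_apply, Matrix.kroneckerMap_apply, splitConfig,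
    Equiv.coe_fn_mk, Matrix.one_apply, restrict_sdiff_eq_iff, mul_ite, mul_one, mul_zero]

lemma embed_eq {Z Λ : Finset Γ} (h : Z ⊆ Λ) (a : Obs D Z) :
    embed h a = Matrix.toEuclideanCLM (n := Config D Λ) (𝕜 := ℂ)
      (embedMatrix D h ((Matrix.toEuclideanCLM (n := Config D Z) (𝕜 := ℂ)).symm a)) := by
  unfold embed
  congr 1
  ext σ τ
  rw [embedMatrix_apply, Matrix.of_apply]

lemma embedMatrix_mul {Z Λ : Finset Γ} (h : Z ⊆ Λ) (A B : Matrix (Config D Z) (Config D Z) ℂ) :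
    embedMatrix D h (A * B) = embedMatrix D h A * embedMatrix D h B := by
  simp only [embedMatrix, Matrix.submatrix_mul_equiv]
  rw [← Matrix.mul_kronecker_mul, one_mul]

/-- The embedding of matrices as a homomorphism of star algebras. -/
def embedMatrixHom (D : Γ → ℕ) {Z Λ : Finset Γ} (h : Z ⊆ Λ) :
    Matrix (Config D Z) (Config D Z) ℂ →⋆ₐ[ℂ] Matrix (Config D Λ) (Config D Λ) ℂ where
  toFun := embedMatrix D h
  map_one' := by simp [embedMatrix]
  map_mul' := embedMatrix_mul h
  map_zero' := by simp [embedMatrix]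
  map_add' a b := by
    simp only [embedMatrix, Matrix.add_kronecker, Matrix.submatrix_add, Pi.add_apply]
  commutes' r := by
    rw [Algebra.algebraMap_eq_smul_one, Algebra.algebraMap_eq_smul_one]
    simp only [embedMatrix, Matrix.smul_kronecker, Matrix.one_kronecker_one]
    rw [← Matrix.submatrix_one_equiv (α := ℂ) (splitConfig D h)]
    rfl
  map_star' a := by
    simp only [embedMatrix, Matrix.star_eq_conjTranspose, Matrix.conjTranspose_submatrix,
      Matrix.conjTranspose_kronecker, Matrix.conjTranspose_one]

/-- The embedding of observables as a homomorphism of star algebras. -/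
def embedHom (D : Γ → ℕ) {Z Λ : Finset Γ} (h : Z ⊆ Λ) : Obs D Z →⋆ₐ[ℂ] Obs D Λ :=
  ((Matrix.toEuclideanCLM (n := Config D Λ) (𝕜 := ℂ)) : _ →⋆ₐ[ℂ] _).comp
    ((embedMatrixHom D h).comp
      ((Matrix.toEuclideanCLM (n := Config D Z) (𝕜 := ℂ)).symm : _ →⋆ₐ[ℂ] _))

@[simp] lemma embedHom_apply {Z Λ : Finset Γ} (h : Z ⊆ Λ) (a : Obs D Z) :
    embedHom D h a = embed h a :=
  (embed_eq h a).symm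

instance nonempty_config {D : Γ → ℕ} [∀ x, NeZero (D x)] (Λ : Finset Γ) : Nonempty (Config D Λ) :=
  ⟨fun _ => 0⟩

lemma embedMatrix_embedMatrix {Y Z Λ : Finset Γ} (h : Y ⊆ Z) (h' : Z ⊆ Λ)
    (A : Matrix (Config D Y) (Config D Y) ℂ) :
    embedMatrix D h' (embedMatrix D h A) = embedMatrix D (h.trans h') A := by
  ext σ τ
  simp only [embedMatrix_apply]
  by_cases h1 : ∀ x : Λ, x.1 ∉ Y → σ x = τ x
  · have h2 : ∀ x : Z, x.1 ∉ Y → σ.restrict h' x = τ.restrict h' x :=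
      fun x hx => h1 ⟨x.1, h' x.2⟩ hx
    rw [if_pos h1, if_pos (fun x hx => h1 x (fun hy => hx (h hy))), if_pos h2]
    rfl
  · rw [if_neg h1]
    split_ifs with h2 h3
    · refine absurd (fun x hx => ?_) h1
      by_cases hz : x.1 ∈ Z
      · exact h3 ⟨x.1, hz⟩ hx
      · exact h2 x hz
    · rfl
    · rfl

lemma embed_embed {Y Z Λ : Finset Γ} (h : Y ⊆ Z) (h' : Z ⊆ Λ) (a : Obs D Y) :
    embed h' (embed h a) = embed (h.trans h') a := by
  simp only [embed_eq]
  rw [StarAlgEquiv.symm_apply_apply, embedMatrix_embedMatrix]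

/-- The matrix of `a` is recovered from the entries with a fixed label outside `Z`. Such a label
exists because all local dimensions are nonzero. -/
lemma embed_injective [∀ x, NeZero (D x)] {Z Λ : Finset Γ} (h : Z ⊆ Λ) :
    Function.Injective (embed (D := D) h) := by
  intro a b hab
  simp only [embed_eq] at hab
  have h1 := (Matrix.toEuclideanCLM (n := Config D Λ) (𝕜 := ℂ)).injective hab
  apply (Matrix.toEuclideanCLM (n := Config D Z) (𝕜 := ℂ)).symm.injective
  ext ξ ξ'
  obtain ⟨η⟩ := nonempty_config (D := D) (Λ \ Z)
  have h2 := congrFun (congrFun h1 ((splitConfig D h).symm (ξ, η)))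
    ((splitConfig D h).symm (ξ', η))
  simp only [embedMatrix, Matrix.submatrix_apply, Matrix.kroneckerMap_apply,
    Equiv.apply_symm_apply, Matrix.one_apply_eq, mul_one] at h2
  exact h2

lemma embedHom_injective [∀ x, NeZero (D x)] {Z Λ : Finset Γ} (h : Z ⊆ Λ) :
    Function.Injective (embedHom D h) := by
  intro a b hab
  rw [embedHom_apply, embedHom_apply] at hab
  exact embed_injective h hab

/-- An injective star homomorphism of C*-algebras is isometric, so norms of interaction terms do not
depend on the volume in which they are computed. -/
lemma norm_embed [∀ x, NeZero (D x)] {Z Λ : Finset Γ} (h : Z ⊆ Λ) (a : Obs D Z) :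
    ‖embed h a‖ = ‖a‖ := by
  have h1 := NonUnitalStarAlgHom.norm_map (embedHom D h) (embedHom_injective h) a
  rwa [embedHom_apply] at h1

/-- Matrices on `Λ \ Z` act on the second factor. -/
lemma embedMatrix_sdiff {Z Λ : Finset Γ} (h : Z ⊆ Λ)
    (B : Matrix (Config D (Λ \ Z)) (Config D (Λ \ Z)) ℂ) (σ τ : Config D Λ) :
    embedMatrix D (Finset.sdiff_subset : Λ \ Z ⊆ Λ) B σ τ =
      if σ.restrict h = τ.restrict h then
        B (σ.restrict Finset.sdiff_subset) (τ.restrict Finset.sdiff_subset) else 0 := by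
  rw [embedMatrix_apply]
  congr 1
  refine propext ⟨fun h1 => ?_, fun h1 x hx => ?_⟩
  · funext x
    exact h1 ⟨x.1, h x.2⟩ (fun h2 => (Finset.mem_sdiff.1 h2).2 x.2)
  · have : x.1 ∈ Z := by
      by_contra h2
      exact hx (Finset.mem_sdiff.2 ⟨x.2, h2⟩)
    exact congrFun h1 ⟨x.1, this⟩

open scoped Kronecker in
lemma embedMatrix_sdiff_eq {Z Λ : Finset Γ} (h : Z ⊆ Λ)
    (B : Matrix (Config D (Λ \ Z)) (Config D (Λ \ Z)) ℂ) :
    embedMatrix D (Finset.sdiff_subset : Λ \ Z ⊆ Λ) B =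
      ((1 : Matrix (Config D Z) (Config D Z) ℂ) ⊗ₖ B).submatrix
        (splitConfig D h) (splitConfig D h) := by
  ext σ τ
  rw [embedMatrix_sdiff h]
  simp [splitConfig, Matrix.one_apply]

/-- In the splitting of the labels the two operators are `A ⊗ 1` and `1 ⊗ B`. -/
lemma commute_embed_sdiff {Z Λ : Finset Γ} (h : Z ⊆ Λ) (a : Obs D Z) (b : Obs D (Λ \ Z)) :
    Commute (embed h a) (embed (Finset.sdiff_subset : Λ \ Z ⊆ Λ) b) := by
  unfold Commute SemiconjBy
  simp only [embed_eq]
  rw [← map_mul, ← map_mul, embedMatrix_sdiff_eq h]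
  simp only [embedMatrix, Matrix.submatrix_mul_equiv]
  rw [← Matrix.mul_kronecker_mul, ← Matrix.mul_kronecker_mul]
  simp

/-- The algebra of observables in volume `Λ` that are supported in `X`. -/
def loc (D : Γ → ℕ) {X Λ : Finset Γ} (h : X ⊆ Λ) : StarSubalgebra ℂ (Obs D Λ) :=
  (embedHom D h).range

lemma mem_loc {X Λ : Finset Γ} (h : X ⊆ Λ) {a : Obs D Λ} :
    a ∈ loc D h ↔ ∃ b, embed h b = a := by
  simp only [← embedHom_apply]
  rfl

lemma embed_mem_loc {X Z Λ : Finset Γ} (h : X ⊆ Λ) (hZ : Z ⊆ X) (h' : Z ⊆ Λ) (b : Obs D Z) :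
    embed h' b ∈ loc D h :=
  (mem_loc h).2 ⟨embed hZ b, embed_embed hZ h b⟩

lemma loc_mono {X Y Λ : Finset Γ} (h : X ⊆ Y) (hX : X ⊆ Λ) (hY : Y ⊆ Λ) {a : Obs D Λ}
    (ha : a ∈ loc D hX) : a ∈ loc D hY := by
  obtain ⟨b, rfl⟩ := (mem_loc _).1 ha
  exact embed_mem_loc hY h hX b

lemma mem_loc_self {Λ : Finset Γ} (a : Obs D Λ) : a ∈ loc D (Finset.Subset.refl Λ) := by
  refine (mem_loc _).2 ⟨a, ?_⟩
  rw [embed_eq, show embedMatrix D (Finset.Subset.refl Λ) = id from ?_]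
  · exact StarAlgEquiv.apply_symm_apply _ _
  · funext A
    ext σ τ
    rw [embedMatrix_apply, if_pos (fun x hx => absurd x.2 hx)]
    rfl

lemma commute_of_mem_loc {X Y Λ : Finset Γ} (hXY : Disjoint X Y) (hX : X ⊆ Λ) (hY : Y ⊆ Λ)
    {a b : Obs D Λ} (ha : a ∈ loc D hX) (hb : b ∈ loc D hY) : Commute a b := by
  have hY' : Y ⊆ Λ \ X := fun y hy =>
    Finset.mem_sdiff.2 ⟨hY hy, fun h => (Finset.disjoint_left.1 hXY h) hy⟩
  obtain ⟨a, rfl⟩ := (mem_loc _).1 ha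
  obtain ⟨b, rfl⟩ := (mem_loc _).1 (loc_mono hY' hY Finset.sdiff_subset hb)
  exact commute_embed_sdiff hX a b

end Embedding

/-! ### Averaging over a finite group of operators. -/

section GroupAverage

variable {𝒜 : Type*} [NormedRing 𝒜] [NormedAlgebra ℂ 𝒜] {G : Type*} [Group G] [Fintype G]

/-- The average of `U g * a * U g⁻¹` over a finite group. -/
def groupAvg (U : G →* 𝒜) : 𝒜 →L[ℂ] 𝒜 :=
  (Fintype.card G : ℂ)⁻¹ • ∑ g, ContinuousLinearMap.mulLeftRight ℂ 𝒜 (U g) (U g⁻¹)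

lemma groupAvg_apply (U : G →* 𝒜) (a : 𝒜) :
    groupAvg U a = (Fintype.card G : ℂ)⁻¹ • ∑ g, U g * a * U g⁻¹ := by
  simp [groupAvg]

lemma norm_groupAvg_le (U : G →* 𝒜) (hU : ∀ g, ‖U g‖ ≤ 1) (a : 𝒜) : ‖groupAvg U a‖ ≤ ‖a‖ := by
  rw [groupAvg_apply, norm_smul, norm_inv, Complex.norm_natCast, inv_mul_le_iff₀
    (by exact_mod_cast Fintype.card_pos)]
  refine (norm_sum_le _ _).trans ?_
  rw [← nsmul_eq_mul, ← Finset.card_univ]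
  refine Finset.sum_le_card_nsmul _ _ _ fun g _ => ?_
  calc ‖U g * a * U g⁻¹‖ ≤ ‖U g‖ * ‖a‖ * ‖U g⁻¹‖ := norm_mul₃_le
    _ ≤ 1 * ‖a‖ * 1 := by gcongr <;> exact hU _
    _ = ‖a‖ := by ring

lemma groupAvg_of_commute (U : G →* 𝒜) {a : 𝒜} (h : ∀ g, Commute (U g) a) : groupAvg U a = a := by
  rw [groupAvg_apply]
  have : ∀ g, U g * a * U g⁻¹ = a := fun g => by
    rw [(h g).eq, mul_assoc, ← map_mul, mul_inv_cancel, map_one, mul_one]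
  simp only [this, Finset.sum_const, Finset.card_univ]
  rw [← Nat.cast_smul_eq_nsmul ℂ, smul_smul, inv_mul_cancel₀, one_smul]
  exact_mod_cast Fintype.card_ne_zero

lemma commute_groupAvg (U : G →* 𝒜) (a : 𝒜) (h : G) : Commute (U h) (groupAvg U a) := by
  have key : U h * groupAvg U a * U h⁻¹ = groupAvg U a := by
    simp only [groupAvg_apply, mul_smul_comm, smul_mul_assoc, Finset.mul_sum, Finset.sum_mul]
    congr 1
    refine Fintype.sum_equiv (Equiv.mulLeft h) _ _ fun g => ?_
    simp only [Equiv.coe_mulLeft, mul_inv_rev, map_mul, mul_assoc]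
  have h2 : U h⁻¹ * U h = 1 := by rw [← map_mul, inv_mul_cancel, map_one]
  have : groupAvg U a * U h = U h * groupAvg U a * U h⁻¹ * U h := by rw [key]
  rw [Commute, SemiconjBy, this, mul_assoc _ (U h⁻¹), h2, mul_one]

/-- The difference is the average of `[a, U g] * U g⁻¹`. -/
lemma norm_sub_groupAvg_le (U : G →* 𝒜) (hU : ∀ g, ‖U g‖ ≤ 1) {a : 𝒜} {c : ℝ}
    (h : ∀ g, ‖a * U g - U g * a‖ ≤ c) : ‖a - groupAvg U a‖ ≤ c := by
  have h0 : (Fintype.card G : ℂ) ≠ 0 := by exact_mod_cast Fintype.card_ne_zero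
  have h1 : a - groupAvg U a =
      (Fintype.card G : ℂ)⁻¹ • ∑ g, (a * U g - U g * a) * U g⁻¹ := by
    have : ∀ g, (a * U g - U g * a) * U g⁻¹ = a - U g * a * U g⁻¹ := fun g => by
      rw [sub_mul, mul_assoc, ← map_mul, mul_inv_cancel, map_one, mul_one]
    simp only [this, Finset.sum_sub_distrib, Finset.sum_const, Finset.card_univ, smul_sub]
    rw [← Nat.cast_smul_eq_nsmul ℂ, smul_smul, inv_mul_cancel₀ h0, one_smul, groupAvg_apply]
  rw [h1, norm_smul, norm_inv, Complex.norm_natCast, inv_mul_le_iff₀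
    (by exact_mod_cast Fintype.card_pos)]
  refine (norm_sum_le _ _).trans ?_
  rw [← nsmul_eq_mul, ← Finset.card_univ]
  refine Finset.sum_le_card_nsmul _ _ _ fun g _ => ?_
  calc ‖(a * U g - U g * a) * U g⁻¹‖ ≤ ‖a * U g - U g * a‖ * ‖U g⁻¹‖ := norm_mul_le _ _
    _ ≤ ‖a * U g - U g * a‖ * 1 := by gcongr; exact hU _
    _ ≤ c := by rw [mul_one]; exact h g

lemma groupAvg_star [StarRing 𝒜] [StarModule ℂ 𝒜] (U : G →* 𝒜) (hU : ∀ g, star (U g) = U g⁻¹)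
    (a : 𝒜) : groupAvg U (star a) = star (groupAvg U a) := by
  simp only [groupAvg_apply, star_smul, star_inv₀, star_natCast, star_sum, star_mul, hU, inv_inv,
    mul_assoc]

end GroupAverage

/-! ### Conditional expectations onto local algebras, by averaging over signed permutations. -/

section CondExp

variable {D : Γ → ℕ}

/-- Diagonal matrices of signs. -/
def signMatrix (n : Type*) [Fintype n] [DecidableEq n] : (n → ℤˣ) →* Matrix n n ℂ where
  toFun θ := Matrix.diagonal fun i => ((θ i : ℤ) : ℂ)
  map_one' := by simp
  map_mul' θ θ' := by simp [Matrix.diagonal_mul_diagonal]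

/-- Permutation matrices. -/
def permutationMatrix (n : Type*) [Fintype n] [DecidableEq n] :
    Equiv.Perm n →* Matrix n n ℂ where
  toFun π := Matrix.of fun i j => if i = π j then 1 else 0
  map_one' := by
    ext i j
    simp only [Matrix.of_apply, Equiv.Perm.coe_one, id_eq, Matrix.one_apply]
    congr
  map_mul' π π' := by
    ext i j
    simp only [Matrix.of_apply, Equiv.Perm.coe_mul, Function.comp_apply, Matrix.mul_apply,
      mul_ite, mul_one, mul_zero, Finset.sum_ite_eq', Finset.mem_univ, if_true]
    congr

lemma permutationMatrix_apply {n : Type*} [Fintype n] [DecidableEq n] (π : Equiv.Perm n) (i j : n) :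
    permutationMatrix n π i j = if i = π j then 1 else 0 := rfl

lemma star_signMatrix {n : Type*} [Fintype n] [DecidableEq n] (θ : n → ℤˣ) :
    star (signMatrix n θ) = signMatrix n θ⁻¹ := by
  simp only [signMatrix, MonoidHom.coe_mk, OneHom.coe_mk, Matrix.star_eq_conjTranspose,
    Matrix.diagonal_conjTranspose]
  congr 1
  funext i
  simp

lemma star_permutationMatrix {n : Type*} [Fintype n] [DecidableEq n] (π : Equiv.Perm n) :
    star (permutationMatrix n π) = permutationMatrix n π⁻¹ := by
  ext i j
  simp only [Matrix.star_apply, permutationMatrix_apply, Equiv.Perm.eq_inv_iff_eq, eq_comm]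
  split_ifs <;> simp

/-- Operators on `Λ` acting as signed permutations of the labels outside `X`. -/
def outsideHom (D : Γ → ℕ) (X Λ : Finset Γ) :
    Matrix (Config D (Λ \ X)) (Config D (Λ \ X)) ℂ →* Obs D Λ :=
  MonoidHom.comp (MonoidHomClass.toMonoidHom (embedHom D (Finset.sdiff_subset : Λ \ X ⊆ Λ)))
    (MonoidHomClass.toMonoidHom (Matrix.toEuclideanCLM (n := Config D (Λ \ X)) (𝕜 := ℂ)))

lemma outsideHom_apply (X Λ : Finset Γ) (A : Matrix (Config D (Λ \ X)) (Config D (Λ \ X)) ℂ) :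
    outsideHom D X Λ A = embed (Finset.sdiff_subset : Λ \ X ⊆ Λ)
      (Matrix.toEuclideanCLM (n := Config D (Λ \ X)) (𝕜 := ℂ) A) := by
  rw [← embedHom_apply]; rfl

lemma outsideHom_mem (X Λ : Finset Γ) (A : Matrix (Config D (Λ \ X)) (Config D (Λ \ X)) ℂ) :
    outsideHom D X Λ A ∈ loc D (Finset.sdiff_subset : Λ \ X ⊆ Λ) := by
  rw [outsideHom_apply]
  exact (mem_loc _).2 ⟨_, rfl⟩

lemma star_outsideHom (X Λ : Finset Γ) (A : Matrix (Config D (Λ \ X)) (Config D (Λ \ X)) ℂ) :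
    star (outsideHom D X Λ A) = outsideHom D X Λ (star A) := by
  rw [outsideHom_apply, outsideHom_apply, map_star, ← embedHom_apply, ← embedHom_apply, map_star]

lemma norm_le_one_of_star_mul_self {𝒜 : Type*} [CStarAlgebra 𝒜] {u : 𝒜} (h : star u * u = 1) :
    ‖u‖ ≤ 1 := by
  rcases subsingleton_or_nontrivial 𝒜 with h1 | h1
  · rw [Subsingleton.elim u 0, norm_zero]; exact zero_le_one
  · have h2 := CStarRing.norm_star_mul_self (x := u)
    rw [h, norm_one] at h2
    nlinarith [norm_nonneg u]

/-- Sign changes of the labels outside `X`. -/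
def signOp (D : Γ → ℕ) (X Λ : Finset Γ) : (Config D (Λ \ X) → ℤˣ) →* Obs D Λ :=
  (outsideHom D X Λ).comp (signMatrix _)

/-- Permutations of the labels outside `X`. -/
def permOp (D : Γ → ℕ) (X Λ : Finset Γ) : Equiv.Perm (Config D (Λ \ X)) →* Obs D Λ :=
  (outsideHom D X Λ).comp (permutationMatrix _)

lemma star_signOp (X Λ : Finset Γ) (θ : Config D (Λ \ X) → ℤˣ) :
    star (signOp D X Λ θ) = signOp D X Λ θ⁻¹ := by
  simp only [signOp, MonoidHom.comp_apply, star_outsideHom, star_signMatrix]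

lemma star_permOp (X Λ : Finset Γ) (π : Equiv.Perm (Config D (Λ \ X))) :
    star (permOp D X Λ π) = permOp D X Λ π⁻¹ := by
  simp only [permOp, MonoidHom.comp_apply, star_outsideHom, star_permutationMatrix]

lemma norm_signOp_le (X Λ : Finset Γ) (θ : Config D (Λ \ X) → ℤˣ) : ‖signOp D X Λ θ‖ ≤ 1 := by
  apply norm_le_one_of_star_mul_self
  rw [star_signOp, ← map_mul, inv_mul_cancel, map_one]

lemma norm_permOp_le (X Λ : Finset Γ) (π : Equiv.Perm (Config D (Λ \ X))) :
    ‖permOp D X Λ π‖ ≤ 1 := by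
  apply norm_le_one_of_star_mul_self
  rw [star_permOp, ← map_mul, inv_mul_cancel, map_one]

/-- Permutations normalise the group of sign changes. This is why two successive averages suffice in
`condE`: the second one does not destroy the invariance achieved by the first. -/
lemma signMatrix_mul_permutationMatrix {n : Type*} [Fintype n] [DecidableEq n] (θ : n → ℤˣ)
    (π : Equiv.Perm n) :
    signMatrix n θ * permutationMatrix n π = permutationMatrix n π * signMatrix n (θ ∘ π) := by
  ext i j
  simp only [signMatrix, MonoidHom.coe_mk, OneHom.coe_mk, Matrix.diagonal_mul,
    Matrix.mul_diagonal, permutationMatrix_apply, Function.comp_apply]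
  split_ifs with h
  · rw [h, mul_comm]
  · simp

lemma signOp_mul_permOp (X Λ : Finset Γ) (θ : Config D (Λ \ X) → ℤˣ)
    (π : Equiv.Perm (Config D (Λ \ X))) :
    signOp D X Λ θ * permOp D X Λ π = permOp D X Λ π * signOp D X Λ (θ ∘ π) := by
  simp only [signOp, permOp, MonoidHom.comp_apply]
  rw [← map_mul, signMatrix_mul_permutationMatrix, map_mul]

/-- The conditional expectation onto the observables supported in `X`. -/
def condE (D : Γ → ℕ) (X Λ : Finset Γ) : Obs D Λ →L[ℂ] Obs D Λ :=
  (groupAvg (permOp D X Λ)).comp (groupAvg (signOp D X Λ))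

lemma condE_apply (X Λ : Finset Γ) (a : Obs D Λ) :
    condE D X Λ a = groupAvg (permOp D X Λ) (groupAvg (signOp D X Λ) a) := rfl

lemma norm_condE_le (X Λ : Finset Γ) (a : Obs D Λ) : ‖condE D X Λ a‖ ≤ ‖a‖ := by
  rw [condE_apply]
  exact (norm_groupAvg_le (permOp D X Λ) (norm_permOp_le X Λ) _).trans
    (norm_groupAvg_le (signOp D X Λ) (norm_signOp_le X Λ) a)

lemma condE_star (X Λ : Finset Γ) (a : Obs D Λ) : condE D X Λ (star a) = star (condE D X Λ a) := by
  rw [condE_apply, condE_apply, groupAvg_star _ (star_signOp X Λ), groupAvg_star _ (star_permOp X Λ)]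

lemma condE_of_mem {X Λ : Finset Γ} (h : X ⊆ Λ) {a : Obs D Λ} (ha : a ∈ loc D h) :
    condE D X Λ a = a := by
  have h1 : ∀ A, Commute (outsideHom D X Λ A) a := fun A =>
    commute_of_mem_loc Finset.sdiff_disjoint _ h (outsideHom_mem X Λ A) ha
  have h2 : groupAvg (signOp D X Λ) a = a := groupAvg_of_commute _ fun θ => h1 _
  have h3 : groupAvg (permOp D X Λ) a = a := groupAvg_of_commute _ fun θ => h1 _
  rw [condE_apply, h2, h3]

/-- Each of the two averages contributes one `c`. Small commutators with everything supported
outside `X` thus mean that `a` is almost supported in `X`; this is how Lieb–Robinson bounds are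
turned into localization. -/
lemma norm_sub_condE_le (X Λ : Finset Γ) {a : Obs D Λ} {c : ℝ}
    (h : ∀ u ∈ loc D (Finset.sdiff_subset : Λ \ X ⊆ Λ), ‖u‖ ≤ 1 → ‖a * u - u * a‖ ≤ c) :
    ‖a - condE D X Λ a‖ ≤ 2 * c := by
  have h1 : ‖a - groupAvg (signOp D X Λ) a‖ ≤ c :=
    norm_sub_groupAvg_le _ (norm_signOp_le X Λ) fun θ =>
      h _ (outsideHom_mem X Λ _) (norm_signOp_le X Λ θ)
  have h2 : ‖a - groupAvg (permOp D X Λ) a‖ ≤ c :=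
    norm_sub_groupAvg_le _ (norm_permOp_le X Λ) fun θ =>
      h _ (outsideHom_mem X Λ _) (norm_permOp_le X Λ θ)
  have h3 : a - condE D X Λ a = (a - groupAvg (permOp D X Λ) a) +
      groupAvg (permOp D X Λ) (a - groupAvg (signOp D X Λ) a) := by
    rw [condE_apply, map_sub]; abel
  rw [h3]
  refine (norm_add_le _ _).trans ?_
  have := norm_groupAvg_le _ (norm_permOp_le X Λ) (a - groupAvg (signOp D X Λ) a)
  linarith

lemma commute_permOp_condE (X Λ : Finset Γ) (a : Obs D Λ) (π : Equiv.Perm (Config D (Λ \ X))) :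
    Commute (permOp D X Λ π) (condE D X Λ a) := by
  rw [condE_apply]
  exact commute_groupAvg (permOp D X Λ) _ π

/-- Moving a sign change `θ` past the permutation `π` turns it into `θ ∘ π`, which commutes with the
sign average, and moving it past `π⁻¹` turns it back into `θ`. -/
lemma commute_signOp_condE (X Λ : Finset Γ) (a : Obs D Λ) (θ : Config D (Λ \ X) → ℤˣ) :
    Commute (signOp D X Λ θ) (condE D X Λ a) := by
  rw [condE_apply, groupAvg_apply]
  refine Commute.smul_right (Commute.sum_right _ _ _ fun π _ => ?_) _
  set b := groupAvg (signOp D X Λ) a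
  have h1 : ∀ θ, signOp D X Λ θ * b = b * signOp D X Λ θ := fun θ =>
    (commute_groupAvg (signOp D X Λ) a θ).eq
  have h2 := signOp_mul_permOp X Λ (θ ∘ π) π⁻¹
  have h3 : (θ ∘ π) ∘ (π⁻¹ : Equiv.Perm _) = θ := by
    funext i; simp
  rw [h3] at h2
  unfold Commute SemiconjBy
  calc signOp D X Λ θ * (permOp D X Λ π * b * permOp D X Λ π⁻¹)
      = (signOp D X Λ θ * permOp D X Λ π) * b * permOp D X Λ π⁻¹ := by simp only [mul_assoc]
    _ = permOp D X Λ π * (signOp D X Λ (θ ∘ π) * b) * permOp D X Λ π⁻¹ := by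
        rw [signOp_mul_permOp]; simp only [mul_assoc]
    _ = permOp D X Λ π * b * (signOp D X Λ (θ ∘ π) * permOp D X Λ π⁻¹) := by
        rw [h1]; simp only [mul_assoc]
    _ = permOp D X Λ π * b * permOp D X Λ π⁻¹ * signOp D X Λ θ := by
        rw [h2]; simp only [mul_assoc]

open scoped Kronecker in
/-- A matrix on a product commuting with sign changes and permutations of the second factor is
a matrix on the first factor. -/
lemma eq_kronecker_one_of_commute {m n : Type*} [Fintype m] [DecidableEq m] [Fintype n]
    [DecidableEq n] [Nonempty n] (M : Matrix (m × n) (m × n) ℂ)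
    (hs : ∀ θ, Commute ((1 : Matrix m m ℂ) ⊗ₖ signMatrix n θ) M)
    (hp : ∀ π, Commute ((1 : Matrix m m ℂ) ⊗ₖ permutationMatrix n π) M) :
    ∃ A : Matrix m m ℂ, M = A ⊗ₖ (1 : Matrix n n ℂ) := by
  obtain ⟨i₀⟩ := ‹Nonempty n›
  refine ⟨Matrix.of fun x y => M (x, i₀) (y, i₀), ?_⟩
  have h1 : ∀ x y i j, i ≠ j → M (x, i) (y, j) = 0 := by
    intro x y i j hij
    -- Flipping only the sign of `i` multiplies the entry by `-1` from one side and by `1` from the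
    -- other.
    have h2 := congrFun (congrFun (hs (Function.update 1 i (-1))).eq (x, i)) (y, j)
    simp only [Matrix.mul_apply, Matrix.kroneckerMap_apply, Fintype.sum_prod_type,
      Matrix.one_apply, signMatrix, MonoidHom.coe_mk, OneHom.coe_mk, Matrix.diagonal_apply,
      ite_mul, mul_ite, one_mul, zero_mul, mul_zero, Finset.sum_ite_eq,
      Finset.sum_ite_eq', Finset.mem_univ, if_true] at h2
    simp [Function.update_of_ne hij.symm] at h2
    have h3 : (2 : ℂ) * M (x, i) (y, j) = 0 := by linear_combination -h2
    simpa using h3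
  have h2 : ∀ x y i, M (x, i) (y, i) = M (x, i₀) (y, i₀) := by
    intro x y i
    -- The transposition of `i` and `i₀` identifies the diagonal blocks at these two labels.
    have h2 := congrFun (congrFun (hp (Equiv.swap i i₀)).eq (x, i)) (y, i₀)
    simp only [Matrix.mul_apply, Matrix.kroneckerMap_apply, Fintype.sum_prod_type,
      Matrix.one_apply, permutationMatrix_apply,
      ite_mul, mul_ite, one_mul, mul_one, zero_mul, mul_zero] at h2
    have h4 : ∀ j, (i = Equiv.swap i i₀ j) = (i₀ = j) := fun j => by
      rw [← Equiv.swap_apply_right i i₀, Equiv.swap_apply_right, eq_iff_iff]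
      constructor
      · intro h
        have := congrArg (Equiv.swap i i₀) h
        simpa using this
      · rintro rfl; simp
    simp [h4] at h2
    exact h2.symm
  ext ⟨x, i⟩ ⟨y, j⟩
  rw [Matrix.kroneckerMap_apply, Matrix.one_apply, Matrix.of_apply]
  split_ifs with h
  · subst h; rw [h2, mul_one]
  · rw [h1 x y i j h, mul_zero]

-- Invariance under signs and permutations outside `X` leaves only matrices of the form `A ⊗ 1`,
-- after transport along `splitConfig`.
open scoped Kronecker in
lemma condE_mem [∀ x, NeZero (D x)] {X Λ : Finset Γ} (h : X ⊆ Λ) (a : Obs D Λ) :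
    condE D X Λ a ∈ loc D h := by
  set b := condE D X Λ a with hb
  set T := Matrix.toEuclideanCLM (n := Config D Λ) (𝕜 := ℂ) with hT
  set e := splitConfig D h with he
  have key : ∀ A, Commute (outsideHom D X Λ A) b →
      Commute ((1 : Matrix (Config D X) (Config D X) ℂ) ⊗ₖ A)
        ((T.symm b).submatrix e.symm e.symm) := by
    intro A hA
    have h1 : T.symm (outsideHom D X Λ A) =
        ((1 : Matrix (Config D X) (Config D X) ℂ) ⊗ₖ A).submatrix e e := by
      rw [outsideHom_apply, embed_eq, ← hT, StarAlgEquiv.symm_apply_apply,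
        StarAlgEquiv.symm_apply_apply, embedMatrix_sdiff_eq h]
    have h2 : Commute (T.symm (outsideHom D X Λ A)) (T.symm b) := by
      unfold Commute SemiconjBy
      rw [← map_mul, hA.eq, map_mul]
    rw [h1] at h2
    have h3 := congrArg (fun M => Matrix.submatrix M e.symm e.symm) h2.eq
    simp only [← Matrix.submatrix_mul_equiv _ _ _ e.symm _, Matrix.submatrix_submatrix,
      Equiv.self_comp_symm, Matrix.submatrix_id_id] at h3
    exact h3
  obtain ⟨A, hA⟩ := eq_kronecker_one_of_commute ((T.symm b).submatrix e.symm e.symm)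
    (fun θ => key _ (commute_signOp_condE X Λ a θ)) (fun π => key _ (commute_permOp_condE X Λ a π))
  refine (mem_loc h).2 ⟨Matrix.toEuclideanCLM (n := Config D X) (𝕜 := ℂ) A, ?_⟩
  rw [embed_eq, StarAlgEquiv.symm_apply_apply, embedMatrix, ← hA]
  simp only [Matrix.submatrix_submatrix, ← he, Equiv.symm_comp_self, Matrix.submatrix_id_id]
  exact StarAlgEquiv.apply_symm_apply _ _

end CondExp

/-! ### Unitary groups, Heisenberg evolution and growth of commutators. -/

section Dynamics

variable {𝒜 : Type*} [CStarAlgebra 𝒜]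

lemma exp_add_of_commute' {a b : 𝒜} (h : Commute a b) :
    NormedSpace.exp (a + b) = NormedSpace.exp a * NormedSpace.exp b := by
  let _ : NormedAlgebra ℚ 𝒜 := NormedAlgebra.restrictScalars ℚ ℂ 𝒜
  exact NormedSpace.exp_add_of_commute h

/-- The unitary group `exp(i t H)`. -/
def evol (H : 𝒜) (t : ℝ) : 𝒜 := NormedSpace.exp (t • (Complex.I • H))

lemma evol_zero (H : 𝒜) : evol H 0 = 1 := by
  rw [evol, zero_smul, NormedSpace.exp_zero]

lemma evol_add (H : 𝒜) (s t : ℝ) : evol H (s + t) = evol H s * evol H t := by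
  rw [evol, add_smul, exp_add_of_commute' (((Commute.refl _).smul_right t).smul_left s)]
  rfl

lemma evol_mul_neg (H : 𝒜) (t : ℝ) : evol H t * evol H (-t) = 1 := by
  rw [← evol_add, add_neg_cancel, evol_zero]

lemma evol_neg_mul (H : 𝒜) (t : ℝ) : evol H (-t) * evol H t = 1 := by
  rw [← evol_add, neg_add_cancel, evol_zero]

lemma star_evol {H : 𝒜} (hH : IsSelfAdjoint H) (t : ℝ) : star (evol H t) = evol H (-t) := by
  rw [evol, NormedSpace.star_exp, evol]
  congr 1
  rw [star_smul, star_smul, hH.star_eq]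
  simp

lemma norm_evol_le {H : 𝒜} (hH : IsSelfAdjoint H) (t : ℝ) : ‖evol H t‖ ≤ 1 :=
  norm_le_one_of_star_mul_self (by rw [star_evol hH, evol_neg_mul])

lemma hasDerivAt_evol (H : 𝒜) (t : ℝ) :
    HasDerivAt (evol H) (evol H t * (Complex.I • H)) t :=
  hasDerivAt_exp_smul_const (𝕂 := ℝ) (Complex.I • H) t

lemma hasDerivAt_evol' (H : 𝒜) (t : ℝ) :
    HasDerivAt (evol H) ((Complex.I • H) * evol H t) t :=
  hasDerivAt_exp_smul_const' (𝕂 := ℝ) (Complex.I • H) t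

lemma hasDerivAt_evol_neg (H : 𝒜) (t : ℝ) :
    HasDerivAt (fun s => evol H (-s)) (-((Complex.I • H) * evol H (-t))) t := by
  refine ((hasDerivAt_evol' H (-t)).scomp t (hasDerivAt_neg t)).congr_deriv ?_
  rw [neg_one_smul]

lemma continuous_evol (H : 𝒜) : Continuous (evol H) :=
  continuous_iff_continuousAt.2 fun t => (hasDerivAt_evol H t).continuousAt

/-- The Heisenberg evolution `a ↦ exp(i t H) a exp(-i t H)`. -/
def heis (H : 𝒜) (t : ℝ) : 𝒜 →L[ℂ] 𝒜 :=
  ContinuousLinearMap.mulLeftRight ℂ 𝒜 (evol H t) (evol H (-t))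

lemma heis_apply (H : 𝒜) (t : ℝ) (a : 𝒜) : heis H t a = evol H t * a * evol H (-t) := rfl

lemma heis_zero (H : 𝒜) (a : 𝒜) : heis H 0 a = a := by
  rw [heis_apply, neg_zero, evol_zero, one_mul, mul_one]

lemma heis_add (H : 𝒜) (s t : ℝ) (a : 𝒜) : heis H (s + t) a = heis H s (heis H t a) := by
  simp only [heis_apply, neg_add_rev, evol_add, mul_assoc]

lemma heis_mul (H : 𝒜) (t : ℝ) (a b : 𝒜) : heis H t (a * b) = heis H t a * heis H t b := by
  simp only [heis_apply]
  calc evol H t * (a * b) * evol H (-t) = evol H t * a * 1 * (b * evol H (-t)) := by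
        simp only [mul_assoc, one_mul]
    _ = _ := by rw [← evol_neg_mul H t]; simp only [mul_assoc]

lemma heis_star {H : 𝒜} (hH : IsSelfAdjoint H) (t : ℝ) (a : 𝒜) :
    heis H t (star a) = star (heis H t a) := by
  have h := star_evol hH (-t)
  rw [neg_neg] at h
  rw [heis_apply, heis_apply, star_mul, star_mul, star_evol hH t, h, mul_assoc]

lemma norm_heis_le {H : 𝒜} (hH : IsSelfAdjoint H) (t : ℝ) (a : 𝒜) : ‖heis H t a‖ ≤ ‖a‖ := by
  rw [heis_apply]
  calc ‖evol H t * a * evol H (-t)‖ ≤ ‖evol H t‖ * ‖a‖ * ‖evol H (-t)‖ := norm_mul₃_le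
    _ ≤ 1 * ‖a‖ * 1 := by gcongr <;> exact norm_evol_le hH _
    _ = ‖a‖ := by ring

lemma evol_commute {H a : 𝒜} (h : Commute H a) (t : ℝ) : Commute (evol H t) a :=
  Commute.exp_left (((h.smul_left Complex.I).smul_left t))

lemma heis_of_commute {H a : 𝒜} (h : Commute H a) (t : ℝ) : heis H t a = a := by
  rw [heis_apply, (evol_commute h t).eq, mul_assoc, evol_mul_neg, mul_one]

lemma hasDerivAt_heis (H : 𝒜) (a : 𝒜) (t : ℝ) :
    HasDerivAt (fun s => heis H s a) (heis H t (Complex.I • (H * a - a * H))) t := by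
  refine (((hasDerivAt_evol H t).mul_const a).mul (hasDerivAt_evol_neg H t)).congr_deriv ?_
  simp only [heis_apply, smul_sub, mul_sub, sub_mul, mul_assoc, smul_mul_assoc, mul_smul_comm, mul_neg]
  abel

/-- If the part `H - Hi` of the Hamiltonian commutes with `a`, the growth of the commutator of
the evolved `a` with `b` is controlled by the commutators of the evolved `Hi` with `b`. -/
lemma norm_commutator_heis_le {H Hi a b : 𝒜} (hH : IsSelfAdjoint H) (hHi : IsSelfAdjoint Hi)
    (hcomm : Commute (H - Hi) a) {T c : ℝ}
    (hc : ∀ s, |s| ≤ T → ‖heis H s Hi * b - b * heis H s Hi‖ ≤ c) {t : ℝ} (ht : |t| ≤ T) :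
    ‖heis H t a * b - b * heis H t a‖ ≤ ‖a * b - b * a‖ + 2 * ‖a‖ * (c * T) := by
  set Hr := H - Hi with hHr
  have hHrs : IsSelfAdjoint Hr := hH.sub hHi
  -- Interaction picture relative to `Hr`. Since `Hr` commutes with `a`, the evolved observable is
  -- `V t * a * W t` with `W` inverse to `V`, and only `Hi` enters the derivatives of `V` and `W`.
  set V : ℝ → 𝒜 := fun s => evol H s * evol Hr (-s) with hV
  set W : ℝ → 𝒜 := fun s => evol Hr s * evol H (-s) with hW
  have hVW : ∀ s, V s * W s = 1 := fun s => by
    simp only [hV, hW]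
    rw [mul_assoc, ← mul_assoc (evol Hr (-s)), evol_neg_mul, one_mul, evol_mul_neg]
  have hWV : ∀ s, W s * V s = 1 := fun s => by
    simp only [hV, hW]
    rw [mul_assoc, ← mul_assoc (evol H (-s)), evol_neg_mul, one_mul, evol_mul_neg]
  have hVn : ∀ s, ‖V s‖ ≤ 1 := fun s => (norm_mul_le _ _).trans
    (mul_le_one₀ (norm_evol_le hH _) (norm_nonneg _) (norm_evol_le hHrs _))
  have hWn : ∀ s, ‖W s‖ ≤ 1 := fun s => (norm_mul_le _ _).trans
    (mul_le_one₀ (norm_evol_le hHrs _) (norm_nonneg _) (norm_evol_le hH _))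
  have hVa : heis H t a = V t * a * W t := by
    simp only [hV, hW]
    have := heis_of_commute hcomm (-t)
    rw [heis_apply, neg_neg] at this
    calc heis H t a = evol H t * (evol Hr (-t) * a * evol Hr t) * evol H (-t) := by
          rw [this, heis_apply]
      _ = _ := by simp only [mul_assoc]
  have hVd : ∀ s, HasDerivAt V (Complex.I • (heis H s Hi * V s)) s := by
    intro s
    refine ((hasDerivAt_evol H s).mul (hasDerivAt_evol_neg Hr s)).congr_deriv ?_
    simp only [hV, heis_apply]
    have h1 : evol H (-s) * (evol H s * evol Hr (-s)) = evol Hr (-s) := by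
      rw [← mul_assoc, evol_neg_mul, one_mul]
    rw [mul_assoc (evol H s * Hi), h1, hHr]
    simp only [smul_sub, mul_sub, sub_mul, mul_assoc, smul_mul_assoc, mul_smul_comm,
      neg_sub]
    abel
  have hWd : ∀ s, HasDerivAt W (-(Complex.I • (W s * heis H s Hi))) s := by
    intro s
    refine ((hasDerivAt_evol Hr s).mul (hasDerivAt_evol_neg H s)).congr_deriv ?_
    simp only [hW, heis_apply]
    have h1 : (evol Hr s * evol H (-s)) * (evol H s * Hi * evol H (-s)) =
        evol Hr s * Hi * evol H (-s) := by
      calc _ = evol Hr s * (evol H (-s) * evol H s) * Hi * evol H (-s) := by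
            simp only [mul_assoc]
        _ = _ := by rw [evol_neg_mul, mul_one]
    rw [h1, hHr]
    simp only [smul_sub, mul_sub, sub_mul, mul_assoc, smul_mul_assoc, mul_smul_comm, mul_neg]
    abel
  have hd : ∀ s, HasDerivAt (fun s => W s * b * V s)
      (-(Complex.I • (W s * (heis H s Hi * b - b * heis H s Hi) * V s))) s := by
    intro s
    refine (((hWd s).mul_const b).mul (hVd s)).congr_deriv ?_
    simp only [smul_sub, mul_sub, sub_mul, mul_assoc, smul_mul_assoc, mul_smul_comm,
      neg_mul]
    abel
  -- Mean value inequality: the derivative of `W b V` is, up to a phase, `W [τ_s(Hi), b] V`, of norm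
  -- at most `c`.
  have hbound : ‖W t * b * V t - b‖ ≤ c * T := by
    have h0 : W 0 * b * V 0 = b := by
      simp only [hV, hW, neg_zero, evol_zero, mul_one, one_mul]
    have h1 := Convex.norm_image_sub_le_of_norm_hasDerivWithin_le (𝕜 := ℝ)
      (s := Set.Icc (-T) T) (C := c) (fun s _ => (hd s).hasDerivWithinAt) (fun s hs => by
        rw [norm_neg, norm_smul, Complex.norm_I, one_mul]
        calc _ ≤ ‖W s‖ * ‖heis H s Hi * b - b * heis H s Hi‖ * ‖V s‖ := norm_mul₃_le
          _ ≤ 1 * c * 1 := by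
            have := hc s (abs_le.2 hs)
            have := (norm_nonneg _).trans this
            gcongr
            · exact hWn s
            · exact hVn s
          _ = c := by ring) (convex_Icc _ _)
        (x := 0) (y := t) (by
          have := (abs_nonneg t).trans ht
          constructor <;> linarith) (abs_le.1 ht)
    rw [h0, sub_zero, Real.norm_eq_abs] at h1
    have hc0 : 0 ≤ c := (norm_nonneg _).trans (hc 0 (by rw [abs_zero]; exact (abs_nonneg t).trans ht))
    exact h1.trans (by gcongr)
  set b' := W t * b * V t with hb'
  have hb : b = V t * b' * W t := by
    rw [hb']
    calc b = (V t * W t) * b * (V t * W t) := by rw [hVW, one_mul, mul_one]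
      _ = _ := by simp only [mul_assoc]
  have h3 : heis H t a * b - b * heis H t a = V t * (a * b' - b' * a) * W t := by
    have h4 : ∀ p q : 𝒜, (V t * p * W t) * (V t * q * W t) = V t * (p * q) * W t := fun p q => by
      calc _ = V t * p * (W t * V t) * q * W t := by simp only [mul_assoc]
        _ = _ := by rw [hWV, mul_one]; simp only [mul_assoc]
    rw [hVa, hb, h4, h4, mul_sub, sub_mul]
  rw [h3]
  calc _ ≤ ‖V t‖ * ‖a * b' - b' * a‖ * ‖W t‖ := norm_mul₃_le
    _ ≤ 1 * ‖a * b' - b' * a‖ * 1 := by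
      gcongr
      · exact hVn t
      · exact hWn t
    _ = ‖(a * b - b * a) + (a * (b' - b) - (b' - b) * a)‖ := by
      rw [one_mul, mul_one]; congr 1; noncomm_ring
    _ ≤ ‖a * b - b * a‖ + (‖a‖ * ‖b' - b‖ + ‖b' - b‖ * ‖a‖) :=
      (norm_add_le _ _).trans (add_le_add le_rfl ((norm_sub_le _ _).trans
        (add_le_add (norm_mul_le _ _) (norm_mul_le _ _))))
    _ = ‖a * b - b * a‖ + 2 * ‖a‖ * ‖b' - b‖ := by ring
    _ ≤ _ := by gcongr

end Dynamics

/-! ### The short-time Lieb–Robinson bound. -/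

section LiebRobinson

variable {D : Γ → ℕ}

/-- The term of a potential on `Z`, as an observable in volume `Λ` (zero unless `Z ⊆ Λ`). -/
def Potential.term (Ψ : Potential D) (Λ Z : Finset Γ) : Obs D Λ :=
  if h : Z ⊆ Λ then embed h (Ψ Λ Z) else 0

lemma Potential.term_eq (Ψ : Potential D) {Λ Z : Finset Γ} (h : Z ⊆ Λ) :
    Ψ.term Λ Z = embed h (Ψ Λ Z) := dif_pos h

lemma Potential.ham_eq_sum_term (Ψ : Potential D) (Λ : Finset Γ) :
    Ψ.ham Λ = ∑ Z ∈ Λ.powerset, Ψ.term Λ Z := by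
  rw [Potential.ham, ← Finset.sum_attach Λ.powerset]
  exact Finset.sum_congr rfl fun Z _ => (Ψ.term_eq (Finset.mem_powerset.1 Z.2)).symm

lemma Potential.term_mem (Ψ : Potential D) {Λ Z X : Finset Γ} (hZ : Z ⊆ X) (hX : X ⊆ Λ) :
    Ψ.term Λ Z ∈ loc D hX := by
  rw [Ψ.term_eq (hZ.trans hX)]
  exact embed_mem_loc hX hZ _ _

lemma isSelfAdjoint_embed {Z Λ : Finset Γ} (h : Z ⊆ Λ) {a : Obs D Z} (ha : IsSelfAdjoint a) :
    IsSelfAdjoint (embed h a) := by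
  rw [← embedHom_apply]
  unfold IsSelfAdjoint
  rw [← map_star, ha.star_eq]

lemma Potential.IsHermitian.term {Ψ : Potential D} (hΨ : Ψ.IsHermitian) (Λ Z : Finset Γ) :
    IsSelfAdjoint (Ψ.term Λ Z) := by
  rw [Potential.term]
  split_ifs with h
  · exact isSelfAdjoint_embed h (hΨ Λ Z h)
  · exact IsSelfAdjoint.zero (Obs D Λ)

lemma isSelfAdjoint_sum' {R : Type*} [NonUnitalRing R] [StarRing R] {ι : Type*} (s : Finset ι)
    {f : ι → R} (h : ∀ i ∈ s, IsSelfAdjoint (f i)) : IsSelfAdjoint (∑ i ∈ s, f i) := by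
  rw [IsSelfAdjoint, star_sum]
  exact Finset.sum_congr rfl fun i hi => h i hi

lemma Potential.IsHermitian.ham {Ψ : Potential D} (hΨ : Ψ.IsHermitian) (Λ : Finset Γ) :
    IsSelfAdjoint (Ψ.ham Λ) := by
  rw [Ψ.ham_eq_sum_term]
  exact isSelfAdjoint_sum' _ fun Z _ => hΨ.term Λ Z

variable [∀ x, NeZero (D x)]

lemma Potential.norm_term (Ψ : Potential D) {Λ Z : Finset Γ} (h : Z ⊆ Λ) :
    ‖Ψ.term Λ Z‖ = ‖Ψ Λ Z‖ := by
  rw [Ψ.term_eq h, norm_embed]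

variable [MetricSpace Γ]

/-- The real-valued form of the bound `‖Ψ‖_F ≤ M`. -/
def Potential.Bound (Ψ : Potential D) (F : ℝ → ℝ) (M : ℝ) : Prop :=
  ∀ (Λ : Finset Γ) (x y : Γ),
    ∑ Z ∈ Λ.powerset with x ∈ Z ∧ y ∈ Z, ‖Ψ Λ Z‖ ≤ M * F (dist x y)

/-- A weight function satisfying the convolution inequality with constant `C`. -/
structure IsConvWeight (Γ : Type*) [MetricSpace Γ] (F : ℝ → ℝ) (C : ℝ) : Prop where
  pos : ∀ r, 0 ≤ r → 0 < F r
  conv : ∀ (Λ : Finset Γ) (x z : Γ),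
    ∑ y ∈ Λ, F (dist x y) * F (dist y z) ≤ C * F (dist x z)

/-- The empty region is disjoint from all of `Λ`. Potentials may have a term on the empty set; this
keeps it harmless in every commutator. -/
lemma mem_loc_empty_commute {Λ : Finset Γ} {a : Obs D Λ} (b : Obs D Λ)
    (ha : a ∈ loc D (Finset.empty_subset Λ)) : Commute a b :=
  commute_of_mem_loc (Finset.disjoint_empty_left Λ) _ _ ha (mem_loc_self b)

lemma norm_commutator_le {𝒜 : Type*} [NormedRing 𝒜] (a b : 𝒜) :
    ‖a * b - b * a‖ ≤ 2 * ‖a‖ * ‖b‖ := by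
  refine (norm_sub_le _ _).trans ?_
  have h1 := norm_mul_le a b
  have h2 := norm_mul_le b a
  linarith

/-- The part of the Hamiltonian that touches `X`. -/
def Potential.hamTouching (Ψ : Potential D) (X Λ : Finset Γ) : Obs D Λ :=
  ∑ Z ∈ Λ.powerset with ¬ Disjoint Z X, Ψ.term Λ Z

lemma Potential.commute_ham_sub (Ψ : Potential D) {X Λ : Finset Γ} (h : X ⊆ Λ) {a : Obs D Λ}
    (ha : a ∈ loc D h) : Commute (Ψ.ham Λ - Ψ.hamTouching X Λ) a := by
  have h1 : Ψ.ham Λ - Ψ.hamTouching X Λ = ∑ Z ∈ Λ.powerset with Disjoint Z X, Ψ.term Λ Z := by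
    rw [Ψ.ham_eq_sum_term, hamTouching, sub_eq_iff_eq_add, Finset.sum_filter_add_sum_filter_not]
  rw [h1]
  refine Commute.sum_left _ _ _ fun Z hZ => ?_
  rw [Finset.mem_filter, Finset.mem_powerset] at hZ
  exact commute_of_mem_loc hZ.2 hZ.1 h (Ψ.term_mem (Finset.Subset.refl Z) hZ.1) ha

/-- Sums over the sets touching `X` are bounded by sums over the points of `X`. -/
lemma sum_touching_le {X Λ : Finset Γ} {f : Finset Γ → ℝ} (hf : ∀ Z, 0 ≤ f Z) :
    ∑ Z ∈ Λ.powerset with ¬ Disjoint Z X, f Z ≤ ∑ x ∈ X, ∑ Z ∈ Λ.powerset with x ∈ Z, f Z := by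
  simp only [Finset.sum_filter]
  rw [Finset.sum_comm]
  refine Finset.sum_le_sum fun Z _ => ?_
  have h0 : ∀ x ∈ X, 0 ≤ if x ∈ Z then f Z else 0 := fun x _ => by
    split_ifs
    exacts [hf Z, le_rfl]
  by_cases h : Disjoint Z X
  · rw [if_neg (not_not.2 h)]
    exact Finset.sum_nonneg h0
  · rw [if_pos h]
    obtain ⟨x, hxZ, hxX⟩ := Finset.not_disjoint_iff.1 h
    exact le_trans (by rw [if_pos hxZ]) (Finset.single_le_sum h0 hxX)

/-- After exchanging the sums, the terms containing a given pair `x, z` are exactly those controlled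
by `F (dist x z)`. -/
lemma sum_terms_weight_le {Ψ : Potential D} {F : ℝ → ℝ} {M : ℝ} (hΨ : Ψ.Bound F M)
    {X Λ : Finset Γ} {w : Γ → ℝ} (hw : ∀ z, 0 ≤ w z) :
    ∑ Z ∈ Λ.powerset with ¬ Disjoint Z X, ‖Ψ Λ Z‖ * ∑ z ∈ Z, w z ≤
      ∑ x ∈ X, ∑ z ∈ Λ, M * F (dist x z) * w z := by
  refine (sum_touching_le fun Z => mul_nonneg (norm_nonneg _)
    (Finset.sum_nonneg fun z _ => hw z)).trans (Finset.sum_le_sum fun x _ => ?_)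
  have h1 : ∀ Z ∈ Λ.powerset.filter (fun Z => x ∈ Z), ‖Ψ Λ Z‖ * ∑ z ∈ Z, w z =
      ∑ z ∈ Λ, if z ∈ Z then ‖Ψ Λ Z‖ * w z else 0 := by
    intro Z hZ
    rw [Finset.mem_filter, Finset.mem_powerset] at hZ
    rw [Finset.mul_sum, ← Finset.sum_filter]
    congr 1
    ext z
    simp only [Finset.mem_filter]
    exact ⟨fun h => ⟨hZ.1 h, h⟩, fun h => h.2⟩
  rw [Finset.sum_congr rfl h1, Finset.sum_comm]
  refine Finset.sum_le_sum fun z _ => ?_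
  rw [← Finset.sum_filter, Finset.filter_filter, ← Finset.sum_mul]
  exact mul_le_mul_of_nonneg_right (hΨ Λ x z) (hw z)

/-- One contraction step. An a priori constant `m`, applied to the terms of the Hamiltonian touching
`X` and combined with the convolution inequality, returns with a factor `2 M C T ≤ 1/2`. The
commutator at time zero contributes `2 / F 0`. The fixed point of `m ↦ 2 / F 0 + m / 2` is `4 / F
0`. -/
lemma commutator_heis_improve {Ψ : Potential D} (hH : Ψ.IsHermitian) {F : ℝ → ℝ} {M C T : ℝ}
    (hF : IsConvWeight Γ F C) (hΨ : Ψ.Bound F M) (hM : 0 ≤ M)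
    (hT : 4 * M * C * T ≤ 1)
    {Λ Y : Finset Γ} (hY : Y ⊆ Λ) {b : Obs D Λ} (hb : b ∈ loc D hY) (hb1 : ‖b‖ ≤ 1)
    {m : ℝ} (hm : 0 ≤ m)
    (h : ∀ (X : Finset Γ) (hX : X ⊆ Λ), ∀ a ∈ loc D hX, ∀ t : ℝ, |t| ≤ T →
      ‖heis (Ψ.ham Λ) t a * b - b * heis (Ψ.ham Λ) t a‖ ≤
        m * ‖a‖ * ∑ x ∈ X, ∑ y ∈ Y, F (dist x y)) :
    ∀ (X : Finset Γ) (hX : X ⊆ Λ), ∀ a ∈ loc D hX, ∀ t : ℝ, |t| ≤ T →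
      ‖heis (Ψ.ham Λ) t a * b - b * heis (Ψ.ham Λ) t a‖ ≤
        (2 / F 0 + m / 2) * ‖a‖ * ∑ x ∈ X, ∑ y ∈ Y, F (dist x y) := by
  intro X hX a ha t ht
  set w : Γ → ℝ := fun x => ∑ y ∈ Y, F (dist x y) with hw
  have hw0 : ∀ x, 0 ≤ w x := fun x => Finset.sum_nonneg fun y _ => (hF.pos _ dist_nonneg).le
  have hW0 : 0 ≤ ∑ x ∈ X, w x := Finset.sum_nonneg fun x _ => hw0 x
  have hF0 := hF.pos 0 le_rfl
  have hHi : IsSelfAdjoint (Ψ.hamTouching X Λ) := isSelfAdjoint_sum' _ fun Z _ => hH.term Λ Z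
  have hc : ∀ s, |s| ≤ T → ‖heis (Ψ.ham Λ) s (Ψ.hamTouching X Λ) * b -
      b * heis (Ψ.ham Λ) s (Ψ.hamTouching X Λ)‖ ≤ m * (M * C * ∑ x ∈ X, w x) := by
    intro s hs
    rw [Potential.hamTouching, map_sum, Finset.sum_mul, Finset.mul_sum, ← Finset.sum_sub_distrib]
    refine (norm_sum_le _ _).trans ?_
    calc _ ≤ ∑ Z ∈ Λ.powerset with ¬ Disjoint Z X, m * (‖Ψ Λ Z‖ * ∑ z ∈ Z, w z) := by
          refine Finset.sum_le_sum fun Z hZ => ?_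
          rw [Finset.mem_filter, Finset.mem_powerset] at hZ
          rw [← mul_assoc, ← Ψ.norm_term hZ.1]
          exact h Z hZ.1 _ (Ψ.term_mem (Finset.Subset.refl Z) hZ.1) s hs
      _ ≤ m * ∑ x ∈ X, ∑ z ∈ Λ, M * F (dist x z) * w z := by
          rw [← Finset.mul_sum]
          exact mul_le_mul_of_nonneg_left (sum_terms_weight_le hΨ hw0) hm
      _ ≤ m * ∑ x ∈ X, M * C * w x := by
          refine mul_le_mul_of_nonneg_left (Finset.sum_le_sum fun x _ => ?_) hm
          have : ∀ z ∈ Λ, M * F (dist x z) * w z =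
              ∑ y ∈ Y, M * (F (dist x z) * F (dist z y)) := fun z _ => by
            rw [hw, Finset.mul_sum]
            exact Finset.sum_congr rfl fun y _ => by ring
          rw [Finset.sum_congr rfl this, Finset.sum_comm, hw, Finset.mul_sum]
          refine Finset.sum_le_sum fun y _ => ?_
          rw [← Finset.mul_sum, mul_assoc M C]
          exact mul_le_mul_of_nonneg_left (hF.conv Λ x y) hM
      _ = _ := by rw [← Finset.mul_sum]
  have h1 := norm_commutator_heis_le (b := b) (hH.ham Λ) hHi (Ψ.commute_ham_sub hX ha) hc ht
  have h2 : ‖a * b - b * a‖ ≤ 2 / F 0 * ‖a‖ * ∑ x ∈ X, w x := by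
    by_cases hd : Disjoint X Y
    -- Disjoint supports give zero; overlapping ones make the weight at least `F 0`, so that the
    -- trivial bound suffices.
    · rw [(commute_of_mem_loc hd hX hY ha hb).eq, sub_self, norm_zero]
      positivity
    · obtain ⟨x, hxX, hxY⟩ := Finset.not_disjoint_iff.1 hd
      have h3 : F 0 ≤ ∑ x ∈ X, w x := by
        refine le_trans ?_ (Finset.single_le_sum (f := w) (fun x _ => hw0 x) hxX)
        have := Finset.single_le_sum (f := fun y => F (dist x y))
          (fun y _ => (hF.pos _ dist_nonneg).le) hxY
        simpa using this
      calc _ ≤ 2 * ‖a‖ * ‖b‖ := norm_commutator_le a b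
        _ ≤ 2 * ‖a‖ * 1 := by gcongr
        _ = 2 / F 0 * ‖a‖ * F 0 := by field_simp
        _ ≤ _ := by gcongr
  have h3 : 2 * ‖a‖ * (m * (M * C * ∑ x ∈ X, w x) * T) ≤ m / 2 * ‖a‖ * ∑ x ∈ X, w x := by
    have h4 : 0 ≤ m * ‖a‖ * ∑ x ∈ X, w x := by positivity
    have h5 := mul_le_mul_of_nonneg_left hT h4
    nlinarith
  calc _ ≤ _ := h1
    _ ≤ 2 / F 0 * ‖a‖ * ∑ x ∈ X, w x + m / 2 * ‖a‖ * ∑ x ∈ X, w x := add_le_add h2 h3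
    _ = _ := by rw [hw]; ring

/-- The Lieb–Robinson bound for short times. -/
theorem commutator_heis_le {Ψ : Potential D} (hH : Ψ.IsHermitian) {F : ℝ → ℝ} {M C T : ℝ}
    (hF : IsConvWeight Γ F C) (hΨ : Ψ.Bound F M) (hM : 0 ≤ M)
    (hT : 4 * M * C * T ≤ 1)
    {Λ Y X : Finset Γ} (hY : Y ⊆ Λ) {b : Obs D Λ} (hb : b ∈ loc D hY) (hb1 : ‖b‖ ≤ 1)
    (hX : X ⊆ Λ) {a : Obs D Λ} (ha : a ∈ loc D hX) {t : ℝ} (ht : |t| ≤ T) :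
    ‖heis (Ψ.ham Λ) t a * b - b * heis (Ψ.ham Λ) t a‖ ≤
      4 / F 0 * ‖a‖ * ∑ x ∈ X, ∑ y ∈ Y, F (dist x y) := by
  rcases Y.eq_empty_or_nonempty with rfl | ⟨y₀, hy₀⟩
  · rw [(mem_loc_empty_commute _ hb).eq, sub_self, norm_zero]
    simp
  set w : Γ → ℝ := fun x => ∑ y ∈ Y, F (dist x y) with hw
  have hw0 : ∀ x, 0 < w x := fun x => Finset.sum_pos (fun y _ => hF.pos _ dist_nonneg) ⟨y₀, hy₀⟩
  have hF0 := hF.pos 0 le_rfl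
  -- A crude constant, depending on the volume, for which the trivial bound `2 ‖a‖` already has the
  -- required form. It is halved at every iteration and disappears in the limit.
  set δ : ℝ := ∑ x ∈ Λ, 2 / w x with hδ
  have hδ0 : 0 ≤ δ := Finset.sum_nonneg fun x _ => (div_pos two_pos (hw0 x)).le
  have key : ∀ j : ℕ, ∀ (X : Finset Γ) (hX : X ⊆ Λ), ∀ a ∈ loc D hX, ∀ t : ℝ, |t| ≤ T →
      ‖heis (Ψ.ham Λ) t a * b - b * heis (Ψ.ham Λ) t a‖ ≤
        (4 / F 0 + δ * (1 / 2) ^ j) * ‖a‖ * ∑ x ∈ X, ∑ y ∈ Y, F (dist x y) := by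
    intro j
    induction j with
    | zero =>
      intro X hX a ha t ht
      rcases X.eq_empty_or_nonempty with rfl | ⟨x₀, hx₀⟩
      · rw [heis_of_commute (mem_loc_empty_commute _ ha).symm, (mem_loc_empty_commute _ ha).eq,
          sub_self, norm_zero]
        simp
      · have h1 : 2 ≤ δ * ∑ x ∈ X, w x := by
          have h2 : 2 / w x₀ ≤ δ := Finset.single_le_sum (f := fun x => 2 / w x)
            (fun x _ => (div_pos two_pos (hw0 x)).le) (hX hx₀)
          have h3 : w x₀ ≤ ∑ x ∈ X, w x := Finset.single_le_sum (fun x _ => (hw0 x).le) hx₀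
          calc (2 : ℝ) = 2 / w x₀ * w x₀ := by field_simp [(hw0 x₀).ne']
            _ ≤ _ := mul_le_mul h2 h3 (hw0 x₀).le hδ0
        have hS : 0 ≤ ∑ x ∈ X, w x := Finset.sum_nonneg fun x _ => (hw0 x).le
        calc _ ≤ 2 * ‖heis (Ψ.ham Λ) t a‖ * ‖b‖ := norm_commutator_le _ _
          _ ≤ 2 * ‖a‖ * 1 := by
            gcongr
            exact norm_heis_le (hH.ham Λ) t a
          _ = 2 * ‖a‖ := mul_one _
          _ ≤ (δ * ∑ x ∈ X, w x) * ‖a‖ := by gcongr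
          _ = (0 + δ * (1 / 2) ^ 0) * ‖a‖ * ∑ x ∈ X, w x := by ring
          _ ≤ _ := by
            have : 0 ≤ 4 / F 0 := by positivity
            gcongr
    | succ j ih =>
      have h1 := commutator_heis_improve hH hF hΨ hM hT hY hb hb1 (by positivity) ih
      convert h1 using 8
      rw [pow_succ]
      ring
  have hlim : Filter.Tendsto (fun j : ℕ => (4 / F 0 + δ * (1 / 2) ^ j) * ‖a‖ *
      ∑ x ∈ X, ∑ y ∈ Y, F (dist x y)) Filter.atTop
      (nhds ((4 / F 0 + δ * 0) * ‖a‖ * ∑ x ∈ X, ∑ y ∈ Y, F (dist x y))) := by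
    have := tendsto_pow_atTop_nhds_zero_of_lt_one (r := (1 / 2 : ℝ)) (by norm_num) (by norm_num)
    exact (((this.const_mul δ).const_add _).mul_const _).mul_const _
  rw [mul_zero, add_zero] at hlim
  exact ge_of_tendsto' hlim fun j => key j X hX a ha t ht

/-- The commutator bound with all observables outside `X'`, fed into `norm_sub_condE_le`; the factor
2 there turns `4 / F 0` into `8 / F 0`. -/
theorem norm_heis_sub_condE_le {Ψ : Potential D} (hH : Ψ.IsHermitian) {F : ℝ → ℝ} {M C T : ℝ}
    (hF : IsConvWeight Γ F C) (hΨ : Ψ.Bound F M) (hM : 0 ≤ M)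
    (hT : 4 * M * C * T ≤ 1) {Λ X : Finset Γ} (X' : Finset Γ)
    (hX : X ⊆ Λ) {a : Obs D Λ} (ha : a ∈ loc D hX) {t : ℝ} (ht : |t| ≤ T) :
    ‖heis (Ψ.ham Λ) t a - condE D X' Λ (heis (Ψ.ham Λ) t a)‖ ≤
      8 / F 0 * ‖a‖ * ∑ x ∈ X, ∑ y ∈ Λ \ X', F (dist x y) := by
  have := norm_sub_condE_le X' Λ fun u hu hu1 =>
    commutator_heis_le hH hF hΨ hM hT (Finset.sdiff_subset (s := Λ) (t := X')) hu hu1 hX ha ht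
  calc _ ≤ _ := this
    _ = _ := by ring

end LiebRobinson

/-! ### Balls, polynomial growth and sums of decay functions. -/

section Geometry

/-- The points of `Λ` at distance at most `r` from `x`. -/
def ball [MetricSpace Γ] (Λ : Finset Γ) (x : Γ) (r : ℕ) : Finset Γ := Λ.filter fun y => dist x y ≤ r

variable [MetricSpace Γ]

lemma mem_ball {Λ : Finset Γ} {x y : Γ} {r : ℕ} : y ∈ ball Λ x r ↔ y ∈ Λ ∧ dist x y ≤ r :=
  Finset.mem_filter

lemma ball_subset (Λ : Finset Γ) (x : Γ) (r : ℕ) : ball Λ x r ⊆ Λ := Finset.filter_subset _ _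

lemma ball_mono {Λ : Finset Γ} {x : Γ} {r r' : ℕ} (h : r ≤ r') : ball Λ x r ⊆ ball Λ x r' :=
  fun y hy => mem_ball.2 ⟨(mem_ball.1 hy).1, (mem_ball.1 hy).2.trans (by exact_mod_cast h)⟩

lemma exists_ball_eq (Λ : Finset Γ) : ∃ N : ℕ, ∀ x ∈ Λ, ∀ r, N ≤ r → ball Λ x r = Λ := by
  obtain ⟨N, hN⟩ := exists_nat_ge (∑ x ∈ Λ, ∑ y ∈ Λ, dist x y)
  refine ⟨N, fun x hx r hr => (ball_subset Λ x r).antisymm fun y hy => mem_ball.2 ⟨hy, ?_⟩⟩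
  have h1 : dist x y ≤ ∑ y ∈ Λ, dist x y :=
    Finset.single_le_sum (f := fun y => dist x y) (fun y _ => dist_nonneg) hy
  have h2 : ∑ y ∈ Λ, dist x y ≤ ∑ x ∈ Λ, ∑ y ∈ Λ, dist x y :=
    Finset.single_le_sum (f := fun x => ∑ y ∈ Λ, dist x y)
      (fun x _ => Finset.sum_nonneg fun y _ => dist_nonneg) hx
  have h3 : (N : ℝ) ≤ r := by exact_mod_cast hr
  linarith

lemma exists_ball_eq' (Λ : Finset Γ) (x : Γ) : ∃ N : ℕ, ball Λ x N = Λ := by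
  obtain ⟨N, hN⟩ := exists_ball_eq (insert x Λ)
  refine ⟨N, (ball_subset Λ x N).antisymm fun y hy => mem_ball.2 ⟨hy, ?_⟩⟩
  have := hN x (Finset.mem_insert_self _ _) N le_rfl
  have hy' : y ∈ ball (insert x Λ) x N := by
    rw [this]
    exact Finset.mem_insert_of_mem hy
  exact (mem_ball.1 hy').2

/-- Finite balls have at most `κ (1 + r) ^ d` points. -/
structure Growth (Γ : Type*) [MetricSpace Γ] (d : ℕ) (κ : ℝ) : Prop where
  one_le : 1 ≤ κ
  card_le : ∀ (Λ : Finset Γ) (x : Γ) (r : ℕ),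
    ((Λ.filter fun y => dist x y ≤ r).card : ℝ) ≤ κ * (1 + r) ^ d

lemma HasFiniteDimension.exists_growth (h : HasFiniteDimension Γ) : ∃ d κ, Growth Γ d κ := by
  obtain ⟨d, κ, h⟩ := h
  refine ⟨d, max κ 1, le_max_right _ _, fun Λ x r => ?_⟩
  obtain ⟨h1, h2⟩ := h x r r.cast_nonneg
  have h3 : (Λ.filter fun y => dist x y ≤ r).card ≤ (Metric.closedBall x (r : ℝ)).ncard := by
    rw [← Set.ncard_coe_finset]
    refine Set.ncard_le_ncard (fun y hy => ?_) h1
    rw [Finset.mem_coe, Finset.mem_filter] at hy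
    rw [Metric.mem_closedBall, dist_comm]
    exact hy.2
  calc _ ≤ ((Metric.closedBall x (r : ℝ)).ncard : ℝ) := by exact_mod_cast h3
    _ ≤ κ * (1 + r) ^ d := h2
    _ ≤ _ := by gcongr; exact le_max_left _ _

/-- Telescoping: each new term is at most `1 / (1 + n) - 1 / (2 + n)`. -/
lemma sum_inv_sq_le (n : ℕ) : ∑ j ∈ Finset.range n, ((1 + (j : ℝ)) ^ 2)⁻¹ ≤ 2 := by
  have h : ∀ n : ℕ, ∑ j ∈ Finset.range (n + 1), ((1 + (j : ℝ)) ^ 2)⁻¹ ≤ 2 - 1 / (1 + (n : ℝ)) := by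
    intro n
    induction n with
    | zero => norm_num
    | succ n ih =>
      rw [Finset.sum_range_succ]
      have h1 : (0 : ℝ) < 1 + n := by positivity
      have h2 : ((1 + ((n + 1 : ℕ) : ℝ)) ^ 2)⁻¹ ≤ 1 / (1 + (n : ℝ)) - 1 / (1 + ((n + 1 : ℕ) : ℝ)) := by
        push_cast
        rw [div_sub_div _ _ h1.ne' (by positivity), inv_eq_one_div,
          div_le_div_iff₀ (by positivity) (by positivity)]
        nlinarith
      linarith
  have h2 : (0 : ℝ) ≤ 1 / (1 + (n : ℝ)) := by positivity
  refine (Finset.sum_le_sum_of_subset_of_nonneg (Finset.range_mono n.le_succ)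
    fun _ _ _ => by positivity).trans ((h n).trans (by linarith))

/-- The points are grouped by `⌈dist x y⌉₊ = m`. There are at most `κ (1 + m)^d` of them in a group,
which leaves the summable `(1 + m)^(-2)`; rounding the distance up costs `2^(d+2)`. -/
lemma Growth.sum_inv_pow_le {d : ℕ} {κ : ℝ} (hg : Growth Γ d κ) (Λ : Finset Γ) (x : Γ) :
    ∑ y ∈ Λ, ((1 + dist x y) ^ (d + 2))⁻¹ ≤ 2 ^ (d + 3) * κ := by
  have hκ := hg.one_le
  have h1 : ∀ y ∈ Λ, ((1 + dist x y) ^ (d + 2))⁻¹ ≤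
      2 ^ (d + 2) * ((1 + (⌈dist x y⌉₊ : ℝ)) ^ (d + 2))⁻¹ := by
    intro y _
    have hd : 0 ≤ dist x y := dist_nonneg
    have h2 := (Nat.ceil_lt_add_one hd).le
    rw [← div_eq_mul_inv, inv_le_iff_one_le_mul₀ (by positivity), div_mul_eq_mul_div,
      le_div_iff₀ (by positivity), one_mul, ← mul_pow]
    gcongr
    linarith
  have h2 : ∀ m ∈ Λ.image (fun y => ⌈dist x y⌉₊),
      ((Λ.filter fun y => ⌈dist x y⌉₊ = m).card : ℝ) * ((1 + (m : ℝ)) ^ (d + 2))⁻¹ ≤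
        κ * ((1 + (m : ℝ)) ^ 2)⁻¹ := by
    intro m _
    have h3 : ((Λ.filter fun y => ⌈dist x y⌉₊ = m).card : ℝ) ≤ κ * (1 + m) ^ d := by
      refine le_trans ?_ (hg.card_le Λ x m)
      gcongr with y hy
      intro h
      rw [← h]
      exact Nat.le_ceil _
    calc _ ≤ κ * (1 + m) ^ d * ((1 + (m : ℝ)) ^ (d + 2))⁻¹ := by gcongr
      _ = _ := by
        rw [pow_add]
        field_simp
  calc _ ≤ ∑ y ∈ Λ, 2 ^ (d + 2) * ((1 + (⌈dist x y⌉₊ : ℝ)) ^ (d + 2))⁻¹ := Finset.sum_le_sum h1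
    _ = 2 ^ (d + 2) * ∑ m ∈ Λ.image (fun y => ⌈dist x y⌉₊),
        ((Λ.filter fun y => ⌈dist x y⌉₊ = m).card : ℝ) * ((1 + (m : ℝ)) ^ (d + 2))⁻¹ := by
      rw [← Finset.mul_sum, Finset.sum_comp (fun m : ℕ => ((1 + (m : ℝ)) ^ (d + 2))⁻¹)]
      simp only [nsmul_eq_mul]
    _ ≤ 2 ^ (d + 2) * ∑ m ∈ Λ.image (fun y => ⌈dist x y⌉₊), κ * ((1 + (m : ℝ)) ^ 2)⁻¹ := by
      exact mul_le_mul_of_nonneg_left (Finset.sum_le_sum h2) (by positivity)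
    _ ≤ 2 ^ (d + 2) * (κ * 2) := by
      rw [← Finset.mul_sum]
      gcongr
      obtain ⟨n, hn⟩ := Finset.exists_nat_subset_range (Λ.image fun y => ⌈dist x y⌉₊)
      exact (Finset.sum_le_sum_of_subset_of_nonneg hn fun _ _ _ => by positivity).trans
        (sum_inv_sq_le n)
    _ = _ := by ring

/-- The tails of a rapidly decaying function are summable with rapidly decaying sums. -/
lemma Growth.exists_tail {d : ℕ} {κ : ℝ} (hg : Growth Γ d κ) {F : ℝ → ℝ}
    (hF : IsDecayFunction Γ F) (k : ℕ) : ∃ c : ℝ, 0 ≤ c ∧ ∀ (Λ : Finset Γ) (x : Γ) (R : ℝ), 0 ≤ R →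
      ∑ y ∈ Λ with R ≤ dist x y, F (dist x y) ≤ c * ((1 + R) ^ k)⁻¹ := by
  obtain ⟨C, hC⟩ := hF.fast (k + (d + 2))
  have hκ := hg.one_le
  have hC0 : 0 ≤ C := le_trans (mul_nonneg (by positivity) (hF.pos 0 le_rfl).le) (hC 0 le_rfl)
  refine ⟨2 ^ (k + (d + 2)) * C * (2 ^ (d + 3) * κ), by positivity, fun Λ x R hR => ?_⟩
  have h1 : ∀ y ∈ Λ.filter (fun y => R ≤ dist x y), F (dist x y) ≤
      2 ^ (k + (d + 2)) * C * ((1 + R) ^ k)⁻¹ * ((1 + dist x y) ^ (d + 2))⁻¹ := by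
    intro y hy
    have hy' := (Finset.mem_filter.1 hy).2
    set r := dist x y
    have hr : 0 ≤ r := dist_nonneg
    have h2 : (1 + r) ^ (k + (d + 2)) ≤ 2 ^ (k + (d + 2)) * (1 + r ^ (k + (d + 2))) := by
      calc (1 + r) ^ (k + (d + 2)) ≤ (2 * max 1 r) ^ (k + (d + 2)) := by
            gcongr
            linarith [le_max_left 1 r, le_max_right 1 r]
        _ = 2 ^ (k + (d + 2)) * (max 1 r) ^ (k + (d + 2)) := mul_pow _ _ _
        _ ≤ _ := by
          gcongr
          rcases max_choice 1 r with h | h <;> rw [h]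
          · rw [one_pow]; linarith [pow_nonneg hr (k + (d + 2))]
          · linarith
    have h3 : (1 + R) ^ k ≤ (1 + r) ^ k := by gcongr
    have hFr := hF.pos r hr
    rw [mul_assoc, ← mul_inv, ← div_eq_mul_inv, le_div_iff₀ (by positivity)]
    calc F r * ((1 + R) ^ k * (1 + r) ^ (d + 2)) ≤ F r * ((1 + r) ^ k * (1 + r) ^ (d + 2)) := by
          gcongr
      _ = (1 + r) ^ (k + (d + 2)) * F r := by rw [pow_add]; ring
      _ ≤ 2 ^ (k + (d + 2)) * (1 + r ^ (k + (d + 2))) * F r := by gcongr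
      _ = 2 ^ (k + (d + 2)) * ((1 + r ^ (k + (d + 2))) * F r) := by ring
      _ ≤ _ := by
        gcongr
        exact hC r hr
  refine (Finset.sum_le_sum h1).trans ?_
  rw [← Finset.mul_sum]
  have h2 : ∑ y ∈ Λ with R ≤ dist x y, ((1 + dist x y) ^ (d + 2))⁻¹ ≤ 2 ^ (d + 3) * κ :=
    (Finset.sum_le_sum_of_subset_of_nonneg (Finset.filter_subset _ _)
      fun _ _ _ => by positivity).trans (hg.sum_inv_pow_le Λ x)
  calc _ ≤ 2 ^ (k + (d + 2)) * C * ((1 + R) ^ k)⁻¹ * (2 ^ (d + 3) * κ) := by gcongr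
    _ = _ := by ring

lemma IsDecayFunction.exists_convWeight {F : ℝ → ℝ} (hF : IsDecayFunction Γ F) :
    ∃ C, 0 ≤ C ∧ IsConvWeight Γ F C := by
  obtain ⟨C, hC⟩ := hF.convolution
  refine ⟨max C 0, le_max_right _ _, hF.pos, fun Λ x z => ?_⟩
  have hz := hF.pos (dist x z) dist_nonneg
  have h1 := (hC x z).1.sum_le_tsum Λ fun y _ => (div_pos (mul_pos (hF.pos _ dist_nonneg)
    (hF.pos _ dist_nonneg)) hz).le
  rw [← Finset.sum_div, div_le_iff₀ hz] at h1
  refine h1.trans ?_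
  gcongr
  exact ((hC x z).2).trans (le_max_left _ _)

/-- Sums of a rapidly decaying function between a ball and the complement of a larger ball. -/
lemma Growth.exists_sum_ball {d : ℕ} {κ : ℝ} (hg : Growth Γ d κ) {F : ℝ → ℝ}
    (hF : IsDecayFunction Γ F) (k : ℕ) : ∃ c : ℝ, 0 ≤ c ∧ ∀ (Λ : Finset Γ) (x : Γ) (j R : ℕ),
      ∑ z ∈ ball Λ x j, ∑ y ∈ Λ \ ball Λ x (j + R), F (dist z y) ≤
        c * (1 + j) ^ d * ((1 + (R : ℝ)) ^ k)⁻¹ := by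
  obtain ⟨c, hc0, hc⟩ := hg.exists_tail hF k
  refine ⟨κ * c, mul_nonneg (zero_le_one.trans hg.one_le) hc0, fun Λ x j R => ?_⟩
  have h1 : ∀ z ∈ ball Λ x j, ∑ y ∈ Λ \ ball Λ x (j + R), F (dist z y) ≤
      c * ((1 + (R : ℝ)) ^ k)⁻¹ := by
    intro z hz
    refine le_trans (Finset.sum_le_sum_of_subset_of_nonneg (fun y hy => ?_) fun _ _ _ =>
      (hF.pos _ dist_nonneg).le) (hc Λ z R R.cast_nonneg)
    rw [Finset.mem_sdiff, mem_ball, not_and, not_le] at hy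
    rw [Finset.mem_filter]
    refine ⟨hy.1, ?_⟩
    have h2 := hy.2 hy.1
    have h3 := (mem_ball.1 hz).2
    have h4 := dist_triangle x z y
    push_cast at h2
    linarith
  refine (Finset.sum_le_sum h1).trans ?_
  rw [Finset.sum_const, nsmul_eq_mul]
  have := hg.card_le Λ x j
  calc _ ≤ κ * (1 + j) ^ d * (c * ((1 + (R : ℝ)) ^ k)⁻¹) := by gcongr; exact this
    _ = _ := by ring

end Geometry

/-! ### Quasi-local observables and their decomposition into shells. -/

section QuasiLocal

variable {D : Γ → ℕ} [MetricSpace Γ]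

/-- `a` is localized near `x`, with errors decaying like the `k`-th inverse power of the
distance. -/
def QuasiLocal {Λ : Finset Γ} (k : ℕ) (x : Γ) (C : ℝ) (a : Obs D Λ) : Prop :=
  ‖a‖ ≤ C ∧ ∀ r : ℕ, ‖a - condE D (ball Λ x r) Λ a‖ * (1 + (r : ℝ)) ^ k ≤ C

lemma QuasiLocal.mono {Λ : Finset Γ} {k : ℕ} {x : Γ} {C C' : ℝ} {a : Obs D Λ}
    (h : QuasiLocal k x C a) (hC : C ≤ C') : QuasiLocal k x C' a :=
  ⟨h.1.trans hC, fun r => (h.2 r).trans hC⟩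

lemma QuasiLocal.nonneg {Λ : Finset Γ} {k : ℕ} {x : Γ} {C : ℝ} {a : Obs D Λ}
    (h : QuasiLocal k x C a) : 0 ≤ C := (norm_nonneg _).trans h.1

lemma QuasiLocal.add {Λ : Finset Γ} {k : ℕ} {x : Γ} {C C' : ℝ} {a b : Obs D Λ}
    (ha : QuasiLocal k x C a) (hb : QuasiLocal k x C' b) : QuasiLocal k x (C + C') (a + b) := by
  refine ⟨(norm_add_le _ _).trans (add_le_add ha.1 hb.1), fun r => ?_⟩
  have h1 := ha.2 r
  have h2 := hb.2 r
  rw [map_add, add_sub_add_comm]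
  calc _ ≤ (‖a - condE D (ball Λ x r) Λ a‖ + ‖b - condE D (ball Λ x r) Λ b‖) * (1 + (r : ℝ)) ^ k := by
        gcongr
        exact norm_add_le _ _
    _ ≤ _ := by linarith

lemma norm_smul_sub_map {𝒜 : Type*} [CStarAlgebra 𝒜] (E : 𝒜 →L[ℂ] 𝒜) (c : ℂ) (a : 𝒜) :
    ‖c • a - E (c • a)‖ = ‖c‖ * ‖a - E a‖ := by
  rw [map_smul, ← smul_sub, norm_smul]

lemma norm_star_sub_map {𝒜 : Type*} [CStarAlgebra 𝒜] (E : 𝒜 →L[ℂ] 𝒜)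
    (hE : ∀ a, E (star a) = star (E a)) (a : 𝒜) : ‖star a - E (star a)‖ = ‖a - E a‖ := by
  rw [hE, ← star_sub, norm_star]

lemma QuasiLocal.smul {Λ : Finset Γ} {k : ℕ} {x : Γ} {C : ℝ} {a : Obs D Λ}
    (ha : QuasiLocal k x C a) (c : ℂ) : QuasiLocal k x (‖c‖ * C) (c • a) := by
  refine ⟨?_, fun r => ?_⟩
  · rw [norm_smul]
    gcongr
    exact ha.1
  · rw [norm_smul_sub_map, mul_assoc]
    gcongr
    exact ha.2 r

lemma QuasiLocal.zero {Λ : Finset Γ} (k : ℕ) (x : Γ) : QuasiLocal k x 0 (0 : Obs D Λ) := by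
  refine ⟨by rw [norm_zero], fun r => ?_⟩
  rw [map_zero, sub_zero, norm_zero, zero_mul]

lemma QuasiLocal.star {Λ : Finset Γ} {k : ℕ} {x : Γ} {C : ℝ} {a : Obs D Λ}
    (ha : QuasiLocal k x C a) : QuasiLocal k x C (star a) := by
  refine ⟨(norm_star (E := Obs D Λ) a).trans_le ha.1, fun r => ?_⟩
  rw [norm_star_sub_map _ (condE_star _ _)]
  exact ha.2 r

variable [∀ x, NeZero (D x)]

/-- The conditional expectation fixes `b` and is a contraction, so it is within a factor 2 of the
best approximation from the local algebra. To prove quasi-locality it is therefore enough to exhibit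
some local approximant. -/
lemma norm_sub_condE_le_of_mem {X Λ : Finset Γ} (h : X ⊆ Λ) {a b : Obs D Λ} (hb : b ∈ loc D h) :
    ‖a - condE D X Λ a‖ ≤ 2 * ‖a - b‖ := by
  have h1 : a - condE D X Λ a = (a - b) - condE D X Λ (a - b) := by
    rw [map_sub, condE_of_mem h hb]
    abel
  rw [h1]
  have h2 := norm_condE_le X Λ (a - b)
  have h3 := norm_sub_le (a - b) (condE D X Λ (a - b))
  linarith

/-- The part of `a` that lives in the ball of radius `j`, but not in the next smaller one. -/
def shell {Λ : Finset Γ} (x : Γ) (a : Obs D Λ) : ℕ → Obs D Λ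
  | 0 => condE D (ball Λ x 0) Λ a
  | j + 1 => condE D (ball Λ x (j + 1)) Λ a - condE D (ball Λ x j) Λ a

lemma sum_shell {Λ : Finset Γ} (x : Γ) (a : Obs D Λ) (n : ℕ) :
    ∑ j ∈ Finset.range (n + 1), shell x a j = condE D (ball Λ x n) Λ a := by
  induction n with
  | zero => rw [Finset.sum_range_one, shell]
  | succ n ih => rw [Finset.sum_range_succ, ih, shell]; abel

lemma sum_shell_of_ball_eq {Λ : Finset Γ} {x : Γ} {N : ℕ} (hN : ball Λ x N = Λ) (a : Obs D Λ) :
    ∑ j ∈ Finset.range (N + 1), shell x a j = a := by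
  rw [sum_shell]
  have : a ∈ loc D (ball_subset Λ x N) := loc_mono (by rw [hN]) _ _ (mem_loc_self a)
  exact condE_of_mem _ this

lemma shell_mem {Λ : Finset Γ} (x : Γ) (a : Obs D Λ) (j : ℕ) :
    shell x a j ∈ loc D (ball_subset Λ x j) := by
  cases j with
  | zero => exact condE_mem _ a
  | succ j => exact sub_mem (condE_mem _ a) (loc_mono (ball_mono j.le_succ) _ _
      (condE_mem (ball_subset Λ x j) a))

lemma QuasiLocal.norm_shell_le {Λ : Finset Γ} {k : ℕ} {x : Γ} {C : ℝ} {a : Obs D Λ}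
    (ha : QuasiLocal k x C a) (j : ℕ) : ‖shell x a j‖ * (1 + (j : ℝ)) ^ k ≤ 2 ^ (k + 1) * C := by
  have hC := ha.nonneg
  cases j with
  | zero =>
    have h3 : ‖shell x a 0‖ ≤ C := (norm_condE_le _ _ a).trans ha.1
    norm_num
    exact h3.trans (le_mul_of_one_le_left hC (one_le_pow₀ one_le_two))
  | succ j =>
    have h3 := ha.2 j
    have h4 := ha.2 (j + 1)
    set p := a - condE D (ball Λ x j) Λ a
    set q := a - condE D (ball Λ x (j + 1)) Λ a
    have h5 : shell x a (j + 1) = p - q := by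
      rw [shell]
      exact (sub_sub_sub_cancel_left _ _ _).symm
    have h6 : (1 + ((j + 1 : ℕ) : ℝ)) ^ k ≤ 2 ^ k * (1 + (j : ℝ)) ^ k := by
      rw [← mul_pow]
      gcongr
      push_cast
      linarith [j.cast_nonneg (α := ℝ)]
    have h7 : (1 : ℝ) ≤ 2 ^ k := one_le_pow₀ one_le_two
    rw [h5]
    calc _ ≤ (‖p‖ + ‖q‖) * (1 + ((j + 1 : ℕ) : ℝ)) ^ k := by
          gcongr
          exact norm_sub_le _ _
      _ = ‖p‖ * (1 + ((j + 1 : ℕ) : ℝ)) ^ k + ‖q‖ * (1 + ((j + 1 : ℕ) : ℝ)) ^ k := add_mul _ _ _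
      _ ≤ ‖p‖ * (2 ^ k * (1 + (j : ℝ)) ^ k) + C := by gcongr
      _ = 2 ^ k * (‖p‖ * (1 + (j : ℝ)) ^ k) + C := by ring
      _ ≤ 2 ^ k * C + 2 ^ k * C := by
        gcongr
        exact le_mul_of_one_le_left hC h7
      _ = _ := by ring

/-- A linear map that is controlled on strictly local observables is controlled on quasi-local
ones. -/
theorem QuasiLocal.map {Λ : Finset Γ} {m k : ℕ} {x : Γ} {K C : ℝ} (hK : 0 ≤ K)
    (T : Obs D Λ →L[ℂ] Obs D Λ)
    (h1 : ∀ (j : ℕ), ∀ a ∈ loc D (ball_subset Λ x j), ‖T a‖ ≤ K * (1 + j) ^ m * ‖a‖)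
    (h2 : ∀ (j : ℕ), ∀ a ∈ loc D (ball_subset Λ x j), ∀ R : ℕ,
      ‖T a - condE D (ball Λ x (j + R)) Λ (T a)‖ * (1 + (R : ℝ)) ^ k ≤ K * (1 + j) ^ m * ‖a‖)
    {a : Obs D Λ} (ha : QuasiLocal (m + k + 2) x C a) :
    QuasiLocal k x (2 ^ (m + 2 * k + 5) * K * C) (T a) := by
  have hC := ha.nonneg
  set E : ℕ → Obs D Λ → Obs D Λ := fun r => condE D (ball Λ x r) Λ with hE
  set c : ℝ := 2 ^ (m + k + 3) * C with hc
  have hc0 : 0 ≤ c := by positivity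
  set s : ℕ → Obs D Λ := shell x a with hs
  have hsmem : ∀ j, s j ∈ loc D (ball_subset Λ x j) := shell_mem x a
  -- Budget of powers: `m` pays for the growth of `T` with the radius, `k` for the decay that is
  -- claimed, and 2 for summing over the shells.
  have hsnorm : ∀ j : ℕ, ‖s j‖ * (1 + (j : ℝ)) ^ (m + k + 2) ≤ c := ha.norm_shell_le
  obtain ⟨N, hN⟩ := exists_ball_eq' Λ x
  have haN : a = ∑ j ∈ Finset.range (N + 1), s j := (sum_shell_of_ball_eq hN a).symm
  have hTs : ∀ j : ℕ, ‖T (s j)‖ * (1 + (j : ℝ)) ^ k ≤ K * c * ((1 + (j : ℝ)) ^ 2)⁻¹ := by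
    intro j
    have h3 := h1 j (s j) (hsmem j)
    rw [← div_eq_mul_inv, le_div_iff₀ (by positivity)]
    calc _ ≤ K * (1 + j) ^ m * ‖s j‖ * (1 + (j : ℝ)) ^ k * (1 + (j : ℝ)) ^ 2 := by gcongr
      _ = K * (‖s j‖ * (1 + (j : ℝ)) ^ (m + k + 2)) := by rw [pow_add, pow_add]; ring
      _ ≤ _ := by
        gcongr
        exact hsnorm j
  have hterm : ∀ j r : ℕ, ‖T (s j) - E r (T (s j))‖ * (1 + (r : ℝ)) ^ k ≤
      2 ^ (k + 1) * K * c * ((1 + (j : ℝ)) ^ 2)⁻¹ := by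
    intro j r
    -- Shells of radius at most `r / 2` leave a margin `R = r - j ≥ r / 2` over which the
    -- localization of `T` applies. On larger shells `1 + r` is comparable to `1 + j`, and the
    -- smallness of the shell itself is enough.
    rcases le_or_gt (2 * j) r with hjr | hjr
    · obtain ⟨R, rfl⟩ := Nat.exists_eq_add_of_le (show j ≤ r by omega)
      have h3 := h2 j (s j) (hsmem j) R
      have h4 : (1 + ((j + R : ℕ) : ℝ)) ^ k ≤ 2 ^ k * (1 + (R : ℝ)) ^ k := by
        rw [← mul_pow]
        gcongr
        have : (j : ℝ) ≤ R := by exact_mod_cast (show j ≤ R by omega)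
        push_cast
        linarith
      have h5 : K * (1 + (j : ℝ)) ^ m * ‖s j‖ ≤ K * c * ((1 + (j : ℝ)) ^ 2)⁻¹ := by
        rw [← div_eq_mul_inv, le_div_iff₀ (by positivity)]
        calc _ = K * (‖s j‖ * (1 + (j : ℝ)) ^ (m + 2)) := by rw [pow_add]; ring
          _ ≤ K * (‖s j‖ * (1 + (j : ℝ)) ^ (m + k + 2)) := by
            gcongr ?_ * (_ * ?_)
            exact pow_le_pow_right₀ (by linarith [j.cast_nonneg (α := ℝ)]) (by omega)
          _ ≤ _ := by
            gcongr
            exact hsnorm j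
      calc _ ≤ ‖T (s j) - E (j + R) (T (s j))‖ * (2 ^ k * (1 + (R : ℝ)) ^ k) := by gcongr
        _ = 2 ^ k * (‖T (s j) - E (j + R) (T (s j))‖ * (1 + (R : ℝ)) ^ k) := by ring
        _ ≤ 2 ^ k * (K * c * ((1 + (j : ℝ)) ^ 2)⁻¹) := by
          exact mul_le_mul_of_nonneg_left (h3.trans h5) (by positivity)
        _ ≤ 2 ^ (k + 1) * (K * c * ((1 + (j : ℝ)) ^ 2)⁻¹) := by
          gcongr
          · exact one_le_two
          · omega
        _ = _ := by ring
    · have h3 : ‖T (s j) - E r (T (s j))‖ ≤ 2 * ‖T (s j)‖ := by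
        have := norm_sub_condE_le_of_mem (ball_subset Λ x r) (a := T (s j)) (zero_mem _)
        rwa [sub_zero] at this
      have h4 : (1 + (r : ℝ)) ^ k ≤ 2 ^ k * (1 + (j : ℝ)) ^ k := by
        rw [← mul_pow]
        gcongr
        have : (r : ℝ) ≤ 2 * j := by exact_mod_cast hjr.le
        linarith
      calc _ ≤ (2 * ‖T (s j)‖) * (2 ^ k * (1 + (j : ℝ)) ^ k) := by gcongr
        _ = 2 ^ (k + 1) * (‖T (s j)‖ * (1 + (j : ℝ)) ^ k) := by ring
        _ ≤ 2 ^ (k + 1) * (K * c * ((1 + (j : ℝ)) ^ 2)⁻¹) := by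
          exact mul_le_mul_of_nonneg_left (hTs j) (by positivity)
        _ = _ := by ring
  have hconst : 2 ^ (k + 1) * K * c * 2 = 2 ^ (m + 2 * k + 5) * K * C := by rw [hc]; ring
  refine ⟨?_, fun r => ?_⟩
  · have h3 : T a = ∑ j ∈ Finset.range (N + 1), T (s j) := by
      conv_lhs => rw [haN]
      exact map_sum T _ _
    rw [h3]
    calc _ ≤ ∑ j ∈ Finset.range (N + 1), ‖T (s j)‖ := norm_sum_le _ _
      _ ≤ ∑ j ∈ Finset.range (N + 1), 2 ^ (k + 1) * K * c * ((1 + (j : ℝ)) ^ 2)⁻¹ := by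
        refine Finset.sum_le_sum fun j _ => ?_
        have h3 := hTs j
        have h4 : (1 : ℝ) ≤ (1 + (j : ℝ)) ^ k := one_le_pow₀ (by linarith [j.cast_nonneg (α := ℝ)])
        have h5 : (1 : ℝ) ≤ 2 ^ (k + 1) := one_le_pow₀ one_le_two
        have h6 : 0 ≤ K * c * ((1 + (j : ℝ)) ^ 2)⁻¹ := by positivity
        calc ‖T (s j)‖ ≤ ‖T (s j)‖ * (1 + (j : ℝ)) ^ k := le_mul_of_one_le_right (norm_nonneg _) h4
          _ ≤ K * c * ((1 + (j : ℝ)) ^ 2)⁻¹ := h3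
          _ ≤ 2 ^ (k + 1) * (K * c * ((1 + (j : ℝ)) ^ 2)⁻¹) := le_mul_of_one_le_left h6 h5
          _ = _ := by ring
      _ ≤ 2 ^ (k + 1) * K * c * 2 := by
        rw [← Finset.mul_sum]
        gcongr
        exact sum_inv_sq_le _
      _ = _ := hconst
  · have h3 : T a - condE D (ball Λ x r) Λ (T a) =
        ∑ j ∈ Finset.range (N + 1), (T (s j) - E r (T (s j))) := by
      have h4 : T a = ∑ j ∈ Finset.range (N + 1), T (s j) := by
        conv_lhs => rw [haN]
        exact map_sum T _ _
      rw [h4]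
      simp only [hE, map_sum, Finset.sum_sub_distrib]
    rw [h3]
    calc _ ≤ (∑ j ∈ Finset.range (N + 1), ‖T (s j) - E r (T (s j))‖) * (1 + (r : ℝ)) ^ k := by
          gcongr
          exact norm_sum_le _ _
      _ ≤ ∑ j ∈ Finset.range (N + 1), 2 ^ (k + 1) * K * c * ((1 + (j : ℝ)) ^ 2)⁻¹ := by
        rw [Finset.sum_mul]
        exact Finset.sum_le_sum fun j _ => hterm j r
      _ ≤ 2 ^ (k + 1) * K * c * 2 := by
        rw [← Finset.mul_sum]
        gcongr
        exact sum_inv_sq_le _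
      _ = _ := hconst

end QuasiLocal

/-! ### Commutators and Heisenberg dynamics preserve quasi-locality. -/

section Bounds

variable {D : Γ → ℕ} [MetricSpace Γ] [∀ x, NeZero (D x)]

/-- The commutator with a fixed element, as a continuous linear map. -/
def adjointAction {𝒜 : Type*} [NormedRing 𝒜] [NormedAlgebra ℂ 𝒜] (H : 𝒜) : 𝒜 →L[ℂ] 𝒜 :=
  ContinuousLinearMap.mul ℂ 𝒜 H - (ContinuousLinearMap.mul ℂ 𝒜).flip H

lemma adjointAction_apply {𝒜 : Type*} [NormedRing 𝒜] [NormedAlgebra ℂ 𝒜] (H a : 𝒜) :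
    adjointAction H a = H * a - a * H := rfl

lemma sum_norm_touching_le {Ψ : Potential D} {F : ℝ → ℝ} {M : ℝ} (hΨ : Ψ.Bound F M)
    (Λ X : Finset Γ) :
    ∑ Z ∈ Λ.powerset with ¬ Disjoint Z X, ‖Ψ Λ Z‖ ≤ X.card * (M * F 0) := by
  refine (sum_touching_le fun Z => norm_nonneg _).trans ?_
  rw [← nsmul_eq_mul]
  refine Finset.sum_le_card_nsmul _ _ _ fun x _ => ?_
  have := hΨ Λ x x
  rw [dist_self] at this
  simpa only [and_self] using this

/-- A set touching `X` and not contained in `X'` contains some `x ∈ X` and some `y` outside `X'`;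
its norm is counted in the bound for that pair. -/
lemma sum_norm_crossing_le {Ψ : Potential D} {F : ℝ → ℝ} {M : ℝ} (hΨ : Ψ.Bound F M)
    {Λ X X' : Finset Γ} :
    ∑ Z ∈ Λ.powerset with ¬ Disjoint Z X, (if Z ⊆ X' then 0 else ‖Ψ Λ Z‖) ≤
      M * ∑ z ∈ X, ∑ y ∈ Λ \ X', F (dist z y) := by
  have h0 : ∀ Z, 0 ≤ if Z ⊆ X' then 0 else ‖Ψ Λ Z‖ := fun Z => by
    split_ifs
    exacts [le_rfl, norm_nonneg _]
  refine (sum_touching_le h0).trans ?_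
  rw [Finset.mul_sum]
  refine Finset.sum_le_sum fun x _ => ?_
  have h1 : ∀ Z ∈ Λ.powerset.filter (fun Z => x ∈ Z), (if Z ⊆ X' then 0 else ‖Ψ Λ Z‖) ≤
      ∑ y ∈ Λ \ X', if y ∈ Z then ‖Ψ Λ Z‖ else 0 := by
    intro Z hZ
    rw [Finset.mem_filter, Finset.mem_powerset] at hZ
    have h2 : ∀ y ∈ Λ \ X', 0 ≤ if y ∈ Z then ‖Ψ Λ Z‖ else 0 := fun y _ => by
      split_ifs
      exacts [norm_nonneg _, le_rfl]
    split_ifs with h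
    · exact Finset.sum_nonneg h2
    · obtain ⟨y, hyZ, hyX⟩ := Finset.not_subset.1 h
      exact le_trans (by rw [if_pos hyZ]) (Finset.single_le_sum h2
        (Finset.mem_sdiff.2 ⟨hZ.1 hyZ, hyX⟩))
  refine (Finset.sum_le_sum h1).trans ?_
  rw [Finset.sum_comm, Finset.mul_sum]
  refine Finset.sum_le_sum fun y _ => ?_
  rw [← Finset.sum_filter, Finset.filter_filter]
  exact hΨ Λ x y

/-- The commutator with a local Hamiltonian preserves quasi-locality. -/
theorem Growth.exists_quasiLocal_commutator {d : ℕ} {κ : ℝ} (hg : Growth Γ d κ) {F : ℝ → ℝ}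
    (hF : IsDecayFunction Γ F) {M : ℝ} (hM : 0 ≤ M) (k : ℕ) : ∃ K : ℝ, 0 ≤ K ∧
      ∀ (Ψ : Potential D), Ψ.Bound F M → ∀ (Λ : Finset Γ) (x : Γ) (C : ℝ) (a : Obs D Λ),
        QuasiLocal (d + k + 2) x C a →
        QuasiLocal k x (K * C) (Ψ.ham Λ * a - a * Ψ.ham Λ) := by
  obtain ⟨c, hc0, hc⟩ := hg.exists_sum_ball hF k
  have hF0 := (hF.pos 0 le_rfl).le
  have hκ : 0 ≤ κ := zero_le_one.trans hg.one_le
  set K : ℝ := 2 * (κ * (M * F 0)) + 4 * (M * c) with hK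
  have hK0 : 0 ≤ K := by positivity
  refine ⟨2 ^ (d + 2 * k + 5) * K, by positivity, fun Ψ hΨ Λ x C a ha => ?_⟩
  have hX : ∀ (j : ℕ), ∀ a ∈ loc D (ball_subset Λ x j), Ψ.ham Λ * a - a * Ψ.ham Λ =
      ∑ Z ∈ Λ.powerset with ¬ Disjoint Z (ball Λ x j), (Ψ.term Λ Z * a - a * Ψ.term Λ Z) := by
    intro j a ha
    have h1 := (Ψ.commute_ham_sub (ball_subset Λ x j) ha).eq
    rw [sub_mul, mul_sub, sub_eq_sub_iff_sub_eq_sub] at h1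
    rw [h1, Potential.hamTouching, Finset.sum_mul, Finset.mul_sum, ← Finset.sum_sub_distrib]
  have hmem : ∀ {Z : Finset Γ} {j : ℕ},
      Z ∈ Λ.powerset.filter (fun Z => ¬ Disjoint Z (ball Λ x j)) → Z ⊆ Λ := fun hZ =>
    Finset.mem_powerset.1 (Finset.mem_filter.1 hZ).1
  refine QuasiLocal.map hK0 (adjointAction (Ψ.ham Λ)) (fun j a ha => ?_) (fun j a ha R => ?_) ha
  · rw [adjointAction_apply, hX j a ha]
    calc _ ≤ ∑ Z ∈ Λ.powerset with ¬ Disjoint Z (ball Λ x j), 2 * ‖Ψ Λ Z‖ * ‖a‖ := by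
          refine (norm_sum_le _ _).trans (Finset.sum_le_sum fun Z hZ => ?_)
          rw [← Ψ.norm_term (hmem hZ)]
          exact norm_commutator_le _ _
      _ = 2 * (∑ Z ∈ Λ.powerset with ¬ Disjoint Z (ball Λ x j), ‖Ψ Λ Z‖) * ‖a‖ := by
        rw [Finset.mul_sum, Finset.sum_mul]
      _ ≤ 2 * (κ * (1 + j) ^ d * (M * F 0)) * ‖a‖ := by
        gcongr
        refine (sum_norm_touching_le hΨ Λ (ball Λ x j)).trans ?_
        gcongr
        exact hg.card_le Λ x j
      _ = (2 * (κ * (M * F 0))) * (1 + j) ^ d * ‖a‖ := by ring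
      _ ≤ K * (1 + j) ^ d * ‖a‖ := by
        gcongr
        rw [hK]
        have : 0 ≤ 4 * (M * c) := by positivity
        linarith
  · rw [adjointAction_apply, hX j a ha]
    set X' := ball Λ x (j + R) with hX'
    -- Local approximant: only the terms lying inside the larger ball are kept, and the discarded
    -- ones cross from radius `j` to beyond `j + R`.
    set b : Obs D Λ := ∑ Z ∈ Λ.powerset with ¬ Disjoint Z (ball Λ x j),
      if Z ⊆ X' then Ψ.term Λ Z * a - a * Ψ.term Λ Z else 0 with hb
    have ha' : a ∈ loc D (ball_subset Λ x (j + R)) := loc_mono (ball_mono (by omega)) _ _ ha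
    have hbmem : b ∈ loc D (ball_subset Λ x (j + R)) := by
      refine sum_mem fun Z _ => ?_
      split_ifs with h
      · have h1 := Ψ.term_mem h (ball_subset Λ x (j + R))
        exact sub_mem (mul_mem h1 ha') (mul_mem ha' h1)
      · exact zero_mem _
    have h2 : ‖(∑ Z ∈ Λ.powerset with ¬ Disjoint Z (ball Λ x j),
        (Ψ.term Λ Z * a - a * Ψ.term Λ Z)) - b‖ ≤ 2 * (M * (c * (1 + j) ^ d *
          ((1 + (R : ℝ)) ^ k)⁻¹)) * ‖a‖ := by
      rw [hb, ← Finset.sum_sub_distrib]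
      calc _ ≤ ∑ Z ∈ Λ.powerset with ¬ Disjoint Z (ball Λ x j),
            2 * (if Z ⊆ X' then 0 else ‖Ψ Λ Z‖) * ‖a‖ := by
            refine (norm_sum_le _ _).trans (Finset.sum_le_sum fun Z hZ => ?_)
            split_ifs
            · simp
            · rw [sub_zero, ← Ψ.norm_term (hmem hZ)]
              exact norm_commutator_le _ _
        _ = 2 * (∑ Z ∈ Λ.powerset with ¬ Disjoint Z (ball Λ x j),
            (if Z ⊆ X' then 0 else ‖Ψ Λ Z‖)) * ‖a‖ := by
          rw [Finset.mul_sum, Finset.sum_mul]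
        _ ≤ 2 * (M * ∑ z ∈ ball Λ x j, ∑ y ∈ Λ \ X', F (dist z y)) * ‖a‖ := by
          gcongr
          exact sum_norm_crossing_le hΨ
        _ ≤ _ := by
          gcongr
          exact hc Λ x j R
    have h3 := (norm_sub_condE_le_of_mem (ball_subset Λ x (j + R)) hbmem).trans
      (mul_le_mul_of_nonneg_left h2 two_pos.le)
    have hRk : 0 ≤ (1 + (R : ℝ)) ^ k := by positivity
    refine (mul_le_mul_of_nonneg_right h3 hRk).trans ?_
    clear h3 h2
    calc
      (2 * (2 * (M * (c * (1 + (j : ℝ)) ^ d * ((1 + (R : ℝ)) ^ k)⁻¹)) * ‖a‖)) *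
          (1 + (R : ℝ)) ^ k = (4 * (M * c)) * (1 + j) ^ d * ‖a‖ := by
        field_simp
        ring
      _ ≤ K * (1 + j) ^ d * ‖a‖ := by
        gcongr
        rw [hK]
        have : 0 ≤ 2 * (κ * (M * F 0)) := by positivity
        linarith

/-- The evolution is cut into steps of length `τ`, and after each step the observable is truncated
to a ball whose radius has grown by `ρ`. The dynamics being isometric and the truncation a
contraction, the errors only add up. -/
lemma heis_steps {Ψ : Potential D} (hH : Ψ.IsHermitian) {Λ : Finset Γ} {x : Γ} {j ρ : ℕ} {τ δ : ℝ}
    {a : Obs D Λ} (ha : a ∈ loc D (ball_subset Λ x j)) (N : ℕ)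
    (hstep : ∀ i < N, ∀ b ∈ loc D (ball_subset Λ x (j + i * ρ)),
      ‖heis (Ψ.ham Λ) τ b - condE D (ball Λ x (j + i * ρ + ρ)) Λ (heis (Ψ.ham Λ) τ b)‖ ≤ δ * ‖b‖)
    (hδ : 0 ≤ δ) :
    ∀ i ≤ N, ∃ b ∈ loc D (ball_subset Λ x (j + i * ρ)), ‖b‖ ≤ ‖a‖ ∧
      ‖heis (Ψ.ham Λ) (i * τ) a - b‖ ≤ i * (δ * ‖a‖) := by
  intro i
  induction i with
  | zero =>
    intro _
    refine ⟨a, ?_, le_rfl, ?_⟩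
    · rw [Nat.zero_mul, Nat.add_zero]; exact ha
    · rw [Nat.cast_zero, zero_mul, heis_zero, sub_self, norm_zero, zero_mul]
  | succ i ih =>
    intro hi
    obtain ⟨b, hb, hba, hbn⟩ := ih (by omega)
    have h1 := hstep i (by omega) b hb
    have he : j + (i + 1) * ρ = j + i * ρ + ρ := by ring
    refine ⟨condE D (ball Λ x (j + i * ρ + ρ)) Λ (heis (Ψ.ham Λ) τ b), ?_,
      (norm_condE_le _ _ _).trans ((norm_heis_le (hH.ham Λ) τ b).trans hba), ?_⟩
    · exact loc_mono (by rw [he]) (ball_subset Λ x (j + i * ρ + ρ)) _ (condE_mem _ _)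
    · have h2 : heis (Ψ.ham Λ) (((i + 1 : ℕ) : ℝ) * τ) a =
          heis (Ψ.ham Λ) τ (heis (Ψ.ham Λ) (i * τ) a) := by
        rw [← heis_add]
        congr 2
        push_cast
        ring
      have h3 : heis (Ψ.ham Λ) τ (heis (Ψ.ham Λ) (i * τ) a) -
          condE D (ball Λ x (j + i * ρ + ρ)) Λ (heis (Ψ.ham Λ) τ b) =
          heis (Ψ.ham Λ) τ (heis (Ψ.ham Λ) (i * τ) a - b) + (heis (Ψ.ham Λ) τ b -
            condE D (ball Λ x (j + i * ρ + ρ)) Λ (heis (Ψ.ham Λ) τ b)) := by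
        rw [map_sub]
        abel
      rw [h2, h3]
      have h4 := norm_heis_le (hH.ham Λ) τ (heis (Ψ.ham Λ) (i * τ) a - b)
      calc _ ≤ _ := norm_add_le _ _
        _ ≤ i * (δ * ‖a‖) + δ * ‖a‖ := by
          refine add_le_add (h4.trans hbn) (h1.trans ?_)
          gcongr
        _ = _ := by
          push_cast
          ring

/-- The Heisenberg evolution preserves quasi-locality, with bounds that are polynomial in time. -/
theorem Growth.exists_quasiLocal_heis {d : ℕ} {κ : ℝ} (hg : Growth Γ d κ) {F : ℝ → ℝ}
    (hF : IsDecayFunction Γ F) {M : ℝ} (hM : 0 ≤ M) (k : ℕ) : ∃ K : ℝ, 0 ≤ K ∧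
      ∀ (Ψ : Potential D), Ψ.IsHermitian → Ψ.Bound F M →
        ∀ (Λ : Finset Γ) (x : Γ) (C t : ℝ) (a : Obs D Λ),
        QuasiLocal (d + k + 2) x C a →
        QuasiLocal k x (K * (1 + |t|) ^ (d + k + 1) * C) (heis (Ψ.ham Λ) t a) := by
  -- The extra `d` powers compensate for the number of points in the balls of radius up to `j + R`
  -- on which the intermediate observables live.
  obtain ⟨c, hc0, hc⟩ := hg.exists_sum_ball hF (d + k)
  obtain ⟨CF, hCF0, hconv⟩ := hF.exists_convWeight
  have hF0 := hF.pos 0 le_rfl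
  obtain ⟨T, hT0, hT⟩ : ∃ T : ℝ, 0 < T ∧ 4 * M * CF * T ≤ 1 := by
    refine ⟨(4 * M * CF + 1)⁻¹, by positivity, ?_⟩
    rw [← div_eq_mul_inv, div_le_one (by positivity)]
    linarith
  set K : ℝ := 1 + 16 / F 0 * c * (2 + T⁻¹) ^ (d + k + 1) with hK
  have hK0 : 0 ≤ K := by positivity
  refine ⟨2 ^ (d + 2 * k + 5) * K, by positivity, fun Ψ hH hΨ Λ x C t a ha => ?_⟩
  have ht1 : (1 : ℝ) ≤ (1 + |t|) ^ (d + k + 1) := one_le_pow₀ (by linarith [abs_nonneg t])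
  have key := QuasiLocal.map (m := d) (k := k) (K := K * (1 + |t|) ^ (d + k + 1)) (by positivity)
    (heis (Ψ.ham Λ) t) (fun j a ha => ?_) (fun j a ha R => ?_) ha
  · convert key using 1
    ring
  · refine (norm_heis_le (hH.ham Λ) t a).trans (le_mul_of_one_le_left (norm_nonneg _) ?_)
    have h1 : 1 ≤ K := by
      rw [hK]
      have : 0 ≤ 16 / F 0 * c * (2 + T⁻¹) ^ (d + k + 1) := by positivity
      linarith
    have h2 : (1 : ℝ) ≤ (1 + (j : ℝ)) ^ d := one_le_pow₀ (by linarith [j.cast_nonneg (α := ℝ)])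
    exact one_le_mul_of_one_le_of_one_le (one_le_mul_of_one_le_of_one_le h1 ht1) h2
  -- The number of steps: large enough that each lasts at most the Lieb–Robinson time `T`, yet
  -- bounded by a constant times `1 + |t|`. Every step may enlarge the radius by `R / N`.
  · set N : ℕ := ⌈|t| / T⌉₊ + 1 with hN
    have hN0 : (0 : ℝ) < N := by positivity
    have hNt : (N : ℝ) ≤ (2 + T⁻¹) * (1 + |t|) := by
      have h1 := (Nat.ceil_lt_add_one (show 0 ≤ |t| / T by positivity)).le
      rw [hN]
      push_cast
      have h2 : |t| / T = T⁻¹ * |t| := by rw [div_eq_inv_mul]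
      have h3 : 0 ≤ T⁻¹ := by positivity
      nlinarith [abs_nonneg t]
    set ρ : ℕ := R / N with hρ
    have hρN : N * ρ ≤ R := Nat.mul_div_le R N
    have hρ1 : (1 + (R : ℝ)) ≤ N * (1 + ρ) := by
      have h1 : R < N * (R / N + 1) := by
        have := Nat.lt_mul_div_succ R (show 0 < N by omega)
        exact this
      have h2 : R + 1 ≤ N * (1 + ρ) := by rw [add_comm 1 ρ]; exact h1
      have h3 : ((R + 1 : ℕ) : ℝ) ≤ ((N * (1 + ρ) : ℕ) : ℝ) := by exact_mod_cast h2
      push_cast at h3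
      linarith
    have hτ : |t / N| ≤ T := by
      rw [abs_div, abs_of_pos hN0, div_le_iff₀ hN0]
      have h1 := Nat.le_ceil (|t| / T)
      rw [div_le_iff₀ hT0] at h1
      rw [hN]
      push_cast
      nlinarith
    set S : ℝ := 8 / F 0 * (c * (1 + (j + R : ℕ)) ^ d * ((1 + (ρ : ℝ)) ^ (d + k))⁻¹) with hS
    have hS0 : 0 ≤ S := by positivity
    obtain ⟨b, hb, -, hbn⟩ := heis_steps hH (ρ := ρ) (τ := t / N) (δ := S) ha N
      (fun i hi b hb => by
        have h1 := norm_heis_sub_condE_le hH hconv hΨ hM hT (ball Λ x (j + i * ρ + ρ))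
          (ball_subset Λ x (j + i * ρ)) hb hτ
        have h2 := hc Λ x (j + i * ρ) ρ
        have h3 : j + i * ρ ≤ j + R := by
          have : i * ρ ≤ N * ρ := Nat.mul_le_mul_right _ hi.le
          omega
        calc _ ≤ _ := h1
          _ ≤ 8 / F 0 * ‖b‖ * (c * (1 + (j + i * ρ : ℕ)) ^ d * ((1 + (ρ : ℝ)) ^ (d + k))⁻¹) := by
            gcongr
          _ ≤ 8 / F 0 * ‖b‖ * (c * (1 + (j + R : ℕ)) ^ d * ((1 + (ρ : ℝ)) ^ (d + k))⁻¹) := by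
            gcongr
          _ = S * ‖b‖ := by rw [hS]; ring) hS0 N le_rfl
    have hNτ : (N : ℝ) * (t / N) = t := by field_simp
    rw [hNτ] at hbn
    have hb' : b ∈ loc D (ball_subset Λ x (j + R)) :=
      loc_mono (ball_mono (by omega)) _ _ hb
    have h1 := norm_sub_condE_le_of_mem (ball_subset Λ x (j + R)) (a := heis (Ψ.ham Λ) t a) hb'
    have h2 : (1 + ((j + R : ℕ) : ℝ)) ^ d ≤ (1 + (j : ℝ)) ^ d * (1 + (R : ℝ)) ^ d := by
      rw [← mul_pow]
      gcongr
      push_cast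
      nlinarith [mul_nonneg (j.cast_nonneg (α := ℝ)) (R.cast_nonneg (α := ℝ))]
    -- Decay is available only in `ρ ≈ R / N`, at the price of `N^(d+k)`. Adding the errors of `N`
    -- steps gives the exponent `d + k + 1` of `1 + |t|`.
    have h3 : (1 + (R : ℝ)) ^ (d + k) * ((1 + (ρ : ℝ)) ^ (d + k))⁻¹ ≤ N ^ (d + k) := by
      rw [← div_eq_mul_inv, div_le_iff₀ (by positivity), ← mul_pow]
      gcongr
    have h4 := h1.trans (mul_le_mul_of_nonneg_left hbn two_pos.le)
    have hRk : 0 ≤ (1 + (R : ℝ)) ^ k := by positivity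
    refine (mul_le_mul_of_nonneg_right h4 hRk).trans ?_
    clear h4 h1 hbn
    calc
      2 * (N * (S * ‖a‖)) * (1 + (R : ℝ)) ^ k = 16 / F 0 * c * N * ((1 + ((j + R : ℕ) : ℝ)) ^ d * (1 + (R : ℝ)) ^ k *
          ((1 + (ρ : ℝ)) ^ (d + k))⁻¹) * ‖a‖ := by
        rw [hS]
        ring
      _ ≤ 16 / F 0 * c * N * (((1 + (j : ℝ)) ^ d * (1 + (R : ℝ)) ^ d) * (1 + (R : ℝ)) ^ k *
          ((1 + (ρ : ℝ)) ^ (d + k))⁻¹) * ‖a‖ := by gcongr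
      _ = 16 / F 0 * c * N * ((1 + (j : ℝ)) ^ d * ((1 + (R : ℝ)) ^ (d + k) *
          ((1 + (ρ : ℝ)) ^ (d + k))⁻¹)) * ‖a‖ := by
        rw [pow_add (1 + (R : ℝ))]
        ring
      _ ≤ 16 / F 0 * c * N * ((1 + (j : ℝ)) ^ d * N ^ (d + k)) * ‖a‖ := by gcongr
      _ = 16 / F 0 * c * N ^ (d + k + 1) * (1 + (j : ℝ)) ^ d * ‖a‖ := by ring
      _ ≤ 16 / F 0 * c * ((2 + T⁻¹) * (1 + |t|)) ^ (d + k + 1) * (1 + (j : ℝ)) ^ d * ‖a‖ := by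
        gcongr
      _ = (16 / F 0 * c * (2 + T⁻¹) ^ (d + k + 1)) * (1 + |t|) ^ (d + k + 1) *
          (1 + (j : ℝ)) ^ d * ‖a‖ := by
        rw [mul_pow]
        ring
      _ ≤ K * (1 + |t|) ^ (d + k + 1) * (1 + (j : ℝ)) ^ d * ‖a‖ := by
        refine mul_le_mul_of_nonneg_right (mul_le_mul_of_nonneg_right
          (mul_le_mul_of_nonneg_right ?_ (by positivity)) (by positivity)) (norm_nonneg a)
        rw [hK]
        exact le_add_of_nonneg_left zero_le_one

end Bounds

/-! ### Construction of an admissible decay function from polynomial bounds. -/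

section DecayFunction

/-- The infimum of the functions `(1 + r / ρ k) ^ (-k)`: it decays faster than any inverse power
and is supermultiplicative up to addition of the arguments. -/
def fastDecay (ρ : ℕ → ℝ) (r : ℝ) : ℝ := ⨅ k : ℕ, ((1 + r / ρ k) ^ k)⁻¹

variable {ρ : ℕ → ℝ}

lemma fastDecay_bddBelow (hρ : ∀ k, 1 ≤ ρ k) {r : ℝ} (hr : 0 ≤ r) :
    BddBelow (Set.range fun k : ℕ => ((1 + r / ρ k) ^ k)⁻¹) := by
  refine ⟨0, ?_⟩
  rintro _ ⟨k, rfl⟩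
  have := zero_le_one.trans (hρ k)
  dsimp only
  positivity

lemma fastDecay_le (hρ : ∀ k, 1 ≤ ρ k) {r : ℝ} (hr : 0 ≤ r) (k : ℕ) :
    fastDecay ρ r ≤ ((1 + r / ρ k) ^ k)⁻¹ := ciInf_le (fastDecay_bddBelow hρ hr) k

lemma fastDecay_le_one (hρ : ∀ k, 1 ≤ ρ k) {r : ℝ} (hr : 0 ≤ r) : fastDecay ρ r ≤ 1 := by
  simpa using fastDecay_le hρ hr 0

/-- The bound `(1 + r / ρ k)^k ≤ exp (k r / ρ k) ≤ exp r`, valid because `k ≤ ρ k`, keeps the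
infimum above `exp (-r)`. -/
lemma fastDecay_pos (hρ : ∀ k, 1 ≤ ρ k) (hρk : ∀ k, k ≤ ρ k) {r : ℝ} (hr : 0 ≤ r) :
    0 < fastDecay ρ r := by
  refine lt_of_lt_of_le (Real.exp_pos (-r)) (le_ciInf fun k => ?_)
  have h0 : 0 < ρ k := zero_lt_one.trans_le (hρ k)
  rw [Real.exp_neg]
  refine inv_anti₀ (by positivity) ?_
  calc (1 + r / ρ k) ^ k ≤ (Real.exp (r / ρ k)) ^ k := by
        gcongr
        linarith [Real.add_one_le_exp (r / ρ k)]
    _ = Real.exp (k * (r / ρ k)) := (Real.exp_nat_mul _ _).symm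
    _ ≤ Real.exp r := by
      gcongr
      rw [← mul_div_assoc, div_le_iff₀ h0, mul_comm r]
      exact mul_le_mul_of_nonneg_right (hρk k) hr

/-- For each `k` separately it comes from `(1 + a)(1 + b) ≥ 1 + a + b`. This is what reduces the
convolution condition to that of the polynomial prefactor. -/
lemma fastDecay_mul_le (hρ : ∀ k, 1 ≤ ρ k) (hρk : ∀ k, k ≤ ρ k) {r s t : ℝ} (hr : 0 ≤ r)
    (hs : 0 ≤ s) (ht0 : 0 ≤ t) (ht : t ≤ r + s) :
    fastDecay ρ r * fastDecay ρ s ≤ fastDecay ρ t := by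
  refine le_ciInf fun k => ?_
  have h0 : 0 < ρ k := zero_lt_one.trans_le (hρ k)
  calc _ ≤ ((1 + r / ρ k) ^ k)⁻¹ * ((1 + s / ρ k) ^ k)⁻¹ :=
        mul_le_mul (fastDecay_le hρ hr k) (fastDecay_le hρ hs k) (fastDecay_pos hρ hρk hs).le
          (by positivity)
    _ = (((1 + r / ρ k) * (1 + s / ρ k)) ^ k)⁻¹ := by rw [mul_pow, mul_inv]
    _ ≤ _ := by
      gcongr
      have h1 : t / ρ k ≤ r / ρ k + s / ρ k := by
        rw [← add_div]
        gcongr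
      have h2 : 0 ≤ r / ρ k * (s / ρ k) := by positivity
      nlinarith

variable [MetricSpace Γ]

/-- The prefactor `p r = (1 + r)^(-(d+2))` provides summability. For `c ≤ a + b` it satisfies `p a *
p b ≤ 2^(d+2) (p a + p b) p c`, so it also provides the convolution bound. The decay faster than any
power is the task of `fastDecay`. -/
lemma isDecayFunction_fastDecay {d : ℕ} {κ : ℝ} (hg : Growth Γ d κ) (hρ : ∀ k, 1 ≤ ρ k)
    (hρk : ∀ k, k ≤ ρ k) :
    IsDecayFunction Γ fun r => ((1 + r) ^ (d + 2))⁻¹ * fastDecay ρ r := by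
  have hκ : 0 ≤ κ := zero_le_one.trans hg.one_le
  set p : ℝ → ℝ := fun r => ((1 + r) ^ (d + 2))⁻¹ with hp
  have hp0 : ∀ r, 0 ≤ r → 0 < p r := fun r hr => by simp only [hp]; positivity
  have hp1 : ∀ r, 0 ≤ r → p r ≤ 1 := fun r hr =>
    inv_le_one_of_one_le₀ (one_le_pow₀ (by linarith))
  have hpos : ∀ r, 0 ≤ r → 0 < p r * fastDecay ρ r := fun r hr =>
    mul_pos (hp0 r hr) (fastDecay_pos hρ hρk hr)
  have hle : ∀ r, 0 ≤ r → p r * fastDecay ρ r ≤ p r := fun r hr =>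
    mul_le_of_le_one_right (hp0 r hr).le (fastDecay_le_one hρ hr)
  refine ⟨hpos, ⟨2 ^ (d + 3) * κ, fun x => ?_⟩,
    ⟨2 ^ (d + 2) * (2 ^ (d + 3) * κ + 2 ^ (d + 3) * κ), fun x z => ?_⟩, fun k => ?_⟩
  · have h1 : ∀ Λ : Finset Γ, ∑ y ∈ Λ, p (dist x y) * fastDecay ρ (dist x y) ≤
        2 ^ (d + 3) * κ := fun Λ =>
      (Finset.sum_le_sum fun y _ => hle _ dist_nonneg).trans (hg.sum_inv_pow_le Λ x)
    have h0 : ∀ y, 0 ≤ p (dist x y) * fastDecay ρ (dist x y) := fun y => (hpos _ dist_nonneg).le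
    exact ⟨summable_of_sum_le h0 h1, Real.tsum_le_of_sum_le h0 h1⟩
  · set f : Γ → ℝ := fun y => p (dist x y) * fastDecay ρ (dist x y) *
      (p (dist y z) * fastDecay ρ (dist y z)) / (p (dist x z) * fastDecay ρ (dist x z)) with hf
    have h0 : ∀ y, 0 ≤ f y := fun y => (div_pos (mul_pos (hpos _ dist_nonneg)
      (hpos _ dist_nonneg)) (hpos _ dist_nonneg)).le
    have hfy : ∀ y, f y ≤ 2 ^ (d + 2) * (p (dist x y) + p (dist z y)) := by
      intro y
      have ha : 0 ≤ dist x y := dist_nonneg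
      have hb : 0 ≤ dist y z := dist_nonneg
      have hc : 0 ≤ dist x z := dist_nonneg
      have ht := dist_triangle x y z
      simp only [hf]
      rw [dist_comm z y]
      set a := dist x y
      set b := dist y z
      set c := dist x z
      rw [div_le_iff₀ (hpos c hc)]
      have h2 := fastDecay_mul_le hρ hρk ha hb hc ht
      have h3 : p a * p b ≤ 2 ^ (d + 2) * (p a + p b) * p c := by
        have h4 : (1 + c) ^ (d + 2) ≤ 2 ^ (d + 2) * ((1 + a) ^ (d + 2) + (1 + b) ^ (d + 2)) := by
          calc (1 + c) ^ (d + 2) ≤ (2 * max (1 + a) (1 + b)) ^ (d + 2) := by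
                gcongr
                have := le_max_left (1 + a) (1 + b)
                have := le_max_right (1 + a) (1 + b)
                linarith
            _ = 2 ^ (d + 2) * (max (1 + a) (1 + b)) ^ (d + 2) := mul_pow _ _ _
            _ ≤ _ := by
              gcongr
              have ha' : 0 ≤ (1 + a) ^ (d + 2) := by positivity
              have hb' : 0 ≤ (1 + b) ^ (d + 2) := by positivity
              rcases max_choice (1 + a) (1 + b) with h | h <;> rw [h] <;> linarith
        have ha' : 0 < (1 + a) ^ (d + 2) := by positivity
        have hb' : 0 < (1 + b) ^ (d + 2) := by positivity
        have hc' : 0 < (1 + c) ^ (d + 2) := by positivity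
        simp only [hp]
        rw [← mul_inv, ← div_eq_mul_inv, le_div_iff₀ hc', inv_mul_le_iff₀ (by positivity)]
        refine h4.trans (le_of_eq ?_)
        field_simp
        ring
      have hpa := hp0 a ha
      have hpb := hp0 b hb
      calc _ = (p a * p b) * (fastDecay ρ a * fastDecay ρ b) := by ring
        _ ≤ (2 ^ (d + 2) * (p a + p b) * p c) * fastDecay ρ c :=
          mul_le_mul h3 h2 (mul_pos (fastDecay_pos hρ hρk ha) (fastDecay_pos hρ hρk hb)).le
            (by have := hp0 c hc; positivity)
        _ = _ := by ring
    have h1 : ∀ Λ : Finset Γ, ∑ y ∈ Λ, f y ≤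
        2 ^ (d + 2) * (2 ^ (d + 3) * κ + 2 ^ (d + 3) * κ) := by
      intro Λ
      refine (Finset.sum_le_sum fun y _ => hfy y).trans ?_
      rw [← Finset.mul_sum, Finset.sum_add_distrib]
      gcongr
      · exact hg.sum_inv_pow_le Λ x
      · exact hg.sum_inv_pow_le Λ z
    exact ⟨summable_of_sum_le h0 h1, Real.tsum_le_of_sum_le h0 h1⟩
  · refine ⟨2 * ρ k ^ k, fun r hr => ?_⟩
    have h0 : 0 < ρ k := zero_lt_one.trans_le (hρ k)
    have h1 : p r * fastDecay ρ r ≤ ((1 + r / ρ k) ^ k)⁻¹ :=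
      (mul_le_of_le_one_left (fastDecay_pos hρ hρk hr).le (hp1 r hr)).trans (fastDecay_le hρ hr k)
    have h2 : 1 + r ^ k ≤ 2 * (1 + r) ^ k := by
      have h3 : (1 : ℝ) ≤ (1 + r) ^ k := one_le_pow₀ (by linarith)
      have h4 : r ^ k ≤ (1 + r) ^ k := by gcongr; linarith
      linarith
    have h3 : (1 + r) ^ k ≤ ρ k ^ k * (1 + r / ρ k) ^ k := by
      rw [← mul_pow]
      gcongr
      rw [mul_add, mul_one, mul_div_cancel₀ _ h0.ne']
      linarith [hρ k]
    calc (1 + r ^ k) * (p r * fastDecay ρ r) ≤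
          (2 * (ρ k ^ k * (1 + r / ρ k) ^ k)) * ((1 + r / ρ k) ^ k)⁻¹ :=
          mul_le_mul (h2.trans (by gcongr)) h1 (hpos r hr).le (by positivity)
      _ = 2 * ρ k ^ k := by field_simp

/-- Any rapidly decaying family of bounds is dominated by an admissible decay function. -/
theorem Growth.exists_decayFunction {d : ℕ} {κ : ℝ} (hg : Growth Γ d κ) (c : ℕ → ℝ)
    (hc : ∀ k, 0 ≤ c k) : ∃ (F : ℝ → ℝ) (C : ℝ), IsDecayFunction Γ F ∧ 0 ≤ C ∧
      ∀ r, 0 ≤ r → ∀ g : ℝ, (∀ k : ℕ, g * (1 + r) ^ k ≤ c k) → g ≤ C * F r := by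
  -- The scale is chosen so that up to `r = c (k + 1 + (d + 2))` the factor `(1 + r / ρ k)^k` stays
  -- below `e ≤ 3`. Beyond that point the one spare power of `1 + r` absorbs the constant `c (k + 1
  -- + (d + 2))`.
  set ρ : ℕ → ℝ := fun k => 1 + k * (1 + c (k + 1 + (d + 2))) with hρdef
  have hρ : ∀ k, 1 ≤ ρ k := fun k => by
    have := hc (k + 1 + (d + 2))
    simp only [hρdef, le_add_iff_nonneg_right]
    positivity
  have hρk : ∀ k : ℕ, k ≤ ρ k := fun k => by
    have := mul_nonneg (k.cast_nonneg (α := ℝ)) (hc (k + 1 + (d + 2)))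
    simp only [hρdef]
    linarith
  refine ⟨_, 3 * c (d + 2) + 1, isDecayFunction_fastDecay hg hρ hρk, by
    have := hc (d + 2); positivity, fun r hr g hgk => ?_⟩
  have h1r : 0 < (1 + r) ^ (d + 2) := by positivity
  rw [mul_left_comm, ← div_eq_inv_mul, le_div_iff₀ h1r]
  set g' := g * (1 + r) ^ (d + 2) with hg'
  have hC0 := hc (d + 2)
  rw [mul_comm, ← div_le_iff₀ (by positivity)]
  refine le_ciInf fun k => ?_
  have h0 : 0 < ρ k := zero_lt_one.trans_le (hρ k)
  have hck := hc (k + 1 + (d + 2))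
  rw [div_le_iff₀ (by positivity), ← div_eq_inv_mul, le_div_iff₀ (by positivity)]
  rcases le_total r (c (k + 1 + (d + 2))) with hrc | hrc
  · have h2 : (1 + r / ρ k) ^ k ≤ 3 := by
      calc (1 + r / ρ k) ^ k ≤ (Real.exp (r / ρ k)) ^ k := by
            gcongr
            linarith [Real.add_one_le_exp (r / ρ k)]
        _ = Real.exp (k * (r / ρ k)) := (Real.exp_nat_mul _ _).symm
        _ ≤ Real.exp 1 := by
          gcongr
          rw [← mul_div_assoc, div_le_one h0]
          simp only [hρdef]
          have := mul_le_mul_of_nonneg_left hrc (k.cast_nonneg (α := ℝ))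
          nlinarith [k.cast_nonneg (α := ℝ)]
        _ ≤ 3 := by linarith [Real.exp_one_lt_d9]
    have h3 : g' ≤ c (d + 2) := hgk (d + 2)
    rcases le_total g' 0 with hg0 | hg0
    · have : g' * (1 + r / ρ k) ^ k ≤ 0 := mul_nonpos_of_nonpos_of_nonneg hg0 (by positivity)
      linarith
    · calc g' * (1 + r / ρ k) ^ k ≤ c (d + 2) * 3 := by gcongr
        _ ≤ _ := by linarith
  · have h2 : g' * (1 + r) ^ (k + 1) ≤ c (k + 1 + (d + 2)) := by
      rw [hg', mul_assoc, ← pow_add, add_comm (d + 2)]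
      exact hgk _
    have h3 : g' * (1 + r) ^ k ≤ 1 := by
      have h4 : (g' * (1 + r) ^ k) * (1 + r) ≤ 1 * (1 + r) := by
        rw [mul_assoc, ← pow_succ]
        linarith
      exact le_of_mul_le_mul_right h4 (by linarith)
    rcases le_total g' 0 with hg0 | hg0
    · have : g' * (1 + r / ρ k) ^ k ≤ 0 := mul_nonpos_of_nonpos_of_nonneg hg0 (by positivity)
      linarith
    · calc g' * (1 + r / ρ k) ^ k ≤ g' * (1 + r) ^ k := by
            gcongr
            exact div_le_self hr (hρ k)
        _ ≤ 1 := h3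
        _ ≤ _ := by linarith

end DecayFunction

/-! ### From sums of quasi-local site observables to potentials, and back to norms. -/

section Conversion

variable {D : Γ → ℕ} [MetricSpace Γ] [∀ x, NeZero (D x)]

/-- The sum of the shells, over the balls that coincide with `Z`, of the observables `B x`. -/
def shellSum (Λ : Finset Γ) (N : ℕ) (B : Γ → Obs D Λ) (Z : Finset Γ) : Obs D Λ :=
  ∑ p ∈ Λ ×ˢ Finset.range (N + 1) with ball Λ p.1 p.2 = Z, shell p.1 (B p.1) p.2

lemma shellSum_mem {Λ : Finset Γ} (N : ℕ) (B : Γ → Obs D Λ) {Z : Finset Γ} (h : Z ⊆ Λ) :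
    shellSum Λ N B Z ∈ loc D h := by
  refine sum_mem fun p hp => ?_
  obtain rfl := (Finset.mem_filter.1 hp).2
  exact shell_mem p.1 (B p.1) p.2

lemma sum_shellSum {Λ : Finset Γ} {N : ℕ} (hN : ∀ x ∈ Λ, ball Λ x N = Λ) (B : Γ → Obs D Λ) :
    ∑ Z ∈ Λ.powerset, shellSum Λ N B Z = ∑ x ∈ Λ, B x := by
  unfold shellSum
  rw [Finset.sum_fiberwise_of_maps_to (fun p _ => Finset.mem_powerset.2 (ball_subset Λ p.1 p.2)),
    Finset.sum_product]
  exact Finset.sum_congr rfl fun x hx => sum_shell_of_ball_eq (hN x hx) (B x)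

lemma isSelfAdjoint_shell {Λ : Finset Γ} (x : Γ) {a : Obs D Λ} (ha : IsSelfAdjoint a) (j : ℕ) :
    IsSelfAdjoint (shell x a j) := by
  have h : ∀ r, IsSelfAdjoint (condE D (ball Λ x r) Λ a) := fun r => by
    unfold IsSelfAdjoint
    rw [← condE_star, ha.star_eq]
  cases j with
  | zero => exact h 0
  | succ j => exact IsSelfAdjoint.sub (R := Obs D Λ) (h (j + 1)) (h j)

/-- If a ball of radius `r` around `x` contains `y` and `z`, then `dist y z ≤ 2 r` and `dist y x ≤
r`. Of the `k + (d + 2) + 2` powers of decay in `r`, the first `k` produce decay in `dist y z`, the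
next `d + 2` make the sum over `x` converge, and the last 2 the sum over `r`. -/
lemma sum_norm_shellSum_le {d : ℕ} {κ : ℝ} (hg : Growth Γ d κ) {Λ : Finset Γ} {N : ℕ}
    {B : Γ → Obs D Λ} {C : ℝ} (hC : 0 ≤ C) {k : ℕ}
    (hB : ∀ x ∈ Λ, QuasiLocal (k + (d + 2) + 2) x C (B x)) (y z : Γ) :
    (∑ Z ∈ Λ.powerset with y ∈ Z ∧ z ∈ Z, ‖shellSum Λ N B Z‖) * (1 + dist y z) ^ k ≤
      2 ^ k * (2 ^ (k + (d + 2) + 2 + 1) * C) * (2 ^ (d + 3) * κ * 2) := by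
  set c : ℝ := 2 ^ (k + (d + 2) + 2 + 1) * C with hc
  have hc0 : 0 ≤ c := by positivity
  have h1 : ∑ Z ∈ Λ.powerset with y ∈ Z ∧ z ∈ Z, ‖shellSum Λ N B Z‖ ≤
      ∑ p ∈ Λ ×ˢ Finset.range (N + 1),
        if y ∈ ball Λ p.1 p.2 ∧ z ∈ ball Λ p.1 p.2 then ‖shell p.1 (B p.1) p.2‖ else 0 := by
    calc _ ≤ ∑ Z ∈ Λ.powerset with y ∈ Z ∧ z ∈ Z,
          ∑ p ∈ Λ ×ˢ Finset.range (N + 1) with ball Λ p.1 p.2 = Z, ‖shell p.1 (B p.1) p.2‖ :=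
          Finset.sum_le_sum fun Z _ => norm_sum_le _ _
      _ = ∑ Z ∈ Λ.powerset, ∑ p ∈ Λ ×ˢ Finset.range (N + 1) with ball Λ p.1 p.2 = Z,
          if y ∈ ball Λ p.1 p.2 ∧ z ∈ ball Λ p.1 p.2 then ‖shell p.1 (B p.1) p.2‖ else 0 := by
        rw [Finset.sum_filter]
        refine Finset.sum_congr rfl fun Z _ => ?_
        split_ifs with h
        · refine Finset.sum_congr rfl fun p hp => ?_
          rw [(Finset.mem_filter.1 hp).2, if_pos h]
        · refine (Finset.sum_eq_zero fun p hp => ?_).symm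
          rw [(Finset.mem_filter.1 hp).2, if_neg h]
      _ = _ := Finset.sum_fiberwise_of_maps_to
        (fun p _ => Finset.mem_powerset.2 (ball_subset Λ p.1 p.2)) _
  have h2 : ∀ p ∈ Λ ×ˢ Finset.range (N + 1),
      (if y ∈ ball Λ p.1 p.2 ∧ z ∈ ball Λ p.1 p.2 then ‖shell p.1 (B p.1) p.2‖ else 0) *
        (1 + dist y z) ^ k ≤
      2 ^ k * c * (((1 + dist y p.1) ^ (d + 2))⁻¹ * ((1 + (p.2 : ℝ)) ^ 2)⁻¹) := by
    rintro ⟨x, r⟩ hp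
    dsimp only
    have hr : (0 : ℝ) ≤ r := r.cast_nonneg
    split_ifs with h
    · have hy := (mem_ball.1 h.1).2
      have hz := (mem_ball.1 h.2).2
      rw [dist_comm x y] at hy
      have hd : dist y z ≤ 2 * r := (dist_triangle y x z).trans (by linarith)
      have h3 := (hB x (Finset.mem_product.1 hp).1).norm_shell_le r
      rw [← hc] at h3
      have hyx : 0 ≤ dist y x := dist_nonneg
      have hyz : 0 ≤ dist y z := dist_nonneg
      rw [← mul_inv, ← div_eq_mul_inv, le_div_iff₀ (by positivity)]
      calc _ ≤ ‖shell x (B x) r‖ * (2 ^ k * (1 + (r : ℝ)) ^ k) *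
            ((1 + (r : ℝ)) ^ (d + 2) * (1 + (r : ℝ)) ^ 2) := by
            rw [← mul_pow 2]
            gcongr
            linarith
        _ = 2 ^ k * (‖shell x (B x) r‖ * (1 + (r : ℝ)) ^ (k + (d + 2) + 2)) := by
          rw [pow_add _ (k + (d + 2)), pow_add _ k]
          ring
        _ ≤ _ := by gcongr
    · rw [zero_mul]
      positivity
  calc _ ≤ (∑ p ∈ Λ ×ˢ Finset.range (N + 1),
        if y ∈ ball Λ p.1 p.2 ∧ z ∈ ball Λ p.1 p.2 then ‖shell p.1 (B p.1) p.2‖ else 0) *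
        (1 + dist y z) ^ k := mul_le_mul_of_nonneg_right h1 (by positivity)
    _ ≤ ∑ p ∈ Λ ×ˢ Finset.range (N + 1),
        2 ^ k * c * (((1 + dist y p.1) ^ (d + 2))⁻¹ * ((1 + (p.2 : ℝ)) ^ 2)⁻¹) := by
      rw [Finset.sum_mul]
      exact Finset.sum_le_sum h2
    _ = 2 ^ k * c * ((∑ x ∈ Λ, ((1 + dist y x) ^ (d + 2))⁻¹) *
        ∑ r ∈ Finset.range (N + 1), ((1 + (r : ℝ)) ^ 2)⁻¹) := by
      rw [← Finset.mul_sum, Finset.sum_product, Finset.sum_mul_sum]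
    _ ≤ _ := by
      refine mul_le_mul_of_nonneg_left ?_ (by positivity)
      refine mul_le_mul (hg.sum_inv_pow_le Λ y) (sum_inv_sq_le _)
        (Finset.sum_nonneg fun _ _ => by positivity) ?_
      have := zero_le_one.trans hg.one_le
      positivity

lemma isSelfAdjoint_half_add_star {𝒜 : Type*} [CStarAlgebra 𝒜] (a : 𝒜) :
    IsSelfAdjoint ((1 / 2 : ℂ) • (a + star a)) := by
  unfold IsSelfAdjoint
  rw [star_smul, star_add, star_star, add_comm]
  congr 1
  norm_num

lemma sum_half_add_star {𝒜 ι : Type*} [CStarAlgebra 𝒜] (s : Finset ι) (f : ι → 𝒜)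
    (h : IsSelfAdjoint (∑ i ∈ s, f i)) :
    ∑ i ∈ s, (1 / 2 : ℂ) • (f i + star (f i)) = ∑ i ∈ s, f i := by
  have h' := h.star_eq
  rw [star_sum] at h'
  rw [← Finset.smul_sum, Finset.sum_add_distrib, h', ← two_smul ℂ, smul_smul]
  norm_num

/-- A sum of uniformly quasi-local observables, one for each site, is a local Hamiltonian. -/
theorem Growth.exists_potential {d : ℕ} {κ : ℝ} (hg : Growth Γ d κ) {ι : Type*}
    (B : (Λ : Finset Γ) → Γ → ι → Obs D Λ)
    (hB : ∀ k, ∃ C, ∀ (Λ : Finset Γ), ∀ x ∈ Λ, ∀ i, QuasiLocal k x C (B Λ x i))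
    (hsa : ∀ Λ i, IsSelfAdjoint (∑ x ∈ Λ, B Λ x i)) :
    ∃ (F : ℝ → ℝ) (C : ℝ) (Ψ : ι → Potential D), IsDecayFunction Γ F ∧ 0 ≤ C ∧
      ∀ i, (Ψ i).IsHermitian ∧ (Ψ i).Bound F C ∧ ∀ Λ, (Ψ i).ham Λ = ∑ x ∈ Λ, B Λ x i := by
  have hκ := zero_le_one.trans hg.one_le
  -- Only the sum over the sites is assumed self-adjoint. Taking real parts site by site does not
  -- change the sum and makes each term of the potential self-adjoint.
  set B' : (Λ : Finset Γ) → Γ → ι → Obs D Λ := fun Λ x i =>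
    (1 / 2 : ℂ) • (B Λ x i + star (B Λ x i)) with hB'
  choose C hC using hB
  have hB'C : ∀ k (Λ : Finset Γ), ∀ x ∈ Λ, ∀ i, QuasiLocal k x |C k| (B' Λ x i) := by
    intro k Λ x hx i
    have h := hC k Λ x hx i
    have h2 := (h.add h.star).smul (1 / 2 : ℂ)
    refine h2.mono ?_
    have : ‖(1 / 2 : ℂ)‖ = 1 / 2 := by norm_num
    rw [this]
    have := le_abs_self (C k)
    linarith
  have hB's : ∀ Λ x i, IsSelfAdjoint (B' Λ x i) := by
    intro Λ x i
    exact isSelfAdjoint_half_add_star (B Λ x i)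
  have hsum : ∀ Λ i, ∑ x ∈ Λ, B' Λ x i = ∑ x ∈ Λ, B Λ x i := by
    intro Λ i
    exact sum_half_add_star Λ (fun x => B Λ x i) (hsa Λ i)
  choose N hN using fun Λ : Finset Γ => exists_ball_eq Λ
  have hpre : ∀ i Λ Z, ∃ b : Obs D Z, ∀ h : Z ⊆ Λ,
      embed h b = shellSum Λ (N Λ) (fun x => B' Λ x i) Z := by
    intro i Λ Z
    by_cases h : Z ⊆ Λ
    · obtain ⟨b, hb⟩ := (mem_loc h).1 (shellSum_mem (N Λ) (fun x => B' Λ x i) h)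
      exact ⟨b, fun _ => hb⟩
    · exact ⟨0, fun h' => absurd h' h⟩
  choose Ψ hΨ using hpre
  set c : ℕ → ℝ := fun k => 2 ^ k * (2 ^ (k + (d + 2) + 2 + 1) * |C (k + (d + 2) + 2)|) *
    (2 ^ (d + 3) * κ * 2) with hc
  -- The constants `c k` depend neither on the volume nor on the index `i`, so neither do `F` and
  -- `C₀`.
  obtain ⟨F, C₀, hF, hC₀, hFC⟩ := hg.exists_decayFunction c fun k => by
    simp only [hc]
    positivity
  refine ⟨F, C₀, Ψ, hF, hC₀, fun i => ⟨fun Λ Z h => ?_, fun Λ y z => ?_, fun Λ => ?_⟩⟩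
  · apply embed_injective h
    have h1 : star (embed h (Ψ i Λ Z)) = embed h (star (Ψ i Λ Z)) := by
      rw [← embedHom_apply, ← embedHom_apply, map_star]
    rw [← h1, hΨ i Λ Z h]
    exact isSelfAdjoint_sum' _ fun p _ => isSelfAdjoint_shell _ (hB's Λ p.1 i) _
  · refine hFC _ dist_nonneg _ fun k => ?_
    have h1 : ∑ Z ∈ Λ.powerset with y ∈ Z ∧ z ∈ Z, ‖Ψ i Λ Z‖ =
        ∑ Z ∈ Λ.powerset with y ∈ Z ∧ z ∈ Z, ‖shellSum Λ (N Λ) (fun x => B' Λ x i) Z‖ := by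
      refine Finset.sum_congr rfl fun Z hZ => ?_
      have h := Finset.mem_powerset.1 (Finset.mem_filter.1 hZ).1
      rw [← hΨ i Λ Z h, norm_embed]
    rw [h1]
    exact sum_norm_shellSum_le hg (abs_nonneg _) (fun x hx => hB'C _ Λ x hx i) y z
  · rw [Potential.ham_eq_sum_term, ← hsum, ← sum_shellSum (fun x hx => hN Λ x hx _ le_rfl)]
    refine Finset.sum_congr rfl fun Z hZ => ?_
    have h := Finset.mem_powerset.1 hZ
    rw [Potential.term_eq (Ψ i) h, hΨ i Λ Z h]

lemma Potential.Bound.fNorm_le {Ψ : Potential D} {F : ℝ → ℝ} {M : ℝ} (h : Ψ.Bound F M)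
    (hF : ∀ r, 0 ≤ r → 0 < F r) : Ψ.fNorm F ≤ ENNReal.ofReal M := by
  refine iSup_le fun Λ => iSup_le fun x => iSup_le fun y => ?_
  have hFp := hF (dist x y) dist_nonneg
  refine ENNReal.div_le_of_le_mul ?_
  rw [← ENNReal.ofReal_mul' hFp.le]
  calc _ = ENNReal.ofReal (∑ Z ∈ Λ.powerset with x ∈ Z ∧ y ∈ Z, ‖Ψ Λ Z‖) := by
        rw [ENNReal.ofReal_sum_of_nonneg fun _ _ => norm_nonneg _]
        exact Finset.sum_congr rfl fun _ _ => (ofReal_norm _).symm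
    _ ≤ _ := ENNReal.ofReal_le_ofReal (h Λ x y)

lemma Potential.bound_of_fNorm_le {Ψ : Potential D} {F : ℝ → ℝ} {M : ℝ} (hM : 0 ≤ M)
    (h : Ψ.fNorm F ≤ ENNReal.ofReal M) (hF : ∀ r, 0 ≤ r → 0 < F r) : Ψ.Bound F M := by
  intro Λ x y
  have hFp := hF (dist x y) dist_nonneg
  have h1 := (le_iSup_of_le Λ (le_iSup_of_le x (le_iSup_of_le y le_rfl))).trans h
  rw [ENNReal.div_le_iff (by simpa using hFp) ENNReal.ofReal_ne_top,
    ← ENNReal.ofReal_mul hM] at h1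
  have h2 : ENNReal.ofReal (∑ Z ∈ Λ.powerset with x ∈ Z ∧ y ∈ Z, ‖Ψ Λ Z‖) =
      ∑ Z ∈ Λ.powerset with x ∈ Z ∧ y ∈ Z, ‖Ψ Λ Z‖ₑ := by
    rw [ENNReal.ofReal_sum_of_nonneg fun _ _ => norm_nonneg _]
    exact Finset.sum_congr rfl fun _ _ => ofReal_norm _
  rw [← h2] at h1
  exact (ENNReal.ofReal_le_ofReal_iff (by positivity)).1 h1

end Conversion

/-! ### The filter function. -/

section

open MeasureTheory FourierTransform
open scoped ContDiff

/-- All polynomial moments of `w` are finite. -/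
def HasMoments (w : ℝ → ℝ) : Prop := ∀ p : ℕ, Integrable (fun t => (1 + |t|) ^ p * w t)

lemma HasMoments.integrable {w : ℝ → ℝ} (h : HasMoments w) : Integrable w := by
  simpa using h 0

/-- A Schwartz function all of whose Fourier modes near zero have weight one and whose Fourier
modes away from zero vanish. -/
lemma exists_schwartz_filter {γ : ℝ} (hγ : 0 < γ) :
    ∃ g : SchwartzMap ℝ ℂ, ∀ ξ : ℝ,
      (|ξ| ≤ γ / 3 → ∫ v, Complex.exp (((-2 * Real.pi * v * ξ : ℝ) : ℂ) * Complex.I) * g v = 1) ∧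
      (2 * γ / 3 ≤ |ξ| →
        ∫ v, Complex.exp (((-2 * Real.pi * v * ξ : ℝ) : ℂ) * Complex.I) * g v = 0) := by
  -- The plateau of width `γ / 3`, and not just the value at zero, is needed later to keep a
  -- reference energy fixed while the Hamiltonian varies.
  let b : ContDiffBump (0 : ℝ) := ⟨γ / 3, 2 * γ / 3, by positivity, by linarith⟩
  have h1 : HasCompactSupport (fun x => ((b x : ℝ) : ℂ)) :=
    b.hasCompactSupport.comp_left (g := Complex.ofReal) Complex.ofReal_zero
  have h2 : ContDiff ℝ ∞ (fun x => ((b x : ℝ) : ℂ)) := Complex.ofRealCLM.contDiff.comp b.contDiff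
  let f : SchwartzMap ℝ ℂ := h1.toSchwartzMap h2
  have hf : ∀ ξ : ℝ, ∫ v, Complex.exp (((-2 * Real.pi * v * ξ : ℝ) : ℂ) * Complex.I) *
      (𝓕⁻ f) v = (b ξ : ℂ) := by
    intro ξ
    have h3 : 𝓕 (𝓕⁻ f) = f := FourierTransform.fourier_fourierInv_eq f
    have h4 : 𝓕 (𝓕⁻ f) ξ = (b ξ : ℂ) := by rw [h3]; rfl
    rw [← h4, SchwartzMap.fourier_coe, Real.fourier_eq']
    refine integral_congr_ae (Filter.Eventually.of_forall fun v => ?_)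
    simp only [smul_eq_mul, RCLike.inner_apply, conj_trivial]
    congr 3
    push_cast
    ring
  refine ⟨𝓕⁻ f, fun ξ => ⟨fun h => ?_, fun h => ?_⟩⟩
  · rw [hf, b.one_of_mem_closedBall (by simpa using h), Complex.ofReal_one]
  · rw [hf, b.zero_of_le_dist (by simpa using h), Complex.ofReal_zero]

lemma integrable_one_add_abs_pow_mul (g : SchwartzMap ℝ ℂ) (p : ℕ) :
    Integrable (fun v => (1 + |v|) ^ p * ‖g v‖) := by
  have h : (fun v => (1 + |v|) ^ p * ‖g v‖) = fun v =>
      ∑ m ∈ Finset.range (p + 1), (p.choose m : ℝ) * (‖v‖ ^ (p - m) * ‖g v‖) := by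
    funext v
    rw [add_pow, Finset.sum_mul]
    refine Finset.sum_congr rfl fun m _ => ?_
    rw [Real.norm_eq_abs]; ring
  rw [h]
  exact integrable_finsetSum _ fun m _ => (g.integrable_pow_mul volume (p - m)).const_mul _

/-- A real weight with finite moments whose Fourier transform is one near zero and vanishes
away from zero. -/
lemma exists_filter {γ : ℝ} (hγ : 0 < γ) :
    ∃ w : ℝ → ℝ, Continuous w ∧ HasMoments w ∧ ∀ ξ : ℝ,
      (|ξ| ≤ γ / 3 → ∫ t : ℝ, (w t : ℂ) * Complex.exp ((t * ξ : ℝ) * Complex.I) = 1) ∧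
      (2 * γ / 3 ≤ |ξ| → ∫ t : ℝ, (w t : ℂ) * Complex.exp ((t * ξ : ℝ) * Complex.I) = 0) := by
  obtain ⟨g, hg⟩ := exists_schwartz_filter hγ
  have hπ := Real.pi_pos
  -- Rescaling by `-1/(2π)` converts the kernel `exp (-2πi v ξ)` into `exp (i t ξ)`.
  set c : ℝ := -(2 * Real.pi)⁻¹ with hc
  have hc0 : c ≠ 0 := by rw [hc]; simp [hπ.ne']
  have hcl : |c| ≤ 1 := by
    rw [hc, abs_neg, abs_of_pos (by positivity)]
    exact inv_le_one_of_one_le₀ (by linarith [Real.pi_gt_three])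
  -- A real weight is needed so that filtered averages of self-adjoint elements are self-adjoint.
  -- The transform of the real part is the mean of `J ξ` and the conjugate of `J (-ξ)`; since the
  -- conditions are even in `ξ`, the values 1 and 0 survive.
  refine ⟨fun t => |c| * (g (c * t)).re, ?_, ?_, ?_⟩
  · exact continuous_const.mul (Complex.continuous_re.comp (g.continuous.comp
      (continuous_const.mul continuous_id)))
  · intro p
    have h1 := ((integrable_one_add_abs_pow_mul g p).comp_mul_left' hc0).const_mul
      (|c|⁻¹ ^ p * |c|)
    refine h1.mono' (by
      have := g.continuous
      have : Continuous fun t : ℝ => (1 + |t|) ^ p * (|c| * (g (c * t)).re) := by fun_prop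
      exact this.aestronglyMeasurable) (Filter.Eventually.of_forall fun t => ?_)
    have hcp : 0 < |c| := abs_pos.2 hc0
    rw [norm_mul, norm_mul, Real.norm_eq_abs, Real.norm_eq_abs, Real.norm_eq_abs, abs_abs,
      abs_of_nonneg (by positivity)]
    have h2 : (1 + |t|) ^ p ≤ |c|⁻¹ ^ p * (1 + |c * t|) ^ p := by
      rw [← mul_pow]
      refine pow_le_pow_left₀ (by positivity) ?_ p
      rw [abs_mul, mul_add, ← mul_assoc, inv_mul_cancel₀ hcp.ne', one_mul, mul_one]
      linarith [(one_le_inv₀ hcp).2 hcl]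
    calc (1 + |t|) ^ p * (|c| * |(g (c * t)).re|)
        ≤ (|c|⁻¹ ^ p * (1 + |c * t|) ^ p) * (|c| * ‖g (c * t)‖) :=
          mul_le_mul h2 (mul_le_mul_of_nonneg_left (Complex.abs_re_le_norm _) hcp.le)
            (by positivity) (by positivity)
      _ = |c|⁻¹ ^ p * |c| * ((1 + |c * t|) ^ p * ‖g (c * t)‖) := by ring
  · intro ξ
    set J : ℝ → ℂ := fun ξ => ∫ v, Complex.exp (((-2 * Real.pi * v * ξ : ℝ) : ℂ) * Complex.I) * g v
      with hJ
    have hint : ∀ ξ : ℝ, Integrable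
        (fun v => Complex.exp (((-2 * Real.pi * v * ξ : ℝ) : ℂ) * Complex.I) * g v) := by
      intro ξ
      have h0 : Integrable (fun v => ‖g v‖) := by simpa using g.integrable_pow_mul volume 0
      have := g.continuous
      refine h0.mono' (by
        have : Continuous fun v : ℝ =>
          Complex.exp (((-2 * Real.pi * v * ξ : ℝ) : ℂ) * Complex.I) * g v := by fun_prop
        exact this.aestronglyMeasurable) (Filter.Eventually.of_forall fun v => ?_)
      rw [norm_mul, Complex.norm_exp_ofReal_mul_I, one_mul]
    have key : ∫ t : ℝ, ((|c| * (g (c * t)).re : ℝ) : ℂ) * Complex.exp ((t * ξ : ℝ) * Complex.I) =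
        2⁻¹ * (J ξ + (starRingEnd ℂ) (J (-ξ))) := by
      rw [hJ]
      simp only
      rw [← integral_conj, ← integral_add (hint ξ)
        (show Integrable (fun v => (starRingEnd ℂ) (Complex.exp
          (((-2 * Real.pi * v * (-ξ) : ℝ) : ℂ) * Complex.I) * g v)) from
          (Complex.conjCLE : ℂ →L[ℝ] ℂ).integrable_comp (hint (-ξ))), ← integral_const_mul]
      have h3 := Measure.integral_comp_mul_left (fun v : ℝ => 2⁻¹ *
        (Complex.exp (((-2 * Real.pi * v * ξ : ℝ) : ℂ) * Complex.I) * g v +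
          (starRingEnd ℂ) (Complex.exp (((-2 * Real.pi * v * (-ξ) : ℝ) : ℂ) * Complex.I) * g v))) c
      have h4 : ∀ z : ℂ, |c| • (|c⁻¹| • z) = z := by
        intro z
        rw [smul_smul, ← abs_mul, mul_inv_cancel₀ hc0, abs_one, one_smul]
      refine Eq.trans ?_ (h4 _)
      rw [← h3, ← integral_smul]
      refine integral_congr_ae (Filter.Eventually.of_forall fun t => ?_)
      simp only
      have h5 : -2 * Real.pi * (c * t) * ξ = t * ξ := by
        rw [hc]; field_simp
      have h6 : -2 * Real.pi * (c * t) * (-ξ) = -(t * ξ) := by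
        rw [← h5]; ring
      have h7 : (starRingEnd ℂ) (Complex.exp (((-(t * ξ) : ℝ) : ℂ) * Complex.I) * g (c * t)) =
          (starRingEnd ℂ) (Complex.exp (((-(t * ξ) : ℝ) : ℂ) * Complex.I)) *
            (starRingEnd ℂ) (g (c * t)) := (starRingEnd ℂ).map_mul _ _
      rw [h5, h6, h7, ← Complex.exp_conj, (starRingEnd ℂ).map_mul, Complex.conj_ofReal, Complex.conj_I,
        Complex.ofReal_neg, neg_mul_neg, ← mul_add, Complex.add_conj, Complex.real_smul]
      push_cast
      ring
    rw [key]
    constructor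
    · intro h
      have h1 : J ξ = 1 := (hg ξ).1 h
      have h2 : J (-ξ) = 1 := (hg (-ξ)).1 (by rwa [abs_neg])
      rw [h1, h2, map_one]; norm_num
    · intro h
      have h1 : J ξ = 0 := (hg ξ).2 h
      have h2 : J (-ξ) = 0 := (hg (-ξ)).2 (by rwa [abs_neg])
      rw [h1, h2, map_zero]; norm_num

end

section

open MeasureTheory Set Filter Topology

/-! ### Differentiation under the integral sign. -/

section ParametricIntegral

variable {E : Type*} [NormedAddCommGroup E] [NormedSpace ℝ E]

lemma norm_slope_le_of_norm_deriv_le {f f' : ℝ → E} {C s : ℝ} (hs : s ∈ Icc (0 : ℝ) 1)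
    (hf : ∀ r ∈ Icc (0 : ℝ) 1, HasDerivWithinAt f (f' r) (Icc 0 1) r)
    (hC : ∀ r ∈ Icc (0 : ℝ) 1, ‖f' r‖ ≤ C) {r : ℝ} (hr : r ∈ Icc (0 : ℝ) 1) :
    ‖slope f s r‖ ≤ C := by
  have h0 : 0 ≤ C := (norm_nonneg _).trans (hC s hs)
  have h := (convex_Icc (0 : ℝ) 1).norm_image_sub_le_of_norm_hasDerivWithin_le hf hC hs hr
  rw [slope_def_module, norm_smul, norm_inv]
  rcases eq_or_ne r s with rfl | hrs
  · simpa using h0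
  · rw [inv_mul_le_iff₀ (norm_pos_iff.2 (sub_ne_zero.2 hrs)), mul_comm]
    exact h

/-- Differentiation under the integral sign on the unit interval. -/
lemma hasDerivWithinAt_integral {α : Type*} [MeasurableSpace α] {μ : Measure α}
    {f f' : α → ℝ → E} {b : α → ℝ} {s : ℝ} (hs : s ∈ Icc (0 : ℝ) 1)
    (hf : ∀ t, ∀ r ∈ Icc (0 : ℝ) 1, HasDerivWithinAt (f t) (f' t r) (Icc 0 1) r)
    (hb : ∀ t, ∀ r ∈ Icc (0 : ℝ) 1, ‖f' t r‖ ≤ b t) (hbi : Integrable b μ)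
    (hfi : ∀ r ∈ Icc (0 : ℝ) 1, Integrable (fun t => f t r) μ) :
    HasDerivWithinAt (fun r => ∫ t, f t r ∂μ) (∫ t, f' t s ∂μ) (Icc 0 1) s := by
  rw [hasDerivWithinAt_iff_tendsto_slope]
  have h1 : Tendsto (fun r => ∫ t, slope (f t) s r ∂μ) (𝓝[Icc 0 1 \ {s}] s)
      (𝓝 (∫ t, f' t s ∂μ)) := by
    refine tendsto_integral_filter_of_dominated_convergence b ?_ ?_ hbi ?_
    · filter_upwards [self_mem_nhdsWithin] with r hr
      have := (((hfi r hr.1).sub (hfi s hs)).smul ((r - s)⁻¹)).aestronglyMeasurable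
      exact this
    · filter_upwards [self_mem_nhdsWithin] with r hr
      exact Eventually.of_forall fun t => norm_slope_le_of_norm_deriv_le hs (hf t) (hb t) hr.1
    · exact Eventually.of_forall fun t => hasDerivWithinAt_iff_tendsto_slope.1 (hf t s hs)
  refine h1.congr' ?_
  filter_upwards [self_mem_nhdsWithin] with r hr
  simp only [slope_def_module]
  rw [integral_smul, integral_sub (hfi r hr.1) (hfi s hs)]

end ParametricIntegral

/-! ### Duhamel's formula and the derivative of the Heisenberg evolution. -/

section Duhamel

variable {𝒜 : Type*} [CStarAlgebra 𝒜]

/-- The function `α ↦ exp(α X)`. -/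
def expPath (X : 𝒜) (α : ℝ) : 𝒜 := NormedSpace.exp (α • X)

lemma hasDerivAt_expPath (X : 𝒜) (α : ℝ) : HasDerivAt (expPath X) (expPath X α * X) α :=
  hasDerivAt_exp_smul_const (𝕂 := ℝ) X α

lemma hasDerivAt_expPath' (X : 𝒜) (α : ℝ) : HasDerivAt (expPath X) (X * expPath X α) α :=
  hasDerivAt_exp_smul_const' (𝕂 := ℝ) X α

lemma continuous_exp_algebra : Continuous (NormedSpace.exp : 𝒜 → 𝒜) := by
  let _ : NormedAlgebra ℚ 𝒜 := NormedAlgebra.restrictScalars ℚ ℂ 𝒜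
  exact NormedSpace.exp_continuous

lemma continuous_uncurry_expPath : Continuous fun p : 𝒜 × ℝ => expPath p.1 p.2 :=
  continuous_exp_algebra.comp (continuous_snd.smul continuous_fst)

/-- Fundamental theorem of calculus for `α ↦ exp (α Y) exp ((1 - α) X)`. -/
lemma exp_sub_exp_eq_integral (X Y : 𝒜) :
    NormedSpace.exp Y - NormedSpace.exp X =
      ∫ α in (0 : ℝ)..1, expPath Y α * (Y - X) * expPath X (1 - α) := by
  have hd : ∀ α : ℝ, HasDerivAt (fun α => expPath Y α * expPath X (1 - α))
      (expPath Y α * (Y - X) * expPath X (1 - α)) α := by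
    intro α
    refine ((hasDerivAt_expPath Y α).mul ((hasDerivAt_expPath' X (1 - α)).scomp α
      ((hasDerivAt_id α).const_sub 1))).congr_deriv ?_
    simp only [Function.comp, neg_one_smul, mul_neg, neg_mul, add_mul, mul_add, mul_assoc, sub_eq_add_neg]
  rw [intervalIntegral.integral_eq_sub_of_hasDerivAt (fun α _ => hd α)]
  · simp [expPath]
  · apply Continuous.intervalIntegrable
    have h1 := continuous_uncurry_expPath (𝒜 := 𝒜)
    exact ((h1.comp (continuous_const.prodMk continuous_id)).mul continuous_const).mul
      (h1.comp (continuous_const.prodMk (continuous_const.sub continuous_id)))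

/-- Duhamel's formula for the derivative of an exponential. -/
lemma hasDerivWithinAt_exp {X : ℝ → 𝒜} {X' : 𝒜} {S : Set ℝ} {s : ℝ}
    (hX : HasDerivWithinAt X X' S s) :
    HasDerivWithinAt (fun r => NormedSpace.exp (X r))
      (∫ α in (0 : ℝ)..1, expPath (X s) α * X' * expPath (X s) (1 - α)) S s := by
  rw [hasDerivWithinAt_iff_tendsto_slope] at hX ⊢
  -- By the exact difference formula the slope of `exp ∘ X` at `s` is `J (X r, slope X s r)`.
  -- Continuity of `J` then gives the derivative.
  set J : 𝒜 × 𝒜 → 𝒜 := fun p =>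
    ∫ α in (0 : ℝ)..1, expPath p.1 α * p.2 * expPath (X s) (1 - α) with hJ
  have hJc : Continuous J := by
    refine intervalIntegral.continuous_parametric_intervalIntegral_of_continuous' ?_ 0 1
    have h1 := continuous_uncurry_expPath (𝒜 := 𝒜)
    exact ((h1.comp ((continuous_fst.comp continuous_fst).prodMk continuous_snd)).mul
      (continuous_snd.comp continuous_fst)).mul
      (h1.comp (continuous_const.prodMk (continuous_const.sub continuous_snd)))
  have hXc : Tendsto X (𝓝[S \ {s}] s) (𝓝 (X s)) := by
    have h2 : HasDerivWithinAt X X' S s := hasDerivWithinAt_iff_tendsto_slope.2 hX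
    exact (h2.continuousWithinAt.mono sdiff_subset).tendsto
  have h3 := (hJc.tendsto (X s, X')).comp (hXc.prodMk_nhds hX)
  refine h3.congr' ?_
  filter_upwards [] with r
  simp only [hJ, Function.comp, slope_def_module]
  rw [exp_sub_exp_eq_integral, ← intervalIntegral.integral_smul]
  refine intervalIntegral.integral_congr fun α _ => ?_
  simp only [mul_smul_comm, smul_mul_assoc]

lemma hasDerivWithinAt_exp' {X : ℝ → 𝒜} {X' : 𝒜} {S : Set ℝ} {s : ℝ}
    (hX : HasDerivWithinAt X X' S s) :
    HasDerivWithinAt (fun r => NormedSpace.exp (X r))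
      (∫ α in (0 : ℝ)..1, expPath (X s) (1 - α) * X' * expPath (X s) α) S s := by
  refine (hasDerivWithinAt_exp hX).congr_deriv ?_
  have h := intervalIntegral.integral_comp_sub_left
    (fun α => expPath (X s) α * X' * expPath (X s) (1 - α)) (1 : ℝ) (a := 0) (b := 1)
  rw [sub_self, sub_zero] at h
  rw [← h]
  simp only [sub_sub_cancel]

lemma expPath_smul (H : 𝒜) (t α : ℝ) : expPath (t • (Complex.I • H)) α = evol H (α * t) := by
  rw [expPath, evol, smul_smul]

/-- Derivative of the Heisenberg evolution with respect to the Hamiltonian and the observable. -/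
lemma hasDerivWithinAt_heis {H a : ℝ → 𝒜} {H' a' : 𝒜} {S : Set ℝ} {s : ℝ} (t : ℝ)
    (hH : HasDerivWithinAt H H' S s) (ha : HasDerivWithinAt a a' S s) :
    HasDerivWithinAt (fun r => heis (H r) t (a r))
      (heis (H s) t a' + ∫ α in (0 : ℝ)..1, (t * Complex.I) • heis (H s) (α * t)
        (H' * heis (H s) ((1 - α) * t) (a s) - heis (H s) ((1 - α) * t) (a s) * H')) S s := by
  have hXd : ∀ t : ℝ, HasDerivWithinAt (fun r => t • (Complex.I • H r)) (t • (Complex.I • H')) S s :=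
    fun t => (hH.const_smul Complex.I).const_smul t
  have h1 := hasDerivWithinAt_exp (hXd t)
  have h2 := hasDerivWithinAt_exp' (hXd (-t))
  have h3 := (h1.mul ha).mul h2
  refine h3.congr_deriv ?_
  change ((∫ α in (0 : ℝ)..1, _) * a s + evol (H s) t * a') * evol (H s) (-t) +
    evol (H s) t * a s * (∫ α in (0 : ℝ)..1, _) = _
  simp only [expPath_smul]
  have hc := continuous_evol (H s)
  have i1 : IntervalIntegrable (fun α : ℝ => evol (H s) (α * t) * (t • Complex.I • H') *
      evol (H s) ((1 - α) * t)) volume 0 1 := by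
    apply Continuous.intervalIntegrable; fun_prop
  have i2 : IntervalIntegrable (fun α : ℝ => evol (H s) ((1 - α) * -t) * (-t • Complex.I • H') *
      evol (H s) (α * -t)) volume 0 1 := by
    apply Continuous.intervalIntegrable; fun_prop
  let m1 : 𝒜 →L[ℂ] 𝒜 := ContinuousLinearMap.mulLeftRight ℂ 𝒜 1 (a s * evol (H s) (-t))
  let m2 : 𝒜 →L[ℂ] 𝒜 := ContinuousLinearMap.mulLeftRight ℂ 𝒜 (evol (H s) t * a s) 1
  have j1 := m1.intervalIntegral_comp_comm i1
  have j2 := m2.intervalIntegral_comp_comm i2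
  have k1 : ∀ x, m1 x = x * (a s * evol (H s) (-t)) := fun x => by
    simp [m1, ContinuousLinearMap.mulLeftRight_apply]
  have k2 : ∀ x, m2 x = evol (H s) t * a s * x := fun x => by
    simp [m2, ContinuousLinearMap.mulLeftRight_apply]
  rw [k1] at j1
  rw [k2] at j2
  rw [add_mul, mul_assoc _ (a s), ← j1, ← j2, add_right_comm, ← heis_apply, add_comm,
    ← intervalIntegral.integral_add]
  · congr 1
    refine intervalIntegral.integral_congr fun α _ => ?_
    simp only [k1, k2, heis_apply]
    -- The outer unitaries are split at the intermediate time `α t`, so that the variations of the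
    -- left and right factors combine into a single commutator.
    have e1 : evol (H s) (-t) = evol (H s) (-((1 - α) * t)) * evol (H s) (-(α * t)) := by
      rw [← evol_add]; congr 1; ring
    have e2 : evol (H s) t = evol (H s) (α * t) * evol (H s) ((1 - α) * t) := by
      rw [← evol_add]; congr 1; ring
    rw [e1, e2]
    simp only [mul_neg, neg_smul, neg_mul, mul_smul,
      mul_smul_comm, smul_mul_assoc, Complex.coe_smul, mul_assoc,
      sub_eq_add_neg, smul_neg, smul_add, add_mul, mul_add]
  · apply Continuous.intervalIntegrable; fun_prop
  · apply Continuous.intervalIntegrable; fun_prop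

end Duhamel

/-! ### Time averages, the quasi-adiabatic map and transport of spectral projections. -/

section Filter

variable {𝒜 : Type*} [CStarAlgebra 𝒜]

lemma continuous_heis (H a : 𝒜) : Continuous fun t => heis H t a :=
  continuous_iff_continuousAt.2 fun t => (hasDerivAt_heis H a t).continuousAt

/-- The weighted time average `∫ w(t) exp(itH) a exp(-itH) dt`. -/
def timeAverage (w : ℝ → ℝ) (H a : 𝒜) : 𝒜 := ∫ t, w t • heis H t a

/-- Time integral of the Heisenberg evolution over `[0, t]`. -/
def heisIntegral (H : 𝒜) (t : ℝ) (a : 𝒜) : 𝒜 := ∫ α in (0 : ℝ)..1, t • heis H (α * t) a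

/-- The quasi-adiabatic (quasi-local inverse Liouvillian) map. -/
def quasiAdiabatic (w : ℝ → ℝ) (H a : 𝒜) : 𝒜 := ∫ t, w t • heisIntegral H t a

lemma continuous_heisIntegral (H a : 𝒜) : Continuous fun t => heisIntegral H t a := by
  refine intervalIntegral.continuous_parametric_intervalIntegral_of_continuous' ?_ 0 1
  exact continuous_fst.smul ((continuous_heis H a).comp (continuous_snd.mul continuous_fst))

lemma norm_heisIntegral_le {H : 𝒜} (hH : IsSelfAdjoint H) (t : ℝ) (a : 𝒜) :
    ‖heisIntegral H t a‖ ≤ |t| * ‖a‖ := by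
  have h := intervalIntegral.norm_integral_le_of_norm_le_const (a := (0 : ℝ)) (b := 1)
    (f := fun α : ℝ => t • heis H (α * t) a) (C := |t| * ‖a‖) fun α _ => by
      rw [norm_smul, Real.norm_eq_abs]
      exact mul_le_mul_of_nonneg_left (norm_heis_le hH _ _) (abs_nonneg t)
  exact h.trans (by simp)

variable {w : ℝ → ℝ}

lemma integrable_smul_of_norm_le {E : Type*} [NormedAddCommGroup E] [NormedSpace ℝ E]
    (hw : HasMoments w) {f : ℝ → E} (hf : Continuous f) {C : ℝ} (p : ℕ)
    (h : ∀ t, ‖f t‖ ≤ C * (1 + |t|) ^ p) : Integrable fun t => w t • f t := by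
  refine ((hw p).norm.const_mul C).mono'
    (hw.integrable.aestronglyMeasurable.smul hf.aestronglyMeasurable)
    (Eventually.of_forall fun t => ?_)
  have h0 : 0 ≤ (1 + |t|) ^ p := by positivity
  rw [norm_smul, norm_mul, Real.norm_of_nonneg h0]
  calc ‖w t‖ * ‖f t‖ ≤ ‖w t‖ * (C * (1 + |t|) ^ p) :=
        mul_le_mul_of_nonneg_left (h t) (norm_nonneg _)
    _ = C * ((1 + |t|) ^ p * ‖w t‖) := by ring

lemma integrable_smul_heis (hw : HasMoments w) {H : 𝒜} (hH : IsSelfAdjoint H) (a : 𝒜) :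
    Integrable fun t => w t • heis H t a :=
  integrable_smul_of_norm_le hw (continuous_heis H a) 0 fun t => by
    rw [pow_zero, mul_one]; exact norm_heis_le hH t a

lemma integrable_smul_heisIntegral (hw : HasMoments w) {H : 𝒜} (hH : IsSelfAdjoint H) (a : 𝒜) :
    Integrable fun t => w t • heisIntegral H t a :=
  integrable_smul_of_norm_le hw (continuous_heisIntegral H a) 1 fun t => by
    rw [pow_one, mul_comm]
    exact (norm_heisIntegral_le hH t a).trans
      (mul_le_mul_of_nonneg_right (by linarith) (norm_nonneg a))

/-- The commutator with `H` as a continuous linear map. -/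
def liouvillian (H : 𝒜) : 𝒜 →L[ℂ] 𝒜 :=
  Complex.I • (ContinuousLinearMap.mul ℂ 𝒜 H - (ContinuousLinearMap.mul ℂ 𝒜).flip H)

lemma liouvillian_apply (H a : 𝒜) : liouvillian H a = Complex.I • (H * a - a * H) := rfl

lemma heis_liouvillian (H : 𝒜) (t : ℝ) (a : 𝒜) :
    heis H t (liouvillian H a) = liouvillian H (heis H t a) := by
  have h1 : heis H t H = H := heis_of_commute (Commute.refl H) t
  rw [liouvillian_apply, liouvillian_apply, map_smul, map_sub, heis_mul, heis_mul, h1]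

/-- `liouvillian H` is the generator of the Heisenberg evolution, so its integral over time is the
total increment. -/
lemma liouvillian_heisIntegral (H : 𝒜) (t : ℝ) (a : 𝒜) :
    liouvillian H (heisIntegral H t a) = heis H t a - a := by
  have hc : Continuous fun α : ℝ => t • heis H (α * t) a :=
    continuous_const.smul ((continuous_heis H a).comp (continuous_id.mul continuous_const))
  rw [heisIntegral, ← (liouvillian H).intervalIntegral_comp_comm (hc.intervalIntegrable 0 1)]
  have hd : ∀ α : ℝ, HasDerivAt (fun α : ℝ => heis H (α * t) a)
      (liouvillian H (t • heis H (α * t) a)) α := by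
    intro α
    refine ((hasDerivAt_heis H a (α * t)).scomp α
      ((hasDerivAt_id α).mul_const t)).congr_deriv ?_
    rw [one_mul, ← liouvillian_apply, heis_liouvillian]
    exact ((liouvillian H).map_smul_of_tower t _).symm
  rw [intervalIntegral.integral_eq_sub_of_hasDerivAt (fun α _ => hd α)
    (((liouvillian H).continuous.comp hc).intervalIntegrable 0 1), one_mul, zero_mul, heis_zero]

/-- The quasi-adiabatic map inverts the Liouvillian up to the time average. -/
lemma liouvillian_quasiAdiabatic (hw : HasMoments w) (hw1 : ∫ t, w t = 1) {H : 𝒜}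
    (hH : IsSelfAdjoint H) (a : 𝒜) :
    liouvillian H (quasiAdiabatic w H a) = timeAverage w H a - a := by
  rw [quasiAdiabatic, ← (liouvillian H).integral_comp_comm (integrable_smul_heisIntegral hw hH a)]
  have h1 : ∀ t, liouvillian H (w t • heisIntegral H t a) = w t • heis H t a - w t • a := by
    intro t
    rw [← smul_sub, ← liouvillian_heisIntegral]
    exact (liouvillian H).map_smul_of_tower (w t) _
  simp only [h1]
  rw [integral_sub (integrable_smul_heis hw hH a) (hw.integrable.smul_const a),
    integral_smul_const, hw1, one_smul, timeAverage]

lemma heisIntegral_sum (H : 𝒜) (t : ℝ) {ι : Type*} (u : Finset ι) (a : ι → 𝒜) :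
    heisIntegral H t (∑ i ∈ u, a i) = ∑ i ∈ u, heisIntegral H t (a i) := by
  simp only [heisIntegral, map_sum, Finset.smul_sum]
  refine intervalIntegral.integral_finsetSum fun i _ => Continuous.intervalIntegrable ?_ 0 1
  exact continuous_const.smul ((continuous_heis H (a i)).comp (continuous_id.mul continuous_const))

lemma quasiAdiabatic_sum (hw : HasMoments w) {H : 𝒜} (hH : IsSelfAdjoint H) {ι : Type*}
    (u : Finset ι) (a : ι → 𝒜) :
    quasiAdiabatic w H (∑ i ∈ u, a i) = ∑ i ∈ u, quasiAdiabatic w H (a i) := by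
  simp only [quasiAdiabatic, heisIntegral_sum, Finset.smul_sum]
  exact integral_finsetSum _ fun i _ => integrable_smul_heisIntegral hw hH (a i)

lemma quasiAdiabatic_add (hw : HasMoments w) {H : 𝒜} (hH : IsSelfAdjoint H) (a b : 𝒜) :
    quasiAdiabatic w H (a + b) = quasiAdiabatic w H a + quasiAdiabatic w H b := by
  have := quasiAdiabatic_sum hw hH (Finset.univ : Finset Bool) (fun i => bif i then a else b)
  simpa using this

lemma isSelfAdjoint_integral {α : Type*} [MeasurableSpace α] {μ : Measure α} {f : α → 𝒜}
    (h : ∀ t, IsSelfAdjoint (f t)) : IsSelfAdjoint (∫ t, f t ∂μ) := by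
  rw [isSelfAdjoint_iff]
  have h1 := (starL' ℝ (A := 𝒜)).integral_comp_comm (μ := μ) f
  simp only [starL'_apply] at h1
  rw [← h1]
  simp only [(h _).star_eq]

lemma isSelfAdjoint_heis {H a : 𝒜} (hH : IsSelfAdjoint H) (ha : IsSelfAdjoint a) (t : ℝ) :
    IsSelfAdjoint (heis H t a) := by
  rw [isSelfAdjoint_iff, ← heis_star hH, ha.star_eq]

lemma isSelfAdjoint_real_smul {a : 𝒜} (ha : IsSelfAdjoint a) (t : ℝ) : IsSelfAdjoint (t • a) :=
  (IsSelfAdjoint.all t).smul ha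

lemma isSelfAdjoint_quasiAdiabatic {H a : 𝒜} (hH : IsSelfAdjoint H) (ha : IsSelfAdjoint a) :
    IsSelfAdjoint (quasiAdiabatic w H a) := by
  refine isSelfAdjoint_integral fun t => isSelfAdjoint_real_smul ?_ _
  rw [heisIntegral, intervalIntegral.integral_of_le zero_le_one]
  exact isSelfAdjoint_integral fun α => isSelfAdjoint_real_smul (isSelfAdjoint_heis hH ha _) _

lemma evol_sub_scalar (H : 𝒜) (c t : ℝ) :
    evol (H - (c : ℂ) • 1) t = Complex.exp ((-(t * c) : ℝ) * Complex.I) • evol H t := by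
  have h1 : t • (Complex.I • (H - (c : ℂ) • (1 : 𝒜))) =
      ((-(t * c) : ℝ) * Complex.I : ℂ) • (1 : 𝒜) + t • (Complex.I • H) := by
    rw [smul_sub, smul_sub, smul_smul, ← Complex.coe_smul t ((Complex.I * (c : ℂ)) • (1 : 𝒜)),
      smul_smul, sub_eq_add_neg, add_comm, ← neg_smul]
    congr 2
    push_cast; ring
  have h2 : Commute ((((-(t * c) : ℝ) * Complex.I : ℂ)) • (1 : 𝒜)) (t • (Complex.I • H)) :=
    (Commute.one_left _).smul_left _
  rw [evol, h1, exp_add_of_commute' h2, ← Algebra.algebraMap_eq_smul_one,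
    ← NormedSpace.algebraMap_exp_comm, ← Complex.exp_eq_exp_ℂ, Algebra.algebraMap_eq_smul_one,
    smul_mul_assoc, one_mul, evol]

lemma heis_sub_scalar (H : 𝒜) (c t : ℝ) (a : 𝒜) :
    heis (H - (c : ℂ) • 1) t a = heis H t a := by
  rw [heis_apply, evol_sub_scalar, evol_sub_scalar, heis_apply, smul_mul_assoc, mul_smul_comm,
    smul_mul_assoc, smul_smul, ← Complex.exp_add]
  simp

lemma evol_mul_of_mul_eq_zero {H P : 𝒜} (h : H * P = 0) (t : ℝ) : evol H t * P = P := by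
  have hd : ∀ t, HasDerivAt (fun t => evol H t * P) 0 t := fun t =>
    ((hasDerivAt_evol H t).mul_const P).congr_deriv (by
      rw [mul_assoc, smul_mul_assoc, h, smul_zero, mul_zero])
  have h1 := is_const_of_deriv_eq_zero (fun t => (hd t).differentiableAt) (fun t => (hd t).deriv) t 0
  simpa [evol_zero] using h1

lemma mul_evol_of_mul_eq_zero {H P : 𝒜} (h : P * H = 0) (t : ℝ) : P * evol H t = P := by
  have hd : ∀ t, HasDerivAt (fun t => P * evol H t) 0 t := fun t =>
    ((hasDerivAt_evol' H t).const_mul P).congr_deriv (by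
      rw [← mul_assoc, mul_smul_comm, h, smul_zero, zero_mul])
  have h1 := is_const_of_deriv_eq_zero (fun t => (hd t).differentiableAt) (fun t => (hd t).deriv) t 0
  simpa [evol_zero] using h1

lemma integrable_smul_evol (hw : HasMoments w) {H : 𝒜} (hH : IsSelfAdjoint H) :
    Integrable fun t => w t • evol H t :=
  integrable_smul_of_norm_le hw (continuous_evol H) (C := 1) 0 fun t => by
    rw [pow_zero, mul_one]; exact norm_evol_le hH t

/-- `P` is the projection onto an isolated eigenvalue `c` of `H`, in a form adapted to the
filter `w`. -/
structure IsFiltered (w : ℝ → ℝ) (H P : 𝒜) (c : ℝ) : Prop where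
  isSelfAdjoint : IsSelfAdjoint H
  mul_left : H * P = (c : ℂ) • P
  mul_right : P * H = (c : ℂ) • P
  average : ∫ t, w t • evol (H - (c : ℂ) • 1) t = P

lemma isSelfAdjoint_sub_scalar {H : 𝒜} (hH : IsSelfAdjoint H) (c : ℝ) :
    IsSelfAdjoint (H - (c : ℂ) • 1) :=
  hH.sub (by rw [isSelfAdjoint_iff, star_smul, star_one, Complex.star_def, Complex.conj_ofReal])

variable {H P : 𝒜} {c : ℝ}

lemma IsFiltered.commute (h : IsFiltered w H P c) : Commute H P := by
  rw [commute_iff_eq, h.mul_left, h.mul_right]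

/-- The dynamics does not change when `H` is shifted by `c`. After the shift the unitary on the
right acts trivially on `P`, and the remaining integral of `w t • evol (H - c) t` is `P` itself. -/
lemma IsFiltered.timeAverage_mul (hw : HasMoments w) (h : IsFiltered w H P c) (a : 𝒜) :
    timeAverage w H a * P = P * a * P := by
  have hH' := isSelfAdjoint_sub_scalar h.isSelfAdjoint c
  have h0 : (H - (c : ℂ) • 1) * P = 0 := by
    rw [sub_mul, h.mul_left, smul_mul_assoc, one_mul, sub_self]
  let m1 : 𝒜 →L[ℂ] 𝒜 := ContinuousLinearMap.mulLeftRight ℂ 𝒜 1 P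
  let m2 : 𝒜 →L[ℂ] 𝒜 := ContinuousLinearMap.mulLeftRight ℂ 𝒜 1 (a * P)
  have e1 : ∀ x, m1 x = x * P := fun x => by simp [m1, ContinuousLinearMap.mulLeftRight_apply]
  have e2 : ∀ x, m2 x = x * (a * P) := fun x => by
    simp [m2, ContinuousLinearMap.mulLeftRight_apply]
  have i1 := m1.integral_comp_comm (integrable_smul_heis hw h.isSelfAdjoint a)
  have i2 := m2.integral_comp_comm (integrable_smul_evol hw hH')
  rw [h.average] at i2
  rw [e1] at i1
  rw [e2] at i2
  rw [timeAverage, ← i1, mul_assoc, ← i2]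
  refine integral_congr_ae (Eventually.of_forall fun t => ?_)
  simp only [e1, e2]
  rw [← heis_sub_scalar H c, heis_apply, smul_mul_assoc, smul_mul_assoc, mul_assoc,
    evol_mul_of_mul_eq_zero h0, mul_assoc]

lemma IsFiltered.mul_timeAverage (hw : HasMoments w) (h : IsFiltered w H P c)
    (hP : IsSelfAdjoint P) (a : 𝒜) :
    P * timeAverage w H a = P * a * P := by
  have h1 := h.timeAverage_mul hw (star a)
  have h2 : star (timeAverage w H (star a)) = timeAverage w H a := by
    have h3 := (starL' ℝ (A := 𝒜)).integral_comp_comm (μ := volume)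
      (fun t => w t • heis H t (star a))
    simp only [starL'_apply] at h3
    rw [timeAverage, ← h3, timeAverage]
    refine integral_congr_ae (Eventually.of_forall fun t => ?_)
    simp only
    rw [star_smul, ← heis_star h.isSelfAdjoint, star_star, star_trivial]
  have h4 := congrArg star h1
  rwa [star_mul, h2, hP.star_eq, star_mul, star_mul, star_star, hP.star_eq, ← mul_assoc] at h4

lemma IsFiltered.commute_timeAverage (hw : HasMoments w) (h : IsFiltered w H P c)
    (hP : IsSelfAdjoint P) (a : 𝒜) : Commute (timeAverage w H a) P := by
  rw [commute_iff_eq, h.timeAverage_mul hw, h.mul_timeAverage hw hP]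

/-- The unitaries generated by `H - c` fix `X` and `w` has integral one. Thus `P` contains every
vector of energy `c`. -/
lemma IsFiltered.mul_eq_self (hw : HasMoments w) (hw1 : ∫ t, w t = 1) (h : IsFiltered w H P c)
    {X : 𝒜} (hX : H * X = (c : ℂ) • X) : P * X = X := by
  have hH' := isSelfAdjoint_sub_scalar h.isSelfAdjoint c
  have h0 : (H - (c : ℂ) • 1) * X = 0 := by
    rw [sub_mul, hX, smul_mul_assoc, one_mul, sub_self]
  let m1 : 𝒜 →L[ℂ] 𝒜 := ContinuousLinearMap.mulLeftRight ℂ 𝒜 1 X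
  have e1 : ∀ x, m1 x = x * X := fun x => by simp [m1, ContinuousLinearMap.mulLeftRight_apply]
  have i1 := m1.integral_comp_comm (integrable_smul_evol hw hH')
  rw [h.average, e1] at i1
  rw [← i1]
  simp only [e1, smul_mul_assoc, evol_mul_of_mul_eq_zero h0]
  rw [integral_smul_const, hw1, one_smul]

lemma IsFiltered.eq_mul_self (hw : HasMoments w) (hw1 : ∫ t, w t = 1) (h : IsFiltered w H P c)
    {X : 𝒜} (hX : X * H = (c : ℂ) • X) : X * P = X := by
  have hH' := isSelfAdjoint_sub_scalar h.isSelfAdjoint c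
  have h0 : X * (H - (c : ℂ) • 1) = 0 := by
    rw [mul_sub, hX, mul_smul_comm, mul_one, sub_self]
  let m1 : 𝒜 →L[ℂ] 𝒜 := ContinuousLinearMap.mulLeftRight ℂ 𝒜 X 1
  have e1 : ∀ x, m1 x = X * x := fun x => by simp [m1, ContinuousLinearMap.mulLeftRight_apply]
  have i1 := m1.integral_comp_comm (integrable_smul_evol hw hH')
  rw [h.average, e1] at i1
  rw [← i1]
  simp only [e1, mul_smul_comm, mul_evol_of_mul_eq_zero h0]
  rw [integral_smul_const, hw1, one_smul]

/-- The quasi-adiabatic generator drives the parallel transport of the spectral projection. -/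
lemma deriv_projection_eq (hw : HasMoments w) (hw1 : ∫ t, w t = 1) {H P : ℝ → 𝒜} {H' P' : 𝒜}
    {s : ℝ} (hs : s ∈ Icc (0 : ℝ) 1) (hH : HasDerivWithinAt H H' (Icc 0 1) s)
    (hP : HasDerivWithinAt P P' (Icc 0 1) s) (hPP : ∀ r ∈ Icc (0 : ℝ) 1, P r * P r = P r)
    (hcomm : ∀ r ∈ Icc (0 : ℝ) 1, H r * P r = P r * H r) (hsa : IsSelfAdjoint (P s))
    (h : IsFiltered w (H s) (P s) c) :
    P' = Complex.I • (quasiAdiabatic w (H s) H' * P s - P s * quasiAdiabatic w (H s) H') := by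
  have hu : UniqueDiffWithinAt ℝ (Icc (0 : ℝ) 1) s := uniqueDiffOn_Icc zero_lt_one s hs
  have e1 : P' * P s + P s * P' = P' :=
    hu.eq_deriv _ ((hP.mul hP).congr (fun r hr => (hPP r hr).symm) (hPP s hs).symm) hP
  have e2 : H' * P s + H s * P' = P' * H s + P s * H' :=
    hu.eq_deriv _ ((hH.mul hP).congr (fun r hr => (hcomm r hr).symm) (hcomm s hs).symm) (hP.mul hH)
  set K := quasiAdiabatic w (H s) H' with hK
  have e3 := liouvillian_quasiAdiabatic hw hw1 h.isSelfAdjoint H'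
  rw [← hK, liouvillian_apply] at e3
  have e4 : timeAverage w (H s) H' * P s = P s * timeAverage w (H s) H' :=
    h.commute_timeAverage hw hsa H'
  set av := timeAverage w (H s) H'
  have hcs := hcomm s hs
  have hps := hPP s hs
  have hl := h.mul_left
  have hr := h.mul_right
  -- The defect `D` is shown to commute with `H` and to be off-diagonal with respect to `P`.
  -- Commuting with `H` forces `D` to preserve the eigenspace, so its off-diagonal parts vanish as
  -- well.
  set D := P' - Complex.I • (K * P s - P s * K) with hD
  have e5 : (av - H') * P s - P s * (av - H') = P s * H' - H' * P s := by
    rw [sub_mul, mul_sub, e4]; abel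
  -- Since `i[H, K]` is the average of `H'` minus `H'`, and the average commutes with `P`, the
  -- commutator of `H` with `i[K, P]` agrees with `[H, P']`, which is read off from the derivative
  -- of `HP = PH`.
  have e6 : H s * D = D * H s := by
    rw [← e3, smul_mul_assoc, mul_smul_comm, ← smul_sub] at e5
    have e7 : H s * P' - P' * H s = P s * H' - H' * P s := by
      rw [sub_eq_sub_iff_add_eq_add, add_comm (H s * P'), e2, add_comm]
    rw [← sub_eq_zero]
    have e8 : H s * D - D * H s = (H s * P' - P' * H s) -
        Complex.I • ((H s * K - K * H s) * P s - P s * (H s * K - K * H s)) := by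
      rw [hD, mul_sub, sub_mul, mul_smul_comm, smul_mul_assoc]
      have e9 : (H s * K - K * H s) * P s - P s * (H s * K - K * H s) =
          H s * (K * P s - P s * K) - (K * P s - P s * K) * H s := by
        have f1 : K * H s * P s = K * P s * H s := by rw [mul_assoc, hcs, mul_assoc]
        have f2 : H s * P s * K = P s * H s * K := by rw [hcs]
        simp only [sub_mul, mul_sub, ← mul_assoc, f1, f2]
        abel
      rw [e9, smul_sub]; abel
    rw [e8, e7, e5, sub_self]
  have e7 : D * P s + P s * D = D := by
    have f1 : (K * P s - P s * K) * P s + P s * (K * P s - P s * K) = K * P s - P s * K := by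
      have f2 : K * P s * P s = K * P s := by rw [mul_assoc, hps]
      have f3 : P s * (P s * K) = P s * K := by rw [← mul_assoc, hps]
      rw [sub_mul, mul_sub, f2, f3, mul_assoc]; abel
    rw [hD, sub_mul, mul_sub, smul_mul_assoc, mul_smul_comm]
    calc _ = (P' * P s + P s * P') - Complex.I •
          ((K * P s - P s * K) * P s + P s * (K * P s - P s * K)) := by rw [smul_add]; abel
      _ = _ := by rw [e1, f1]
  have e8 : P s * D * P s = 0 := by
    have f1 := congrArg (fun x => P s * x * P s) e7
    simp only [mul_add, add_mul] at f1
    have f2 : P s * (D * P s) * P s = P s * D * P s := by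
      rw [← mul_assoc, mul_assoc (P s * D), hps]
    have f3 : P s * (P s * D) * P s = P s * D * P s := by rw [← mul_assoc, hps]
    rw [f2, f3] at f1
    simpa using f1
  -- `D P` has energy `c` from the left, so `P D P = D P`; the left side is zero.
  have e9 : D * P s = 0 := by
    have f1 := h.mul_eq_self hw hw1 (X := D * P s)
      (by rw [← mul_assoc, e6, mul_assoc, hl, mul_smul_comm])
    rw [← f1, ← mul_assoc, e8]
  have e10 : P s * D = 0 := by
    have f1 := h.eq_mul_self hw hw1 (X := P s * D)
      (by rw [mul_assoc, ← e6, ← mul_assoc, hr, smul_mul_assoc])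
    rw [← f1, e8]
  rw [e9, e10, add_zero] at e7
  exact sub_eq_zero.1 e7.symm

end Filter

/-! ### The ground state projection of a gapped family. -/

section Ground

variable {D : Γ → ℕ} {Λ : Finset Γ}

lemma evol_apply_of_eigenvector {H : Obs D Λ} {v : Hilb D Λ} {μ : ℝ} (h : H v = (μ : ℂ) • v)
    (t : ℝ) : evol H t v = Complex.exp ((t * μ : ℝ) * Complex.I) • v := by
  let ev : Obs D Λ →L[ℂ] Hilb D Λ := ContinuousLinearMap.apply ℂ (Hilb D Λ) v
  have hd : ∀ t : ℝ, HasDerivAt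
      (fun t : ℝ => Complex.exp (-((t * μ : ℝ) * Complex.I)) • evol H t v) 0 t := by
    intro t
    have h1 : HasDerivAt (fun t : ℝ => evol H t v) ((Complex.I * μ) • evol H t v) t := by
      have h2 := (ev.restrictScalars ℝ).hasFDerivAt.comp_hasDerivAt t (hasDerivAt_evol H t)
      refine h2.congr_deriv ?_
      change (evol H t * (Complex.I • H)) v = _
      rw [mul_apply_eq_comp, smul_apply, h, smul_smul, map_smul]
    have h3 : HasDerivAt (fun t : ℝ => Complex.exp (-((t * μ : ℝ) * Complex.I)))
        (-(μ * Complex.I) * Complex.exp (-((t * μ : ℝ) * Complex.I))) t := by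
      have h4 : HasDerivAt (fun t : ℝ => -((t * μ : ℝ) * Complex.I)) (-(μ * Complex.I)) t := by
        have := (((hasDerivAt_id t).mul_const μ).ofReal_comp.mul_const Complex.I).fun_neg
        simpa using this
      exact (h4.cexp).congr_deriv (mul_comm _ _)
    refine (h3.smul h1).congr_deriv ?_
    rw [smul_smul, ← add_smul]
    rw [show Complex.exp (-((t * μ : ℝ) * Complex.I)) * (Complex.I * μ) + -(μ * Complex.I) *
      Complex.exp (-((t * μ : ℝ) * Complex.I)) = 0 by ring, zero_smul]
  have h1 := is_const_of_deriv_eq_zero (fun t => (hd t).differentiableAt) (fun t => (hd t).deriv) t 0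
  simp only [evol_zero] at h1
  have h2 : evol H t v = Complex.exp ((t * μ : ℝ) * Complex.I) •
      (Complex.exp (-((t * μ : ℝ) * Complex.I)) • evol H t v) := by
    rw [smul_smul, ← Complex.exp_add, add_neg_cancel, Complex.exp_zero, one_smul]
  rw [h2, h1]
  simp

lemma mem_spectrum_of_eigenvector {H : Obs D Λ} {v : Hilb D Λ} {μ : ℝ} (hv : v ≠ 0)
    (h : H v = (μ : ℂ) • v) : μ ∈ spectrum ℝ H := by
  rw [← spectrum.algebraMap_mem_iff ℂ]
  intro hu
  rw [Complex.coe_algebraMap] at hu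
  obtain ⟨u, hu⟩ := hu
  have h1 : (u : Obs D Λ) v = 0 := by
    rw [hu, sub_apply, h, Algebra.algebraMap_eq_smul_one,
      smul_apply, one_apply_eq_self, sub_self]
  have h2 : (↑u⁻¹ * ↑u : Obs D Λ) v = v := by rw [Units.inv_mul]; rfl
  rw [mul_apply_eq_comp, h1, map_zero] at h2
  exact hv h2.symm

lemma groundProj_apply_of_eq {H : Obs D Λ} {v : Hilb D Λ}
    (h : H v = (groundEnergy H : ℂ) • v) : groundProj H v = v :=
  Submodule.starProjection_eq_self_iff.2 (Module.End.mem_eigenspace_iff.2 h)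

lemma groundProj_apply_of_ne {H : Obs D Λ} (hH : IsSelfAdjoint H) {v : Hilb D Λ} {μ : ℝ}
    (h : H v = (μ : ℂ) • v) (hμ : μ ≠ groundEnergy H) : groundProj H v = 0 := by
  rw [groundProj, Submodule.starProjection_apply_eq_zero_iff]
  intro x hx
  have hsym : (H : Hilb D Λ →ₗ[ℂ] Hilb D Λ).IsSymmetric := hH.isSymmetric
  have h1 : (groundEnergy H : ℂ) ≠ (μ : ℂ) := fun h => hμ (Complex.ofReal_injective h).symm
  exact hsym.orthogonalFamily_eigenspaces h1 ⟨x, hx⟩ ⟨v, Module.End.mem_eigenspace_iff.2 h⟩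

lemma mul_groundProj (H : Obs D Λ) : H * groundProj H = (groundEnergy H : ℂ) • groundProj H := by
  ext1 v
  have h := Submodule.starProjection_apply_mem
    (Module.End.eigenspace (H : Hilb D Λ →ₗ[ℂ] Hilb D Λ) (groundEnergy H : ℂ)) v
  exact Module.End.mem_eigenspace_iff.1 h

lemma isSelfAdjoint_groundProj (H : Obs D Λ) : IsSelfAdjoint (groundProj H) :=
  isSelfAdjoint_starProjection _

lemma groundProj_mul_self (H : Obs D Λ) : groundProj H * groundProj H = groundProj H :=
  Submodule.isIdempotentElem_starProjection _

lemma IsSelfAdjoint.mul_eq_smul_of_mul_eq_smul {𝒜 : Type*} [CStarAlgebra 𝒜] {H P : 𝒜} {c : ℝ}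
    (hH : IsSelfAdjoint H) (hP : IsSelfAdjoint P) (h : H * P = (c : ℂ) • P) :
    P * H = (c : ℂ) • P := by
  have h1 := congrArg star h
  rwa [star_mul, hH.star_eq, hP.star_eq, star_smul, hP.star_eq, Complex.star_def,
    Complex.conj_ofReal] at h1

lemma groundProj_mul {H : Obs D Λ} (hH : IsSelfAdjoint H) :
    groundProj H * H = (groundEnergy H : ℂ) • groundProj H :=
  IsSelfAdjoint.mul_eq_smul_of_mul_eq_smul hH (isSelfAdjoint_groundProj H) (mul_groundProj H)

/-- The ground state energy of `H` is separated by a gap `γ` from the rest of the spectrum. -/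
def HasGap (γ : ℝ) (H : Obs D Λ) : Prop :=
  ∀ μ ∈ spectrum ℝ H, μ ≠ groundEnergy H → groundEnergy H + γ ≤ μ

/-- The filter function separates the ground state energy from the rest of the spectrum. -/
def IsGapFilter (γ : ℝ) (w : ℝ → ℝ) : Prop := ∀ ξ : ℝ,
      (|ξ| ≤ γ / 3 → ∫ t : ℝ, (w t : ℂ) * Complex.exp ((t * ξ : ℝ) * Complex.I) = 1) ∧
      (2 * γ / 3 ≤ |ξ| → ∫ t : ℝ, (w t : ℂ) * Complex.exp ((t * ξ : ℝ) * Complex.I) = 0)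

lemma IsGapFilter.integral_eq_one {γ : ℝ} {w : ℝ → ℝ} (h : IsGapFilter γ w) (hγ : 0 < γ) :
    ∫ t, w t = 1 := by
  have h1 := (h 0).1 (by rw [abs_zero]; positivity)
  simp only [mul_zero, Complex.ofReal_zero, zero_mul, Complex.exp_zero, mul_one] at h1
  rw [integral_complex_ofReal] at h1
  exact_mod_cast h1

/-- Checked on an eigenbasis. The reference energy `E` need only be within `γ / 3` of the ground
state energy: the ground state then lies on the plateau of the filter, and every excited energy is
at distance at least `γ - γ / 3 = 2 γ / 3` from `E`. -/
lemma integral_evol_eq_groundProj {γ : ℝ} {w : ℝ → ℝ} (hw : HasMoments w)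
    (hf : IsGapFilter γ w) {H : Obs D Λ} (hH : IsSelfAdjoint H) (hgap : HasGap γ H) {E : ℝ}
    (hE : |groundEnergy H - E| ≤ γ / 3) :
    ∫ t, w t • evol (H - (E : ℂ) • 1) t = groundProj H := by
  have hsym : (H : Hilb D Λ →ₗ[ℂ] Hilb D Λ).IsSymmetric := hH.isSymmetric
  have hH' := isSelfAdjoint_sub_scalar hH E
  set b := hsym.eigenvectorBasis rfl
  have key : ∀ i, (∫ t, w t • evol (H - (E : ℂ) • 1) t) (b i) = groundProj H (b i) := by
    intro i
    set μ : ℝ := hsym.eigenvalues rfl i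
    have h1 : H (b i) = (μ : ℂ) • b i := hsym.apply_eigenvectorBasis rfl i
    have h2 : (H - (E : ℂ) • (1 : Obs D Λ)) (b i) = ((μ - E : ℝ) : ℂ) • b i := by
      rw [sub_apply, smul_apply, h1,
        one_apply_eq_self, ← sub_smul, Complex.ofReal_sub]
    rw [ContinuousLinearMap.integral_apply (integrable_smul_evol hw hH')]
    have h3 : ∀ t : ℝ, (w t • evol (H - (E : ℂ) • 1) t) (b i) =
        ((w t : ℂ) * Complex.exp ((t * (μ - E) : ℝ) * Complex.I)) • b i := by
      intro t
      rw [smul_apply, evol_apply_of_eigenvector h2, mul_smul, Complex.coe_smul]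
    simp only [h3]
    rw [integral_smul_const]
    rcases eq_or_ne μ (groundEnergy H) with hμ | hμ
    · rw [(hf _).1 (by rwa [hμ]), one_smul, groundProj_apply_of_eq (by rw [h1, hμ])]
    · have h4 := hgap μ (mem_spectrum_of_eigenvector (b.orthonormal.ne_zero i) h1) hμ
      rw [(hf _).2 ?_, zero_smul, groundProj_apply_of_ne hH h1 hμ]
      have h5 := (abs_le.1 hE).1
      exact le_trans (by linarith) (le_abs_self _)
  apply ContinuousLinearMap.coe_injective
  exact b.toBasis.ext fun i => by simpa using key i

lemma isFiltered_groundProj {γ : ℝ} {w : ℝ → ℝ} (hw : HasMoments w) (hγ : 0 < γ)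
    (hf : IsGapFilter γ w) {H : Obs D Λ} (hH : IsSelfAdjoint H) (hgap : HasGap γ H) :
    IsFiltered w H (groundProj H) (groundEnergy H) where
  isSelfAdjoint := hH
  mul_left := mul_groundProj H
  mul_right := groundProj_mul hH
  average := integral_evol_eq_groundProj hw hf hH hgap (by
    rw [sub_self, abs_zero]; positivity)

/-- Operator inequality `K ≥ H - ‖H - K‖`; used in both directions it makes the ground state energy
Lipschitz in the norm. -/
lemma sInf_spectrum_sub_norm_le {𝒜 : Type*} [CStarAlgebra 𝒜] [PartialOrder 𝒜] [StarOrderedRing 𝒜]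
    [Nontrivial 𝒜] {H K : 𝒜} (hH : IsSelfAdjoint H) (hK : IsSelfAdjoint K) :
    sInf (spectrum ℝ H) - ‖H - K‖ ≤ sInf (spectrum ℝ K) := by
  have h1 : algebraMap ℝ 𝒜 (sInf (spectrum ℝ H)) ≤ H :=
    (algebraMap_le_iff_le_spectrum hH).2 fun x hx =>
      csInf_le (spectrum.isCompact (𝕜 := ℝ) H).bddBelow hx
  have h2 : H - K ≤ algebraMap ℝ 𝒜 ‖H - K‖ := (hH.sub hK).le_algebraMap_norm_self
  have h3 : algebraMap ℝ 𝒜 (sInf (spectrum ℝ H) - ‖H - K‖) ≤ K := by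
    rw [map_sub]
    calc _ ≤ H - (H - K) := sub_le_sub h1 h2
      _ = K := sub_sub_cancel _ _
  have h4 := (algebraMap_le_iff_le_spectrum hK).1 h3
  exact le_csInf (ContinuousFunctionalCalculus.spectrum_nonempty K hK) h4

lemma abs_groundEnergy_sub_le [∀ x, NeZero (D x)] {H K : Obs D Λ} (hH : IsSelfAdjoint H)
    (hK : IsSelfAdjoint K) : |groundEnergy H - groundEnergy K| ≤ ‖H - K‖ := by
  have h1 : groundEnergy H - ‖H - K‖ ≤ groundEnergy K := sInf_spectrum_sub_norm_le hH hK
  have h2 : groundEnergy K - ‖K - H‖ ≤ groundEnergy H := sInf_spectrum_sub_norm_le hK hH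
  rw [norm_sub_rev] at h2
  exact abs_le.2 ⟨by linarith, by linarith⟩

lemma norm_integral_evol_mul_le {𝒜 : Type*} [CStarAlgebra 𝒜] {H a : 𝒜} (hH : IsSelfAdjoint H)
    (t : ℝ) : ‖∫ α in (0 : ℝ)..1, evol H (α * t) * (t • (Complex.I • a)) * evol H ((1 - α) * t)‖ ≤
      |t| * ‖a‖ := by
  have h := intervalIntegral.norm_integral_le_of_norm_le_const (a := (0 : ℝ)) (b := 1)
    (f := fun α : ℝ => evol H (α * t) * (t • (Complex.I • a)) * evol H ((1 - α) * t))
    (C := |t| * ‖a‖) fun α _ => by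
      refine (norm_mul_le _ _).trans ((mul_le_mul (norm_mul_le _ _) (norm_evol_le hH _)
        (norm_nonneg _) (by positivity)).trans ?_)
      rw [norm_smul, norm_smul, Complex.norm_I, one_mul, mul_one, Real.norm_eq_abs]
      exact (mul_le_mul_of_nonneg_right (norm_evol_le hH _) (by positivity)).trans (one_mul _).le
  exact h.trans (by simp)

lemma differentiableWithinAt_integral_evol {𝒜 : Type*} [CStarAlgebra 𝒜] {w : ℝ → ℝ}
    (hw : HasMoments w) {H H' : ℝ → 𝒜} (hH : ∀ r ∈ Icc (0 : ℝ) 1, IsSelfAdjoint (H r))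
    (hd : ∀ r ∈ Icc (0 : ℝ) 1, HasDerivWithinAt H (H' r) (Icc 0 1) r) {C : ℝ}
    (hC : ∀ r ∈ Icc (0 : ℝ) 1, ‖H' r‖ ≤ C) {s : ℝ} (hs : s ∈ Icc (0 : ℝ) 1) :
    DifferentiableWithinAt ℝ (fun r => ∫ t, w t • evol (H r) t) (Icc 0 1) s := by
  refine (hasDerivWithinAt_integral (b := fun t => C * ‖(1 + |t|) ^ 1 * w t‖) (f' := fun t r => w t •
    ∫ α in (0 : ℝ)..1, evol (H r) (α * t) * (t • (Complex.I • H' r)) * evol (H r) ((1 - α) * t))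
    hs ?_ ?_ ?_ ?_).differentiableWithinAt
  · intro t r hr
    refine HasDerivWithinAt.const_smul (w t) ?_
    have h1 := hasDerivWithinAt_exp (((hd r hr).const_smul Complex.I).const_smul t)
    simp only [Pi.smul_apply, expPath_smul] at h1
    exact h1
  · intro t r hr
    rw [norm_smul, norm_mul, Real.norm_of_nonneg (show 0 ≤ (1 + |t|) ^ 1 by positivity), pow_one]
    have h1 := norm_integral_evol_mul_le (a := H' r) (hH r hr) t
    have h2 : |t| * ‖H' r‖ ≤ (1 + |t|) * C := by
      have := hC r hr
      have := norm_nonneg (H' r)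
      have := abs_nonneg t
      nlinarith
    calc ‖w t‖ * _ ≤ ‖w t‖ * ((1 + |t|) * C) :=
          mul_le_mul_of_nonneg_left (h1.trans h2) (norm_nonneg _)
      _ = _ := by ring
  · exact (hw 1).norm.const_mul C
  · exact fun r hr => integrable_smul_evol hw (hH r hr)

/-- The ground state projection of a gapped family evolves by the quasi-adiabatic generator. -/
lemma hasDerivWithinAt_groundProj [∀ x, NeZero (D x)] {γ : ℝ} {w : ℝ → ℝ} (hw : HasMoments w)
    (hγ : 0 < γ) (hf : IsGapFilter γ w) {H H' : ℝ → Obs D Λ}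
    (hH : ∀ r ∈ Icc (0 : ℝ) 1, IsSelfAdjoint (H r))
    (hd : ∀ r ∈ Icc (0 : ℝ) 1, HasDerivWithinAt H (H' r) (Icc 0 1) r) {C : ℝ}
    (hC : ∀ r ∈ Icc (0 : ℝ) 1, ‖H' r‖ ≤ C) (hgap : ∀ r ∈ Icc (0 : ℝ) 1, HasGap γ (H r))
    {s : ℝ} (hs : s ∈ Icc (0 : ℝ) 1) :
    HasDerivWithinAt (fun r => groundProj (H r))
      (Complex.I • (quasiAdiabatic w (H s) (H' s) * groundProj (H s) -
        groundProj (H s) * quasiAdiabatic w (H s) (H' s))) (Icc 0 1) s := by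
  set E := groundEnergy (H s) with hE
  -- With `E` frozen at its value at `s`, the filter integral is differentiable in `r` and still
  -- equals the ground projection for `r` near `s`. No differentiability of the ground state energy
  -- is needed.
  have h1 := differentiableWithinAt_integral_evol hw (H := fun r => H r - (E : ℂ) • 1)
    (fun r hr => isSelfAdjoint_sub_scalar (hH r hr) E) (fun r hr => (hd r hr).sub_const _) hC hs
  have h2 : (fun r => groundProj (H r)) =ᶠ[𝓝[Icc 0 1] s]
      fun r => ∫ t, w t • evol (H r - (E : ℂ) • 1) t := by
    have h3 : Tendsto (fun r => ‖H r - H s‖) (𝓝[Icc 0 1] s) (𝓝 0) :=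
      tendsto_iff_norm_sub_tendsto_zero.1 (hd s hs).continuousWithinAt
    filter_upwards [self_mem_nhdsWithin,
      h3.eventually (gt_mem_nhds (show (0 : ℝ) < γ / 3 by positivity))] with r hr hr2
    exact (integral_evol_eq_groundProj hw hf (hH r hr) (hgap r hr)
      ((abs_groundEnergy_sub_le (hH r hr) (hH s hs)).trans hr2.le)).symm
  have h4 : DifferentiableWithinAt ℝ (fun r => groundProj (H r)) (Icc 0 1) s :=
    h1.congr_of_eventuallyEq_of_mem h2 hs
  have h5 := deriv_projection_eq hw (hf.integral_eq_one hγ) hs (hd s hs) h4.hasDerivWithinAt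
    (fun r _ => groundProj_mul_self (H r))
    (fun r hr => by rw [mul_groundProj, groundProj_mul (hH r hr)])
    (isSelfAdjoint_groundProj _) (isFiltered_groundProj hw hγ hf (hH s hs) (hgap s hs))
  exact h4.hasDerivWithinAt.congr_deriv h5

end Ground

/-! ### Propagation of centrality through commutators, evolutions and integrals. -/

section Abstract

variable {𝒜 : Type*} [CStarAlgebra 𝒜]

lemma coe_smul_algebra (c : ℝ) (a : 𝒜) : (c : ℂ) • a = c • a := Complex.coe_smul c a

lemma commute_integral {α : Type*} [MeasurableSpace α] {μ : Measure α} {f : α → 𝒜} {a : 𝒜}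
    (hf : Integrable f μ) (h : ∀ t, Commute (f t) a) : Commute (∫ t, f t ∂μ) a := by
  let L : 𝒜 →L[ℂ] 𝒜 := ContinuousLinearMap.mul ℂ 𝒜 a - (ContinuousLinearMap.mul ℂ 𝒜).flip a
  have hL : ∀ x, L x = a * x - x * a := fun x => rfl
  have h1 := L.integral_comp_comm hf
  simp only [hL, (h _).eq, sub_self, integral_zero] at h1
  exact (sub_eq_zero.1 h1.symm).symm

lemma hasDerivWithinAt_commutator {G B : ℝ → 𝒜} {G' B' : 𝒜} {S : Set ℝ} {s : ℝ}
    (hG : HasDerivWithinAt G G' S s) (hB : HasDerivWithinAt B B' S s) :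
    HasDerivWithinAt (fun r => G r * B r - B r * G r)
      ((G' * B s - B s * G') + (G s * B' - B' * G s)) S s := by
  refine ((hG.mul hB).sub (hB.mul hG)).congr_deriv ?_
  abel

lemma sum_commutator {ι : Type*} (u : Finset ι) (G : 𝒜) (B : ι → 𝒜) :
    ∑ i ∈ u, (G * B i - B i * G) = G * ∑ i ∈ u, B i - (∑ i ∈ u, B i) * G := by
  rw [Finset.sum_sub_distrib, Finset.mul_sum, Finset.sum_mul]

lemma commute_sum_commutator {ι : Type*} (u : Finset ι) (G : 𝒜) (B : ι → 𝒜)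
    (h : ∀ a, Commute (∑ i ∈ u, B i) a) (a : 𝒜) : Commute (∑ i ∈ u, (G * B i - B i * G)) a := by
  rw [sum_commutator, (h G).eq, sub_self]
  exact Commute.zero_left a

lemma commute_sum_heis {ι : Type*} (u : Finset ι) (G : 𝒜) (t : ℝ) (B : ι → 𝒜)
    (h : ∀ a, Commute (∑ i ∈ u, B i) a) (a : 𝒜) : Commute (∑ i ∈ u, heis G t (B i)) a := by
  rw [← map_sum, heis_of_commute (h G).symm]
  exact h a

lemma commute_sum_integral {ι : Type*} (u : Finset ι) {f : ι → ℝ → 𝒜}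
    (hf : ∀ i ∈ u, Integrable (f i)) (h : ∀ t a, Commute (∑ i ∈ u, f i t) a) (a : 𝒜) :
    Commute (∑ i ∈ u, ∫ t, f i t) a := by
  rw [← integral_finsetSum u hf]
  exact commute_integral (integrable_finsetSum u hf) fun t => h t a

lemma commute_sum_add {ι : Type*} (u : Finset ι) {f g : ι → 𝒜}
    (hf : ∀ a, Commute (∑ i ∈ u, f i) a) (hg : ∀ a, Commute (∑ i ∈ u, g i) a) (a : 𝒜) :
    Commute (∑ i ∈ u, (f i + g i)) a := by
  rw [Finset.sum_add_distrib]
  exact (hf a).add_left (hg a)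

lemma commute_sum_smul {ι : Type*} (u : Finset ι) {f : ι → 𝒜}
    (hf : ∀ a, Commute (∑ i ∈ u, f i) a) (c : ℂ) (a : 𝒜) :
    Commute (∑ i ∈ u, c • f i) a := by
  rw [← Finset.smul_sum]
  exact (hf a).smul_left c

lemma continuous_heis_comp {T : Type*} [TopologicalSpace T] (G : 𝒜) {B : T → 𝒜}
    (hB : Continuous B) : Continuous fun p : T × ℝ => heis G p.2 (B p.1) := by
  have h := continuous_evol G
  simp only [heis_apply]
  fun_prop

lemma hasDerivWithinAt_isSelfAdjoint {G : ℝ → 𝒜} {G' : 𝒜} {s : ℝ} (hs : s ∈ Icc (0 : ℝ) 1)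
    (hG : ∀ r ∈ Icc (0 : ℝ) 1, IsSelfAdjoint (G r)) (h : HasDerivWithinAt G G' (Icc 0 1) s) :
    IsSelfAdjoint G' := by
  have h1 : HasDerivWithinAt (fun r => star (G r)) (star G') (Icc 0 1) s := h.star
  exact (uniqueDiffOn_Icc zero_lt_one s hs).eq_deriv _
    (h1.congr (fun r hr => (hG r hr).star_eq.symm) (hG s hs).star_eq.symm) h

end Abstract

/-! ### Smooth families of quasi-local site observables. -/

section Sites

variable {D : Γ → ℕ} [MetricSpace Γ]

lemma norm_integral_sub_map_le {𝒜 : Type*} [CStarAlgebra 𝒜] (E : 𝒜 →L[ℂ] 𝒜) {f : ℝ → 𝒜}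
    {b : ℝ → ℝ} (hf : Integrable f) (hb : Integrable b) {c : ℝ} (hc : 0 ≤ c)
    (h : ∀ t, ‖f t - E (f t)‖ * c ≤ b t) : ‖(∫ t, f t) - E (∫ t, f t)‖ * c ≤ ∫ t, b t := by
  rw [← E.integral_comp_comm hf, ← integral_sub hf (E.integrable_comp hf)]
  have h1 : ‖∫ t, c • (f t - E (f t))‖ ≤ ∫ t, b t := by
    refine norm_integral_le_of_norm_le hb (Eventually.of_forall fun t => ?_)
    rw [norm_smul, Real.norm_of_nonneg hc, mul_comm]
    exact h t
  rwa [integral_smul, norm_smul, Real.norm_of_nonneg hc, mul_comm] at h1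

lemma QuasiLocal.integral {Λ : Finset Γ} {k : ℕ} {x : Γ} {f : ℝ → Obs D Λ} {b : ℝ → ℝ}
    (hf : Integrable f) (hb : Integrable b) (h : ∀ t, QuasiLocal k x (b t) (f t)) :
    QuasiLocal k x (∫ t, b t) (∫ t, f t) :=
  ⟨norm_integral_le_of_norm_le hb (Eventually.of_forall fun t => (h t).1),
    fun r => norm_integral_sub_map_le _ hf hb (by positivity) fun t => (h t).2 r⟩

lemma QuasiLocal.real_smul {Λ : Finset Γ} {k : ℕ} {x : Γ} {C : ℝ} {a : Obs D Λ}
    (ha : QuasiLocal k x C a) (c : ℝ) : QuasiLocal k x (|c| * C) (c • a) := by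
  have h := ha.smul (c : ℂ)
  rw [Complex.norm_real, Real.norm_eq_abs] at h
  have h1 : (c : ℂ) • a = c • a := coe_smul_algebra c a
  rwa [h1] at h

variable {T T' : Type} [NormedAddCommGroup T] [NormedAddCommGroup T']

variable (D T) in
/-- Families of observables attached to the sites of finite volumes, depending on a parameter in
`T` and on time. -/
abbrev SiteFamily : Type _ := (Λ : Finset Γ) → Γ → T → ℝ → Obs D Λ

/-- A family of observables that is continuous in the parameter and quasi-local at the sites, with
bounds that grow at most polynomially in the parameter; under the condition `z` the sum over the
sites is central at time zero. -/
structure SiteBound (z : Prop) (B : SiteFamily D T) : Prop where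
  cont : ∀ Λ, ∀ x ∈ Λ, ∀ s ∈ Icc (0 : ℝ) 1, Continuous fun θ => B Λ x θ s
  bound : ∀ k, ∃ (C : ℝ) (p : ℕ), 0 ≤ C ∧ ∀ Λ, ∀ x ∈ Λ, ∀ θ, ∀ s ∈ Icc (0 : ℝ) 1,
    QuasiLocal k x (C * (1 + ‖θ‖) ^ p) (B Λ x θ s)
  central : z → ∀ Λ θ a, Commute (∑ x ∈ Λ, B Λ x θ 0) a

/-- Families of site observables of class `C^m` in time. -/
def SiteC (z : Prop) : ℕ → SiteFamily D T → Prop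
  | 0, B => SiteBound z B
  | m + 1, B => SiteBound z B ∧ ∃ B' : SiteFamily D T,
      (∀ Λ, ∀ x ∈ Λ, ∀ θ, ∀ s ∈ Icc (0 : ℝ) 1,
        HasDerivWithinAt (B Λ x θ) (B' Λ x θ s) (Icc 0 1) s) ∧ SiteC z m B'

variable {z : Prop} {m : ℕ} {B B₁ B₂ : SiteFamily D T}

lemma SiteC.siteBound (h : SiteC z m B) : SiteBound z B := by
  cases m with
  | zero => exact h
  | succ m => exact h.1

lemma SiteC.of_succ (h : SiteC z (m + 1) B) : SiteC z m B := by
  induction m generalizing B with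
  | zero => exact h.1
  | succ m ih =>
    obtain ⟨h1, B', hd, h2⟩ := h
    exact ⟨h1, B', hd, ih h2⟩

lemma SiteC.of_le {m' : ℕ} (hm : m' ≤ m) (h : SiteC z m B) : SiteC z m' B := by
  induction hm with
  | refl => exact h
  | step _ ih => exact ih h.of_succ

lemma pow_le_pow_max {t : ℝ} (ht : 0 ≤ t) {p q : ℕ} (h : p ≤ q) : (1 + t) ^ p ≤ (1 + t) ^ q :=
  pow_le_pow_right₀ (by linarith) h

lemma SiteBound.add (h₁ : SiteBound z B₁) (h₂ : SiteBound z B₂) :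
    SiteBound z (fun Λ x θ s => B₁ Λ x θ s + B₂ Λ x θ s) where
  cont Λ x hx s hs := (h₁.cont Λ x hx s hs).add (h₂.cont Λ x hx s hs)
  bound k := by
    obtain ⟨C₁, p₁, hC₁, h₁⟩ := h₁.bound k
    obtain ⟨C₂, p₂, hC₂, h₂⟩ := h₂.bound k
    refine ⟨C₁ + C₂, max p₁ p₂, add_nonneg hC₁ hC₂, fun Λ x hx θ s hs => ?_⟩
    refine ((h₁ Λ x hx θ s hs).add (h₂ Λ x hx θ s hs)).mono ?_
    rw [add_mul]
    exact add_le_add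
      (mul_le_mul_of_nonneg_left (pow_le_pow_max (norm_nonneg θ) (le_max_left _ _)) hC₁)
      (mul_le_mul_of_nonneg_left (pow_le_pow_max (norm_nonneg θ) (le_max_right _ _)) hC₂)
  central hz Λ θ a := commute_sum_add Λ (h₁.central hz Λ θ) (h₂.central hz Λ θ) a

lemma SiteC.add (h₁ : SiteC z m B₁) (h₂ : SiteC z m B₂) :
    SiteC z m (fun Λ x θ s => B₁ Λ x θ s + B₂ Λ x θ s) := by
  induction m generalizing B₁ B₂ with
  | zero => exact SiteBound.add h₁ h₂
  | succ m ih =>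
    obtain ⟨h1, B₁', hd₁, h1'⟩ := h₁
    obtain ⟨h2, B₂', hd₂, h2'⟩ := h₂
    exact ⟨h1.add h2, fun Λ x θ s => B₁' Λ x θ s + B₂' Λ x θ s,
      fun Λ x hx θ s hs => (hd₁ Λ x hx θ s hs).add (hd₂ Λ x hx θ s hs), ih h1' h2'⟩

/-- Multiplication by a polynomially bounded scalar function of the parameter. -/
lemma SiteBound.scalar (h : SiteBound z B) {f : T → ℂ} (hf : Continuous f) {K : ℝ} {q : ℕ}
    (hK : 0 ≤ K) (hfb : ∀ θ, ‖f θ‖ ≤ K * (1 + ‖θ‖) ^ q) :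
    SiteBound z (fun Λ x θ s => f θ • B Λ x θ s) where
  cont Λ x hx s hs := hf.smul (h.cont Λ x hx s hs)
  bound k := by
    obtain ⟨C, p, hC, h⟩ := h.bound k
    refine ⟨K * C, q + p, mul_nonneg hK hC, fun Λ x hx θ s hs => ?_⟩
    refine ((h Λ x hx θ s hs).smul (f θ)).mono ?_
    calc _ ≤ K * (1 + ‖θ‖) ^ q * (C * (1 + ‖θ‖) ^ p) :=
          mul_le_mul_of_nonneg_right (hfb θ) (by positivity)
      _ = _ := by ring
  central hz Λ θ a := commute_sum_smul Λ (h.central hz Λ θ) _ a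

lemma SiteC.scalar (h : SiteC z m B) {f : T → ℂ} (hf : Continuous f) {K : ℝ} {q : ℕ}
    (hK : 0 ≤ K) (hfb : ∀ θ, ‖f θ‖ ≤ K * (1 + ‖θ‖) ^ q) :
    SiteC z m (fun Λ x θ s => f θ • B Λ x θ s) := by
  induction m generalizing B with
  | zero => exact SiteBound.scalar h hf hK hfb
  | succ m ih =>
    obtain ⟨h1, B', hd, h2⟩ := h
    exact ⟨h1.scalar hf hK hfb, fun Λ x θ s => f θ • B' Λ x θ s,
      fun Λ x hx θ s hs => (hd Λ x hx θ s hs).const_smul (f θ), ih h2⟩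

lemma SiteC.const_smul (h : SiteC z m B) (c : ℂ) :
    SiteC z m (fun Λ x θ s => c • B Λ x θ s) :=
  h.scalar (f := fun _ => c) continuous_const (K := ‖c‖) (q := 0) (norm_nonneg c)
    fun θ => by rw [pow_zero, mul_one]

/-- Pullback along a polynomially bounded map of parameters. -/
lemma SiteBound.comp (h : SiteBound z B) {g : T' → T} (hg : Continuous g) {q : ℕ}
    (hgb : ∀ θ, 1 + ‖g θ‖ ≤ (1 + ‖θ‖) ^ q) :
    SiteBound z (fun Λ x θ s => B Λ x (g θ) s) where
  cont Λ x hx s hs := (h.cont Λ x hx s hs).comp hg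
  bound k := by
    obtain ⟨C, p, hC, h⟩ := h.bound k
    refine ⟨C, q * p, hC, fun Λ x hx θ s hs => (h Λ x hx (g θ) s hs).mono ?_⟩
    rw [pow_mul]
    exact mul_le_mul_of_nonneg_left (pow_le_pow_left₀ (by positivity) (hgb θ) p) hC
  central hz Λ θ a := h.central hz Λ (g θ) a

lemma SiteC.comp (h : SiteC z m B) {g : T' → T} (hg : Continuous g) {q : ℕ}
    (hgb : ∀ θ, 1 + ‖g θ‖ ≤ (1 + ‖θ‖) ^ q) :
    SiteC z m (fun Λ x θ s => B Λ x (g θ) s) := by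
  induction m generalizing B with
  | zero => exact SiteBound.comp h hg hgb
  | succ m ih =>
    obtain ⟨h1, B', hd, h2⟩ := h
    exact ⟨h1.comp hg hgb, fun Λ x θ s => B' Λ x (g θ) s,
      fun Λ x hx θ s hs => hd Λ x hx (g θ) s hs, ih h2⟩

lemma SiteBound.congr (h : SiteBound z B₁)
    (he : ∀ Λ, ∀ x ∈ Λ, ∀ θ, ∀ s ∈ Icc (0 : ℝ) 1, B₂ Λ x θ s = B₁ Λ x θ s) : SiteBound z B₂ where
  cont Λ x hx s hs := (h.cont Λ x hx s hs).congr fun θ => (he Λ x hx θ s hs).symm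
  bound k := by
    obtain ⟨C, p, hC, h⟩ := h.bound k
    exact ⟨C, p, hC, fun Λ x hx θ s hs => by rw [he Λ x hx θ s hs]; exact h Λ x hx θ s hs⟩
  central hz Λ θ a := by
    rw [Finset.sum_congr rfl fun x hx => he Λ x hx θ 0 ⟨le_rfl, zero_le_one⟩]
    exact h.central hz Λ θ a

lemma SiteC.congr (h : SiteC z m B₁)
    (he : ∀ Λ, ∀ x ∈ Λ, ∀ θ, ∀ s ∈ Icc (0 : ℝ) 1, B₂ Λ x θ s = B₁ Λ x θ s) : SiteC z m B₂ := by
  cases m with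
  | zero => exact SiteBound.congr h he
  | succ m =>
    obtain ⟨h1, B', hd, h2⟩ := h
    exact ⟨h1.congr he, B', fun Λ x hx θ s hs => (hd Λ x hx θ s hs).congr
      (fun r hr => he Λ x hx θ r hr) (he Λ x hx θ s hs), h2⟩

/-- Time-dependent operators whose commutator preserves quasi-locality. -/
def CommBound (G : (Λ : Finset Γ) → ℝ → Obs D Λ) : Prop :=
  ∀ k, ∃ (k' : ℕ) (K : ℝ), 0 ≤ K ∧ ∀ Λ, ∀ x ∈ Λ, ∀ s ∈ Icc (0 : ℝ) 1, ∀ (C : ℝ) (a : Obs D Λ),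
    QuasiLocal k' x C a → QuasiLocal k x (K * C) (G Λ s * a - a * G Λ s)

/-- Time-dependent operators of class `C^m` whose derivatives have commutators that preserve
quasi-locality. -/
def CommC : ℕ → ((Λ : Finset Γ) → ℝ → Obs D Λ) → Prop
  | 0, G => CommBound G
  | m + 1, G => CommBound G ∧ ∃ G' : (Λ : Finset Γ) → ℝ → Obs D Λ,
      (∀ Λ, ∀ s ∈ Icc (0 : ℝ) 1, HasDerivWithinAt (G Λ) (G' Λ s) (Icc 0 1) s) ∧ CommC m G'

lemma CommC.of_succ {G : (Λ : Finset Γ) → ℝ → Obs D Λ} (h : CommC (m + 1) G) : CommC m G := by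
  induction m generalizing G with
  | zero => exact h.1
  | succ m ih =>
    obtain ⟨h1, G', hd, h2⟩ := h
    exact ⟨h1, G', hd, ih h2⟩

lemma CommC.of_le {G : (Λ : Finset Γ) → ℝ → Obs D Λ} {m' : ℕ} (hm : m' ≤ m) (h : CommC m G) :
    CommC m' G := by
  induction hm with
  | refl => exact h
  | step _ ih => exact ih h.of_succ

lemma SiteBound.commutator {G : (Λ : Finset Γ) → ℝ → Obs D Λ} (hG : CommBound G)
    (h : SiteBound z B) : SiteBound z (fun Λ x θ s => G Λ s * B Λ x θ s - B Λ x θ s * G Λ s) where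
  cont Λ x hx s hs := (continuous_const.mul (h.cont Λ x hx s hs)).sub
    ((h.cont Λ x hx s hs).mul continuous_const)
  bound k := by
    obtain ⟨k', K, hK, hG⟩ := hG k
    obtain ⟨C, p, hC, h⟩ := h.bound k'
    refine ⟨K * C, p, mul_nonneg hK hC, fun Λ x hx θ s hs => ?_⟩
    rw [mul_assoc]
    exact hG Λ x hx s hs _ _ (h Λ x hx θ s hs)
  central hz Λ θ a := commute_sum_commutator Λ (G Λ 0) _ (h.central hz Λ θ) a

/-- Product rule: the derivative is a sum of two commutators, each with one order of smoothness less
to prove. -/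
lemma SiteC.commutator {G : (Λ : Finset Γ) → ℝ → Obs D Λ} (hG : CommC m G) (h : SiteC z m B) :
    SiteC z m (fun Λ x θ s => G Λ s * B Λ x θ s - B Λ x θ s * G Λ s) := by
  induction m generalizing B G with
  | zero => exact SiteBound.commutator hG h
  | succ m ih =>
    have hG0 := hG.of_succ
    have h0 := h.of_succ
    obtain ⟨h1, B', hd, h2⟩ := h
    obtain ⟨hG1, G', hGd, hG2⟩ := hG
    exact ⟨h1.commutator hG1, _, fun Λ x hx θ s hs =>
      hasDerivWithinAt_commutator (hGd Λ s hs) (hd Λ x hx θ s hs), (ih hG2 h0).add (ih hG0 h2)⟩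

/-- Time-dependent operators whose dynamics preserves quasi-locality. -/
def HeisBound (G : (Λ : Finset Γ) → ℝ → Obs D Λ) : Prop :=
  ∀ k, ∃ (k' : ℕ) (K : ℝ) (q : ℕ), 0 ≤ K ∧ ∀ Λ, ∀ x ∈ Λ, ∀ s ∈ Icc (0 : ℝ) 1,
    ∀ (C t : ℝ) (a : Obs D Λ), QuasiLocal k' x C a →
      QuasiLocal k x (K * (1 + |t|) ^ q * C) (heis (G Λ s) t a)

/-- The evolution time is recorded as an additional parameter, to be rescaled and integrated out
afterwards; the growth of the bounds stays polynomial in it. -/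
lemma SiteBound.heis {G : (Λ : Finset Γ) → ℝ → Obs D Λ} (hG : HeisBound G) (h : SiteBound z B) :
    SiteBound z (fun Λ x (p : T × ℝ) s => heis (G Λ s) p.2 (B Λ x p.1 s)) where
  cont Λ x hx s hs := continuous_heis_comp (G Λ s) (h.cont Λ x hx s hs)
  bound k := by
    obtain ⟨k', K, q, hK, hG⟩ := hG k
    obtain ⟨C, p, hC, h⟩ := h.bound k'
    refine ⟨K * C, q + p, mul_nonneg hK hC, fun Λ x hx θ s hs =>
      (hG Λ x hx s hs _ _ _ (h Λ x hx θ.1 s hs)).mono ?_⟩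
    have h1 : (1 + |θ.2|) ^ q ≤ (1 + ‖θ‖) ^ q :=
      pow_le_pow_left₀ (by positivity) (by have := norm_snd_le θ; rw [Real.norm_eq_abs] at this; linarith) q
    have h2 : (1 + ‖θ.1‖) ^ p ≤ (1 + ‖θ‖) ^ p :=
      pow_le_pow_left₀ (by positivity) (by have := norm_fst_le θ; linarith) p
    calc K * (1 + |θ.2|) ^ q * (C * (1 + ‖θ.1‖) ^ p)
        = K * C * ((1 + |θ.2|) ^ q * (1 + ‖θ.1‖) ^ p) := by ring
      _ ≤ K * C * ((1 + ‖θ‖) ^ q * (1 + ‖θ‖) ^ p) :=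
          mul_le_mul_of_nonneg_left (mul_le_mul h1 h2 (by positivity) (by positivity))
            (mul_nonneg hK hC)
      _ = _ := by rw [pow_add]
  central hz Λ θ a := commute_sum_heis Λ (G Λ 0) _ _ (h.central hz Λ θ.1) a

lemma one_add_norm_prod_le (θ : T) (t : ℝ) : 1 + ‖(θ, t)‖ ≤ (1 + ‖θ‖) * (1 + |t|) := by
  have h1 := norm_nonneg θ
  have h2 := abs_nonneg t
  rw [Prod.norm_def, Real.norm_eq_abs]
  rcases max_cases ‖θ‖ |t| with h | h <;> rw [h.1] <;> nlinarith

lemma pow_one_add_norm_prod_le (θ : T) (t : ℝ) (p : ℕ) :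
    (1 + ‖(θ, t)‖) ^ p ≤ (1 + ‖θ‖) ^ p * (1 + |t|) ^ p := by
  rw [← mul_pow]
  exact pow_le_pow_left₀ (by positivity) (one_add_norm_prod_le θ t) p

lemma SiteBound.integrable {w : ℝ → ℝ} (hw : HasMoments w) {B : SiteFamily D (T × ℝ)}
    (h : SiteBound z B) {Λ : Finset Γ} {x : Γ} (hx : x ∈ Λ) (θ : T) {s : ℝ}
    (hs : s ∈ Icc (0 : ℝ) 1) : Integrable fun t => w t • B Λ x (θ, t) s := by
  obtain ⟨C, p, hC, hb⟩ := h.bound 0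
  refine integrable_smul_of_norm_le hw ((h.cont Λ x hx s hs).comp
    (continuous_const.prodMk continuous_id)) (C := C * (1 + ‖θ‖) ^ p) p fun t =>
      ((hb Λ x hx (θ, t) s hs).1).trans ?_
  rw [mul_assoc]
  exact mul_le_mul_of_nonneg_left (pow_one_add_norm_prod_le θ t p) hC

/-- The last parameter is integrated out against `w`. The moments of `w` absorb the polynomial
growth in that parameter, and the growth in the others keeps its exponent. -/
lemma SiteBound.integral {w : ℝ → ℝ} (hw : HasMoments w) {B : SiteFamily D (T × ℝ)}
    (h : SiteBound z B) : SiteBound z (fun Λ x θ s => ∫ t, w t • B Λ x (θ, t) s) where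
  cont Λ x hx s hs := by
    obtain ⟨C, p, hC, hb⟩ := h.bound 0
    refine continuous_iff_continuousAt.2 fun θ₀ => ?_
    refine continuousAt_of_dominated
      (bound := fun t => C * (1 + (‖θ₀‖ + 1)) ^ p * ‖(1 + |t|) ^ p * w t‖) ?_ ?_ ?_ ?_
    · exact Eventually.of_forall fun θ => (h.integrable hw hx θ hs).aestronglyMeasurable
    · have h1 : ∀ᶠ θ in 𝓝 θ₀, ‖θ‖ < ‖θ₀‖ + 1 :=
        (continuous_norm.tendsto θ₀).eventually (gt_mem_nhds (lt_add_one _))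
      filter_upwards [h1] with θ hθ
      refine Eventually.of_forall fun t => ?_
      rw [norm_smul, norm_mul, Real.norm_of_nonneg (show 0 ≤ (1 + |t|) ^ p by positivity)]
      have h2 : ‖B Λ x (θ, t) s‖ ≤ C * ((1 + (‖θ₀‖ + 1)) ^ p * (1 + |t|) ^ p) := by
        refine ((hb Λ x hx (θ, t) s hs).1).trans (mul_le_mul_of_nonneg_left
          ((pow_one_add_norm_prod_le θ t p).trans ?_) hC)
        exact mul_le_mul_of_nonneg_right
          (pow_le_pow_left₀ (by positivity) (by linarith) p) (by positivity)
      calc ‖w t‖ * ‖B Λ x (θ, t) s‖ ≤ ‖w t‖ * (C * ((1 + (‖θ₀‖ + 1)) ^ p * (1 + |t|) ^ p)) :=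
            mul_le_mul_of_nonneg_left h2 (norm_nonneg _)
        _ = _ := by ring
    · exact (hw p).norm.const_mul _
    · exact Eventually.of_forall fun t => (((h.cont Λ x hx s hs).comp
        (continuous_id.prodMk continuous_const)).const_smul (w t)).continuousAt
  bound k := by
    obtain ⟨C, p, hC, hb⟩ := h.bound k
    refine ⟨C * ∫ t, ‖(1 + |t|) ^ p * w t‖, p,
      mul_nonneg hC (integral_nonneg fun t => norm_nonneg _), fun Λ x hx θ s hs => ?_⟩
    have h1 := QuasiLocal.integral (k := k) (x := x) (h.integrable hw hx θ hs)
      ((hw p).norm.const_mul (C * (1 + ‖θ‖) ^ p)) fun t => by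
        refine ((hb Λ x hx (θ, t) s hs).real_smul (w t)).mono ?_
        rw [norm_mul, Real.norm_of_nonneg (show 0 ≤ (1 + |t|) ^ p by positivity), Real.norm_eq_abs]
        calc |w t| * (C * (1 + ‖(θ, t)‖) ^ p)
            ≤ |w t| * (C * ((1 + ‖θ‖) ^ p * (1 + |t|) ^ p)) :=
              mul_le_mul_of_nonneg_left (mul_le_mul_of_nonneg_left
                (pow_one_add_norm_prod_le θ t p) hC) (abs_nonneg _)
          _ = _ := by ring
    refine h1.mono (le_of_eq ?_)
    rw [integral_const_mul]; ring
  central hz Λ θ a := by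
    refine commute_sum_integral Λ (fun x hx => h.integrable hw hx θ ⟨le_rfl, zero_le_one⟩) ?_ a
    intro t a
    have h1 := commute_sum_smul Λ (h.central hz Λ (θ, t)) (w t : ℂ) a
    simpa only [Complex.coe_smul] using h1

lemma SiteC.integral {w : ℝ → ℝ} (hw : HasMoments w) {B : SiteFamily D (T × ℝ)}
    (h : SiteC z m B) : SiteC z m (fun Λ x θ s => ∫ t, w t • B Λ x (θ, t) s) := by
  induction m generalizing B with
  | zero => exact SiteBound.integral hw h
  | succ m ih =>
    obtain ⟨h1, B', hd, h2⟩ := h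
    refine ⟨h1.integral hw, _, fun Λ x hx θ s hs => ?_, ih h2⟩
    obtain ⟨C, p, hC, hb⟩ := h2.siteBound.bound 0
    refine hasDerivWithinAt_integral (b := fun t => C * (1 + ‖θ‖) ^ p * ‖(1 + |t|) ^ p * w t‖) hs
      (fun t r hr => (hd Λ x hx (θ, t) r hr).const_smul (w t)) (fun t r hr => ?_)
      ((hw p).norm.const_mul _) fun r hr => h1.integrable hw hx θ hr
    rw [norm_smul, norm_mul, Real.norm_of_nonneg (show 0 ≤ (1 + |t|) ^ p by positivity)]
    calc ‖w t‖ * ‖B' Λ x (θ, t) r‖ ≤ ‖w t‖ * (C * ((1 + ‖θ‖) ^ p * (1 + |t|) ^ p)) :=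
          mul_le_mul_of_nonneg_left (((hb Λ x hx (θ, t) r hr).1).trans
            (mul_le_mul_of_nonneg_left (pow_one_add_norm_prod_le θ t p) hC)) (norm_nonneg _)
      _ = _ := by ring

end Sites

/-- The indicator function of the unit interval. -/
def unitWeight : ℝ → ℝ := indicator (Ioc 0 1) 1

lemma hasMoments_unitWeight : HasMoments unitWeight := by
  intro p
  have h1 : (fun t : ℝ => (1 + |t|) ^ p * unitWeight t) =
      indicator (Ioc 0 1) fun t : ℝ => (1 + |t|) ^ p := by
    funext t
    by_cases ht : t ∈ Ioc (0 : ℝ) 1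
    · simp [unitWeight, indicator_of_mem ht]
    · simp [unitWeight, indicator_of_notMem ht]
  rw [h1, integrable_indicator_iff measurableSet_Ioc]
  have hc : Continuous fun t : ℝ => (1 + |t|) ^ p := by fun_prop
  exact (hc.integrableOn_Icc (a := 0) (b := 1)).mono_set Ioc_subset_Icc_self

/-- Integrals over `[0, 1]`, as they occur in Duhamel's formula, become a special case of weighted
integrals. -/
lemma intervalIntegral_eq_integral_unitWeight {E : Type*} [NormedAddCommGroup E] [NormedSpace ℝ E]
    (f : ℝ → E) : ∫ t in (0 : ℝ)..1, f t = ∫ t, unitWeight t • f t := by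
  rw [intervalIntegral.integral_of_le zero_le_one, ← integral_indicator measurableSet_Ioc]
  refine integral_congr_ae (Eventually.of_forall fun t => ?_)
  by_cases ht : t ∈ Ioc (0 : ℝ) 1
  · simp [unitWeight, indicator_of_mem ht]
  · simp [unitWeight, indicator_of_notMem ht]

section Sites

variable {D : Γ → ℕ} [MetricSpace Γ]
variable {T T' : Type} [NormedAddCommGroup T] [NormedAddCommGroup T']
variable {z : Prop} {m : ℕ}

lemma SiteC.intervalIntegral {B : SiteFamily D (T × ℝ)}
    (h : SiteC z m B) : SiteC z m (fun Λ x θ s => ∫ t in (0 : ℝ)..1, B Λ x (θ, t) s) :=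
  (h.integral hasMoments_unitWeight).congr fun _ _ _ _ _ _ =>
    intervalIntegral_eq_integral_unitWeight _

/-- The times `(1 - α) t` and `α t` of Duhamel's formula are quadratic in the parameters, hence the
exponent 2 in this substitution and in the next one. -/
lemma one_add_norm_path_le (p : (T × ℝ) × ℝ) : 1 + ‖(p.1.1, (1 - p.2) * p.1.2)‖ ≤ (1 + ‖p‖) ^ 2 := by
  obtain ⟨⟨θ, t⟩, α⟩ := p
  have h1 : ‖θ‖ ≤ ‖((θ, t), α)‖ := (norm_fst_le (θ, t)).trans (norm_fst_le ((θ, t), α))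
  have h2 : |t| ≤ ‖((θ, t), α)‖ := (norm_snd_le (θ, t)).trans (norm_fst_le ((θ, t), α))
  have h3 : |α| ≤ ‖((θ, t), α)‖ := norm_snd_le ((θ, t), α)
  set N := ‖((θ, t), α)‖
  have h4 : |(1 - α) * t| ≤ (1 + N) * N := by
    rw [abs_mul]
    refine mul_le_mul ?_ h2 (abs_nonneg _) (by positivity)
    exact (abs_sub _ _).trans (by rw [abs_one]; linarith)
  have h0 : 0 ≤ N := norm_nonneg _
  rw [Prod.norm_def, Real.norm_eq_abs]
  rcases max_cases ‖θ‖ |(1 - α) * t| with h | h <;> simp only [h.1] <;> nlinarith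

lemma one_add_norm_path_le' (p : (T × ℝ) × ℝ) : 1 + ‖(p, p.2 * p.1.2)‖ ≤ (1 + ‖p‖) ^ 2 := by
  have h2 : |p.1.2| ≤ ‖p‖ := (norm_snd_le p.1).trans (norm_fst_le p)
  have h3 : |p.2| ≤ ‖p‖ := norm_snd_le p
  have h4 : |p.2 * p.1.2| ≤ ‖p‖ * ‖p‖ := by
    rw [abs_mul]
    exact mul_le_mul h3 h2 (abs_nonneg _) (norm_nonneg _)
  have h0 : 0 ≤ ‖p‖ := norm_nonneg _
  rw [Prod.norm_def, Real.norm_eq_abs]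
  rcases max_cases ‖p‖ |p.2 * p.1.2| with h | h <;> simp only [h.1] <;> nlinarith

/-- The Heisenberg evolution preserves smooth families of site observables. -/
theorem SiteC.heis {G G' : (Λ : Finset Γ) → ℝ → Obs D Λ} {N : ℕ} (hG : HeisBound G)
    (hd : ∀ Λ, ∀ s ∈ Icc (0 : ℝ) 1, HasDerivWithinAt (G Λ) (G' Λ s) (Icc 0 1) s)
    (hG' : CommC N G') (hm : m ≤ N + 1) {B : SiteFamily D T} (h : SiteC z m B) :
    SiteC z m (fun Λ x (p : T × ℝ) s => heis (G Λ s) p.2 (B Λ x p.1 s)) := by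
  induction m generalizing T with
  | zero => exact SiteBound.heis hG h
  | succ m ih =>
    have hm' : m ≤ N + 1 := by omega
    have h0 := h.of_succ
    obtain ⟨h1, B', hB, h2⟩ := h
    refine ⟨h1.heis hG, fun Λ x p s => SpinLattice.heis (G Λ s) p.2 (B' Λ x p.1 s) +
      ∫ α in (0 : ℝ)..1, (p.2 * Complex.I) • SpinLattice.heis (G Λ s) (α * p.2)
        (G' Λ s * SpinLattice.heis (G Λ s) ((1 - α) * p.2) (B Λ x p.1 s) -
          SpinLattice.heis (G Λ s) ((1 - α) * p.2) (B Λ x p.1 s) * G' Λ s),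
      fun Λ x hx p s hs => hasDerivWithinAt_heis p.2 (hd Λ s hs) (hB Λ x hx p.1 s hs),
      (ih hm' h2).add ?_⟩
    -- The Duhamel term is assembled from the inside: evolution for `(1 - α) t`, commutator with the
    -- derivative of `G`, evolution for `α t`, the factor `i t`, and integration over `α`. All of
    -- these are available at order `m` by induction, since the commutator needs `m` derivatives of
    -- `G'` only.
    have c1 := (ih hm' h0).comp (T' := (T × ℝ) × ℝ)
      (g := fun p => (p.1.1, (1 - p.2) * p.1.2)) (by fun_prop) (q := 2) one_add_norm_path_le
    have c2 := ih hm' (c1.commutator (hG'.of_le (by omega)))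
    have c3 := c2.comp (T' := (T × ℝ) × ℝ) (g := fun p => (p, p.2 * p.1.2)) (by fun_prop)
      (q := 2) one_add_norm_path_le'
    have c4 := c3.scalar (f := fun p => (p.1.2 * Complex.I : ℂ)) (by fun_prop) (K := 1) (q := 1)
      zero_le_one fun p => by
        have h2 : |p.1.2| ≤ ‖p‖ := (norm_snd_le p.1).trans (norm_fst_le p)
        rw [norm_mul, Complex.norm_I, Complex.norm_real, Real.norm_eq_abs]
        linarith
    exact c4.intervalIntegral

/-- The quasi-adiabatic map preserves smooth families of site observables. -/
theorem SiteC.quasiAdiabatic {w : ℝ → ℝ} (hw : HasMoments w)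
    {G G' : (Λ : Finset Γ) → ℝ → Obs D Λ} {N : ℕ} (hG : HeisBound G)
    (hd : ∀ Λ, ∀ s ∈ Icc (0 : ℝ) 1, HasDerivWithinAt (G Λ) (G' Λ s) (Icc 0 1) s)
    (hG' : CommC N G') (hm : m ≤ N + 1) {B : SiteFamily D T} (h : SiteC z m B) :
    SiteC z m (fun Λ x θ s => quasiAdiabatic w (G Λ s) (B Λ x θ s)) := by
  -- The parameters are `((θ, t), α)`: `α` is integrated over the unit interval to form
  -- `heisIntegral`, and `t` is then integrated against `w`.
  have c1 := (h.heis hG hd hG' hm).comp (T' := (T × ℝ) × ℝ)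
    (g := fun p => (p.1.1, (p.2) * p.1.2)) (by fun_prop) (q := 2) fun p => by
      have h3 := one_add_norm_path_le' p
      refine le_trans (add_le_add_right ?_ 1) h3
      rw [Prod.norm_def, Prod.norm_def (x := (p, p.2 * p.1.2))]
      exact max_le_max ((norm_fst_le p.1).trans (norm_fst_le p)) le_rfl
  have c2 := c1.scalar (f := fun p => (p.1.2 : ℂ)) (by fun_prop) (K := 1) (q := 1)
    zero_le_one fun p => by
      have h2 : |p.1.2| ≤ ‖p‖ := (norm_snd_le p.1).trans (norm_fst_le p)
      rw [Complex.norm_real, Real.norm_eq_abs]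
      linarith
  refine (c2.intervalIntegral.integral hw).congr fun Λ x _ θ s _ => ?_
  rfl

end Sites

/-! ### Local Hamiltonians as smooth sums of site observables. -/

section Loc

variable {D : Γ → ℕ} [MetricSpace Γ]

variable (D) in
/-- Time-dependent observables in every finite volume. -/
abbrev ObsFamily : Type _ := (Λ : Finset Γ) → ℝ → Obs D Λ

/-- `G` is a sum of site observables of class `C^m` in time, and under the condition `z` it is
central at time zero together with its derivatives. -/
def LocC (z : Prop) (m : ℕ) (G : ObsFamily D) : Prop :=
  ∃ B : SiteFamily D Unit, SiteC z m B ∧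
    ∀ Λ, ∀ s ∈ Icc (0 : ℝ) 1, G Λ s = ∑ x ∈ Λ, B Λ x () s

/-- `G` is self-adjoint at all times in `[0, 1]`. -/
def SelfAdj (G : ObsFamily D) : Prop := ∀ Λ, ∀ s ∈ Icc (0 : ℝ) 1, IsSelfAdjoint (G Λ s)

variable {z z' : Prop} {m : ℕ} {G G₁ G₂ : ObsFamily D}

lemma LocC.of_le {m' : ℕ} (hm : m' ≤ m) (h : LocC z m G) : LocC z m' G := by
  obtain ⟨B, hB, h⟩ := h
  exact ⟨B, hB.of_le hm, h⟩

lemma LocC.congr (h : LocC z m G₁) (he : ∀ Λ, ∀ s ∈ Icc (0 : ℝ) 1, G₂ Λ s = G₁ Λ s) :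
    LocC z m G₂ := by
  obtain ⟨B, hB, h⟩ := h
  exact ⟨B, hB, fun Λ s hs => (he Λ s hs).trans (h Λ s hs)⟩

lemma LocC.add (h₁ : LocC z m G₁) (h₂ : LocC z m G₂) : LocC z m (G₁ + G₂) := by
  obtain ⟨B₁, hB₁, h₁⟩ := h₁
  obtain ⟨B₂, hB₂, h₂⟩ := h₂
  refine ⟨_, hB₁.add hB₂, fun Λ s hs => ?_⟩
  rw [Finset.sum_add_distrib, ← h₁ Λ s hs, ← h₂ Λ s hs]
  rfl

lemma LocC.const_smul (h : LocC z m G) (c : ℂ) : LocC z m (c • G) := by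
  obtain ⟨B, hB, h⟩ := h
  refine ⟨_, hB.const_smul c, fun Λ s hs => ?_⟩
  rw [← Finset.smul_sum, ← h Λ s hs]
  rfl

lemma LocC.neg (h : LocC z m G) : LocC z m (-G) := by
  have := h.const_smul (-1)
  rwa [show (-1 : ℂ) • G = -G from neg_one_smul ℂ G] at this

lemma LocC.sub (h₁ : LocC z m G₁) (h₂ : LocC z m G₂) : LocC z m (G₁ - G₂) := by
  rw [sub_eq_add_neg]
  exact h₁.add h₂.neg

lemma SiteBound.zero : SiteBound z (fun _ _ _ _ => 0 : SiteFamily D Unit) where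
  cont _ _ _ _ _ := continuous_const
  bound k := ⟨0, 0, le_rfl, fun Λ x _ θ s _ => by rw [zero_mul]; exact QuasiLocal.zero k x⟩
  central _ Λ _ a := by rw [Finset.sum_const_zero]; exact Commute.zero_left a

lemma SiteC.zero : SiteC z m (fun _ _ _ _ => 0 : SiteFamily D Unit) := by
  induction m with
  | zero => exact SiteBound.zero
  | succ m ih =>
    exact ⟨SiteBound.zero, _, fun Λ x _ _ s _ => hasDerivWithinAt_const s _ (0 : Obs D Λ), ih⟩

lemma LocC.zero : LocC z m (0 : ObsFamily D) :=
  ⟨_, SiteC.zero, fun Λ s _ => by rw [Finset.sum_const_zero]; rfl⟩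

lemma LocC.sum {ι : Type*} (u : Finset ι) {G : ι → ObsFamily D} (h : ∀ i ∈ u, LocC z m (G i)) :
    LocC z m (∑ i ∈ u, G i) := by
  classical
  induction u using Finset.induction_on with
  | empty => exact LocC.zero
  | insert i u hi ih =>
    rw [Finset.sum_insert hi]
    exact (h i (Finset.mem_insert_self i u)).add
      (ih fun j hj => h j (Finset.mem_insert_of_mem hj))

lemma LocC.central (h : LocC True m G) (Λ : Finset Γ) (a : Obs D Λ) : Commute (G Λ 0) a := by
  obtain ⟨B, hB, h⟩ := h
  rw [h Λ 0 ⟨le_rfl, zero_le_one⟩]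
  exact hB.siteBound.central trivial Λ () a

/-- The time derivative of a family of observables. -/
def ObsFamily.deriv (G : ObsFamily D) : ObsFamily D :=
  fun Λ s => derivWithin (G Λ) (Icc 0 1) s

lemma LocC.exists_hasDerivWithinAt (h : LocC z (m + 1) G) : ∃ G' : ObsFamily D,
    (∀ Λ, ∀ s ∈ Icc (0 : ℝ) 1, HasDerivWithinAt (G Λ) (G' Λ s) (Icc 0 1) s) ∧ LocC z m G' := by
  obtain ⟨B, ⟨-, B', hd, hB'⟩, h⟩ := h
  refine ⟨fun Λ s => ∑ x ∈ Λ, B' Λ x () s, fun Λ s hs => ?_, B', hB', fun _ _ _ => rfl⟩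
  exact (HasDerivWithinAt.fun_sum fun x hx => hd Λ x hx () s hs).congr (fun r hr => h Λ r hr)
    (h Λ s hs)

lemma LocC.hasDerivWithinAt (h : LocC z (m + 1) G) (Λ : Finset Γ) {s : ℝ}
    (hs : s ∈ Icc (0 : ℝ) 1) : HasDerivWithinAt (G Λ) (G.deriv Λ s) (Icc 0 1) s := by
  obtain ⟨G', hd, -⟩ := h.exists_hasDerivWithinAt
  exact (hd Λ s hs).differentiableWithinAt.hasDerivWithinAt

lemma LocC.deriv (h : LocC z (m + 1) G) : LocC z m G.deriv := by
  obtain ⟨G', hd, h'⟩ := h.exists_hasDerivWithinAt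
  exact h'.congr fun Λ s hs => (hd Λ s hs).derivWithin (uniqueDiffOn_Icc zero_lt_one s hs)

lemma SelfAdj.deriv (hG : SelfAdj G) (h : LocC z (m + 1) G) : SelfAdj G.deriv :=
  fun Λ _ hs => hasDerivWithinAt_isSelfAdjoint hs (hG Λ) (h.hasDerivWithinAt Λ hs)

variable [∀ x, NeZero (D x)] {d : ℕ} {κ : ℝ}

/-- The commutator with a sum of quasi-local site observables preserves quasi-locality. -/
lemma Growth.exists_commutator_bound (hg : Growth Γ d κ) {ι : Type*}
    (B : (Λ : Finset Γ) → Γ → ι → Obs D Λ)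
    (hB : ∀ k, ∃ C, ∀ (Λ : Finset Γ), ∀ x ∈ Λ, ∀ i, QuasiLocal k x C (B Λ x i))
    (hsa : ∀ Λ i, IsSelfAdjoint (∑ x ∈ Λ, B Λ x i)) (k : ℕ) :
    ∃ (k' : ℕ) (K : ℝ), 0 ≤ K ∧ ∀ (Λ : Finset Γ) (x : Γ) (i : ι) (C : ℝ) (a : Obs D Λ),
      QuasiLocal k' x C a →
        QuasiLocal k x (K * C) ((∑ y ∈ Λ, B Λ y i) * a - a * ∑ y ∈ Λ, B Λ y i) := by
  obtain ⟨F, M, Ψ, hF, hM, hΨ⟩ := hg.exists_potential B hB hsa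
  obtain ⟨K, hK, h⟩ := hg.exists_quasiLocal_commutator (D := D) hF hM k
  refine ⟨d + k + 2, K, hK, fun Λ x i C a ha => ?_⟩
  rw [← (hΨ i).2.2 Λ]
  exact h (Ψ i) (hΨ i).2.1 Λ x C a ha

/-- The dynamics generated by a sum of quasi-local site observables preserves quasi-locality. -/
lemma Growth.exists_heis_bound (hg : Growth Γ d κ) {ι : Type*}
    (B : (Λ : Finset Γ) → Γ → ι → Obs D Λ)
    (hB : ∀ k, ∃ C, ∀ (Λ : Finset Γ), ∀ x ∈ Λ, ∀ i, QuasiLocal k x C (B Λ x i))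
    (hsa : ∀ Λ i, IsSelfAdjoint (∑ x ∈ Λ, B Λ x i)) (k : ℕ) :
    ∃ (k' : ℕ) (K : ℝ) (q : ℕ), 0 ≤ K ∧
      ∀ (Λ : Finset Γ) (x : Γ) (i : ι) (C t : ℝ) (a : Obs D Λ), QuasiLocal k' x C a →
        QuasiLocal k x (K * (1 + |t|) ^ q * C) (heis (∑ y ∈ Λ, B Λ y i) t a) := by
  obtain ⟨F, M, Ψ, hF, hM, hΨ⟩ := hg.exists_potential B hB hsa
  obtain ⟨K, hK, h⟩ := hg.exists_quasiLocal_heis (D := D) hF hM k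
  refine ⟨d + k + 2, K, d + k + 1, hK, fun Λ x i C t a ha => ?_⟩
  rw [← (hΨ i).2.2 Λ]
  exact h (Ψ i) (hΨ i).1 (hΨ i).2.1 Λ x C t a ha

lemma SiteBound.exists_bound {B : SiteFamily D Unit} (h : SiteBound z B) (k : ℕ) :
    ∃ C, 0 ≤ C ∧ ∀ (Λ : Finset Γ), ∀ x ∈ Λ, ∀ s ∈ Icc (0 : ℝ) 1, QuasiLocal k x C (B Λ x () s) := by
  obtain ⟨C, p, hC, h⟩ := h.bound k
  refine ⟨C, hC, fun Λ x hx s hs => (h Λ x hx () s hs).mono (le_of_eq ?_)⟩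
  rw [show ‖(() : Unit)‖ = 0 from rfl, add_zero, one_pow, mul_one]

/-- Time is used as the index of the family of potentials, so that a single decay function, and
hence a single constant, serves all times in `[0, 1]`. -/
lemma LocC.commBound (hg : Growth Γ d κ) (hG : SelfAdj G) (h : LocC z m G) : CommBound G := by
  intro k
  obtain ⟨B, hB, h⟩ := h
  obtain ⟨k', K, hK, hb⟩ := hg.exists_commutator_bound (ι := Icc (0 : ℝ) 1)
    (fun Λ x i => B Λ x () i) (fun k => by
      obtain ⟨C, -, hC⟩ := hB.siteBound.exists_bound k
      exact ⟨C, fun Λ x hx i => hC Λ x hx i i.2⟩)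
    (fun Λ i => by rw [← h Λ i i.2]; exact hG Λ i i.2) k
  refine ⟨k', K, hK, fun Λ x _ s hs C a ha => ?_⟩
  rw [h Λ s hs]
  exact hb Λ x ⟨s, hs⟩ C a ha

lemma LocC.heisBound (hg : Growth Γ d κ) (hG : SelfAdj G) (h : LocC z m G) : HeisBound G := by
  intro k
  obtain ⟨B, hB, h⟩ := h
  obtain ⟨k', K, q, hK, hb⟩ := hg.exists_heis_bound (ι := Icc (0 : ℝ) 1)
    (fun Λ x i => B Λ x () i) (fun k => by
      obtain ⟨C, -, hC⟩ := hB.siteBound.exists_bound k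
      exact ⟨C, fun Λ x hx i => hC Λ x hx i i.2⟩)
    (fun Λ i => by rw [← h Λ i i.2]; exact hG Λ i i.2) k
  refine ⟨k', K, q, hK, fun Λ x _ s hs C t a ha => ?_⟩
  rw [h Λ s hs]
  exact hb Λ x ⟨s, hs⟩ C t a ha

lemma LocC.commC (hg : Growth Γ d κ) (hG : SelfAdj G) (h : LocC z m G) : CommC m G := by
  induction m generalizing G with
  | zero => exact h.commBound hg hG
  | succ m ih =>
    exact ⟨h.commBound hg hG, _, fun Λ s hs => h.hasDerivWithinAt Λ hs,
      ih (hG.deriv h) h.deriv⟩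

/-- Centrality at time zero is inherited from `G₂` alone, whatever the flag `z'` of `G₁`: the
commutator with a central element vanishes. This matters because the Hamiltonian itself is not
central at time zero. -/
lemma LocC.commutator (hg : Growth Γ d κ) (hG₁ : SelfAdj G₁) (h₁ : LocC z' m G₁)
    (h₂ : LocC z m G₂) : LocC z m (G₁ * G₂ - G₂ * G₁) := by
  have hc := h₁.commC hg hG₁
  obtain ⟨B, hB, h₂⟩ := h₂
  refine ⟨_, hB.commutator hc, fun Λ s hs => ?_⟩
  rw [sum_commutator, ← h₂ Λ s hs]
  rfl

/-- The quasi-adiabatic map, applied at every time. -/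
def ObsFamily.quasiAdiabatic (w : ℝ → ℝ) (H G : ObsFamily D) : ObsFamily D :=
  fun Λ s => SpinLattice.quasiAdiabatic w (H Λ s) (G Λ s)

lemma LocC.quasiAdiabatic (hg : Growth Γ d κ) {w : ℝ → ℝ} (hw : HasMoments w) {H : ObsFamily D}
    {N : ℕ} (hH : SelfAdj H) (hHl : LocC z' (N + 1) H) (hm : m ≤ N + 1) (h : LocC z m G) :
    LocC z m (H.quasiAdiabatic w G) := by
  obtain ⟨B, hB, h⟩ := h
  refine ⟨_, hB.quasiAdiabatic hw (hHl.heisBound hg hH) (fun Λ s hs => hHl.hasDerivWithinAt Λ hs)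
    (hHl.deriv.commC hg (hH.deriv hHl)) hm, fun Λ s hs => ?_⟩
  rw [← quasiAdiabatic_sum hw (hH Λ s hs), ← h Λ s hs]
  rfl

end Loc

/-! ### Site observables of a given potential. -/

section PotentialSites

variable {D : Γ → ℕ} [MetricSpace Γ]

/-- The part of the Hamiltonian attributed to the site `x`: every term of the potential is shared
equally among the points of its support. -/
def Potential.site (Ψ : Potential D) (Λ : Finset Γ) (x : Γ) : Obs D Λ :=
  ∑ Z ∈ Λ.powerset with x ∈ Z, ((Z.card : ℂ)⁻¹) • Ψ.term Λ Z

/-- A nonempty `Z` is counted once for each of its points, with weight `1 / |Z|`. The empty set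
belongs to no site and is lost; it accounts for the difference between `ham` and `reducedHam`. -/
lemma sum_sum_div_card {V : Type*} [AddCommGroup V] [Module ℂ V] (Λ : Finset Γ)
    (f : Finset Γ → V) :
    ∑ x ∈ Λ, ∑ Z ∈ Λ.powerset with x ∈ Z, ((Z.card : ℂ)⁻¹) • f Z =
      ∑ Z ∈ Λ.powerset, f Z - f ∅ := by
  have h1 : ∀ Z ∈ Λ.powerset, ∑ x ∈ Λ, (if x ∈ Z then ((Z.card : ℂ)⁻¹) • f Z else 0) =
      f Z - if Z = ∅ then f ∅ else 0 := by
    intro Z hZ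
    rw [← Finset.sum_filter, Finset.sum_const, Finset.filter_mem_eq_inter,
      Finset.inter_eq_right.2 (Finset.mem_powerset.1 hZ), ← Nat.cast_smul_eq_nsmul ℂ, smul_smul]
    rcases Z.eq_empty_or_nonempty with rfl | hne
    · simp
    · rw [mul_inv_cancel₀ (by simpa using hne.ne_empty), one_smul, if_neg hne.ne_empty, sub_zero]
  simp only [Finset.sum_filter]
  rw [Finset.sum_comm, Finset.sum_congr rfl h1, Finset.sum_sub_distrib,
    Finset.sum_ite_eq' Λ.powerset ∅, if_pos (Finset.empty_mem_powerset Λ)]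

lemma Potential.sum_site (Ψ : Potential D) (Λ : Finset Γ) :
    ∑ x ∈ Λ, Ψ.site Λ x = Ψ.ham Λ - Ψ.term Λ ∅ := by
  rw [Ψ.ham_eq_sum_term]
  exact sum_sum_div_card Λ _

variable [∀ x, NeZero (D x)]

lemma Potential.commute_term_empty (Ψ : Potential D) (Λ : Finset Γ) (a : Obs D Λ) :
    Commute (Ψ.term Λ ∅) a :=
  mem_loc_empty_commute a (Ψ.term_mem subset_rfl (Finset.empty_subset Λ))

lemma norm_inv_natCast_le (n : ℕ) : ‖((n : ℂ)⁻¹)‖ ≤ 1 := by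
  rw [norm_inv, Complex.norm_natCast]
  exact Nat.cast_inv_le_one n

lemma norm_inv_card_smul_le {V : Type*} [NormedAddCommGroup V] [NormedSpace ℂ V] (n : ℕ) (a : V) :
    ‖((n : ℂ)⁻¹) • a‖ ≤ ‖a‖ := by
  rw [norm_smul]
  exact (mul_le_mul_of_nonneg_right (norm_inv_natCast_le n) (norm_nonneg a)).trans (one_mul _).le

/-- The site observables of a potential with rapidly decaying interactions are quasi-local. -/
lemma Growth.exists_quasiLocal_site {d : ℕ} {κ : ℝ} (hg : Growth Γ d κ) {F : ℝ → ℝ}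
    (hF : IsDecayFunction Γ F) {M : ℝ} (hM : 0 ≤ M) (k : ℕ) : ∃ C : ℝ, 0 ≤ C ∧
      ∀ Ψ : Potential D, Ψ.Bound F M → ∀ (Λ : Finset Γ), ∀ x ∈ Λ,
        QuasiLocal k x C (Ψ.site Λ x) := by
  obtain ⟨c, hc0, hc⟩ := hg.exists_tail hF k
  have hF0 := (hF.pos 0 le_rfl).le
  refine ⟨M * F 0 + 2 * (M * c), by positivity, fun Ψ hΨ Λ x hx => ⟨?_, fun r => ?_⟩⟩
  · have h1 : ‖Ψ.site Λ x‖ ≤ M * F 0 := by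
      refine (norm_sum_le _ _).trans ?_
      have h2 := hΨ Λ x x
      rw [dist_self] at h2
      simp only [and_self] at h2
      refine (Finset.sum_le_sum fun Z hZ => ?_).trans h2
      refine (norm_inv_card_smul_le _ _).trans (le_of_eq (Ψ.norm_term ?_))
      exact Finset.mem_powerset.1 (Finset.mem_filter.1 hZ).1
    have : 0 ≤ 2 * (M * c) := by positivity
    linarith
  · set X := ball Λ x r with hX
    -- The approximant in the ball consists of the terms contained in it. The others join `x` to a
    -- point at distance more than `r`, and the tail estimate applies.
    set b : Obs D Λ := ∑ Z ∈ (Λ.powerset.filter fun Z => x ∈ Z) with Z ⊆ X,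
      ((Z.card : ℂ)⁻¹) • Ψ.term Λ Z with hb
    have hbm : b ∈ loc D (ball_subset Λ x r) :=
      sum_mem fun Z hZ => (loc D (ball_subset Λ x r)).smul_mem
        (Ψ.term_mem (Finset.mem_filter.1 hZ).2 _) _
    have h1 : Ψ.site Λ x - b = ∑ Z ∈ (Λ.powerset.filter fun Z => x ∈ Z) with ¬ Z ⊆ X,
        ((Z.card : ℂ)⁻¹) • Ψ.term Λ Z := by
      rw [sub_eq_iff_eq_add, add_comm, hb, Finset.sum_filter_add_sum_filter_not]
      rfl
    have h2 : ‖Ψ.site Λ x - b‖ ≤ M * ∑ y ∈ Λ \ X, F (dist x y) := by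
      have h3 := sum_norm_crossing_le hΨ (Λ := Λ) (X := {x}) (X' := X)
      rw [Finset.sum_singleton] at h3
      refine le_trans ?_ h3
      rw [h1]
      refine (norm_sum_le _ _).trans ?_
      rw [Finset.sum_filter]
      have h4 : Λ.powerset.filter (fun Z => x ∈ Z) =
          Λ.powerset.filter (fun Z => ¬ Disjoint Z {x}) := by
        ext Z; simp
      rw [h4]
      refine Finset.sum_le_sum fun Z hZ => ?_
      by_cases hZX : Z ⊆ X
      · rw [if_neg (not_not_intro hZX), if_pos hZX]
      · rw [if_pos hZX, if_neg hZX]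
        refine (norm_inv_card_smul_le _ _).trans (le_of_eq (Ψ.norm_term ?_))
        exact Finset.mem_powerset.1 (Finset.mem_filter.1 hZ).1
    have h5 : ∑ y ∈ Λ \ X, F (dist x y) ≤ c * ((1 + (r : ℝ)) ^ k)⁻¹ := by
      refine le_trans (Finset.sum_le_sum_of_subset_of_nonneg (fun y hy => ?_) fun y _ _ =>
        (hF.pos _ dist_nonneg).le) (hc Λ x r r.cast_nonneg)
      rw [Finset.mem_sdiff, hX, mem_ball] at hy
      refine Finset.mem_filter.2 ⟨hy.1, ?_⟩
      by_contra hlt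
      exact hy.2 ⟨hy.1, (not_le.1 hlt).le⟩
    have h6 := norm_sub_condE_le_of_mem (ball_subset Λ x r) (a := Ψ.site Λ x) hbm
    have hr : (0 : ℝ) < (1 + (r : ℝ)) ^ k := by positivity
    have h7 : M * (c * ((1 + (r : ℝ)) ^ k)⁻¹) * (1 + (r : ℝ)) ^ k = M * c := by
      field_simp
    have h8 : M * ∑ y ∈ Λ \ X, F (dist x y) ≤ M * (c * ((1 + (r : ℝ)) ^ k)⁻¹) :=
      mul_le_mul_of_nonneg_left h5 hM
    have h9 : 0 ≤ M * F 0 := mul_nonneg hM hF0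
    calc _ ≤ (2 * (M * (c * ((1 + (r : ℝ)) ^ k)⁻¹))) * (1 + (r : ℝ)) ^ k :=
          mul_le_mul_of_nonneg_right (h6.trans (mul_le_mul_of_nonneg_left (h2.trans h8)
            zero_le_two)) hr.le
      _ = 2 * (M * (c * ((1 + (r : ℝ)) ^ k)⁻¹) * (1 + (r : ℝ)) ^ k) := by ring
      _ ≤ _ := by rw [h7]; linarith

lemma hasDerivWithinAt_embed {Z Λ : Finset Γ} (h : Z ⊆ Λ) {f : ℝ → Obs D Z} {f' : Obs D Z}
    {S : Set ℝ} {s : ℝ} (hf : HasDerivWithinAt f f' S s) :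
    HasDerivWithinAt (fun r => embed h (f r)) (embed h f') S s := by
  let L : Obs D Z →L[ℂ] Obs D Λ := LinearMap.mkContinuous
    { toFun := embed h
      map_add' := fun a b => by simp only [← embedHom_apply, map_add]
      map_smul' := fun c a => by simp only [← embedHom_apply, map_smul, RingHom.id_apply] } 1
    fun a => by rw [one_mul]; exact (norm_embed h a).le
  exact (L.restrictScalars ℝ).hasFDerivAt.comp_hasDerivWithinAt s hf

variable {n : ℕ} {Φ : ℝ → Potential D}

lemma IsLocalC.hasDerivWithinAt_term (hΦ : IsLocalC n Φ) {k : ℕ} (hk : k < n) (Λ Z : Finset Γ)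
    {s : ℝ} (hs : s ∈ Icc (0 : ℝ) 1) :
    HasDerivWithinAt (fun r => (Potential.timeDeriv k Φ r).term Λ Z)
      ((Potential.timeDeriv (k + 1) Φ s).term Λ Z) (Icc 0 1) s := by
  by_cases hZ : Z ⊆ Λ
  · simp only [Potential.term_eq _ hZ]
    refine hasDerivWithinAt_embed hZ ?_
    have h1 := (hΦ.contDiffOn Λ Z hZ).differentiableOn_iteratedDerivWithin (m := k)
      (by exact_mod_cast hk) (uniqueDiffOn_Icc zero_lt_one) s hs
    simp only [Potential.timeDeriv]
    rw [iteratedDerivWithin_succ]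
    exact h1.hasDerivWithinAt
  · simp only [Potential.term, dif_neg hZ]
    exact hasDerivWithinAt_const _ _ _

lemma IsLocalC.hasDerivWithinAt_ham (hΦ : IsLocalC n Φ) {k : ℕ} (hk : k < n) (Λ : Finset Γ)
    {s : ℝ} (hs : s ∈ Icc (0 : ℝ) 1) :
    HasDerivWithinAt (fun r => (Potential.timeDeriv k Φ r).ham Λ)
      ((Potential.timeDeriv (k + 1) Φ s).ham Λ) (Icc 0 1) s := by
  simp only [Potential.ham_eq_sum_term]
  exact HasDerivWithinAt.fun_sum fun Z _ => hΦ.hasDerivWithinAt_term hk Λ Z hs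

lemma timeDeriv_zero : Potential.timeDeriv 0 Φ = Φ := by
  funext s Λ Z
  rw [Potential.timeDeriv, iteratedDerivWithin_zero]

lemma IsLocalC.iteratedDerivWithin_ham (hΦ : IsLocalC n Φ) {k : ℕ} (hk : k ≤ n) (Λ : Finset Γ)
    {s : ℝ} (hs : s ∈ Icc (0 : ℝ) 1) :
    iteratedDerivWithin k (fun r => (Φ r).ham Λ) (Icc 0 1) s =
      (Potential.timeDeriv k Φ s).ham Λ := by
  induction k generalizing s with
  | zero => rw [iteratedDerivWithin_zero, timeDeriv_zero]
  | succ k ih =>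
    rw [iteratedDerivWithin_succ, derivWithin_congr (fun r hr => ih (by omega) hr)
      (ih (by omega) hs)]
    exact (hΦ.hasDerivWithinAt_ham hk Λ hs).derivWithin (uniqueDiffOn_Icc zero_lt_one s hs)

/-- The site observables of the time derivatives of a local Hamiltonian. -/
def Potential.siteFamily (Φ : ℝ → Potential D) (k : ℕ) : SiteFamily D Unit :=
  fun Λ x _ s => (Potential.timeDeriv k Φ s).site Λ x

/-- When the derivative of the Hamiltonian vanishes at time zero, the sum over the sites is only
minus the term on the empty set, a scalar. This is why centrality, and not vanishing, is the
property that is propagated. -/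
lemma IsLocalC.siteBound {d : ℕ} {κ : ℝ} (hg : Growth Γ d κ) (hΦ : IsLocalC n Φ) {k : ℕ}
    (hk : k ≤ n) {z : Prop}
    (hz : z → ∀ Λ, (Potential.timeDeriv k Φ 0).ham Λ = 0) :
    SiteBound z (Potential.siteFamily Φ k) where
  cont _ _ _ _ _ := continuous_const
  bound j := by
    obtain ⟨F, hF, hb⟩ := hΦ.bounded
    obtain ⟨M, hM⟩ := hb k hk
    obtain ⟨C, hC, h⟩ := hg.exists_quasiLocal_site (D := D) hF M.2 j
    refine ⟨C, 0, hC, fun Λ x hx _ s hs => ?_⟩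
    rw [pow_zero, mul_one]
    refine h _ (Potential.bound_of_fNorm_le M.2 ?_ hF.pos) Λ x hx
    refine (hM s hs).trans (le_of_eq ?_)
    exact (ENNReal.ofReal_coe_nnreal (p := M)).symm
  central h Λ _ a := by
    simp only [Potential.siteFamily]
    rw [Potential.sum_site, hz h, zero_sub]
    exact (Potential.commute_term_empty _ Λ a).neg_left

lemma IsLocalC.siteC {d : ℕ} {κ : ℝ} (hg : Growth Γ d κ) (hΦ : IsLocalC n Φ) {m k : ℕ}
    (hk : k + m ≤ n) {z : Prop}
    (hz : z → ∀ j, k ≤ j → j ≤ n → ∀ Λ, (Potential.timeDeriv j Φ 0).ham Λ = 0) :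
    SiteC z m (Potential.siteFamily Φ k) := by
  induction m generalizing k with
  | zero => exact hΦ.siteBound hg hk fun h => hz h k le_rfl hk
  | succ m ih =>
    refine ⟨hΦ.siteBound hg (by omega) fun h => hz h k le_rfl (by omega),
      Potential.siteFamily Φ (k + 1), fun Λ x _ _ s hs => ?_,
      ih (by omega) fun h j hj => hz h j (k.le_succ.trans hj)⟩
    simp only [Potential.siteFamily, Potential.site]
    exact HasDerivWithinAt.fun_sum fun Z _ =>
      (hΦ.hasDerivWithinAt_term (k := k) (by omega) Λ Z hs).fun_const_smul ((Z.card : ℂ)⁻¹)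

/-- The Hamiltonian without the scalar contribution of the empty set. -/
def Potential.reducedHam (Φ : ℝ → Potential D) (k : ℕ) : ObsFamily D :=
  fun Λ s => (Potential.timeDeriv k Φ s).ham Λ - (Potential.timeDeriv k Φ s).term Λ ∅

lemma IsLocalC.locC {d : ℕ} {κ : ℝ} (hg : Growth Γ d κ) (hΦ : IsLocalC n Φ) {m k : ℕ}
    (hk : k + m ≤ n) {z : Prop}
    (hz : z → ∀ j, k ≤ j → j ≤ n → ∀ Λ, (Potential.timeDeriv j Φ 0).ham Λ = 0) :
    LocC z m (Potential.reducedHam Φ k) :=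
  ⟨_, hΦ.siteC hg hk hz, fun Λ _ _ => (Potential.sum_site _ Λ).symm⟩

lemma IsLocalC.hasDerivWithinAt_reducedHam (hΦ : IsLocalC n Φ) {k : ℕ} (hk : k < n)
    (Λ : Finset Γ) {s : ℝ} (hs : s ∈ Icc (0 : ℝ) 1) :
    HasDerivWithinAt (Potential.reducedHam Φ k Λ) (Potential.reducedHam Φ (k + 1) Λ s)
      (Icc 0 1) s :=
  (hΦ.hasDerivWithinAt_ham hk Λ hs).sub (hΦ.hasDerivWithinAt_term hk Λ ∅ hs)

lemma IsLocalC.selfAdj_reducedHam (hΦ : IsLocalC n Φ) : SelfAdj (Potential.reducedHam Φ 0) := by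
  intro Λ s hs
  simp only [Potential.reducedHam, timeDeriv_zero]
  exact IsSelfAdjoint.sub (R := Obs D Λ) ((hΦ.hermitian s hs).ham Λ) ((hΦ.hermitian s hs).term Λ ∅)

end PotentialSites

end

section

open MeasureTheory Set Filter Topology
open scoped Nat

/-! ### Expansion of the conjugation by `exp(iS)` and the dressed evolution equation. -/

section Remainder

variable {𝒜 : Type*} [CStarAlgebra 𝒜]

/-- The commutator with `-i S`. -/
def adjointS (S a : 𝒜) : 𝒜 := (-Complex.I • S) * a - a * (-Complex.I • S)

/-- Integral remainder in the expansion of `exp(-iS) a exp(iS)` in iterated commutators. -/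
def expRemainder (S : 𝒜) (j : ℕ) (a : 𝒜) : 𝒜 :=
  ∫ u in (0 : ℝ)..1, ((1 - u) ^ j / (j ! : ℝ)) • heis S (-u) a

lemma continuous_expRemainder_integrand (S : 𝒜) (j : ℕ) (a : 𝒜) :
    Continuous fun u : ℝ => ((1 - u) ^ j / (j ! : ℝ)) • heis S (-u) a := by
  have h := (continuous_heis S a).comp continuous_neg
  have h1 : Continuous fun u : ℝ => (1 - u) ^ j / (j ! : ℝ) := by fun_prop
  exact h1.smul h

lemma hasDerivAt_heis_neg (S a : 𝒜) (u : ℝ) :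
    HasDerivAt (fun u => heis S (-u) a) (heis S (-u) (adjointS S a)) u := by
  refine ((hasDerivAt_heis S a (-u)).scomp u (hasDerivAt_neg u)).congr_deriv ?_
  rw [neg_one_smul, ← map_neg, adjointS]
  congr 1
  rw [neg_smul, neg_mul, mul_neg, smul_sub, smul_mul_assoc, mul_smul_comm]
  abel

/-- Integration by parts in `u`, that is, one step of Taylor's formula with integral remainder. -/
lemma expRemainder_eq (S : 𝒜) (j : ℕ) (a : 𝒜) :
    expRemainder S j a = ((j + 1)! : ℂ)⁻¹ • a + expRemainder S (j + 1) (adjointS S a) := by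
  have hd : ∀ u : ℝ, HasDerivAt
      (fun u : ℝ => (-((1 - u) ^ (j + 1) / ((j + 1)! : ℝ))) • heis S (-u) a)
      (((1 - u) ^ j / (j ! : ℝ)) • heis S (-u) a -
        ((1 - u) ^ (j + 1) / ((j + 1)! : ℝ)) • heis S (-u) (adjointS S a)) u := by
    intro u
    have h1 : HasDerivAt (fun u : ℝ => -((1 - u) ^ (j + 1) / ((j + 1)! : ℝ)))
        ((1 - u) ^ j / (j ! : ℝ)) u := by
      have h2 := ((((hasDerivAt_id u).const_sub 1).fun_pow (j + 1)).div_const ((j + 1)! : ℝ)).fun_neg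
      refine h2.congr_deriv ?_
      rw [Nat.factorial_succ]
      have : (j ! : ℝ) ≠ 0 := by positivity
      push_cast
      simp only [id]
      field_simp
    refine (h1.smul (hasDerivAt_heis_neg S a u)).congr_deriv ?_
    rw [neg_smul]
    abel
  have h0 := intervalIntegral.integral_eq_sub_of_hasDerivAt (a := 0) (b := 1) (fun u _ => hd u)
    (((continuous_expRemainder_integrand S j a).sub
      (continuous_expRemainder_integrand S (j + 1) (adjointS S a))).intervalIntegrable 0 1)
  rw [intervalIntegral.integral_sub
    ((continuous_expRemainder_integrand S j a).intervalIntegrable 0 1)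
    ((continuous_expRemainder_integrand S (j + 1) (adjointS S a)).intervalIntegrable 0 1)] at h0
  have h3 : ((j + 1)! : ℂ)⁻¹ • a = ((j + 1)! : ℝ)⁻¹ • a := by
    rw [← Complex.coe_smul]; push_cast; rfl
  rw [h3, ← sub_eq_iff_eq_add]
  refine h0.trans ?_
  simp [heis_zero]

lemma expRemainder_zero_eq_sum (S : 𝒜) (N : ℕ) (a : 𝒜) :
    expRemainder S 0 a = ∑ j ∈ Finset.range N, ((j + 1)! : ℂ)⁻¹ • (adjointS S)^[j] a +
      expRemainder S N ((adjointS S)^[N] a) := by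
  induction N with
  | zero => simp
  | succ N ih =>
    rw [ih, Finset.sum_range_succ, expRemainder_eq S N, ← Function.iterate_succ_apply' (adjointS S) N a, add_assoc]

lemma expRemainder_add (S : 𝒜) (j : ℕ) (a b : 𝒜) :
    expRemainder S j (a + b) = expRemainder S j a + expRemainder S j b := by
  rw [expRemainder, expRemainder, expRemainder, ← intervalIntegral.integral_add
    ((continuous_expRemainder_integrand S j a).intervalIntegrable 0 1)
    ((continuous_expRemainder_integrand S j b).intervalIntegrable 0 1)]
  simp only [map_add, smul_add]

lemma expRemainder_smul (S : 𝒜) (j : ℕ) (c : ℂ) (a : 𝒜) :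
    expRemainder S j (c • a) = c • expRemainder S j a := by
  rw [expRemainder, expRemainder, ← intervalIntegral.integral_smul]
  refine intervalIntegral.integral_congr fun u _ => ?_
  simp only [map_smul]
  rw [smul_comm]

lemma heis_expRemainder (S : 𝒜) (j : ℕ) (a : 𝒜) :
    heis S 1 (expRemainder S j a) =
      ∫ u in (0 : ℝ)..1, ((1 - u) ^ j / (j ! : ℝ)) • heis S (1 - u) a := by
  rw [expRemainder, ← (heis S 1).intervalIntegral_comp_comm
    ((continuous_expRemainder_integrand S j a).intervalIntegrable 0 1)]
  refine intervalIntegral.integral_congr fun u _ => ?_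
  rw [sub_eq_add_neg, heis_add]
  exact (heis S 1).map_smul_of_tower _ _

lemma heis_neg_one (S H : 𝒜) : heis S (-1) H = H + expRemainder S 0 (adjointS S H) := by
  have h0 := intervalIntegral.integral_eq_sub_of_hasDerivAt (a := 0) (b := 1)
    (fun u _ => hasDerivAt_heis_neg S H u)
    (((continuous_heis S (adjointS S H)).comp continuous_neg).intervalIntegrable 0 1)
  rw [neg_zero, heis_zero] at h0
  rw [expRemainder]
  simp only [pow_zero, Nat.factorial_zero, Nat.cast_one, div_one, one_smul]
  rw [h0]
  abel

/-- Derivative of the dressed projection. -/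
lemma hasDerivWithinAt_dressed {S P : ℝ → 𝒜} {S' P' : 𝒜} {U : Set ℝ} {s : ℝ}
    (hS : HasDerivWithinAt S S' U s) (hP : HasDerivWithinAt P P' U s) :
    HasDerivWithinAt (fun r => heis (S r) 1 (P r))
      (heis (S s) 1 (P' + Complex.I • (expRemainder (S s) 0 S' * P s -
        P s * expRemainder (S s) 0 S'))) U s := by
  refine (hasDerivWithinAt_heis 1 hS hP).congr_deriv ?_
  rw [map_add]
  congr 1
  set T := S s
  set Ω := expRemainder T 0 S' with hΩ
  have h1 : heis T 1 Ω = ∫ α in (0 : ℝ)..1, heis T α S' := by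
    rw [hΩ, heis_expRemainder]
    simp only [pow_zero, Nat.factorial_zero, Nat.cast_one, div_one, one_smul]
    have h := intervalIntegral.integral_comp_sub_left (fun α => heis T α S') (1 : ℝ)
      (a := 0) (b := 1)
    rwa [sub_self, sub_zero] at h
  let L : 𝒜 →L[ℂ] 𝒜 := Complex.I • ((ContinuousLinearMap.mul ℂ 𝒜).flip (heis T 1 (P s)) -
    ContinuousLinearMap.mul ℂ 𝒜 (heis T 1 (P s)))
  have hL : ∀ x, L x = Complex.I • (x * heis T 1 (P s) - heis T 1 (P s) * x) := fun x => rfl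
  have h2 : heis T 1 (Complex.I • (Ω * P s - P s * Ω)) = L (heis T 1 Ω) := by
    rw [hL, map_smul, map_sub, heis_mul, heis_mul]
  rw [h2, h1, ← L.intervalIntegral_comp_comm ((continuous_heis T S').intervalIntegrable 0 1)]
  refine intervalIntegral.integral_congr fun α _ => ?_
  simp only [hL, mul_one, Complex.ofReal_one, one_mul]
  rw [map_sub, heis_mul, heis_mul, ← heis_add]
  congr 5 <;> ring

/-- The evolution equation of the dressed projection, with an explicit remainder. -/
lemma dressed_equation {H P S S' K Q : 𝒜} (ε : ℂ) (hHP : Commute H P) (hQ : Commute Q P) :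
    (Complex.I * ε) • heis S 1 (Complex.I • (K * P - P * K) +
        Complex.I • (expRemainder S 0 S' * P - P * expRemainder S 0 S')) =
      (H + heis S 1 (expRemainder S 0 (-ε • S' + Complex.I • (S * H - H * S)) - ε • K - Q)) *
          heis S 1 P -
        heis S 1 P * (H + heis S 1
          (expRemainder S 0 (-ε • S' + Complex.I • (S * H - H * S)) - ε • K - Q)) := by
  set Ω := expRemainder S 0 S'
  have h1 : Complex.I • (S * H - H * S) = -(1 : ℂ) • adjointS S H := by
    rw [adjointS, neg_one_smul, neg_smul, neg_mul, mul_neg, smul_mul_assoc, mul_smul_comm, smul_sub]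
    abel
  -- `H` is conjugated backwards and forwards, so that the whole equation takes place inside `heis S
  -- 1`.
  have h2 : H = heis S 1 (H + expRemainder S 0 (adjointS S H)) := by
    rw [← heis_neg_one, ← heis_add, add_neg_cancel, heis_zero]
  -- The part of the integral coming from `i[S, H]` cancels the correction to `H`. Of the rest, `H`
  -- and `Q` commute with `P`, and only `-ε (Ω + K)` drives the projection.
  have h3 : H + heis S 1 (expRemainder S 0 (-ε • S' + Complex.I • (S * H - H * S)) - ε • K - Q) =
      heis S 1 (H - (ε • (Ω + K) + Q)) := by
    nth_rewrite 1 [h2]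
    rw [← map_add, h1, expRemainder_add, expRemainder_smul, expRemainder_smul]
    congr 1
    rw [neg_one_smul, neg_smul, smul_add]
    abel
  rw [h3, ← heis_mul, ← heis_mul, ← map_sub, ← map_smul]
  congr 1
  have h4 : (H - (ε • (Ω + K) + Q)) * P - P * (H - (ε • (Ω + K) + Q)) =
      -(ε • ((Ω + K) * P - P * (Ω + K))) := by
    rw [sub_mul, mul_sub, add_mul, mul_add, hHP.eq, hQ.eq, smul_mul_assoc, mul_smul_comm, smul_sub]
    abel
  rw [h4, ← smul_add, smul_smul]
  have h5 : Complex.I * ε * Complex.I = -ε := by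
    rw [mul_right_comm, Complex.I_mul_I, neg_one_mul]
  rw [h5, neg_smul]
  congr 2
  rw [add_mul, mul_add]
  abel

end Remainder

end

section

open MeasureTheory Set Filter Topology Polynomial
open scoped Nat

/-! ### Orders in `ε` and the recursion for the dressing transformation. -/

section Coefficients

variable {D : Γ → ℕ}

/-- Generating polynomial of the dressing transformation. -/
def dressPoly (A : ℕ → ObsFamily D) (n : ℕ) : (ObsFamily D)[X] :=
  ∑ p ∈ Finset.range (n + 1), monomial p (-Complex.I • A p)

/-- The coefficient of order `k` in `-ε ∂ₛS + i[S, H]`. -/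
def driftCoeff (H : ObsFamily D) (A : ℕ → ObsFamily D) (k : ℕ) : ObsFamily D :=
  -- At `k = 0` truncated subtraction yields `A 0`, which is zero for a dressing, so no spurious
  -- term arises.
  Complex.I • (A k * H - H * A k) - (A (k - 1)).deriv

/-- The iterated commutators of the dressing generator with the drift. -/
def iterPoly (H : ObsFamily D) (A : ℕ → ObsFamily D) (n : ℕ) : ℕ → (ObsFamily D)[X]
  -- The range reaches order `n + 1` because `ε ∂ₛS` contains `ε^(n+1)` times the derivative of `A
  -- n`.
  | 0 => ∑ k ∈ Finset.range (n + 2), monomial k (driftCoeff H A k)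
  | j + 1 => dressPoly A n * iterPoly H A n j - iterPoly H A n j * dressPoly A n

/-- The coefficient of order `k` of the dressed drift. -/
def dressedCoeff (H K : ObsFamily D) (A : ℕ → ObsFamily D) (n k : ℕ) : ObsFamily D :=
  ∑ j ∈ Finset.range (n + 1), ((j + 1)! : ℂ)⁻¹ • (iterPoly H A n j).coeff k -
    if k = 1 then K else 0

/-- The part of the coefficient of order `k` that only depends on the lower orders of the
dressing transformation. -/
def lowerCoeff (H K : ObsFamily D) (A : ℕ → ObsFamily D) (n k : ℕ) : ObsFamily D :=
  dressedCoeff H K A n k - Complex.I • (A k * H - H * A k)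

variable {H K : ObsFamily D} {A A' : ℕ → ObsFamily D} {n : ℕ}

lemma ObsFamily.smul_zero (c : ℂ) : c • (0 : ObsFamily D) = 0 := by
  funext Λ s
  exact _root_.smul_zero (A := Obs D Λ) c

lemma ObsFamily.neg_one_smul (G : ObsFamily D) : (-1 : ℂ) • G = -G := by
  funext Λ s
  exact _root_.neg_one_smul ℂ (G Λ s)

lemma smul_commutator {𝒜 : Type*} [CStarAlgebra 𝒜] (c : ℂ) (a b : 𝒜) :
    (c • a) * b - b * (c • a) = c • (a * b - b * a) := by
  rw [smul_mul_assoc, mul_smul_comm, smul_sub]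

lemma ObsFamily.smul_commutator (c : ℂ) (a b : ObsFamily D) :
    (c • a) * b - b * (c • a) = c • (a * b - b * a) := by
  funext Λ s
  exact SpinLattice.smul_commutator c (a Λ s) (b Λ s)

lemma neg_smul_commutator {𝒜 : Type*} [CStarAlgebra 𝒜] (c : ℂ) (a b : 𝒜) :
    -c • (a * b - b * a) = c • (b * a - a * b) := by
  rw [neg_smul, ← smul_neg, neg_sub]

lemma ObsFamily.neg_smul_commutator (c : ℂ) (a b : ObsFamily D) :
    -c • (a * b - b * a) = c • (b * a - a * b) := by
  funext Λ s
  exact SpinLattice.neg_smul_commutator c (a Λ s) (b Λ s)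

lemma deriv_zero_family : (0 : ObsFamily D).deriv = 0 := by
  funext Λ s
  exact congrFun (derivWithin_const (Icc (0 : ℝ) 1) (0 : Obs D Λ)) s

lemma coeff_dressPoly (hn : ∀ p, n < p → A p = 0) (p : ℕ) :
    (dressPoly A n).coeff p = -Complex.I • A p := by
  rw [dressPoly, finsetSum_coeff]
  simp only [coeff_monomial]
  rw [Finset.sum_ite_eq' (Finset.range (n + 1)) p]
  split_ifs with h
  · rfl
  · rw [hn p (by simpa using h), ObsFamily.smul_zero]

lemma coeff_iterPoly_zero (hn : ∀ p, n < p → A p = 0) (k : ℕ) :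
    (iterPoly H A n 0).coeff k = driftCoeff H A k := by
  rw [iterPoly, finsetSum_coeff]
  simp only [coeff_monomial]
  rw [Finset.sum_ite_eq' (Finset.range (n + 2)) k]
  split_ifs with h
  · rfl
  · have hk : n + 2 ≤ k := by simpa using h
    rw [driftCoeff, hn k (by omega), hn (k - 1) (by omega), zero_mul, mul_zero, sub_zero, ObsFamily.smul_zero,
      deriv_zero_family, sub_zero]

lemma coeff_iterPoly_succ (hn : ∀ p, n < p → A p = 0) (j k : ℕ) :
    (iterPoly H A n (j + 1)).coeff k = ∑ x ∈ Finset.HasAntidiagonal.antidiagonal k,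
      -Complex.I • (A x.1 * (iterPoly H A n j).coeff x.2 - (iterPoly H A n j).coeff x.2 * A x.1) := by
  rw [iterPoly, coeff_sub, coeff_mul, coeff_mul, ← Finset.Nat.sum_antidiagonal_swap
    (f := fun x : ℕ × ℕ => (iterPoly H A n j).coeff x.1 * (dressPoly A n).coeff x.2),
    ← Finset.sum_sub_distrib]
  refine Finset.sum_congr rfl fun x _ => ?_
  simp only [Prod.fst_swap, Prod.snd_swap, coeff_dressPoly hn]
  exact ObsFamily.smul_commutator _ _ _

/-- The drift starts at order one and every commutator with `S` raises the order by at least one.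
Hence orders up to `n` involve only finitely many iterated commutators. -/
lemma coeff_iterPoly_eq_zero (h0 : A 0 = 0) (hn : ∀ p, n < p → A p = 0) {j k : ℕ} (hk : k ≤ j) :
    (iterPoly H A n j).coeff k = 0 := by
  induction j generalizing k with
  | zero =>
    obtain rfl : k = 0 := by omega
    rw [coeff_iterPoly_zero hn, driftCoeff, h0, zero_mul, mul_zero, sub_zero, ObsFamily.smul_zero,
      deriv_zero_family, sub_zero]
  | succ j ih =>
    rw [coeff_iterPoly_succ hn]
    refine Finset.sum_eq_zero fun x hx => ?_
    have hx' : x.1 + x.2 = k := Finset.HasAntidiagonal.mem_antidiagonal.1 hx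
    rcases Nat.eq_zero_or_pos x.1 with h | h
    · rw [h, h0, zero_mul, mul_zero, sub_zero, ObsFamily.smul_zero]
    · rw [ih (by omega), zero_mul, mul_zero, sub_zero, ObsFamily.smul_zero]

lemma dressedCoeff_zero (h0 : A 0 = 0) (hn : ∀ p, n < p → A p = 0) :
    dressedCoeff H K A n 0 = 0 := by
  rw [dressedCoeff, if_neg (by norm_num), sub_zero]
  exact Finset.sum_eq_zero fun j _ => by
    rw [coeff_iterPoly_eq_zero h0 hn (Nat.zero_le j), ObsFamily.smul_zero]

lemma coeff_iterPoly_congr (hn : ∀ p, n < p → A p = 0)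
    (hn' : ∀ p, n < p → A' p = 0) (j : ℕ) {k : ℕ} (h : ∀ p ≤ k, A p = A' p) :
    (iterPoly H A n j).coeff k = (iterPoly H A' n j).coeff k := by
  induction j generalizing k with
  | zero =>
    rw [coeff_iterPoly_zero hn, coeff_iterPoly_zero hn', driftCoeff, driftCoeff,
      h k le_rfl, h (k - 1) (Nat.sub_le _ _)]
  | succ j ih =>
    rw [coeff_iterPoly_succ hn, coeff_iterPoly_succ hn']
    refine Finset.sum_congr rfl fun x hx => ?_
    have hx' : x.1 + x.2 = k := Finset.HasAntidiagonal.mem_antidiagonal.1 hx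
    rw [h x.1 (by omega), ih fun p hp => h p (by omega)]

lemma lowerCoeff_eq (hn : ∀ p, n < p → A p = 0) (k : ℕ) :
    lowerCoeff H K A n k = ∑ j ∈ Finset.range n,
      ((j + 1 + 1)! : ℂ)⁻¹ • (iterPoly H A n (j + 1)).coeff k - (A (k - 1)).deriv -
        if k = 1 then K else 0 := by
  rw [lowerCoeff, dressedCoeff, Finset.sum_range_succ', coeff_iterPoly_zero hn, driftCoeff]
  simp only [zero_add, Nat.factorial_one, Nat.cast_one, inv_one, one_smul]
  abel

/-- The system for the `A k` is triangular. In a commutator of `S` with an iterated drift both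
factors have order at least one, so order `k` splits into strictly smaller orders; the only place
where `A k` enters is `i[A_k, H]`, which has been subtracted. -/
lemma lowerCoeff_congr (h0 : A 0 = 0) (hn : ∀ p, n < p → A p = 0) (h0' : A' 0 = 0)
    (hn' : ∀ p, n < p → A' p = 0) {k : ℕ} (h : ∀ p < k, A p = A' p) :
    lowerCoeff H K A n k = lowerCoeff H K A' n k := by
  rw [lowerCoeff_eq hn, lowerCoeff_eq hn']
  have h1 : (A (k - 1)).deriv = (A' (k - 1)).deriv := by
    rcases Nat.eq_zero_or_pos k with rfl | hk
    · rw [h0, h0']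
    · rw [h (k - 1) (by omega)]
  rw [h1]
  congr 2
  refine Finset.sum_congr rfl fun j _ => ?_
  congr 1
  rw [coeff_iterPoly_succ hn, coeff_iterPoly_succ hn']
  refine Finset.sum_congr rfl fun x hx => ?_
  have hx' : x.1 + x.2 = k := Finset.HasAntidiagonal.mem_antidiagonal.1 hx
  rcases Nat.eq_zero_or_pos x.2 with h2 | h2
  · rw [h2, coeff_iterPoly_eq_zero h0 hn (Nat.zero_le j),
      coeff_iterPoly_eq_zero h0' hn' (Nat.zero_le j)]
    simp only [zero_mul, mul_zero]
  · rw [h x.1 (by omega)]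
    rcases Nat.eq_zero_or_pos x.1 with h3 | h3
    · rw [h3, h0']
      simp only [zero_mul, mul_zero]
    · rw [coeff_iterPoly_congr hn hn' j fun p hp => h p (by omega)]

variable [MetricSpace Γ]

lemma SelfAdj.add {G₁ G₂ : ObsFamily D} (h₁ : SelfAdj G₁) (h₂ : SelfAdj G₂) : SelfAdj (G₁ + G₂) :=
  fun Λ s hs => IsSelfAdjoint.add (R := Obs D Λ) (h₁ Λ s hs) (h₂ Λ s hs)

lemma SelfAdj.sub {G₁ G₂ : ObsFamily D} (h₁ : SelfAdj G₁) (h₂ : SelfAdj G₂) : SelfAdj (G₁ - G₂) :=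
  fun Λ s hs => IsSelfAdjoint.sub (R := Obs D Λ) (h₁ Λ s hs) (h₂ Λ s hs)

lemma SelfAdj.zero : SelfAdj (0 : ObsFamily D) := fun Λ _ _ => IsSelfAdjoint.zero (Obs D Λ)

lemma SelfAdj.sum {ι : Type*} (u : Finset ι) {G : ι → ObsFamily D} (h : ∀ i ∈ u, SelfAdj (G i)) :
    SelfAdj (∑ i ∈ u, G i) := by
  classical
  induction u using Finset.induction_on with
  | empty => exact SelfAdj.zero
  | insert i u hi ih =>
    rw [Finset.sum_insert hi]
    exact (h i (Finset.mem_insert_self i u)).add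
      (ih fun j hj => h j (Finset.mem_insert_of_mem hj))

lemma isSelfAdjoint_smul_of_conj {𝒜 : Type*} [CStarAlgebra 𝒜] {c : ℂ} {a : 𝒜}
    (hc : (starRingEnd ℂ) c = c) (ha : IsSelfAdjoint a) : IsSelfAdjoint (c • a) := by
  rw [isSelfAdjoint_iff, star_smul, ha.star_eq, Complex.star_def, hc]

lemma SelfAdj.smul {G : ObsFamily D} (h : SelfAdj G) {c : ℂ} (hc : (starRingEnd ℂ) c = c) :
    SelfAdj (c • G) := fun Λ s hs => isSelfAdjoint_smul_of_conj hc (h Λ s hs)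

lemma isSelfAdjoint_commutator {𝒜 : Type*} [CStarAlgebra 𝒜] {a b : 𝒜} {c : ℂ}
    (hc : (starRingEnd ℂ) c = -c) (ha : IsSelfAdjoint a) (hb : IsSelfAdjoint b) :
    IsSelfAdjoint (c • (a * b - b * a)) := by
  rw [isSelfAdjoint_iff, star_smul, star_sub, star_mul, star_mul, ha.star_eq, hb.star_eq,
    Complex.star_def, hc, neg_smul, ← smul_neg, neg_sub]

lemma SelfAdj.commutator {G₁ G₂ : ObsFamily D} (h₁ : SelfAdj G₁) (h₂ : SelfAdj G₂) {c : ℂ}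
    (hc : (starRingEnd ℂ) c = -c) : SelfAdj (c • (G₁ * G₂ - G₂ * G₁)) :=
  fun Λ s hs => isSelfAdjoint_commutator hc (h₁ Λ s hs) (h₂ Λ s hs)

lemma SelfAdj.quasiAdiabatic {G : ObsFamily D} {w : ℝ → ℝ} (hH : SelfAdj H) (h : SelfAdj G) :
    SelfAdj (H.quasiAdiabatic w G) :=
  fun Λ s hs => isSelfAdjoint_quasiAdiabatic (hH Λ s hs) (h Λ s hs)

variable [∀ x, NeZero (D x)] {d : ℕ} {κ : ℝ}

/-- The conditions on the orders of the dressing transformation: the order `p` is a local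
self-adjoint observable of class `C^(n+1-p)`. -/
structure IsDressing (A : ℕ → ObsFamily D) (n : ℕ) : Prop where
  zero : A 0 = 0
  eq_zero : ∀ p, n < p → A p = 0
  loc : ∀ p, LocC True (n + 1 - p) (A p)
  selfAdj : ∀ p, SelfAdj (A p)

lemma conj_I_smul : (starRingEnd ℂ) Complex.I = -Complex.I := Complex.conj_I

lemma conj_neg_I : (starRingEnd ℂ) (-Complex.I) = -(-Complex.I) := by
  rw [map_neg, Complex.conj_I]

lemma IsDressing.deriv_pred (hA : IsDressing A n) (k : ℕ) :
    LocC True (n + 1 - k) (A (k - 1)).deriv ∧ SelfAdj (A (k - 1)).deriv := by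
  by_cases h : 1 ≤ k ∧ k ≤ n + 1
  · have h1 := hA.loc (k - 1)
    rw [show n + 1 - (k - 1) = n + 1 - k + 1 by omega] at h1
    exact ⟨h1.deriv, (hA.selfAdj (k - 1)).deriv h1⟩
  · have h2 : A (k - 1) = 0 := by
      rcases Nat.eq_zero_or_pos k with rfl | hk
      · exact hA.zero
      · exact hA.eq_zero _ (by omega)
    rw [h2, deriv_zero_family]
    exact ⟨LocC.zero, SelfAdj.zero⟩

/-- Each order in `ε` costs one time derivative. Products of orders adding up to `k` therefore still
have `n + 1 - k` derivatives. -/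
lemma IsDressing.coeff_iterPoly (hg : Growth Γ d κ) (hA : IsDressing A n) (hH : SelfAdj H)
    (hHl : LocC False (n + 1) H) (j k : ℕ) :
    LocC True (n + 1 - k) ((iterPoly H A n j).coeff k) ∧ SelfAdj ((iterPoly H A n j).coeff k) := by
  induction j generalizing k with
  | zero =>
    rw [coeff_iterPoly_zero hA.eq_zero, driftCoeff]
    obtain ⟨h1, h2⟩ := hA.deriv_pred k
    refine ⟨LocC.sub ?_ h1, ((hA.selfAdj k).commutator hH conj_I_smul).sub h2⟩
    -- The commutator is reversed so that `A k`, which is central at time zero, stands in the second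
    -- place.
    have h3 := (LocC.commutator hg hH (hHl.of_le (by omega)) (hA.loc k)).const_smul (-Complex.I)
    rwa [ObsFamily.neg_smul_commutator] at h3
  | succ j ih =>
    rw [coeff_iterPoly_succ hA.eq_zero]
    constructor
    · refine LocC.sum _ fun x hx => LocC.const_smul ?_ _
      have hx' : x.1 + x.2 = k := Finset.HasAntidiagonal.mem_antidiagonal.1 hx
      exact LocC.commutator hg (hA.selfAdj x.1) ((hA.loc x.1).of_le (by omega))
        ((ih x.2).1.of_le (by omega))
    · exact SelfAdj.sum _ fun x _ => (hA.selfAdj x.1).commutator (ih x.2).2 conj_neg_I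

lemma conj_inv_factorial (j : ℕ) : (starRingEnd ℂ) ((j ! : ℂ)⁻¹) = (j ! : ℂ)⁻¹ := by
  rw [map_inv₀, map_natCast]

lemma IsDressing.dressedCoeff (hg : Growth Γ d κ) (hA : IsDressing A n) (hH : SelfAdj H)
    (hHl : LocC False (n + 1) H) (hK : LocC True n K) (hKs : SelfAdj K) (k : ℕ) :
    LocC True (n + 1 - k) (dressedCoeff H K A n k) ∧ SelfAdj (dressedCoeff H K A n k) := by
  rw [SpinLattice.dressedCoeff]
  refine ⟨LocC.sub (LocC.sum _ fun j _ => (hA.coeff_iterPoly hg hH hHl j k).1.const_smul _) ?_,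
    SelfAdj.sub (SelfAdj.sum _ fun j _ => (hA.coeff_iterPoly hg hH hHl j k).2.smul
      (conj_inv_factorial _)) ?_⟩
  · split_ifs with h
    · exact hK.of_le (by omega)
    · exact LocC.zero
  · split_ifs
    exacts [hKs, SelfAdj.zero]

lemma IsDressing.lowerCoeff (hg : Growth Γ d κ) (hA : IsDressing A n) (hH : SelfAdj H)
    (hHl : LocC False (n + 1) H) (hK : LocC True n K) (hKs : SelfAdj K) (k : ℕ) :
    LocC True (n + 1 - k) (lowerCoeff H K A n k) ∧ SelfAdj (lowerCoeff H K A n k) := by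
  rw [SpinLattice.lowerCoeff]
  obtain ⟨h1, h2⟩ := hA.dressedCoeff hg hH hHl hK hKs k
  refine ⟨h1.sub ?_, h2.sub ((hA.selfAdj k).commutator hH conj_I_smul)⟩
  have h3 := (LocC.commutator hg hH (hHl.of_le (by omega)) (hA.loc k)).const_smul (-Complex.I)
  rwa [ObsFamily.neg_smul_commutator] at h3

/-- Inductive construction of the dressing transformation. -/
lemma exists_dressing (hg : Growth Γ d κ) {w : ℝ → ℝ} (hw : HasMoments w) (hH : SelfAdj H)
    (hHl : LocC False (n + 1) H) (hK : LocC True n K) (hKs : SelfAdj K) :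
    ∃ A : ℕ → ObsFamily D, IsDressing A n ∧
      ∀ k, 1 ≤ k → k ≤ n → A k = -H.quasiAdiabatic w (lowerCoeff H K A n k) := by
  -- The orders beyond `N` are set to zero at stage `N`; defining the next one does not disturb the
  -- equations already solved, by triangularity.
  suffices h : ∀ N ≤ n, ∃ A : ℕ → ObsFamily D, IsDressing A n ∧ (∀ p, N < p → A p = 0) ∧
      ∀ k, 1 ≤ k → k ≤ N → A k = -H.quasiAdiabatic w (lowerCoeff H K A n k) by
    obtain ⟨A, h1, -, h2⟩ := h n le_rfl
    exact ⟨A, h1, h2⟩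
  intro N hN
  induction N with
  | zero =>
    exact ⟨fun _ => 0, ⟨rfl, fun _ _ => rfl, fun _ => LocC.zero, fun _ => SelfAdj.zero⟩,
      fun _ _ => rfl, fun k h1 h2 => by omega⟩
  | succ N ih =>
    obtain ⟨A, hA, hA0, hAk⟩ := ih (by omega)
    set a := -H.quasiAdiabatic w (SpinLattice.lowerCoeff H K A n (N + 1)) with ha
    obtain ⟨hL, hLs⟩ := hA.lowerCoeff hg hH hHl hK hKs (N + 1)
    have hne : ∀ p, p ≠ N + 1 → Function.update A (N + 1) a p = A p := fun p hp =>
      Function.update_of_ne hp _ _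
    have heq : Function.update A (N + 1) a (N + 1) = a := Function.update_self _ _ _
    have hA' : IsDressing (Function.update A (N + 1) a) n := by
      refine ⟨by rw [hne 0 (by omega), hA.zero], fun p hp => by rw [hne p (by omega), hA.eq_zero p hp],
        fun p => ?_, fun p => ?_⟩
      · rcases eq_or_ne p (N + 1) with rfl | hp
        · rw [heq, ha]
          exact (LocC.quasiAdiabatic hg hw (N := n) hH hHl (by omega) hL).neg
        · rw [hne p hp]; exact hA.loc p
      · rcases eq_or_ne p (N + 1) with rfl | hp
        · rw [heq, ha]
          have h1 := (hH.quasiAdiabatic (w := w) hLs).smul (c := -1) (by simp)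
          rwa [ObsFamily.neg_one_smul] at h1
        · rw [hne p hp]; exact hA.selfAdj p
    refine ⟨_, hA', fun p hp => by rw [hne p (by omega)]; exact hA0 p (by omega), fun k h1 h2 => ?_⟩
    have h3 : SpinLattice.lowerCoeff H K (Function.update A (N + 1) a) n k =
        SpinLattice.lowerCoeff H K A n k :=
      lowerCoeff_congr hA'.zero hA'.eq_zero hA.zero hA.eq_zero fun p hp => hne p (by omega)
    rw [h3]
    rcases eq_or_ne k (N + 1) with rfl | hk
    · rw [heq]
    · rw [hne k hk]; exact hAk k h1 (by omega)

lemma neg_commutator {𝒜 : Type*} [CStarAlgebra 𝒜] (a b : 𝒜) : -a * b - b * -a = b * a - a * b := by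
  rw [neg_mul, mul_neg]
  abel

/-- The dressed coefficients are time averages. -/
lemma dressedCoeff_eq_timeAverage {w : ℝ → ℝ} (hw : HasMoments w) (hw1 : ∫ t, w t = 1)
    (hH : SelfAdj H) {k : ℕ} (hk : A k = -H.quasiAdiabatic w (lowerCoeff H K A n k))
    (Λ : Finset Γ) {s : ℝ} (hs : s ∈ Icc (0 : ℝ) 1) :
    dressedCoeff H K A n k Λ s = timeAverage w (H Λ s) (lowerCoeff H K A n k Λ s) := by
  have h1 := liouvillian_quasiAdiabatic hw hw1 (hH Λ s hs) (lowerCoeff H K A n k Λ s)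
  rw [liouvillian_apply, eq_sub_iff_add_eq] at h1
  rw [← h1]
  have h2 : dressedCoeff H K A n k Λ s = Complex.I • (A k Λ s * H Λ s - H Λ s * A k Λ s) +
      lowerCoeff H K A n k Λ s := by
    rw [lowerCoeff]
    change _ = Complex.I • (A k Λ s * H Λ s - H Λ s * A k Λ s) + (dressedCoeff H K A n k Λ s -
      Complex.I • (A k Λ s * H Λ s - H Λ s * A k Λ s))
    abel
  have h3 : A k Λ s = -SpinLattice.quasiAdiabatic w (H Λ s) (lowerCoeff H K A n k Λ s) :=
    congrFun (congrFun hk Λ) s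
  rw [h2, h3, neg_commutator]

end Coefficients

/-! ### Evaluation of the formal expansion at a value of `ε`. -/

section Evaluation

variable {D : Γ → ℕ}

/-- Evaluation of polynomials with coefficients in families of observables, in a volume, at a
time and at a value of the adiabatic parameter. -/
def evalPoly (Λ : Finset Γ) (s : ℝ) (ε : ℂ) (p : (ObsFamily D)[X]) : Obs D Λ :=
  p.eval₂ ((Pi.evalRingHom (fun _ : ℝ => Obs D Λ) s).comp
    (Pi.evalRingHom (fun Λ : Finset Γ => ℝ → Obs D Λ) Λ)) (algebraMap ℂ (Obs D Λ) ε)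

variable (Λ : Finset Γ) (s : ℝ) (ε : ℂ)

lemma obs_smul_zero (c : ℂ) : c • (0 : Obs D Λ) = 0 := smul_zero (A := Obs D Λ) c

lemma sub_smul_eq {𝒜 : Type*} [CStarAlgebra 𝒜] (c : ℂ) (a b : 𝒜) : a - c • b = -c • b + a := by
  rw [neg_smul]; abel

/-- The coefficients do not commute, but evaluation is multiplicative because the scalar `ε` is
central. -/
lemma evalPoly_mul (p q : (ObsFamily D)[X]) :
    evalPoly Λ s ε (p * q) = evalPoly Λ s ε p * evalPoly Λ s ε q :=
  eval₂_mul_noncomm _ _ fun _ => (Algebra.commutes ε _).symm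

lemma evalPoly_sub (p q : (ObsFamily D)[X]) :
    evalPoly Λ s ε (p - q) = evalPoly Λ s ε p - evalPoly Λ s ε q :=
  eval₂_sub _

lemma mul_algebraMap_pow {𝒜 : Type*} [Ring 𝒜] [Algebra ℂ 𝒜] (a : 𝒜) (ε : ℂ) (k : ℕ) :
    a * algebraMap ℂ 𝒜 ε ^ k = ε ^ k • a := by
  rw [← map_pow, ← Algebra.commutes, Algebra.smul_def]

lemma evalPoly_monomial (k : ℕ) (G : ObsFamily D) :
    evalPoly Λ s ε (monomial k G) = ε ^ k • G Λ s := by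
  rw [evalPoly, eval₂_monomial]
  exact mul_algebraMap_pow (G Λ s) ε k

lemma evalPoly_sum_monomial (u : Finset ℕ) (G : ℕ → ObsFamily D) :
    evalPoly Λ s ε (∑ k ∈ u, monomial k (G k)) = ∑ k ∈ u, ε ^ k • G k Λ s := by
  rw [evalPoly, eval₂_finsetSum]
  exact Finset.sum_congr rfl fun k _ => evalPoly_monomial Λ s ε k (G k)

lemma evalPoly_eq_sum {p : (ObsFamily D)[X]} {N : ℕ} (hN : p.natDegree < N) :
    evalPoly Λ s ε p = ∑ k ∈ Finset.range N, ε ^ k • p.coeff k Λ s := by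
  conv_lhs => rw [p.as_sum_range' N hN]
  exact evalPoly_sum_monomial Λ s ε _ _

/-- The generator of the dressing transformation. -/
def dressGen (A : ℕ → ObsFamily D) (n : ℕ) (ε : ℂ) : ObsFamily D :=
  fun Λ s => ∑ p ∈ Finset.Icc 1 n, ε ^ p • A p Λ s

/-- The derivative of the generator of the dressing transformation. -/
def dressGenDeriv (A : ℕ → ObsFamily D) (n : ℕ) (ε : ℂ) : ObsFamily D :=
  fun Λ s => ∑ p ∈ Finset.Icc 1 n, ε ^ p • (A p).deriv Λ s

lemma sum_range_succ_eq_sum_Icc {M : Type*} [AddCommMonoid M] (f : ℕ → M) (n : ℕ) (h : f 0 = 0) :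
    ∑ p ∈ Finset.range (n + 1), f p = ∑ p ∈ Finset.Icc 1 n, f p := by
  rw [Finset.sum_range_succ', h, add_zero, Finset.range_eq_Ico, Finset.sum_Ico_add' f 0 n 1]
  rfl

variable {H K : ObsFamily D} {A : ℕ → ObsFamily D} {n : ℕ}

lemma evalPoly_dressPoly (h0 : A 0 = 0) :
    evalPoly Λ s ε (dressPoly A n) = -Complex.I • dressGen A n ε Λ s := by
  rw [dressPoly, evalPoly_sum_monomial, dressGen, Finset.smul_sum,
    sum_range_succ_eq_sum_Icc _ _ ?_]
  · refine Finset.sum_congr rfl fun p _ => ?_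
    exact smul_comm (ε ^ p) (-Complex.I) (A p Λ s)
  · rw [h0, ObsFamily.smul_zero]
    exact obs_smul_zero Λ _

lemma sum_commutator_left {𝒜 ι : Type*} [CStarAlgebra 𝒜] (u : Finset ι) (H : 𝒜) (c : ι → ℂ)
    (a : ι → 𝒜) :
    ∑ i ∈ u, c i • Complex.I • (a i * H - H * a i) =
      Complex.I • ((∑ i ∈ u, c i • a i) * H - H * ∑ i ∈ u, c i • a i) := by
  rw [Finset.sum_mul, Finset.mul_sum, ← Finset.sum_sub_distrib, Finset.smul_sum]
  refine Finset.sum_congr rfl fun i _ => ?_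
  rw [smul_comm, smul_commutator]

lemma evalPoly_iterPoly_zero (h0 : A 0 = 0) (hn : ∀ p, n < p → A p = 0) :
    evalPoly Λ s ε (iterPoly H A n 0) = -ε • dressGenDeriv A n ε Λ s +
      Complex.I • (dressGen A n ε Λ s * H Λ s - H Λ s * dressGen A n ε Λ s) := by
  rw [iterPoly, evalPoly_sum_monomial]
  have h1 : ∀ k, ε ^ k • driftCoeff H A k Λ s = ε ^ k • Complex.I •
      (A k Λ s * H Λ s - H Λ s * A k Λ s) - ε ^ k • (A (k - 1)).deriv Λ s := fun k =>
    smul_sub (A := Obs D Λ) (ε ^ k) _ _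
  have hA0 : A 0 Λ s = 0 := by rw [h0]; rfl
  have hA0' : (A 0).deriv Λ s = 0 := by rw [h0, deriv_zero_family]; rfl
  have hAn : A (n + 1) Λ s = 0 := by rw [hn (n + 1) (by omega)]; rfl
  have e1 : ∑ k ∈ Finset.range (n + 2), ε ^ k • A k Λ s = dressGen A n ε Λ s := by
    rw [Finset.sum_range_succ, hAn, obs_smul_zero, add_zero,
      sum_range_succ_eq_sum_Icc (fun k => ε ^ k • A k Λ s) n (by
        rw [hA0, obs_smul_zero])]
    rfl
  have e2 : ∑ k ∈ Finset.range (n + 2), ε ^ k • (A (k - 1)).deriv Λ s =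
      ε • dressGenDeriv A n ε Λ s := by
    rw [Finset.sum_range_succ', Nat.zero_sub, hA0', obs_smul_zero, add_zero, dressGenDeriv,
      ← sum_range_succ_eq_sum_Icc (fun k => ε ^ k • (A k).deriv Λ s) n (by
        rw [hA0', obs_smul_zero]), Finset.smul_sum]
    refine Finset.sum_congr rfl fun k _ => ?_
    rw [Nat.add_sub_cancel, smul_smul, pow_succ']
  simp only [h1]
  rw [Finset.sum_sub_distrib, e2,
    sum_commutator_left (Finset.range (n + 2)) (H Λ s) (fun k => ε ^ k) (fun k => A k Λ s), e1]
  exact sub_smul_eq _ _ _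

lemma evalPoly_iterPoly (h0 : A 0 = 0) (j : ℕ) :
    evalPoly Λ s ε (iterPoly H A n j) =
      (adjointS (dressGen A n ε Λ s))^[j] (evalPoly Λ s ε (iterPoly H A n 0)) := by
  induction j with
  | zero => rfl
  | succ j ih =>
    rw [Function.iterate_succ_apply', ← ih, iterPoly, evalPoly_sub, evalPoly_mul, evalPoly_mul,
      evalPoly_dressPoly Λ s ε h0, adjointS]

/-- A bound on the degrees of the iterated commutators. -/
def degBound (H : ObsFamily D) (A : ℕ → ObsFamily D) (n : ℕ) : ℕ :=
  -- The summand `n + 3` also ensures that the orders `1` and `n` lie below the bound.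
  ∑ j ∈ Finset.range (n + 2), (iterPoly H A n j).natDegree + n + 3

lemma natDegree_lt_degBound {j : ℕ} (hj : j < n + 2) :
    (iterPoly H A n j).natDegree < degBound H A n := by
  have := Finset.single_le_sum (f := fun j => (iterPoly H A n j).natDegree)
    (fun _ _ => Nat.zero_le _) (Finset.mem_range.2 hj)
  rw [degBound]
  omega

/-- The terms of the dressed drift of order larger than `n`, divided by `ε ^ (n + 1)`. -/
def remainderCoeff (c : ℕ → ObsFamily D) (n N : ℕ) (ε : ℂ) : ObsFamily D :=
  fun Λ s => ∑ k ∈ Finset.Ico (n + 1) N, ε ^ (k - (n + 1)) • c k Λ s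

lemma sum_Ico_eq_remainderCoeff (c : ℕ → ObsFamily D) (n N : ℕ) :
    ∑ k ∈ Finset.Ico (n + 1) N, ε ^ k • c k Λ s = ε ^ (n + 1) • remainderCoeff c n N ε Λ s := by
  rw [remainderCoeff, Finset.smul_sum]
  refine Finset.sum_congr rfl fun k hk => ?_
  rw [smul_smul, ← pow_add, Nat.add_sub_cancel' (Finset.mem_Ico.1 hk).1]

/-- Expansion of the dressed drift in powers of `ε`. -/
lemma dressed_expansion (h0 : A 0 = 0) (hn : ∀ p, n < p → A p = 0) :
    expRemainder (dressGen A n ε Λ s) 0 (-ε • dressGenDeriv A n ε Λ s +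
        Complex.I • (dressGen A n ε Λ s * H Λ s - H Λ s * dressGen A n ε Λ s)) - ε • K Λ s -
        ∑ k ∈ Finset.range (n + 1), ε ^ k • dressedCoeff H K A n k Λ s =
      ε ^ (n + 1) • (remainderCoeff (dressedCoeff H K A n) n (degBound H A n) ε Λ s +
        expRemainder (dressGen A n ε Λ s) (n + 1)
          (remainderCoeff (fun k => (iterPoly H A n (n + 1)).coeff k) n (degBound H A n) ε Λ s)) := by
  set S := dressGen A n ε Λ s
  set N := degBound H A n with hN
  have hNn : n + 1 ≤ N := by rw [hN, degBound]; omega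
  have hN2 : 1 < N := by rw [hN, degBound]; omega
  have hsplit : ∀ f : ℕ → Obs D Λ, ∑ k ∈ Finset.range N, f k =
      ∑ k ∈ Finset.range (n + 1), f k + ∑ k ∈ Finset.Ico (n + 1) N, f k := fun f =>
    (Finset.sum_range_add_sum_Ico f hNn).symm
  -- Taylor expansion with `n + 1` terms: these produce the coefficients `dressedCoeff`, while the
  -- integral remainder contains `n + 1` commutators with `S` and hence only orders above `n`.
  rw [← evalPoly_iterPoly_zero Λ s ε h0 hn, expRemainder_zero_eq_sum S (n + 1)]
  simp only [S, ← evalPoly_iterPoly Λ s ε h0]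
  have e1 : ∑ j ∈ Finset.range (n + 1), ((j + 1)! : ℂ)⁻¹ • evalPoly Λ s ε (iterPoly H A n j) =
      ∑ k ∈ Finset.range N, ε ^ k • dressedCoeff H K A n k Λ s + ε • K Λ s := by
    have h1 : ∀ k, dressedCoeff H K A n k Λ s = ∑ j ∈ Finset.range (n + 1),
        ((j + 1)! : ℂ)⁻¹ • (iterPoly H A n j).coeff k Λ s - if k = 1 then K Λ s else 0 := by
      intro k
      rw [dressedCoeff]
      change (∑ j ∈ Finset.range (n + 1), ((j + 1)! : ℂ)⁻¹ • (iterPoly H A n j).coeff k) Λ s -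
        (if k = 1 then K else 0 : ObsFamily D) Λ s = _
      congr 1
      · rw [Finset.sum_apply, Finset.sum_apply]
        rfl
      · split_ifs <;> rfl
    have h2 : ∑ k ∈ Finset.range N, ε ^ k • (if k = 1 then K Λ s else 0) = ε • K Λ s := by
      rw [Finset.sum_eq_single_of_mem 1 (Finset.mem_range.2 hN2)]
      · rw [if_pos rfl, pow_one]
      · intro k _ hk
        rw [if_neg hk, obs_smul_zero]
    simp only [h1, smul_sub]
    rw [Finset.sum_sub_distrib, h2, sub_add_cancel]
    simp only [Finset.smul_sum]
    rw [Finset.sum_comm]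
    refine Finset.sum_congr rfl fun j hj => ?_
    rw [evalPoly_eq_sum Λ s ε (natDegree_lt_degBound (H := H) (A := A) (n := n) (j := j)
      (by have := Finset.mem_range.1 hj; omega)), Finset.smul_sum]
    refine Finset.sum_congr rfl fun k _ => ?_
    exact smul_comm (M := ℂ) (N := ℂ) (α := Obs D Λ) _ _ _
  have e2 : evalPoly Λ s ε (iterPoly H A n (n + 1)) = ε ^ (n + 1) •
      remainderCoeff (fun k => (iterPoly H A n (n + 1)).coeff k) n N ε Λ s := by
    rw [evalPoly_eq_sum Λ s ε (natDegree_lt_degBound (H := H) (A := A) (n := n) (j := n + 1)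
      (by omega)), hsplit, ← sum_Ico_eq_remainderCoeff]
    refine (congrArg (· + _) (Finset.sum_eq_zero fun k hk => ?_)).trans (zero_add _)
    rw [coeff_iterPoly_eq_zero h0 hn (Nat.lt_succ_iff.1 (Finset.mem_range.1 hk) |>.trans n.le_succ)]
    exact obs_smul_zero Λ _
  rw [e1, e2, expRemainder_smul, hsplit, sum_Ico_eq_remainderCoeff, smul_add]
  abel

end Evaluation

end

section

open MeasureTheory Set Filter Topology
open scoped Nat

/-! ### Locality uniform in time and in the adiabatic parameter. -/

section UniformlyLocal

variable {D : Γ → ℕ} [MetricSpace Γ] {ι ι' : Type*}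

/-- A family of observables that is a sum of quasi-local site observables, with bounds that are
uniform in the index. -/
def UnifLoc (G : (Λ : Finset Γ) → ι → Obs D Λ) : Prop :=
  ∃ B : (Λ : Finset Γ) → Γ → ι → Obs D Λ,
    (∀ k, ∃ C, 0 ≤ C ∧ ∀ (Λ : Finset Γ), ∀ x ∈ Λ, ∀ i, QuasiLocal k x C (B Λ x i)) ∧
    ∀ Λ i, G Λ i = ∑ x ∈ Λ, B Λ x i

variable {G G₁ G₂ : (Λ : Finset Γ) → ι → Obs D Λ}

lemma UnifLoc.add (h₁ : UnifLoc G₁) (h₂ : UnifLoc G₂) : UnifLoc fun Λ i => G₁ Λ i + G₂ Λ i := by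
  obtain ⟨B₁, hB₁, h₁⟩ := h₁
  obtain ⟨B₂, hB₂, h₂⟩ := h₂
  refine ⟨fun Λ x i => B₁ Λ x i + B₂ Λ x i, fun k => ?_, fun Λ i => ?_⟩
  · obtain ⟨C₁, hC₁, hb₁⟩ := hB₁ k
    obtain ⟨C₂, hC₂, hb₂⟩ := hB₂ k
    exact ⟨C₁ + C₂, add_nonneg hC₁ hC₂, fun Λ x hx i => (hb₁ Λ x hx i).add (hb₂ Λ x hx i)⟩
  · beta_reduce
    rw [h₁, h₂, Finset.sum_add_distrib]

lemma UnifLoc.zero : UnifLoc fun Λ (_ : ι) => (0 : Obs D Λ) :=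
  ⟨fun _ _ _ => 0, fun k => ⟨0, le_rfl, fun _ x _ _ => QuasiLocal.zero k x⟩, fun _ _ => by
    rw [Finset.sum_const_zero]⟩

lemma UnifLoc.smul (h : UnifLoc G) {f : ι → ℂ} (hf : ∀ i, ‖f i‖ ≤ 1) :
    UnifLoc fun Λ i => f i • G Λ i := by
  obtain ⟨B, hB, h⟩ := h
  refine ⟨fun Λ x i => f i • B Λ x i, fun k => ?_, fun Λ i => ?_⟩
  · obtain ⟨C, hC, hb⟩ := hB k
    refine ⟨C, hC, fun Λ x hx i => ((hb Λ x hx i).smul (f i)).mono ?_⟩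
    exact (mul_le_mul_of_nonneg_right (hf i) hC).trans (one_mul C).le
  · beta_reduce
    rw [h, Finset.smul_sum]

lemma UnifLoc.sum {α : Type*} (u : Finset α) {G : α → (Λ : Finset Γ) → ι → Obs D Λ}
    (h : ∀ a ∈ u, UnifLoc (G a)) : UnifLoc fun Λ i => ∑ a ∈ u, G a Λ i := by
  classical
  induction u using Finset.induction_on with
  | empty => simpa using UnifLoc.zero
  | insert a u ha ih =>
    simp only [Finset.sum_insert ha]
    exact (h a (Finset.mem_insert_self a u)).add
      (ih fun j hj => h j (Finset.mem_insert_of_mem hj))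

/-- Joining two families under one index type gives them a common decay function and a common
constant. This is how the `A_p` and the remainder come to share `F` and `C`. -/
lemma UnifLoc.sumElim {G' : (Λ : Finset Γ) → ι' → Obs D Λ} (h : UnifLoc G) (h' : UnifLoc G') :
    UnifLoc fun Λ (i : ι ⊕ ι') => Sum.elim (G Λ) (G' Λ) i := by
  obtain ⟨B, hB, h⟩ := h
  obtain ⟨B', hB', h'⟩ := h'
  refine ⟨fun Λ x i => Sum.elim (B Λ x) (B' Λ x) i, fun k => ?_, fun Λ i => ?_⟩
  · obtain ⟨C, hC, hb⟩ := hB k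
    obtain ⟨C', hC', hb'⟩ := hB' k
    refine ⟨C + C', add_nonneg hC hC', fun Λ x hx i => ?_⟩
    rcases i with i | i
    · exact (hb Λ x hx i).mono (by linarith)
    · exact (hb' Λ x hx i).mono (by linarith)
  · rcases i with i | i
    · exact h Λ i
    · exact h' Λ i

lemma UnifLoc.finite {P : Type*} [Fintype P] {G : P → (Λ : Finset Γ) → ι → Obs D Λ}
    (h : ∀ p, UnifLoc (G p)) : UnifLoc fun Λ (i : P × ι) => G i.1 Λ i.2 := by
  choose B hB h using h
  refine ⟨fun Λ x i => B i.1 Λ x i.2, fun k => ?_, fun Λ i => h i.1 Λ i.2⟩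
  choose C hC hb using fun p => hB p k
  exact ⟨∑ p, C p, Finset.sum_nonneg fun p _ => hC p, fun Λ x hx i => (hb i.1 Λ x hx i.2).mono
    (Finset.single_le_sum (f := C) (fun p _ => hC p) (Finset.mem_univ i.1))⟩

variable [∀ x, NeZero (D x)] {d : ℕ} {κ : ℝ} {S : (Λ : Finset Γ) → ι → Obs D Λ}

lemma LocC.unifLoc {z : Prop} {m : ℕ} {G : ObsFamily D} (h : LocC z m G) (τ : ι → Icc (0 : ℝ) 1) :
    UnifLoc fun Λ i => G Λ (τ i) := by
  obtain ⟨B, hB, h⟩ := h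
  refine ⟨fun Λ x i => B Λ x () (τ i), fun k => ?_, fun Λ i => h Λ _ (τ i).2⟩
  obtain ⟨C, hC, hb⟩ := hB.siteBound.exists_bound k
  exact ⟨C, hC, fun Λ x hx i => hb Λ x hx _ (τ i).2⟩

lemma UnifLoc.exists_heis_bound (hg : Growth Γ d κ) (hS : UnifLoc S)
    (hSs : ∀ Λ i, IsSelfAdjoint (S Λ i)) (k : ℕ) : ∃ (k' : ℕ) (K : ℝ), 0 ≤ K ∧
      ∀ (Λ : Finset Γ) (x : Γ) (i : ι) (C t : ℝ) (a : Obs D Λ), |t| ≤ 1 → QuasiLocal k' x C a →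
        QuasiLocal k x (K * C) (heis (S Λ i) t a) := by
  obtain ⟨B, hB, h⟩ := hS
  obtain ⟨k', K, q, hK, hb⟩ := hg.exists_heis_bound B (fun k => (hB k).imp fun C h => h.2)
    (fun Λ i => by rw [← h]; exact hSs Λ i) k
  refine ⟨k', K * 2 ^ q, by positivity, fun Λ x i C t a ht ha => ?_⟩
  rw [h]
  refine (hb Λ x i C t a ha).mono (mul_le_mul_of_nonneg_right (mul_le_mul_of_nonneg_left
    (pow_le_pow_left₀ (by positivity) (by linarith) q) hK) ha.nonneg)

lemma UnifLoc.heis_one (hg : Growth Γ d κ) (hS : UnifLoc S) (hSs : ∀ Λ i, IsSelfAdjoint (S Λ i))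
    (h : UnifLoc G) : UnifLoc fun Λ i => heis (S Λ i) 1 (G Λ i) := by
  obtain ⟨B, hB, h⟩ := h
  refine ⟨fun Λ x i => heis (S Λ i) 1 (B Λ x i), fun k => ?_, fun Λ i => by
    beta_reduce
    rw [h, map_sum]⟩
  obtain ⟨k', K, hK, hb⟩ := hS.exists_heis_bound hg hSs k
  obtain ⟨C, hC, hBk⟩ := hB k'
  exact ⟨K * C, mul_nonneg hK hC, fun Λ x hx i => hb Λ x i C 1 _ (by rw [abs_one]) (hBk Λ x hx i)⟩

lemma continuous_smul_heis {𝒜 : Type*} [CStarAlgebra 𝒜] {f : ℝ → ℝ} (hf : Continuous f) (S a : 𝒜) :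
    Continuous fun u : ℝ => f u • heis S (1 - u) a :=
  hf.smul ((continuous_heis S a).comp (continuous_const.sub continuous_id))

lemma integrable_unitWeight_smul {E : Type*} [NormedAddCommGroup E] [NormedSpace ℝ E] {f : ℝ → E}
    (hf : Continuous f) : Integrable fun u => unitWeight u • f u := by
  have h1 : (fun u => unitWeight u • f u) = indicator (Ioc 0 1) f := by
    funext u
    by_cases hu : u ∈ Ioc (0 : ℝ) 1
    · simp [unitWeight, indicator_of_mem hu]
    · simp [unitWeight, indicator_of_notMem hu]
  rw [h1, integrable_indicator_iff measurableSet_Ioc]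
  exact (hf.integrableOn_Icc (a := 0) (b := 1)).mono_set Ioc_subset_Icc_self

lemma UnifLoc.integral_heis (hg : Growth Γ d κ) (hS : UnifLoc S)
    (hSs : ∀ Λ i, IsSelfAdjoint (S Λ i)) (h : UnifLoc G) {f : ℝ → ℝ} (hf : Continuous f)
    (hf1 : ∀ u ∈ Ioc (0 : ℝ) 1, |f u| ≤ 1) :
    UnifLoc fun Λ i => ∫ u in (0 : ℝ)..1, f u • heis (S Λ i) (1 - u) (G Λ i) := by
  obtain ⟨B, hB, h⟩ := h
  refine ⟨fun Λ x i => ∫ u in (0 : ℝ)..1, f u • heis (S Λ i) (1 - u) (B Λ x i), fun k => ?_,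
    fun Λ i => ?_⟩
  · obtain ⟨k', K, hK, hb⟩ := hS.exists_heis_bound hg hSs k
    obtain ⟨C, hC, hBk⟩ := hB k'
    have hu : Integrable fun u => ‖unitWeight u‖ := hasMoments_unitWeight.integrable.norm
    refine ⟨∫ u, ‖unitWeight u‖ * (K * C), integral_nonneg fun u =>
      mul_nonneg (norm_nonneg _) (mul_nonneg hK hC), fun Λ x hx i => ?_⟩
    beta_reduce
    rw [intervalIntegral_eq_integral_unitWeight]
    refine QuasiLocal.integral (integrable_unitWeight_smul (continuous_smul_heis hf _ _))
      (hu.mul_const _) fun u => ?_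
    by_cases hu1 : u ∈ Ioc (0 : ℝ) 1
    · have ht : |1 - u| ≤ 1 := abs_le.2 ⟨by linarith [hu1.2], by linarith [hu1.1]⟩
      refine (((hb Λ x i C (1 - u) _ ht (hBk Λ x hx i)).real_smul (f u)).mono ?_).real_smul _
      exact (mul_le_mul_of_nonneg_right (hf1 u hu1) (mul_nonneg hK hC)).trans (one_mul _).le
    · have h0 : unitWeight u = 0 := indicator_of_notMem hu1 _
      rw [h0, norm_zero, zero_mul]
      exact (zero_smul ℝ (f u • heis (S Λ i) (1 - u) (B Λ x i))).symm ▸ QuasiLocal.zero k x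
  · simp only [h, map_sum, Finset.smul_sum]
    exact intervalIntegral.integral_finsetSum fun x _ =>
      (continuous_smul_heis hf _ _).intervalIntegrable 0 1

/-- A uniformly local family of self-adjoint observables is given by local Hamiltonians. -/
lemma UnifLoc.exists_potential (hg : Growth Γ d κ) (h : UnifLoc G)
    (hs : ∀ Λ i, IsSelfAdjoint (G Λ i)) :
    ∃ (F : ℝ → ℝ) (C : ℝ) (Ψ : ι → Potential D), IsDecayFunction Γ F ∧ 0 ≤ C ∧
      ∀ i, (Ψ i).IsHermitian ∧ (Ψ i).Bound F C ∧ ∀ Λ, (Ψ i).ham Λ = G Λ i := by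
  obtain ⟨B, hB, h⟩ := h
  obtain ⟨F, C, Ψ, hF, hC, hΨ⟩ := hg.exists_potential B (fun k => (hB k).imp fun C h => h.2)
    fun Λ i => by rw [← h]; exact hs Λ i
  exact ⟨F, C, Ψ, hF, hC, fun i => ⟨(hΨ i).1, (hΨ i).2.1, fun Λ => by rw [(hΨ i).2.2, h]⟩⟩

end UniformlyLocal

/-! ### Real multiples of potentials. -/

section SmulPotential

variable {D : Γ → ℕ}

/-- A potential multiplied by a real number. -/
def Potential.rsmul (c : ℝ) (Ψ : Potential D) : Potential D := fun Λ Z => (c : ℂ) • Ψ Λ Z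

lemma Potential.IsHermitian.rsmul {Ψ : Potential D} (h : Ψ.IsHermitian) (c : ℝ) :
    (Ψ.rsmul c).IsHermitian := fun Λ Z hZ =>
  isSelfAdjoint_smul_of_conj (Complex.conj_ofReal c) (h Λ Z hZ)

lemma Potential.ham_rsmul (Ψ : Potential D) (c : ℝ) (Λ : Finset Γ) :
    (Ψ.rsmul c).ham Λ = (c : ℂ) • Ψ.ham Λ := by
  rw [Potential.ham, Potential.ham, Finset.smul_sum]
  refine Finset.sum_congr rfl fun Z _ => ?_
  rw [← embedHom_apply, ← embedHom_apply]
  exact map_smul _ (c : ℂ) _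

lemma Potential.Bound.rsmul [MetricSpace Γ] {Ψ : Potential D} {F : ℝ → ℝ} {M : ℝ}
    (h : Ψ.Bound F M) {c : ℝ} (hc : 0 ≤ c) : (Ψ.rsmul c).Bound F (M * c) := by
  intro Λ x y
  have h1 : ∀ Z, ‖Ψ.rsmul c Λ Z‖ = c * ‖Ψ Λ Z‖ := fun Z => by
    rw [Potential.rsmul, norm_smul, Complex.norm_real, Real.norm_of_nonneg hc]
  simp only [h1]
  rw [← Finset.mul_sum]
  calc _ ≤ c * (M * F (dist x y)) := mul_le_mul_of_nonneg_left (h Λ x y) hc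
    _ = _ := by ring

end SmulPotential

/-! ### Central terms do not affect the dynamics. -/

section Central

variable {𝒜 : Type*} [CStarAlgebra 𝒜] {c : 𝒜}

lemma heis_add_central (hc : ∀ a, Commute c a) (H : 𝒜) (t : ℝ) (a : 𝒜) :
    heis (H + c) t a = heis H t a := by
  have h1 : ∀ t, evol (H + c) t = evol c t * evol H t := by
    intro t
    rw [evol, smul_add, smul_add, add_comm, exp_add_of_commute'
      (((hc H).smul_left _).smul_left _ |>.smul_right _ |>.smul_right _)]
    rfl
  have h2 : ∀ t a, Commute (evol c t) a := fun t a => evol_commute (hc a) t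
  rw [heis_apply, h1, h1, heis_apply]
  calc evol c t * evol H t * a * (evol c (-t) * evol H (-t))
      = evol c t * (evol H t * a * evol c (-t)) * evol H (-t) := by simp only [mul_assoc]
    _ = evol c t * (evol c (-t) * (evol H t * a)) * evol H (-t) := by rw [(h2 (-t) _).eq]
    _ = _ := by rw [← mul_assoc (evol c t), evol_mul_neg, one_mul]

lemma timeAverage_add_central (hc : ∀ a, Commute c a) (w : ℝ → ℝ) (H a : 𝒜) :
    timeAverage w (H + c) a = timeAverage w H a := by
  simp only [timeAverage, heis_add_central hc]

lemma quasiAdiabatic_add_central (hc : ∀ a, Commute c a) (w : ℝ → ℝ) (H a : 𝒜) :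
    quasiAdiabatic w (H + c) a = quasiAdiabatic w H a := by
  simp only [quasiAdiabatic, heisIntegral, heis_add_central hc]

lemma commute_quasiAdiabatic (hc : ∀ a, Commute c a) (w : ℝ → ℝ) (H a : 𝒜) :
    Commute (quasiAdiabatic w H c) a := by
  have h1 : ∀ t, heisIntegral H t c = t • c := fun t => by
    simp [heisIntegral, heis_of_commute (hc H).symm]
  simp only [quasiAdiabatic, h1, smul_smul]
  rw [integral_smul_const]
  exact (hc a).smul_left _

lemma commutator_add_of_commute {a b c : 𝒜} (h : Commute c b) :
    (a + c) * b - b * (a + c) = a * b - b * a := by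
  rw [add_mul, mul_add, h.eq]
  abel

end Central

/-! ### Evolution of the dressed ground state projection. -/

section GroundEvolution

variable {D : Γ → ℕ} {n : ℕ} {Φ : ℝ → Potential D}

lemma timeDeriv_ham_eq (k : ℕ) (Λ : Finset Γ) (s : ℝ) : (Potential.timeDeriv k Φ s).ham Λ =
    Potential.reducedHam Φ k Λ s + (Potential.timeDeriv k Φ s).term Λ ∅ :=
  (sub_add_cancel _ _).symm

variable [MetricSpace Γ] [∀ x, NeZero (D x)]

lemma ham_eq_reducedHam_add (Λ : Finset Γ) (s : ℝ) : (Φ s).ham Λ =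
    Potential.reducedHam Φ 0 Λ s + (Φ s).term Λ ∅ := by
  have h := timeDeriv_ham_eq (Φ := Φ) 0 Λ s
  rwa [timeDeriv_zero] at h

/-- Compactness of `[0, 1]`. The bound may depend on the volume: it only justifies differentiating
the projection in that fixed volume. -/
lemma IsLocalC.exists_norm_ham_le (hΦ : IsLocalC n Φ) {k : ℕ} (hk : k ≤ n) (Λ : Finset Γ) :
    ∃ C, ∀ s ∈ Icc (0 : ℝ) 1, ‖(Potential.timeDeriv k Φ s).ham Λ‖ ≤ C := by
  have h1 : ∀ Z : {Z // Z ∈ Λ.powerset}, ∃ C, ∀ s ∈ Icc (0 : ℝ) 1,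
      ‖Potential.timeDeriv k Φ s Λ Z.1‖ ≤ C := fun Z =>
    isCompact_Icc.exists_bound_of_continuousOn
      ((hΦ.contDiffOn Λ Z.1 (Finset.mem_powerset.1 Z.2)).continuousOn_iteratedDerivWithin
        (by exact_mod_cast hk) (uniqueDiffOn_Icc zero_lt_one))
  choose C hC using h1
  refine ⟨∑ Z ∈ Λ.powerset.attach, C Z, fun s hs => (norm_sum_le _ _).trans
    (Finset.sum_le_sum fun Z _ => ?_)⟩
  rw [norm_embed]
  exact hC Z s hs

variable {γ : ℝ} {w : ℝ → ℝ}

/-- The ground state projection evolves by the quasi-adiabatic generator of the reduced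
Hamiltonian. -/
lemma IsLocalC.hasDerivWithinAt_groundProj (hΦ : IsLocalC (n + 1) Φ) (hw : HasMoments w)
    (hγ : 0 < γ) (hf : IsGapFilter γ w) {Λ : Finset Γ}
    (hgap : ∀ s ∈ Icc (0 : ℝ) 1, HasGap γ ((Φ s).ham Λ)) {s : ℝ} (hs : s ∈ Icc (0 : ℝ) 1) :
    HasDerivWithinAt (fun r => groundProj ((Φ r).ham Λ))
      (Complex.I • ((Potential.reducedHam Φ 0).quasiAdiabatic w (Potential.reducedHam Φ 1) Λ s *
          groundProj ((Φ s).ham Λ) - groundProj ((Φ s).ham Λ) *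
        (Potential.reducedHam Φ 0).quasiAdiabatic w (Potential.reducedHam Φ 1) Λ s))
      (Icc 0 1) s := by
  obtain ⟨C, hC⟩ := hΦ.exists_norm_ham_le (k := 1) (by omega) Λ
  have hd := fun r hr => hΦ.hasDerivWithinAt_ham (k := 0) (by omega) Λ (s := r) hr
  rw [timeDeriv_zero] at hd
  have h1 := SpinLattice.hasDerivWithinAt_groundProj hw hγ hf
    (fun r hr => (hΦ.hermitian r hr).ham Λ) hd hC hgap hs
  refine h1.congr_deriv ?_
  congr 1
  -- The scalar terms on the empty set change the generator only by a central element, which drops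
  -- out of the commutator with the projection.
  have h2 : quasiAdiabatic w ((Φ s).ham Λ) ((Potential.timeDeriv (0 + 1) Φ s).ham Λ) =
      (Potential.reducedHam Φ 0).quasiAdiabatic w (Potential.reducedHam Φ 1) Λ s +
        quasiAdiabatic w (Potential.reducedHam Φ 0 Λ s)
          ((Potential.timeDeriv 1 Φ s).term Λ ∅) := by
    rw [ham_eq_reducedHam_add, quasiAdiabatic_add_central
      ((Φ s).commute_term_empty Λ), timeDeriv_ham_eq,
      quasiAdiabatic_add hw (hΦ.selfAdj_reducedHam Λ s hs)]
    rfl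
  rw [h2]
  exact commutator_add_of_commute
    (commute_quasiAdiabatic ((Potential.timeDeriv 1 Φ s).commute_term_empty Λ) _ _ _)

variable {K : ObsFamily D} {A : ℕ → ObsFamily D}

/-- Order zero vanishes. By the choice of `A k` the orders from 1 to `n` are time averages, which
commute with the ground projection because of the gap. -/
lemma commute_sum_dressedCoeff (hΦ : IsLocalC (n + 1) Φ) (hw : HasMoments w) (hγ : 0 < γ)
    (hf : IsGapFilter γ w) (h0 : A 0 = 0) (hn : ∀ p, n < p → A p = 0)
    (hA : ∀ k, 1 ≤ k → k ≤ n →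
      A k = -(Potential.reducedHam Φ 0).quasiAdiabatic w (lowerCoeff (Potential.reducedHam Φ 0) K A n k))
    {Λ : Finset Γ} (hgap : ∀ s ∈ Icc (0 : ℝ) 1, HasGap γ ((Φ s).ham Λ)) (ε : ℂ)
    {s : ℝ} (hs : s ∈ Icc (0 : ℝ) 1) :
    Commute (∑ k ∈ Finset.range (n + 1), ε ^ k • dressedCoeff (Potential.reducedHam Φ 0) K A n k Λ s)
      (groundProj ((Φ s).ham Λ)) := by
  refine Commute.sum_left _ _ _ fun k hk => Commute.smul_left ?_ _
  rcases Nat.eq_zero_or_pos k with rfl | hk0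
  · rw [dressedCoeff_zero h0 hn]
    exact Commute.zero_left _
  · rw [dressedCoeff_eq_timeAverage hw (hf.integral_eq_one hγ) hΦ.selfAdj_reducedHam
      (hA k hk0 (Nat.lt_succ_iff.1 (Finset.mem_range.1 hk))) Λ hs,
      ← timeAverage_add_central ((Φ s).commute_term_empty Λ), ← ham_eq_reducedHam_add]
    exact (isFiltered_groundProj hw hγ hf ((hΦ.hermitian s hs).ham Λ)
      (hgap s hs)).commute_timeAverage hw (isSelfAdjoint_groundProj _) _

/-- The remainder of the dressed evolution, divided by `ε ^ (n + 1)`. -/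
def dressRemainder (H K : ObsFamily D) (A : ℕ → ObsFamily D) (n : ℕ) (ε : ℂ) : ObsFamily D :=
  fun Λ s => heis (dressGen A n ε Λ s) 1
      (remainderCoeff (dressedCoeff H K A n) n (degBound H A n) ε Λ s) +
    ∫ u in (0 : ℝ)..1, ((1 - u) ^ (n + 1) / ((n + 1)! : ℝ)) • heis (dressGen A n ε Λ s) (1 - u)
      (remainderCoeff (fun k => (iterPoly H A n (n + 1)).coeff k) n (degBound H A n) ε Λ s)

lemma IsDressing.hasDerivWithinAt_dressGen (hA : IsDressing A n) (ε : ℂ) (Λ : Finset Γ) {s : ℝ}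
    (hs : s ∈ Icc (0 : ℝ) 1) :
    HasDerivWithinAt (dressGen A n ε Λ) (dressGenDeriv A n ε Λ s) (Icc 0 1) s := by
  refine HasDerivWithinAt.fun_sum fun p hp => ?_
  have h1 := hA.loc p
  rw [show n + 1 - p = n - p + 1 by have := (Finset.mem_Icc.1 hp).2; omega] at h1
  exact (h1.hasDerivWithinAt Λ hs).fun_const_smul (ε ^ p)

lemma commutator_central_add {𝒜 : Type*} [CStarAlgebra 𝒜] {c H R P : 𝒜} (hc : Commute c P) :
    (H + R) * P - P * (H + R) = ⁅H + c + R, P⁆ := by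
  rw [Ring.lie_def, show H + c + R = H + R + c by abel, commutator_add_of_commute hc]

/-- The dressed ground state projection solves the perturbed evolution equation. -/
theorem exists_hasDerivWithinAt_dressed (hΦ : IsLocalC (n + 1) Φ) (hw : HasMoments w) (hγ : 0 < γ)
    (hf : IsGapFilter γ w)
    (hK : K = (Potential.reducedHam Φ 0).quasiAdiabatic w (Potential.reducedHam Φ 1))
    (hA : IsDressing A n) (hAk : ∀ k, 1 ≤ k → k ≤ n →
      A k = -(Potential.reducedHam Φ 0).quasiAdiabatic w (lowerCoeff (Potential.reducedHam Φ 0) K A n k))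
    {Λ : Finset Γ} (hgap : ∀ s ∈ Icc (0 : ℝ) 1, HasGap γ ((Φ s).ham Λ)) (ε : ℂ)
    {s : ℝ} (hs : s ∈ Icc (0 : ℝ) 1) :
    ∃ X : Obs D Λ, HasDerivWithinAt
        (fun r => heis (dressGen A n ε Λ r) 1 (groundProj ((Φ r).ham Λ))) X (Icc 0 1) s ∧
      (Complex.I * ε) • X = ⁅(Φ s).ham Λ +
        ε ^ (n + 1) • dressRemainder (Potential.reducedHam Φ 0) K A n ε Λ s,
        heis (dressGen A n ε Λ s) 1 (groundProj ((Φ s).ham Λ))⁆ := by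
  have hc := (Φ s).commute_term_empty Λ
  have hP := hΦ.hasDerivWithinAt_groundProj hw hγ hf hgap hs
  rw [← hK] at hP
  refine ⟨_, hasDerivWithinAt_dressed (hA.hasDerivWithinAt_dressGen ε Λ hs) hP, ?_⟩
  have hHP : Commute (Potential.reducedHam Φ 0 Λ s) (groundProj ((Φ s).ham Λ)) := by
    have h1 := (isFiltered_groundProj hw hγ hf ((hΦ.hermitian s hs).ham Λ) (hgap s hs)).commute
    have h2 := h1.sub_left (hc (groundProj ((Φ s).ham Λ)))
    rw [Potential.reducedHam, timeDeriv_zero]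
    exact h2
  rw [dressed_equation ε hHP
    (commute_sum_dressedCoeff hΦ hw hγ hf hA.zero hA.eq_zero hAk hgap ε hs),
    dressed_expansion Λ s ε hA.zero hA.eq_zero, map_smul, map_add, heis_expRemainder,
    commutator_central_add (hc _), ← ham_eq_reducedHam_add]
  rfl

/-- All `A p` are central at time zero, hence so is the generator. -/
lemma IsDressing.heis_dressGen_zero (hA : IsDressing A n) (ε : ℂ) (Λ : Finset Γ) (a : Obs D Λ) :
    heis (dressGen A n ε Λ 0) 1 a = a :=
  heis_of_commute (Commute.sum_left _ _ _ fun p _ =>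
    Commute.smul_left ((hA.loc p).central Λ a) _) 1

end GroundEvolution

/-! ### Uniform locality of the remainder. -/

section Remainder

variable {D : Γ → ℕ} [MetricSpace Γ] [∀ x, NeZero (D x)] {d : ℕ} {κ : ℝ} {n : ℕ}
  {H K : ObsFamily D} {A : ℕ → ObsFamily D}

lemma norm_ofReal_pow_le_one {ε : ℝ} (hε : ε ∈ Ioc (0 : ℝ) 1) (k : ℕ) : ‖(ε : ℂ) ^ k‖ ≤ 1 := by
  rw [norm_pow, Complex.norm_real, Real.norm_of_nonneg hε.1.le]
  exact pow_le_one₀ hε.1.le hε.2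

lemma conj_ofReal_pow (ε : ℝ) (k : ℕ) : (starRingEnd ℂ) ((ε : ℂ) ^ k) = (ε : ℂ) ^ k := by
  rw [map_pow, Complex.conj_ofReal]

lemma isSelfAdjoint_finset_sum {𝒜 ι : Type*} [CStarAlgebra 𝒜] (u : Finset ι) {f : ι → 𝒜}
    (h : ∀ i ∈ u, IsSelfAdjoint (f i)) : IsSelfAdjoint (∑ i ∈ u, f i) := by
  rw [isSelfAdjoint_iff, star_sum]
  exact Finset.sum_congr rfl fun i hi => (h i hi).star_eq

lemma LocC.unifLoc_smul {z : Prop} {m : ℕ} {G : ObsFamily D} (h : LocC z m G) (k : ℕ) :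
    UnifLoc fun Λ (i : Ioc (0 : ℝ) 1 × Icc (0 : ℝ) 1) => ((i.1 : ℝ) : ℂ) ^ k • G Λ i.2 :=
  (h.unifLoc Prod.snd).smul fun i => norm_ofReal_pow_le_one i.1.2 k

lemma unifLoc_remainderCoeff {c : ℕ → ObsFamily D} (hc : ∀ k, LocC True (n + 1 - k) (c k)) (N : ℕ) :
    UnifLoc fun Λ (i : Ioc (0 : ℝ) 1 × Icc (0 : ℝ) 1) =>
      remainderCoeff c n N ((i.1 : ℝ) : ℂ) Λ i.2 :=
  UnifLoc.sum _ fun k _ => (hc k).unifLoc_smul _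

lemma selfAdj_remainderCoeff {c : ℕ → ObsFamily D} (hc : ∀ k, SelfAdj (c k)) (N : ℕ) (ε : ℝ) :
    SelfAdj (remainderCoeff c n N (ε : ℂ)) := fun Λ s hs =>
  isSelfAdjoint_finset_sum _ fun k _ => isSelfAdjoint_smul_of_conj (conj_ofReal_pow ε _) (hc k Λ s hs)

lemma IsDressing.unifLoc_dressGen (hA : IsDressing A n) :
    UnifLoc fun Λ (i : Ioc (0 : ℝ) 1 × Icc (0 : ℝ) 1) => dressGen A n ((i.1 : ℝ) : ℂ) Λ i.2 :=
  UnifLoc.sum _ fun p _ => (hA.loc p).unifLoc_smul p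

lemma IsDressing.selfAdj_dressGen (hA : IsDressing A n) (ε : ℝ) :
    SelfAdj (dressGen A n (ε : ℂ)) := fun Λ s hs =>
  isSelfAdjoint_finset_sum _ fun p _ =>
    isSelfAdjoint_smul_of_conj (conj_ofReal_pow ε _) (hA.selfAdj p Λ s hs)

lemma abs_one_sub_pow_div_le (j : ℕ) {u : ℝ} (hu : u ∈ Ioc (0 : ℝ) 1) :
    |(1 - u) ^ j / (j ! : ℝ)| ≤ 1 := by
  have h1 : 0 ≤ 1 - u := by linarith [hu.2]
  rw [abs_of_nonneg (by positivity)]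
  refine div_le_one_of_le₀ ((pow_le_one₀ h1 (by linarith [hu.1])).trans ?_) (by positivity)
  exact_mod_cast j.factorial_pos

lemma IsDressing.unifLoc_dressRemainder (hg : Growth Γ d κ) (hA : IsDressing A n) (hH : SelfAdj H)
    (hHl : LocC False (n + 1) H) (hK : LocC True n K) (hKs : SelfAdj K) :
    UnifLoc fun Λ (i : Ioc (0 : ℝ) 1 × Icc (0 : ℝ) 1) =>
      dressRemainder H K A n ((i.1 : ℝ) : ℂ) Λ i.2 := by
  have hS : ∀ Λ (i : Ioc (0 : ℝ) 1 × Icc (0 : ℝ) 1),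
      IsSelfAdjoint (dressGen A n ((i.1 : ℝ) : ℂ) Λ i.2) := fun Λ i =>
    hA.selfAdj_dressGen i.1 Λ i.2 i.2.2
  refine (hA.unifLoc_dressGen.heis_one hg hS (unifLoc_remainderCoeff
    (fun k => (hA.dressedCoeff hg hH hHl hK hKs k).1) _)).add
    (hA.unifLoc_dressGen.integral_heis hg hS (unifLoc_remainderCoeff
      (fun k => (hA.coeff_iterPoly hg hH hHl (n + 1) k).1) _)
      (f := fun u => (1 - u) ^ (n + 1) / ((n + 1)! : ℝ)) (by fun_prop)
      fun u hu => abs_one_sub_pow_div_le (n + 1) hu)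

lemma IsDressing.selfAdj_dressRemainder (hg : Growth Γ d κ) (hA : IsDressing A n) (hH : SelfAdj H)
    (hHl : LocC False (n + 1) H) (hK : LocC True n K) (hKs : SelfAdj K) (ε : ℝ) :
    SelfAdj (dressRemainder H K A n (ε : ℂ)) := by
  intro Λ s hs
  have hS := hA.selfAdj_dressGen ε Λ s hs
  refine IsSelfAdjoint.add (R := Obs D Λ) (isSelfAdjoint_heis hS (selfAdj_remainderCoeff
    (fun k => (hA.dressedCoeff hg hH hHl hK hKs k).2) _ ε Λ s hs) 1) ?_
  rw [intervalIntegral.integral_of_le zero_le_one]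
  exact isSelfAdjoint_integral fun u => isSelfAdjoint_real_smul (isSelfAdjoint_heis hS
    (selfAdj_remainderCoeff (fun k => (hA.coeff_iterPoly hg hH hHl (n + 1) k).2) _ ε Λ s hs) _) _

/-- The dressing transformation and its remainder are given by local Hamiltonians. -/
theorem IsDressing.exists_potentials (hg : Growth Γ d κ) (hA : IsDressing A n) (hH : SelfAdj H)
    (hHl : LocC False (n + 1) H) (hK : LocC True n K) (hKs : SelfAdj K) :
    ∃ (F : ℝ → ℝ) (C : ℝ) (A' : ℕ → ℝ → Potential D) (R : ℝ → ℝ → Potential D),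
      IsDecayFunction Γ F ∧
      (∀ p ∈ Finset.Icc 1 n, ∀ s ∈ Icc (0 : ℝ) 1, (A' p s).IsHermitian ∧
        (A' p s).fNorm F ≤ ENNReal.ofReal C ∧ ∀ Λ, (A' p s).ham Λ = A p Λ s) ∧
      ∀ ε ∈ Ioc (0 : ℝ) 1, ∀ s ∈ Icc (0 : ℝ) 1, (R ε s).IsHermitian ∧
        (R ε s).fNorm F ≤ ENNReal.ofReal (C * ε ^ (n + 1)) ∧
        ∀ Λ, (R ε s).ham Λ = (ε : ℂ) ^ (n + 1) • dressRemainder H K A n (ε : ℂ) Λ s := by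
  classical
  have h1 : UnifLoc fun Λ (i : {p // p ∈ Finset.Icc 1 n} × Icc (0 : ℝ) 1) => A i.1 Λ i.2 :=
    UnifLoc.finite (G := fun (p : {p // p ∈ Finset.Icc 1 n}) Λ (s : Icc (0 : ℝ) 1) => A p Λ s)
      fun p => (hA.loc p).unifLoc id
  -- The remainder enters already divided by `ε^(n+1)`, so its bound is uniform in `ε`. The power is
  -- restored below by scaling the potential.
  obtain ⟨F, C, Ψ, hF, -, hΨ⟩ :=
    (h1.sumElim (hA.unifLoc_dressRemainder hg hH hHl hK hKs)).exists_potential hg (by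
      rintro Λ (i | i)
      · exact hA.selfAdj i.1 Λ i.2 i.2.2
      · exact hA.selfAdj_dressRemainder hg hH hHl hK hKs i.1 Λ i.2 i.2.2)
  -- Outside the relevant ranges the potentials are set to zero; those values are never used.
  refine ⟨F, C, fun p s => if h : p ∈ Finset.Icc 1 n ∧ s ∈ Icc (0 : ℝ) 1 then
      Ψ (Sum.inl (⟨p, h.1⟩, ⟨s, h.2⟩)) else 0,
    fun ε s => if h : ε ∈ Ioc (0 : ℝ) 1 ∧ s ∈ Icc (0 : ℝ) 1 then
      (Ψ (Sum.inr (⟨ε, h.1⟩, ⟨s, h.2⟩))).rsmul (ε ^ (n + 1)) else 0, hF, ?_, ?_⟩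
  · intro p hp s hs
    obtain ⟨h2, h3, h4⟩ := hΨ (Sum.inl (⟨p, hp⟩, ⟨s, hs⟩))
    beta_reduce
    rw [dif_pos ⟨hp, hs⟩]
    exact ⟨h2, h3.fNorm_le hF.pos, h4⟩
  · intro ε hε s hs
    obtain ⟨h2, h3, h4⟩ := hΨ (Sum.inr (⟨ε, hε⟩, ⟨s, hs⟩))
    beta_reduce
    rw [dif_pos ⟨hε, hs⟩]
    refine ⟨h2.rsmul _, (h3.rsmul (pow_nonneg hε.1.le _)).fNorm_le hF.pos, fun Λ => ?_⟩
    rw [Potential.ham_rsmul, h4, Complex.ofReal_pow]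
    rfl

end Remainder

/-! ### Assembly of the dressed projection. -/

section DressedProjection

variable {D : Γ → ℕ} [MetricSpace Γ] [∀ x, NeZero (D x)] {n : ℕ} {A : ℕ → ObsFamily D}
  {Φ : ℝ → Potential D}

lemma dressedProj_eq_heis (hA : IsDressing A n) {A' : ℕ → ℝ → Potential D} {s : ℝ}
    (hs : s ∈ Icc (0 : ℝ) 1) {Λ : Finset Γ}
    (h : ∀ p ∈ Finset.Icc 1 n, (A' p s).ham Λ = A p Λ s) (ε : ℝ) :
    dressedProj Φ A' n ε s Λ = heis (dressGen A n (ε : ℂ) Λ s) 1 (groundProj ((Φ s).ham Λ)) := by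
  have h1 : dressS A' n ε s Λ = dressGen A n (ε : ℂ) Λ s :=
    Finset.sum_congr rfl fun p hp => by rw [h p hp]
  have h2 : dressV A' n ε s Λ = evol (dressGen A n (ε : ℂ) Λ s) 1 := by
    rw [dressV, h1, evol, one_smul]
  rw [dressedProj, h2, star_evol (hA.selfAdj_dressGen ε Λ s hs), heis_apply]

variable {d : ℕ} {κ : ℝ}

lemma selfAdj_reducedHam_one (hΦ : IsLocalC (n + 1) Φ) : SelfAdj (Potential.reducedHam Φ 1) :=
  fun Λ _ hs => hasDerivWithinAt_isSelfAdjoint hs (hΦ.selfAdj_reducedHam Λ)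
    (hΦ.hasDerivWithinAt_reducedHam (k := 0) (by omega) Λ hs)

/-- A gapped local Hamiltonian that is stationary to order `n + 1` at time zero has a dressing
transformation of order `n`. -/
theorem IsLocalC.exists_dressedProj (hg : Growth Γ d κ) (hΦ : IsLocalC (n + 1) Φ)
    (hgap : UniformlyGapped Φ)
    (hzero : ∀ (Λ : Finset Γ) (k : ℕ), 1 ≤ k → k ≤ n + 1 →
      iteratedDerivWithin k (fun s => (Φ s).ham Λ) (Icc (0 : ℝ) 1) 0 = 0) :
    ∃ (F : ℝ → ℝ) (C : ℝ) (A : ℕ → ℝ → Potential D) (R : ℝ → ℝ → Potential D),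
      IsDecayFunction Γ F ∧
      (∀ p ∈ Finset.Icc 1 n, ∀ s ∈ Icc (0 : ℝ) 1,
        (A p s).IsHermitian ∧ (A p s).fNorm F ≤ ENNReal.ofReal C) ∧
      (∀ ε ∈ Ioc (0 : ℝ) 1, ∀ s ∈ Icc (0 : ℝ) 1,
        (R ε s).IsHermitian ∧ (R ε s).fNorm F ≤ ENNReal.ofReal (C * ε ^ (n + 1))) ∧
      (∀ ε ∈ Ioc (0 : ℝ) 1, ∀ Λ : Finset Γ,
        DifferentiableOn ℝ (fun s => dressedProj Φ A n ε s Λ) (Icc 0 1) ∧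
        (∀ s ∈ Icc (0 : ℝ) 1,
          (Complex.I * (ε : ℂ)) • derivWithin (fun r => dressedProj Φ A n ε r Λ) (Icc 0 1) s =
            ⁅(Φ s).ham Λ + (R ε s).ham Λ, dressedProj Φ A n ε s Λ⁆) ∧
        dressedProj Φ A n ε 0 Λ = groundProj ((Φ 0).ham Λ)) := by
  obtain ⟨γ, hγ, hgap⟩ := hgap
  obtain ⟨w, -, hw, hf⟩ := exists_filter hγ
  have h01 : (0 : ℝ) ∈ Icc (0 : ℝ) 1 := ⟨le_rfl, zero_le_one⟩
  have hH := hΦ.selfAdj_reducedHam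
  have hHl : LocC False (n + 1) (Potential.reducedHam Φ 0) :=
    hΦ.locC hg (by omega) fun h => h.elim
  -- The only place where the vanishing derivatives at time zero are used: the flag `True` records
  -- centrality there for orders 1 to `n + 1` of the Hamiltonian.
  have hHd : LocC True n (Potential.reducedHam Φ 1) :=
    hΦ.locC hg (by omega) fun _ j hj hjn Λ => by
      rw [← hΦ.iteratedDerivWithin_ham hjn Λ h01]
      exact hzero Λ j hj hjn
  obtain ⟨K, hKdef⟩ : ∃ K, K = (Potential.reducedHam Φ 0).quasiAdiabatic w
    (Potential.reducedHam Φ 1) := ⟨_, rfl⟩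
  have hK : LocC True n K := by
    rw [hKdef]
    exact LocC.quasiAdiabatic hg hw hH hHl n.le_succ hHd
  have hKs : SelfAdj K := by
    rw [hKdef]
    exact hH.quasiAdiabatic (selfAdj_reducedHam_one hΦ)
  obtain ⟨B, hB, hBk⟩ := exists_dressing hg hw hH hHl hK hKs
  obtain ⟨F, C, A, R, hF, hA, hR⟩ := hB.exists_potentials hg hH hHl hK hKs
  refine ⟨F, C, A, R, hF, fun p hp s hs => ⟨(hA p hp s hs).1, (hA p hp s hs).2.1⟩,
    fun ε hε s hs => ⟨(hR ε hε s hs).1, (hR ε hε s hs).2.1⟩, fun ε hε Λ => ?_⟩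
  have heq : ∀ s ∈ Icc (0 : ℝ) 1, dressedProj Φ A n ε s Λ =
      heis (dressGen B n (ε : ℂ) Λ s) 1 (groundProj ((Φ s).ham Λ)) := fun s hs =>
    dressedProj_eq_heis hB hs (fun p hp => (hA p hp s hs).2.2 Λ) ε
  have hd : ∀ s ∈ Icc (0 : ℝ) 1, ∃ X : Obs D Λ,
      HasDerivWithinAt (fun r => dressedProj Φ A n ε r Λ) X (Icc 0 1) s ∧
      (Complex.I * (ε : ℂ)) • X =
        ⁅(Φ s).ham Λ + (R ε s).ham Λ, dressedProj Φ A n ε s Λ⁆ := fun s hs => by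
    obtain ⟨X, hX, he⟩ := exists_hasDerivWithinAt_dressed hΦ hw hγ hf hKdef hB hBk
      (hgap Λ) (ε : ℂ) hs
    refine ⟨X, hX.congr heq (heq s hs), ?_⟩
    rw [he, heq s hs, (hR ε hε s hs).2.2]
  refine ⟨fun s hs => ?_, fun s hs => ?_, ?_⟩
  · obtain ⟨X, hX, -⟩ := hd s hs
    exact hX.differentiableWithinAt
  · obtain ⟨X, hX, he⟩ := hd s hs
    rw [hX.derivWithin (uniqueDiffOn_Icc zero_lt_one s hs), he]
  · rw [heq 0 h01, hB.heis_dressGen_zero]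

end DressedProjection

end

end SpinLattice

end

theorem mainTheorem2 {Γ : Type*} [DecidableEq Γ] [Countable Γ] [MetricSpace Γ]
    (hΓ : SpinLattice.HasFiniteDimension Γ)
    (D : Γ → ℕ) (hD : ∀ x, 0 < D x) (n : ℕ)
    (Φ : ℝ → SpinLattice.Potential D)
    (hΦ : SpinLattice.IsLocalC (n + 1) Φ)
    (hgap : SpinLattice.UniformlyGapped Φ)
    (hzero : ∀ (Λ : Finset Γ) (k : ℕ), 1 ≤ k → k ≤ n + 1 →
      iteratedDerivWithin k (fun s => (Φ s).ham Λ) (Set.Icc (0 : ℝ) 1) 0 = 0) :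
    ∃ (F : ℝ → ℝ) (C : ℝ) (A : ℕ → ℝ → SpinLattice.Potential D)
      (R : ℝ → ℝ → SpinLattice.Potential D),
      SpinLattice.IsDecayFunction Γ F ∧
      -- the `A_p` are local Hamiltonians, uniformly in time and volume
      (∀ p ∈ Finset.Icc 1 n, ∀ s ∈ Set.Icc (0 : ℝ) 1,
        (A p s).IsHermitian ∧ (A p s).fNorm F ≤ ENNReal.ofReal C) ∧
      -- the remainder is a local Hamiltonian of order `ε ^ (n + 1)`, uniformly in time and volume
      (∀ ε ∈ Set.Ioc (0 : ℝ) 1, ∀ s ∈ Set.Icc (0 : ℝ) 1,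
        (R ε s).IsHermitian ∧ (R ε s).fNorm F ≤ ENNReal.ofReal (C * ε ^ (n + 1))) ∧
      -- the dressed projection solves the perturbed evolution equation in every finite volume
      (∀ ε ∈ Set.Ioc (0 : ℝ) 1, ∀ Λ : Finset Γ,
        DifferentiableOn ℝ (fun s => SpinLattice.dressedProj Φ A n ε s Λ) (Set.Icc 0 1) ∧
        (∀ s ∈ Set.Icc (0 : ℝ) 1,
          (Complex.I * (ε : ℂ)) •
              derivWithin (fun r => SpinLattice.dressedProj Φ A n ε r Λ) (Set.Icc 0 1) s =
            ⁅(Φ s).ham Λ + (R ε s).ham Λ, SpinLattice.dressedProj Φ A n ε s Λ⁆) ∧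
        SpinLattice.dressedProj Φ A n ε 0 Λ = SpinLattice.groundProj ((Φ 0).ham Λ)) := by
  have : ∀ x, NeZero (D x) := fun x => ⟨(hD x).ne'⟩
  obtain ⟨d, κ, hg⟩ := hΓ.exists_growth
  exact hΦ.exists_dressedProj hg hgap hzero
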